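/- **Notation.** Functions $f(t,v)$ are real valued, $t>0$, $v\in\mathbb R^3$; $D^m$ ($m\in\mathbb N^3$) and $\partial_t$ are weak derivatives in $v$ and $t$. Let $\lambda(v)=e^{|v|}$, $\tilde\lambda(v)=e^{|v|}/(1+|v|)$. For $\nu\in\{\lambda,\tilde\lambda\}$ put $\|g\|_{H^n_\nu}^2=\sum_{|m|\le n}\int\nu|D^mg|^2\,dv$ and $\|f\|_{V^n_{A,\nu}}^2=\int_0^\infty e^{-At}\|f(t,\cdot)\|^2_{H^n_\nu}\,dt$; $V^n_{A,\nu}$ is the space of functions for which this norm is defined and finite (equivalently, the closure of $C_c^\infty([0,\infty)\times\mathbb R^3)$ in it). $\mathcal L(f)(z,v)=\int_0^\infty e^{-zt}f(t,v)\,dt$ is the Laplace transform, understood on lines $\mathrm{Re}\,z=a$ in the sense of Plancherel's theorem. For $n\ge12$, suprema being over $v\in\mathbb R^3$, $\mathrm{Re}\,z=A/2$, $|m|\le n-6$ (essential suprema in $v$ and $z$), set $$\|f\|_{E_A}=\sup|D^m\mathcal L(f)|(1+|z|^2)e^{|v|/2},\qquad \|f\|_{F_{\varepsilon,A}}=\sup|D^m\mathcal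 L(f)|\tfrac{(1+|z|^2)(1+\varepsilon|z|)}{\varepsilon|z|}e^{|v|/2},$$ $$\|f\|_{G_{\varepsilon,A}}=\sup|D^m\mathcal L(f)|(1+|z|^2)(1+\varepsilon|z|)e^{|v|/2}.$$ Let $\Omega=\Omega^{A,\delta}_{\tilde R,\delta_1,R,\varepsilon}$ be the set of $f\in V^n_{A,\tilde\lambda}$ with $\int f(t,v)\,dv=0$ for a.e. $t>0$, $\operatorname{supp}f\subset[0,2\delta_1]\times\mathbb R^3$, $\|f\|_{V^n_{A,\tilde\lambda}}+\|\partial_tf\|_{V^{n-2}_{A,\tilde\lambda}}\le1$, $\operatorname{ess\,sup}_{t\in[0,1]}\|\partial_tf(t,\cdot)\|_{H^{n-4}_{\tilde\lambda}}\le\tilde R$, $\|f\|_{G_{\varepsilon,A}}\le R$, and $f=f_1+f_2$ for some $f_1,f_2$ with $\|f_1\|_{E_A}\le\delta$, $\|f_2\|_{F_{\varepsilon,A}}\le R$. Let $\phi$ be the potential on $\mathbb R^3$ with $(2\pi)^{-3/2}\int\phi(x)e^{-ik\cdot x}dx=(1+|k|^2)^{-3/2}$, and $$K[g](t,v)=\iint\nabla\phi(x)\otimes\nabla\phi(x-t(v-v'))\,g(v')\,dv'\,dx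 .$$ Fix a mollifier: $\rho\in C_c^\infty(\mathbb R^3)$, $\rho\ge0$, $\operatorname{supp}\rho\subset\overline{B_1(0)}$, $\int\rho=1$; let $\varphi_\gamma(v)=\gamma^{-3}\rho(v/\gamma)$ and ${}^\gamma\nabla g=\nabla(\varphi_\gamma*g)$. For a multi-index $\alpha$ set $$Q^{\alpha,\alpha}_{\varepsilon,A}[f](u)=\int_0^\infty\!\!\int\frac{e^{-At}}{\varepsilon}\,{}^\gamma\nabla(\lambda D^\alpha u(t))\cdot\int_0^t\Big(K[f(s)]\big(\tfrac{t-s}\varepsilon,v\big)\,{}^\gamma\nabla D^\alpha u(s)-\big({}^\gamma\nabla\cdot K[f(s)]\big)\big(\tfrac{t-s}\varepsilon,v\big)\,D^\alpha u(s)\Big)ds\,dv\,dt .$$ For $z\in\mathbb C$, $v\ne0$, let $P_v$ be the orthogonal projection onto $\mathbb Cv$, $P_v^\perp=1-P_v$, $|W|_v=|P_v^\perp W|+\frac{|P_vW|}{1+|v|}$, $\mathsf a=\frac{|\mathrm{Im}\,z|}{1+|v|}$, $\mathsf b=\frac{|\mathrm{Re}\,z|}{1+|v|}$, and $$B_1(z,v)[V,W]=\frac{|V|_v|W|_v}{(1+|v|)(1+\mathsf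 a)^2}+\frac{\mathsf b+\mathsf a^2}{(1+|v|)(1+\mathsf a)^4}|P_vV||P_vW| .$$ With $z=\frac A2+i\omega$ let $$D^\alpha_{\varepsilon,A}(u)=\int_{\mathbb R}\int_{\mathbb R^3}B_1(\varepsilon z,v)\big[{}^\gamma\nabla D^\alpha\mathcal L(u)(z,v),{}^\gamma\nabla D^\alpha\mathcal L(u)(z,v)\big]\lambda(v)\,dv\,d\omega .$$ **Lemma.** Let $A\ge1$, $n\ge12$ and $c>0$. There is $\delta_0=\delta_0(c,A,n)>0$ such that for all $\delta\in(0,\delta_0]$, $R,\tilde R>0$ and $\delta_1\in(0,1)$ there is $\varepsilon_0=\varepsilon_0(\delta,R,\tilde R,\delta_1,A,c,n)>0$ such that for all $\varepsilon\in(0,\varepsilon_0]$, all $\gamma\in(0,1]$, all multi-indices $|\alpha|\le n$, all $f\in\Omega^{A,\delta}_{\tilde R,\delta_1,R,\varepsilon}$ and all $u\in V^n_{A,\lambda}$: $$(2\pi)^{1/2}\,|Q^{\alpha,\alpha}_{\varepsilon,A}[f](u)|\le c\,D^\alpha_{\varepsilon,A}(u)+\|u\|^2_{V^n_{A,\lambda}}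 .$$ (The constants $\delta_0,\varepsilon_0$ may also depend on the fixed profile $\rho$, but not on $\gamma$, $\alpha$, $f$, $u$.) -/

import Mathlib

noncomputable section

open MeasureTheory Set
open scoped ENNReal FourierTransform

namespace NonMarkov

/-- The velocity space. -/
abbrev Vel := EuclideanSpace ℝ (Fin 3)

/-- Complex vectors with the hermitian norm. -/
abbrev CVec := EuclideanSpace ℂ (Fin 3)

/-! ### Derivatives in the velocity variable -/

/-- Absolute value of a multi-index. -/
def order (m : Fin 3 → ℕ) : ℕ := ∑ i, m i

/-- The multi-indices of absolute value at most `n`. -/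
def indices (n : ℕ) : Finset (Fin 3 → ℕ) :=
  (Fintype.piFinset fun _ => Finset.range (n + 1)).filter fun m => order m ≤ n

/-- Every multi-index of absolute value at most `n` is listed in `indices n`, and no other. -/
theorem mem_indices {n : ℕ} {m : Fin 3 → ℕ} : m ∈ indices n ↔ order m ≤ n := by
  simp only [indices, Finset.mem_filter, Fintype.mem_piFinset, Finset.mem_range,
    and_iff_right_iff_imp]
  intro h i
  have : m i ≤ order m := Finset.single_le_sum (fun _ _ => Nat.zero_le _) (Finset.mem_univ i)
  omega

/-- Classical partial derivative in the direction `i`. -/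
def pderiv (i : Fin 3) (g : Vel → ℝ) : Vel → ℝ :=
  fun v => fderiv ℝ g v (EuclideanSpace.single i 1)

/-- Classical partial derivative of multi-index `m`. -/
def mderiv (m : Fin 3 → ℕ) (g : Vel → ℝ) : Vel → ℝ :=
  (pderiv 0)^[m 0] ((pderiv 1)^[m 1] ((pderiv 2)^[m 2] g))

/-! ### Functions of time and velocity: weak derivatives on `(0,∞) × ℝ³` -/

/-- Test functions: smooth with compact support in `(0,∞) × ℝ³`. -/
def IsTest (ψ : ℝ × Vel → ℝ) : Prop :=
  ContDiff ℝ (⊤ : ℕ∞) ψ ∧ HasCompactSupport ψ ∧ tsupport ψ ⊆ Ioi 0 ×ˢ univ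

/-- Local integrability on `(0,∞) × ℝ³`. -/
def LocInt (f : ℝ → Vel → ℝ) : Prop :=
  LocallyIntegrableOn (Function.uncurry f) (Ioi (0 : ℝ) ×ˢ (univ : Set Vel)) volume

/-- `g` is the weak velocity derivative `D^m f`. -/
def IsWeakDeriv (m : Fin 3 → ℕ) (f g : ℝ → Vel → ℝ) : Prop :=
  LocInt f ∧ LocInt g ∧ ∀ ψ : ℝ × Vel → ℝ, IsTest ψ →
    ∫ p : ℝ × Vel, f p.1 p.2 * mderiv m (fun v => ψ (p.1, v)) p.2
      = (-1) ^ order m * ∫ p : ℝ × Vel, g p.1 p.2 * ψ p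

/-- `g` is the weak time derivative `∂ₜ f`. -/
def IsWeakTimeDeriv (f g : ℝ → Vel → ℝ) : Prop :=
  LocInt f ∧ LocInt g ∧ ∀ ψ : ℝ × Vel → ℝ, IsTest ψ →
    ∫ p : ℝ × Vel, f p.1 p.2 * deriv (fun t => ψ (t, p.2)) p.1
      = -∫ p : ℝ × Vel, g p.1 p.2 * ψ p

open Classical in
/-- The weak derivative `D^m f`, determined almost everywhere (zero if there is none). -/
def weakDeriv (m : Fin 3 → ℕ) (f : ℝ → Vel → ℝ) : ℝ → Vel → ℝ :=
  if h : ∃ g, IsWeakDeriv m f g then h.choose else 0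

open Classical in
/-- The weak derivative `∂ₜ f`, determined almost everywhere (zero if there is none). -/
def timeDeriv (f : ℝ → Vel → ℝ) : ℝ → Vel → ℝ :=
  if h : ∃ g, IsWeakTimeDeriv f g then h.choose else 0

/-! ### The weighted spaces -/

/-- The weight `λ(v) = e^{|v|}`. -/
def lam (v : Vel) : ℝ := Real.exp ‖v‖

/-- The weight `e^{|v|} / (1 + |v|)`. -/
def lamTilde (v : Vel) : ℝ := Real.exp ‖v‖ / (1 + ‖v‖)

/-- Membership in `V^n_{A,ν}`: all weak velocity derivatives of order at most `n` exist and are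
square integrable with respect to `e^{-At} ν(v) dv dt` on `(0,∞) × ℝ³`. -/
def MemV (n : ℕ) (A : ℝ) (ν : Vel → ℝ) (f : ℝ → Vel → ℝ) : Prop :=
  ∀ m, order m ≤ n → (∃ g, IsWeakDeriv m f g) ∧
    IntegrableOn (fun p : ℝ × Vel => Real.exp (-A * p.1) * ν p.2 * weakDeriv m f p.1 p.2 ^ 2)
      (Ioi (0 : ℝ) ×ˢ (univ : Set Vel)) volume

/-- `‖f(t,·)‖²` in `H^n_ν`. -/
def normHsq (n : ℕ) (ν : Vel → ℝ) (f : ℝ → Vel → ℝ) (t : ℝ) : ℝ :=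
  ∑ m ∈ indices n, ∫ v, ν v * weakDeriv m f t v ^ 2

/-- `‖f‖²` in `V^n_{A,ν}`. -/
def normVsq (n : ℕ) (A : ℝ) (ν : Vel → ℝ) (f : ℝ → Vel → ℝ) : ℝ :=
  ∫ t in Ioi (0 : ℝ), Real.exp (-A * t) * normHsq n ν f t

/-! ### The Laplace transform on a vertical line -/

/-- The function `t ↦ e^{-at} g(t)` on `t > 0`, extended by zero. -/
def damped (a : ℝ) (g : ℝ → ℝ) : ℝ → ℂ :=
  (Ioi (0 : ℝ)).indicator fun t => ((Real.exp (-a * t) * g t : ℝ) : ℂ)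

open Classical in
/-- The Laplace transform `ω ↦ ∫₀^∞ e^{-(a+iω)t} g(t) dt` of a function `g` for which `e^{-at} g`
is square integrable on `(0,∞)`; the integral is understood in the sense of Plancherel's theorem,
and the result is determined for almost every `ω`. Mathlib's Fourier transform carries the phase
`e^{-2πiξt}`, hence the argument `ω/(2π)`. -/
def laplaceLine (a : ℝ) (g : ℝ → ℝ) (ω : ℝ) : ℂ :=
  if h : MemLp (damped a g) 2 (volume : Measure ℝ) then
    (𝓕 (h.toLp (damped a g)) : Lp ℂ 2 (volume : Measure ℝ)) (ω / (2 * Real.pi))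
  else 0

/-- The derivatives `D^m f`, `|m| ≤ k`, exist, and for almost every `v` their Laplace transforms
on the line `Re z = a` make sense. -/
def HasLaplace (k : ℕ) (a : ℝ) (f : ℝ → Vel → ℝ) : Prop :=
  ∀ m, order m ≤ k → (∃ g, IsWeakDeriv m f g) ∧
    ∀ᵐ v : Vel, MemLp (damped a fun t => weakDeriv m f t v) 2 (volume : Measure ℝ)

open Classical in
/-- `sup |D^m_v L(f)(z,v)| w(z) e^{|v|/2}` over `v ∈ ℝ³`, `Re z = a`, `|m| ≤ k`. -/
def lapNorm (k : ℕ) (a : ℝ) (w : ℂ → ℝ) (f : ℝ → Vel → ℝ) : ℝ≥0∞ :=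
  if HasLaplace k a f then
    ⨆ m ∈ indices k, essSup (fun v : Vel => essSup (fun ω : ℝ =>
      ENNReal.ofReal (‖laplaceLine a (fun t => weakDeriv m f t v) ω‖
        * w (a + ω * Complex.I) * Real.exp (‖v‖ / 2))) volume) volume
  else ∞

def normE (n : ℕ) (A : ℝ) (f : ℝ → Vel → ℝ) : ℝ≥0∞ :=
  lapNorm (n - 6) (A / 2) (fun z => 1 + ‖z‖ ^ 2) f

def normF (n : ℕ) (ε A : ℝ) (f : ℝ → Vel → ℝ) : ℝ≥0∞ :=
  lapNorm (n - 6) (A / 2) (fun z => (1 + ‖z‖ ^ 2) * (1 + ε * ‖z‖) / (ε * ‖z‖)) f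

def normG (n : ℕ) (ε A : ℝ) (f : ℝ → Vel → ℝ) : ℝ≥0∞ :=
  lapNorm (n - 6) (A / 2) (fun z => (1 + ‖z‖ ^ 2) * (1 + ε * ‖z‖)) f

/-- The set `Γ^n_{A,δ₁}`. -/
def Gam (n : ℕ) (A δ₁ : ℝ) : Set (ℝ → Vel → ℝ) :=
  {f | MemV n A lamTilde f ∧
    (∀ᵐ t ∂(volume.restrict (Ioi (0 : ℝ))), ∫ v, f t v = 0) ∧
    (∀ᵐ p ∂((volume : Measure (ℝ × Vel)).restrict (Ioi (2 * δ₁) ×ˢ univ)), f p.1 p.2 = 0)}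

/-- The set `Ω^{A,δ}_{R',δ₁,R,ε}`. -/
def Omega (n : ℕ) (A δ R' δ₁ R ε : ℝ) : Set (ℝ → Vel → ℝ) :=
  {f | f ∈ Gam n A δ₁ ∧
    ((∃ g, IsWeakTimeDeriv f g) ∧ MemV (n - 2) A lamTilde (timeDeriv f) ∧
      Real.sqrt (normVsq n A lamTilde f) + Real.sqrt (normVsq (n - 2) A lamTilde (timeDeriv f))
        ≤ 1) ∧
    (∀ᵐ t ∂(volume.restrict (Icc (0 : ℝ) 1)),
      Real.sqrt (normHsq (n - 4) lamTilde (timeDeriv f) t) ≤ R') ∧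
    normG n ε A f ≤ ENNReal.ofReal R ∧
    ∃ f₁ f₂ : ℝ → Vel → ℝ,
      (∀ᵐ p ∂((volume : Measure (ℝ × Vel)).restrict (Ioi 0 ×ˢ univ)),
        f p.1 p.2 = f₁ p.1 p.2 + f₂ p.1 p.2) ∧
      normF n ε A f₂ ≤ ENNReal.ofReal R ∧ normE n A f₁ ≤ ENNReal.ofReal δ}

/-! ### Mollified gradients -/

/-- The profile of a standard mollifier sequence. -/
structure IsMollifier (ρ : Vel → ℝ) : Prop where
  smooth : ContDiff ℝ (⊤ : ℕ∞) ρ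
  nonneg : ∀ v, 0 ≤ ρ v
  supp : Function.support ρ ⊆ Metric.closedBall 0 1
  integral_eq_one : ∫ v, ρ v = 1

/-- The convolution of `φ_γ(v) = γ⁻³ ρ(v/γ)` with `g`. -/
def mollify (ρ : Vel → ℝ) (γ : ℝ) (g : Vel → ℝ) : Vel → ℝ :=
  fun v => ∫ y, (γ ^ 3)⁻¹ * ρ (γ⁻¹ • (v - y)) * g y

/-- The component `i` of the mollified gradient, `∂_i (φ_γ * g)`. -/
def mgrad (ρ : Vel → ℝ) (γ : ℝ) (i : Fin 3) (g : Vel → ℝ) : Vel → ℝ :=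
  pderiv i (mollify ρ γ g)

/-! ### The interaction potential and the kernel -/

/-- The potential with Fourier transform `(1+|k|²)^{-3/2}`, as a superposition of Gaussians; see
`integrable_potential` and `fourier_potential`. It is smooth away from the origin. -/
def potential (x : Vel) : ℝ :=
  (Real.sqrt (2 * Real.pi))⁻¹ *
    ∫ s in Ioi (0 : ℝ), s⁻¹ * Real.exp (-s) * Real.exp (-(‖x‖ ^ 2 / (4 * s)))

/-- The superposition of Gaussians in `potential` converges absolutely. -/
theorem integrable_gaussians :
    Integrable (fun p : ℝ × Vel =>
      p.1⁻¹ * Real.exp (-p.1) * Real.exp (-(‖p.2‖ ^ 2 / (4 * p.1))))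
      ((volume.restrict (Ioi (0 : ℝ))).prod (volume : Measure Vel)) := by
  have hx : ∀ s : ℝ, 0 < s → Integrable (fun x : Vel => Real.exp (-(‖x‖ ^ 2 / (4 * s)))) ∧
      ∫ x : Vel, Real.exp (-(‖x‖ ^ 2 / (4 * s))) = (4 * Real.pi * s) ^ (3 / 2 : ℝ) := by
    intro s hs
    have hb : (0 : ℝ) < 1 / (4 * s) := by positivity
    have e : (fun x : Vel => Real.exp (-(‖x‖ ^ 2 / (4 * s))))
        = fun x : Vel => Real.exp (-(1 / (4 * s)) * ‖x‖ ^ 2) := by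
      funext x; congr 1; ring
    have hI := GaussianFourier.integral_rexp_neg_mul_sq_norm (V := Vel) hb
    have hv : Real.pi / (1 / (4 * s)) = 4 * Real.pi * s := by field_simp
    have hd : (Module.finrank ℝ Vel : ℝ) = 3 := by simp
    rw [hv, hd] at hI
    rw [e]
    refine ⟨.of_integral_ne_zero ?_, hI⟩
    rw [hI]
    positivity
  have hmeas : Measurable (fun p : ℝ × Vel =>
      p.1⁻¹ * Real.exp (-p.1) * Real.exp (-(‖p.2‖ ^ 2 / (4 * p.1)))) := by fun_prop
  rw [integrable_prod_iff hmeas.aestronglyMeasurable]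
  constructor
  · filter_upwards [ae_restrict_mem measurableSet_Ioi] with s hs
    exact (hx s hs).1.const_mul _
  · have h0 : IntegrableOn (fun s : ℝ => (4 * Real.pi) ^ (3 / 2 : ℝ) *
        (s ^ ((3 / 2 : ℝ) - 1) * Real.exp (-(1 * s)))) (Ioi 0) := by
      refine Integrable.const_mul (.of_integral_ne_zero ?_) _
      rw [Real.integral_rpow_mul_exp_neg_mul_Ioi (by norm_num) one_pos]
      have := Real.Gamma_pos_of_pos (show (0 : ℝ) < 3 / 2 by norm_num)
      positivity
    refine h0.congr ?_
    filter_upwards [ae_restrict_mem measurableSet_Ioi] with s hs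
    have hs' : 0 < s := hs
    have : ∀ x : Vel, ‖s⁻¹ * Real.exp (-s) * Real.exp (-(‖x‖ ^ 2 / (4 * s)))‖
        = s⁻¹ * Real.exp (-s) * Real.exp (-(‖x‖ ^ 2 / (4 * s))) := fun x => by
      rw [Real.norm_of_nonneg]; positivity
    simp only [this]
    rw [integral_const_mul, (hx s hs').2, Real.mul_rpow (by positivity) hs'.le,
      Real.rpow_sub_one hs'.ne', one_mul]
    field_simp

/-- The potential is integrable. -/
theorem integrable_potential : Integrable potential :=
  integrable_gaussians.integral_prod_right.const_mul _

/-- The Fourier transform of the potential is `(1+|k|²)^{-3/2}`. -/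
theorem fourier_potential (k : Vel) :
    (((2 * Real.pi) ^ (-(3 / 2) : ℝ) : ℝ) : ℂ) *
      ∫ x : Vel, (potential x : ℂ) * Complex.exp (-Complex.I * (inner ℝ k x : ℝ))
        = (((1 + ‖k‖ ^ 2) ^ (-(3 / 2) : ℝ) : ℝ) : ℂ) := by
  set F : ℝ → Vel → ℝ := fun s x =>
    s⁻¹ * Real.exp (-s) * Real.exp (-(‖x‖ ^ 2 / (4 * s))) with hF
  have hint : Integrable (fun p : ℝ × Vel =>
      (F p.1 p.2 : ℂ) * Complex.exp (-Complex.I * (inner ℝ k p.2 : ℝ)))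
      ((volume.restrict (Ioi (0 : ℝ))).prod (volume : Measure Vel)) := by
    refine integrable_gaussians.ofReal.mul_bdd (c := 1)
      (Continuous.aestronglyMeasurable (by fun_prop)) (.of_forall fun p => ?_)
    rw [Complex.norm_exp]
    simp
  have hx : ∀ s : ℝ, 0 < s →
      ∫ x : Vel, (F s x : ℂ) * Complex.exp (-Complex.I * (inner ℝ k x : ℝ))
        = (((4 * Real.pi) ^ (3 / 2 : ℝ) *
          (s ^ ((3 / 2 : ℝ) - 1) * Real.exp (-((1 + ‖k‖ ^ 2) * s))) : ℝ) : ℂ) := by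
    intro s hs
    have hb : 0 < ((1 / (4 * s) : ℝ) : ℂ).re := by rw [Complex.ofReal_re]; positivity
    have hI := GaussianFourier.integral_cexp_neg_mul_sq_norm_add (V := Vel) hb (-Complex.I) k
    have e : ∀ x : Vel, (F s x : ℂ) * Complex.exp (-Complex.I * (inner ℝ k x : ℝ))
        = ((s⁻¹ * Real.exp (-s) : ℝ) : ℂ) *
          Complex.exp (-((1 / (4 * s) : ℝ) : ℂ) * (‖x‖ : ℂ) ^ 2
            + -Complex.I * (inner ℝ k x : ℝ)) := by
      intro x
      rw [Complex.exp_add, ← mul_assoc, hF]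
      congr 1
      push_cast
      congr 2
      field_simp
    simp only [e]
    rw [integral_const_mul, hI]
    have hd : ((Module.finrank ℝ Vel : ℂ) / 2) = ((3 / 2 : ℝ) : ℂ) := by simp
    have hv : (Real.pi : ℂ) / ((1 / (4 * s) : ℝ) : ℂ) = ((4 * Real.pi * s : ℝ) : ℂ) := by
      have : (s : ℂ) ≠ 0 := by exact_mod_cast hs.ne'
      push_cast
      field_simp
    have hq : (-Complex.I) ^ 2 * (‖k‖ : ℂ) ^ 2 / (4 * ((1 / (4 * s) : ℝ) : ℂ))
        = ((-(‖k‖ ^ 2 * s) : ℝ) : ℂ) := by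
      have : (s : ℂ) ≠ 0 := by exact_mod_cast hs.ne'
      push_cast
      rw [neg_sq, Complex.I_sq]
      field_simp
    rw [hd, hv, hq, ← Complex.ofReal_cpow (by positivity), ← Complex.ofReal_exp,
      ← Complex.ofReal_mul, ← Complex.ofReal_mul]
    congr 1
    rw [Real.mul_rpow (by positivity) hs.le, Real.rpow_sub_one hs.ne',
      show -((1 + ‖k‖ ^ 2) * s) = -s + -(‖k‖ ^ 2 * s) by ring, Real.exp_add]
    field_simp
  have hswap := integral_integral_swap (f := fun (s : ℝ) (x : Vel) =>
    (F s x : ℂ) * Complex.exp (-Complex.I * (inner ℝ k x : ℝ))) hint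
  have hpot : ∀ x : Vel, (potential x : ℂ) * Complex.exp (-Complex.I * (inner ℝ k x : ℝ))
      = (((Real.sqrt (2 * Real.pi))⁻¹ : ℝ) : ℂ) * ∫ s in Ioi (0 : ℝ),
        (F s x : ℂ) * Complex.exp (-Complex.I * (inner ℝ k x : ℝ)) := by
    intro x
    rw [integral_mul_const, integral_complex_ofReal, ← mul_assoc, ← Complex.ofReal_mul]
    rfl
  simp only [hpot]
  rw [integral_const_mul, ← hswap,
    setIntegral_congr_fun measurableSet_Ioi (fun s hs => hx s hs), integral_complex_ofReal,
    ← Complex.ofReal_mul, ← Complex.ofReal_mul]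
  congr 1
  have hk : 0 < 1 + ‖k‖ ^ 2 := by positivity
  have h32 : ∀ y : ℝ, 0 < y → y ^ (3 / 2 : ℝ) = y * Real.sqrt y := fun y hy => by
    rw [show (3 / 2 : ℝ) = 1 + 1 / 2 by norm_num, Real.rpow_add hy, Real.rpow_one,
      ← Real.sqrt_eq_rpow]
  have hG : Real.Gamma (3 / 2) = 1 / 2 * Real.sqrt Real.pi := by
    rw [show (3 / 2 : ℝ) = 1 / 2 + 1 by norm_num, Real.Gamma_add_one (by norm_num),
      Real.Gamma_one_half_eq]
  have h4 : Real.sqrt (4 * Real.pi) = 2 * Real.sqrt Real.pi := by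
    rw [Real.sqrt_mul (by norm_num), show (4 : ℝ) = 2 ^ 2 by norm_num,
      Real.sqrt_sq (by norm_num)]
  rw [integral_const_mul, Real.integral_rpow_mul_exp_neg_mul_Ioi (by norm_num) hk, hG, one_div,
    Real.inv_rpow hk.le, ← Real.rpow_neg hk.le, Real.rpow_neg (by positivity) (3 / 2),
    h32 (2 * Real.pi) (by positivity), h32 (4 * Real.pi) (by positivity), h4]
  have hp : Real.sqrt Real.pi ^ 2 = Real.pi := Real.sq_sqrt Real.pi_pos.le
  have h2p : Real.sqrt (2 * Real.pi) ^ 2 = 2 * Real.pi := Real.sq_sqrt (by positivity)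
  field_simp
  rw [h2p, hp]
  ring

/-- The kernel `K[u](t,v) = ∫∫ ∇φ(x) ⊗ ∇φ(x - t(v-v')) u(v') dx dv'`. -/
def kernelK (u : Vel → ℝ) (t : ℝ) (v : Vel) : Matrix (Fin 3) (Fin 3) ℝ :=
  Matrix.of fun i j => ∫ v' : Vel, (∫ x : Vel,
    gradient potential x i * gradient potential (x - t • (v - v')) j) * u v'

/-! ### The quadratic functionals -/

/-- `Q^{α,β}_{ε,A}[ν](u)`, with mollification parameter `γ`. -/
def Q (ρ : Vel → ℝ) (γ ε A : ℝ) (α β : Fin 3 → ℕ) (ν u : ℝ → Vel → ℝ) : ℝ :=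
  (∫ t in Ioi (0 : ℝ), ∫ v : Vel, Real.exp (-A * t) / ε *
    ∑ i, mgrad ρ γ i (fun y => weakDeriv α u t y * lam y) v *
      ∫ s in (0 : ℝ)..t, ∑ j,
        mderiv (α - β) (fun y => kernelK (ν s) ((t - s) / ε) y i j) v *
          mgrad ρ γ j (weakDeriv β u s) v) -
  ∫ t in Ioi (0 : ℝ), ∫ v : Vel, Real.exp (-A * t) / ε *
    ∑ i, mgrad ρ γ i (fun y => weakDeriv α u t y * lam y) v *
      ∫ s in (0 : ℝ)..t,
        (∑ j, mderiv (α - β) (mgrad ρ γ j fun y => kernelK (ν s) ((t - s) / ε) y i j) v) *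
          weakDeriv β u s v

/-- The orthogonal projection `P_v` onto the line spanned by `v ≠ 0`. -/
def proj (v : Vel) (W : CVec) : CVec :=
  WithLp.toLp 2 fun i => (∑ j, (v j : ℂ) * W j) / (‖v‖ : ℂ) ^ 2 * (v i : ℂ)

/-- The anisotropic norm `|W|_v`. -/
def anorm (v : Vel) (W : CVec) : ℝ := ‖W - proj v W‖ + ‖proj v W‖ / (1 + ‖v‖)

def weightAlpha (z : ℂ) (v : Vel) : ℝ := |z.im| / (1 + ‖v‖)

def weightBeta (z : ℂ) (v : Vel) : ℝ := |z.re| / (1 + ‖v‖)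

def weightC1 (z : ℂ) (v : Vel) : ℝ := 1 / ((1 + ‖v‖) * (1 + weightAlpha z v) ^ 2)

def weightC2 (z : ℂ) (v : Vel) : ℝ :=
  (weightBeta z v + weightAlpha z v ^ 2) / ((1 + ‖v‖) * (1 + weightAlpha z v) ^ 4)

def weightB1 (z : ℂ) (v : Vel) (V W : CVec) : ℝ :=
  weightC1 z v * anorm v V * anorm v W + weightC2 z v * ‖proj v V‖ * ‖proj v W‖

/-- The Laplace transform of the mollified gradient of `D^α u` at `(A/2 + iω, v)`. -/
def lapGrad (ρ : Vel → ℝ) (γ A : ℝ) (α : Fin 3 → ℕ) (u : ℝ → Vel → ℝ) (ω : ℝ) (v : Vel) : CVec :=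
  WithLp.toLp 2 fun i => laplaceLine (A / 2) (fun t => mgrad ρ γ i (weakDeriv α u t) v) ω

/-- The dissipation functional `D^α_{ε,A}(u)`. The integrand is nonnegative; the `ω` integral is
carried out first because the Laplace transform is determined for almost every `ω`, for each `v`. -/
def dissipation (ρ : Vel → ℝ) (γ ε A : ℝ) (α : Fin 3 → ℕ) (u : ℝ → Vel → ℝ) : ℝ :=
  ∫ v : Vel, (∫ ω : ℝ, weightB1 (ε * ((A / 2 : ℝ) + ω * Complex.I)) v
    (lapGrad ρ γ A α u ω v) (lapGrad ρ γ A α u ω v)) * lam v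

end NonMarkov

end

noncomputable section

open MeasureTheory Set
open scoped ENNReal FourierTransform

namespace NonMarkov

open SchwartzMap ComplexConjugate

/-! ### The Fourier transform of square integrable functions on the line -/

/-- `F` is the Fourier transform of the square integrable function `f`. -/
structure IsFT (f F : ℝ → ℂ) : Prop where
  left : MemLp f 2 volume
  right : MemLp F 2 volume
  pairing : ∀ ψ : 𝓢(ℝ, ℂ), ∫ ξ, ψ ξ * F ξ = ∫ x, 𝓕 (ψ : ℝ → ℂ) x * f x

theorem isFT_fourier {f : ℝ → ℂ} (hf : MemLp f 2 volume) :
    IsFT f (𝓕 (hf.toLp f) : Lp ℂ 2 (volume : Measure ℝ)) := by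
  refine ⟨hf, Lp.memLp _, fun ψ => ?_⟩
  have h := congrArg (fun T => T ψ) (Lp.fourier_toTemperedDistribution_eq (hf.toLp f))
  simp only [TemperedDistribution.fourier_apply, Lp.toTemperedDistribution_apply, smul_eq_mul] at h
  rw [← h, SchwartzMap.fourier_coe]
  refine integral_congr_ae ?_
  filter_upwards [hf.coeFn_toLp] with x hx
  rw [hx]

theorem ae_eq_of_schwartz {F G : ℝ → ℂ} (hF : LocallyIntegrable F) (hG : LocallyIntegrable G)
    (h : ∀ ψ : 𝓢(ℝ, ℂ), HasCompactSupport ψ → ∫ ξ, ψ ξ * F ξ = ∫ ξ, ψ ξ * G ξ) : F =ᵐ[volume] G := by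
  refine ae_eq_of_integral_contDiff_smul_eq hF hG fun g gs gc => ?_
  have hg₁ : HasCompactSupport (Complex.ofRealCLM ∘ g) := gc.comp_left rfl
  have hg₂ : ContDiff ℝ (⊤ : ℕ∞) (Complex.ofRealCLM ∘ g) := by fun_prop
  have := h (hg₁.toSchwartzMap hg₂) hg₁
  simpa using this

theorem IsFT.ae_eq {f F G : ℝ → ℂ} (hF : IsFT f F) (hG : IsFT f G) : F =ᵐ[volume] G :=
  ae_eq_of_schwartz (hF.right.locallyIntegrable (by norm_num))
    (hG.right.locallyIntegrable (by norm_num))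
    fun ψ _ => by rw [hF.pairing, hG.pairing]

theorem IsFT.congr_left {f g F : ℝ → ℂ} (hF : IsFT f F) (h : f =ᵐ[volume] g) : IsFT g F :=
  ⟨hF.left.ae_eq h, hF.right, fun ψ => by
    rw [hF.pairing]
    exact integral_congr_ae (by filter_upwards [h] with x hx; rw [hx])⟩

theorem IsFT.congr_right {f F G : ℝ → ℂ} (hF : IsFT f F) (h : F =ᵐ[volume] G) : IsFT f G :=
  ⟨hF.left, hF.right.ae_eq h, fun ψ => by
    rw [← hF.pairing]
    exact integral_congr_ae (by filter_upwards [h] with x hx; rw [hx])⟩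

theorem IsFT.toLp_eq {f F : ℝ → ℂ} (hF : IsFT f F) : 𝓕 (hF.left.toLp f) = hF.right.toLp F := by
  refine Lp.ext (((isFT_fourier hF.left).ae_eq hF).trans ?_)
  exact hF.right.coeFn_toLp.symm

/-- Plancherel's identity. -/
theorem IsFT.integral_conj_mul {f F g G : ℝ → ℂ} (hF : IsFT f F) (hG : IsFT g G) :
    ∫ ξ, conj (F ξ) * G ξ = ∫ x, conj (f x) * g x := by
  have h := Lp.inner_fourier_eq (hF.left.toLp f) (hG.left.toLp g)
  rw [hF.toLp_eq, hG.toLp_eq, L2.inner_def, L2.inner_def] at h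
  have e1 : ∫ ξ, conj (F ξ) * G ξ = ∫ a, inner ℂ (hF.right.toLp F a) (hG.right.toLp G a) := by
    refine integral_congr_ae ?_
    filter_upwards [hF.right.coeFn_toLp, hG.right.coeFn_toLp] with x h1 h2
    rw [h1, h2, RCLike.inner_apply, mul_comm]
  rw [e1, h]
  refine integral_congr_ae ?_
  filter_upwards [hF.left.coeFn_toLp, hG.left.coeFn_toLp] with x h1 h2
  rw [h1, h2, RCLike.inner_apply, mul_comm]

theorem IsFT.integral_norm_sq {f F : ℝ → ℂ} (hF : IsFT f F) :
    ∫ ξ, ‖F ξ‖ ^ 2 = ∫ x, ‖f x‖ ^ 2 := by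
  have h := hF.integral_conj_mul hF
  simp only [Complex.conj_mul'] at h
  have e : ∀ g : ℝ → ℂ, ∫ x, (‖g x‖ : ℂ) ^ 2 = ((∫ x, ‖g x‖ ^ 2 : ℝ) : ℂ) := fun g => by
    rw [← integral_complex_ofReal]; push_cast; rfl
  rw [e, e] at h
  exact_mod_cast h

theorem schwartz_mul_integrable {F : ℝ → ℂ} (hF : MemLp F 2 volume) (ψ : 𝓢(ℝ, ℂ)) :
    Integrable fun ξ => ψ ξ * F ξ :=
  (ψ.memLp 2 volume).integrable_mul hF

theorem schwartz_fourier_mul_integrable {F : ℝ → ℂ} (hF : MemLp F 2 volume) (ψ : 𝓢(ℝ, ℂ)) :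
    Integrable fun ξ => 𝓕 (ψ : ℝ → ℂ) ξ * F ξ := by
  rw [← SchwartzMap.fourier_coe]
  exact schwartz_mul_integrable hF _

theorem IsFT.add {f F g G : ℝ → ℂ} (hF : IsFT f F) (hG : IsFT g G) :
    IsFT (fun x => f x + g x) fun x => F x + G x :=
  ⟨hF.left.add hG.left, hF.right.add hG.right, fun ψ => by
    simp only [mul_add]
    rw [integral_add (schwartz_mul_integrable hF.right ψ) (schwartz_mul_integrable hG.right ψ),
      integral_add (schwartz_fourier_mul_integrable hF.left ψ)
        (schwartz_fourier_mul_integrable hG.left ψ), hF.pairing, hG.pairing]⟩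

/-- It suffices to test the pairing on smooth functions with compact support. -/
theorem isFT_of_compact {f F : ℝ → ℂ} (hf : MemLp f 2 volume) (hF : LocallyIntegrable F)
    (h : ∀ ψ : 𝓢(ℝ, ℂ), HasCompactSupport ψ → ∫ ξ, ψ ξ * F ξ = ∫ x, 𝓕 (ψ : ℝ → ℂ) x * f x) :
    IsFT f F :=
  (isFT_fourier hf).congr_right (ae_eq_of_schwartz
    ((isFT_fourier hf).right.locallyIntegrable (by norm_num)) hF
    fun ψ hψ => by rw [h ψ hψ, (isFT_fourier hf).pairing])

theorem isFT_of_integrable {f : ℝ → ℂ} (hf : MemLp f 2 volume) (hf' : Integrable f) :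
    IsFT f (𝓕 f) := by
  refine isFT_of_compact hf ?_ fun ψ _ => ?_
  · exact (VectorFourier.fourierIntegral_continuous Real.continuous_fourierChar
      (by fun_prop) hf').locallyIntegrable
  · have := VectorFourier.integral_fourierIntegral_smul_eq_flip (L := innerₗ ℝ)
      Real.continuous_fourierChar (by fun_prop) ψ.integrable hf' (μ := volume) (ν := volume)
    simp only [smul_eq_mul, flip_innerₗ] at this
    exact this.symm

/-- Translation corresponds to multiplication by a character. -/
theorem IsFT.translate {f F : ℝ → ℂ} (hF : IsFT f F) (τ : ℝ) :
    IsFT (fun x => f (x + τ)) fun ξ => Complex.exp (2 * Real.pi * (τ * ξ : ℝ) * Complex.I) * F ξ := by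
  set e : ℝ → ℂ := fun ξ => Complex.exp (2 * Real.pi * (τ * ξ : ℝ) * Complex.I) with he
  have he' : ContDiff ℝ (⊤ : ℕ∞) e := by
    have : ContDiff ℝ (⊤ : ℕ∞) fun ξ : ℝ => ((ξ : ℝ) : ℂ) := Complex.ofRealCLM.contDiff
    simp only [he]; push_cast
    fun_prop
  have hen : ∀ ξ, ‖e ξ‖ = 1 := fun ξ => by
    simp only [he]
    rw [← Complex.norm_exp_ofReal_mul_I (2 * Real.pi * (τ * ξ))]; push_cast; rfl
  have hmem : MemLp (fun ξ => e ξ * F ξ) 2 volume :=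
    hF.right.of_le (he'.continuous.aestronglyMeasurable.mul hF.right.1)
      (.of_forall fun ξ => by simp [hen])
  refine isFT_of_compact (hF.left.comp_measurePreserving (measurePreserving_add_right volume τ))
    (hmem.locallyIntegrable (by norm_num)) fun ψ hψ => ?_
  have h1 : HasCompactSupport (fun ξ => e ξ * ψ ξ) := hψ.mul_left
  have h2 : ContDiff ℝ (⊤ : ℕ∞) (fun ξ => e ξ * ψ ξ) := he'.mul (ψ.smooth ⊤)
  have h3 := hF.pairing (h1.toSchwartzMap h2)
  have hc : ⇑(h1.toSchwartzMap h2) = fun ξ => e ξ * ψ ξ := rfl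
  rw [hc] at h3
  beta_reduce at h3
  have : ∀ ξ, ψ ξ * (e ξ * F ξ) = e ξ * ψ ξ * F ξ := fun ξ => by ring
  refine (integral_congr_ae (.of_forall this)).trans (h3.trans ?_)
  rw [← integral_add_right_eq_self (fun x => 𝓕 (fun ξ => e ξ * ψ ξ) x * f x) τ]
  congr 1; ext x; congr 1
  rw [Real.fourier_eq', Real.fourier_eq']
  congr 1; ext ξ
  simp only [smul_eq_mul, he, ← mul_assoc, ← Complex.exp_add]
  congr 2
  simp
  ring

/-- Modulation corresponds to translation. -/
theorem IsFT.modulate {f F : ℝ → ℂ} (hF : IsFT f F) (θ : ℝ) :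
    IsFT (fun x => Complex.exp (2 * Real.pi * (θ * x : ℝ) * Complex.I) * f x)
      fun ξ => F (ξ - θ) := by
  set e : ℝ → ℂ := fun ξ => Complex.exp (2 * Real.pi * (θ * ξ : ℝ) * Complex.I) with he
  have he' : ContDiff ℝ (⊤ : ℕ∞) e := by
    have : ContDiff ℝ (⊤ : ℕ∞) fun ξ : ℝ => ((ξ : ℝ) : ℂ) := Complex.ofRealCLM.contDiff
    simp only [he]; push_cast
    fun_prop
  have hen : ∀ ξ, ‖e ξ‖ = 1 := fun ξ => by
    simp only [he]
    rw [← Complex.norm_exp_ofReal_mul_I (2 * Real.pi * (θ * ξ))]; push_cast; rfl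
  have hmem : MemLp (fun ξ => e ξ * f ξ) 2 volume :=
    hF.left.of_le (he'.continuous.aestronglyMeasurable.mul hF.left.1)
      (.of_forall fun ξ => by simp [hen])
  refine isFT_of_compact hmem
    ((hF.right.comp_measurePreserving (measurePreserving_sub_right volume θ)).locallyIntegrable
      (by norm_num)) fun ψ hψ => ?_
  have h1 : HasCompactSupport (fun ξ => ψ (ξ + θ)) :=
    hψ.comp_homeomorph (Homeomorph.addRight θ)
  have h2 : ContDiff ℝ (⊤ : ℕ∞) (fun ξ => ψ (ξ + θ)) := by
    have := ψ.smooth ⊤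
    fun_prop
  have h3 := hF.pairing (h1.toSchwartzMap h2)
  have hc : ⇑(h1.toSchwartzMap h2) = fun ξ => ψ (ξ + θ) := rfl
  rw [hc] at h3
  beta_reduce at h3
  rw [← integral_add_right_eq_self (fun x => ψ x * F (x - θ)) θ]
  simp only [add_sub_cancel_right]
  rw [h3]
  congr 1; ext x; rw [← mul_assoc]; congr 1
  rw [Real.fourier_eq', Real.fourier_eq',
    ← integral_add_right_eq_self (fun v => Complex.exp _ • ψ v) θ, ← integral_mul_const]
  congr 1; ext ξ
  simp only [smul_eq_mul]
  rw [mul_right_comm _ (ψ _), ← Complex.exp_add]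
  congr 2
  simp
  ring

/-- The Fourier transform of the transform is the reflected function. -/
theorem IsFT.reflect {f F : ℝ → ℂ} (hF : IsFT f F) : IsFT F fun x => f (-x) := by
  refine isFT_of_compact hF.right ?_ fun ψ _ => ?_
  · exact (hF.left.comp_measurePreserving (Measure.measurePreserving_neg volume)).locallyIntegrable
      (by norm_num)
  · rw [← SchwartzMap.fourier_coe, hF.pairing, ← integral_neg_eq_self]
    congr 1; ext x
    simp only [neg_neg]
    congr 1
    have h := Real.fourierInv_eq_fourier_neg (⇑(𝓕 ψ : 𝓢(ℝ, ℂ))) (-x)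
    rw [neg_neg] at h
    rw [← h, ← SchwartzMap.fourierInv_coe, FourierTransform.fourierInv_fourier_eq]

/-- Fourier inversion for a square integrable function with integrable transform. -/
theorem IsFT.inversion {f F : ℝ → ℂ} (hF : IsFT f F) (hi : Integrable F) :
    ∀ᵐ x, f x = ∫ ξ, Complex.exp (2 * Real.pi * (ξ * x : ℝ) * Complex.I) * F ξ := by
  have h := (Measure.measurePreserving_neg (volume : Measure ℝ)).quasiMeasurePreserving.ae
    (hF.reflect.ae_eq (isFT_of_integrable hF.right hi))
  filter_upwards [h] with x hx
  rw [neg_neg] at hx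
  rw [hx, Real.fourier_eq']
  congr 1; ext ξ
  rw [smul_eq_mul]
  congr 2
  simp
  ring

theorem memLp_two_norm_sq {f : ℝ → ℂ} (hf : MemLp f 2 volume) :
    Integrable fun x => ‖f x‖ ^ 2 :=
  (memLp_two_iff_integrable_sq_norm hf.1).1 hf

theorem integrable_conj_mul_shift {V W k : ℝ → ℂ} (hV : MemLp V 2 volume) (hW : MemLp W 2 volume)
    (hk : Integrable k) :
    Integrable (fun p : ℝ × ℝ => conj (V p.1) * (k p.2 * W (p.1 - p.2)))
      ((volume : Measure ℝ).prod volume) := by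
  have h1 : Integrable (fun p : ℝ × ℝ => ‖k p.2‖ * ‖W (p.1 - p.2)‖ ^ 2)
      ((volume : Measure ℝ).prod volume) := by
    simpa using hk.norm.convolution_integrand (ContinuousLinearMap.mul ℝ ℝ) (memLp_two_norm_sq hW)
  have h2 : Integrable (fun p : ℝ × ℝ => ‖V p.1‖ ^ 2 * ‖k p.2‖)
      ((volume : Measure ℝ).prod volume) := (memLp_two_norm_sq hV).mul_prod hk.norm
  have hm : AEStronglyMeasurable (fun p : ℝ × ℝ => k p.2 * W (p.1 - p.2))
      ((volume : Measure ℝ).prod volume) := by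
    simpa using hk.1.convolution_integrand (ContinuousLinearMap.mul ℝ ℂ) hW.1
  refine (h1.add h2).mono' ((Complex.continuous_conj.comp_aestronglyMeasurable
    hV.1.comp_fst).mul hm) (.of_forall fun p => ?_)
  simp only [norm_mul, RCLike.norm_conj, Pi.add_apply]
  nlinarith [sq_nonneg (‖V p.1‖ - ‖W (p.1 - p.2)‖), norm_nonneg (k p.2),
    mul_nonneg (norm_nonneg (k p.2)) (sq_nonneg (‖V p.1‖ - ‖W (p.1 - p.2)‖)),
    mul_nonneg (norm_nonneg (k p.2)) (sq_nonneg (‖V p.1‖)),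
    mul_nonneg (norm_nonneg (k p.2)) (sq_nonneg (‖W (p.1 - p.2)‖))]

/-- Plancherel's identity for a convolution. -/
theorem IsFT.integral_conj_mul_convolution {V V' W W' k : ℝ → ℂ} (hV : IsFT V V') (hW : IsFT W W')
    (hk : Integrable k) :
    ∫ t, conj (V t) * ∫ s, k (t - s) * W s = ∫ ξ, conj (V' ξ) * (𝓕 k ξ * W' ξ) := by
  have e1 : ∀ t, ∫ s, k (t - s) * W s = ∫ τ, k τ * W (t - τ) := fun t => by
    rw [← integral_sub_left_eq_self (fun τ => k τ * W (t - τ)) volume t]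
    simp
  simp only [e1, ← integral_const_mul]
  rw [integral_integral_swap (f := fun t τ => conj (V t) * (k τ * W (t - τ)))
    (integrable_conj_mul_shift hV.left hW.left hk)]
  have e2 : ∀ τ, ∫ t, conj (V t) * (k τ * W (t - τ)) = ∫ ξ, k τ *
      (conj (V' ξ) * (Complex.exp (2 * Real.pi * (-τ * ξ : ℝ) * Complex.I) * W' ξ)) := fun τ => by
    rw [integral_const_mul, hV.integral_conj_mul (hW.translate (-τ)), ← integral_const_mul]
    congr 1; ext t; rw [← sub_eq_add_neg]; ring
  simp only [e2]
  have hVW : Integrable fun ξ => conj (V' ξ) * W' ξ :=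
    hV.right.star.integrable_mul hW.right
  rw [integral_integral_swap]
  · congr 1; ext ξ
    rw [Real.fourier_eq', ← integral_mul_const, ← integral_const_mul]
    congr 1; ext τ
    rw [smul_eq_mul]
    have : Complex.exp (2 * Real.pi * (-τ * ξ : ℝ) * Complex.I)
        = Complex.exp (((-2 * Real.pi * inner ℝ τ ξ : ℝ) : ℂ) * Complex.I) := by
      congr 2; simp; ring
    rw [this]; ring
  · refine (hk.norm.mul_prod hVW.norm).mono' ?_ (.of_forall fun p => ?_)
    · have hc : Continuous fun p : ℝ × ℝ =>
          Complex.exp (2 * Real.pi * (-p.1 * p.2 : ℝ) * Complex.I) := by fun_prop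
      exact hk.1.comp_fst.mul ((Complex.continuous_conj.comp_aestronglyMeasurable
        hV.right.1.comp_snd).mul (hc.aestronglyMeasurable.mul hW.right.1.comp_snd))
    · have : ‖Complex.exp (2 * Real.pi * (-p.1 * p.2 : ℝ) * Complex.I)‖ = 1 := by
        rw [← Complex.norm_exp_ofReal_mul_I (2 * Real.pi * (-p.1 * p.2))]; push_cast; rfl
      simp only [Function.uncurry, norm_mul, this, RCLike.norm_conj, one_mul, le_refl]

end NonMarkov

end

noncomputable section

open MeasureTheory Set
open scoped ENNReal FourierTransform

namespace NonMarkov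

open ComplexConjugate

/-! ### Superpositions of modulated convolutions -/

/-- The character `e^{2πix}`. -/
def character (x : ℝ) : ℂ := Complex.exp (2 * Real.pi * (x : ℝ) * Complex.I)

@[simp] theorem norm_character (x : ℝ) : ‖character x‖ = 1 := by
  rw [character, ← Complex.norm_exp_ofReal_mul_I (2 * Real.pi * x)]; push_cast; rfl

theorem continuous_character : Continuous character := by
  unfold character; fun_prop

section Superposition

variable {Θ : Type*} [MeasurableSpace Θ] {μ : Measure Θ} {θ : Θ → ℝ}
  {k : Θ → ℝ → ℂ} {Ψ : Θ → ℝ} {E : ℝ → ℝ} {V V' W W' : ℝ → ℂ}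

theorem superposition_eq (t : ℝ) :
    conj (V t) * ∫ s, (∫ ϑ, k ϑ (t - s) * character (θ ϑ * s) ∂μ) * W s
      = ∫ τ, ∫ ϑ, conj (V t) * (k ϑ τ * (character (θ ϑ * (t - τ)) * W (t - τ))) ∂μ := by
  rw [← integral_sub_left_eq_self
      (fun τ => ∫ ϑ, conj (V t) * (k ϑ τ * (character (θ ϑ * (t - τ)) * W (t - τ))) ∂μ) volume t,
    ← integral_const_mul]
  congr 1; ext s
  rw [← integral_mul_const, ← integral_const_mul]
  congr 1; ext ϑ
  rw [sub_sub_cancel]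
  ring

theorem integrable_superposition (hθ : Measurable θ) (hk : StronglyMeasurable (Function.uncurry k))
    (hΨ : Integrable Ψ μ) (hE : Integrable E) (hb : ∀ ϑ τ, ‖k ϑ τ‖ ≤ Ψ ϑ * E τ)
    (hV : MemLp V 2 volume) (hW : MemLp W 2 volume) :
    Integrable (fun p : (ℝ × ℝ) × Θ => conj (V p.1.1) *
      (k p.2 p.1.2 * (character (θ p.2 * (p.1.1 - p.1.2)) * W (p.1.1 - p.1.2))))
      (((volume : Measure ℝ).prod volume).prod μ) := by
  have h1 := (integrable_conj_mul_shift hV hW hE.ofReal).norm.mul_prod hΨ.norm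
  have hW' : AEStronglyMeasurable (fun p : ℝ × ℝ => W (p.1 - p.2))
      ((volume : Measure ℝ).prod volume) :=
    hW.1.comp_quasiMeasurePreserving (quasiMeasurePreserving_sub_of_right_invariant volume volume)
  refine h1.mono' ?_ (.of_forall fun p => ?_)
  · have hk' : StronglyMeasurable fun p : (ℝ × ℝ) × Θ => k p.2 p.1.2 :=
      hk.comp_measurable (g := fun p : (ℝ × ℝ) × Θ => (p.2, p.1.2)) (by fun_prop)
    have hc : Measurable fun p : (ℝ × ℝ) × Θ => character (θ p.2 * (p.1.1 - p.1.2)) :=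
      continuous_character.measurable.comp (by fun_prop)
    exact (Complex.continuous_conj.comp_aestronglyMeasurable hV.1.comp_fst.comp_fst).mul
      (hk'.aestronglyMeasurable.mul (hc.aestronglyMeasurable.mul hW'.comp_fst))
  · simp only [norm_mul, RCLike.norm_conj, norm_character, one_mul]
    have hb' : ‖k p.2 p.1.2‖ ≤ ‖Ψ p.2‖ * |E p.1.2| := by
      rw [← Real.norm_eq_abs, ← norm_mul]
      exact (hb _ _).trans (le_abs_self _)
    rw [RCLike.norm_ofReal]
    calc ‖V p.1.1‖ * (‖k p.2 p.1.2‖ * ‖W (p.1.1 - p.1.2)‖)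
        ≤ ‖V p.1.1‖ * ((‖Ψ p.2‖ * |E p.1.2|) * ‖W (p.1.1 - p.1.2)‖) := by gcongr
      _ = _ := by ring

variable [SFinite μ]

theorem integrable_conj_mul_superposition (hθ : Measurable θ)
    (hk : StronglyMeasurable (Function.uncurry k))
    (hΨ : Integrable Ψ μ) (hE : Integrable E) (hb : ∀ ϑ τ, ‖k ϑ τ‖ ≤ Ψ ϑ * E τ)
    (hV : MemLp V 2 volume) (hW : MemLp W 2 volume) :
    Integrable fun t => conj (V t) * ∫ s, (∫ ϑ, k ϑ (t - s) * character (θ ϑ * s) ∂μ) * W s := by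
  simp only [superposition_eq]
  exact (integrable_superposition hθ hk hΨ hE hb hV hW).integral_prod_left.integral_prod_left

/-- The bilinear form of a superposition of modulated convolutions on the Fourier side. -/
theorem integral_conj_mul_superposition (hθ : Measurable θ)
    (hk : StronglyMeasurable (Function.uncurry k))
    (hΨ : Integrable Ψ μ) (hE : Integrable E) (hb : ∀ ϑ τ, ‖k ϑ τ‖ ≤ Ψ ϑ * E τ)
    (hV : IsFT V V') (hW : IsFT W W') :
    ∫ t, conj (V t) * ∫ s, (∫ ϑ, k ϑ (t - s) * character (θ ϑ * s) ∂μ) * W s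
      = ∫ ϑ, (∫ ξ, conj (V' ξ) * (𝓕 (k ϑ) ξ * W' (ξ - θ ϑ))) ∂μ := by
  have hH := integrable_superposition hθ hk hΨ hE hb hV.left hW.left
  simp only [superposition_eq]
  have h1 := integral_prod _ hH.integral_prod_left
  rw [← h1, ← integral_prod _ hH, integral_prod_symm _ hH]
  refine integral_congr_ae ?_
  filter_upwards [hH.prod_left_ae] with ϑ hϑ
  have hkϑ : Integrable (k ϑ) :=
    (hE.const_mul (Ψ ϑ)).mono' (hk.comp_measurable measurable_prodMk_left).aestronglyMeasurable
      (.of_forall (hb ϑ))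
  rw [← hV.integral_conj_mul_convolution (hW.modulate (θ ϑ)) hkϑ, integral_prod _ hϑ]
  congr 1; ext t
  rw [← integral_sub_left_eq_self
      (fun τ => conj (V t) * (k ϑ τ * (character (θ ϑ * (t - τ)) * W (t - τ)))) volume t,
    ← integral_const_mul]
  congr 1; ext s
  rw [sub_sub_cancel]
  rfl

theorem integrable_superposition_fourier (hθ : Measurable θ)
    (hk : StronglyMeasurable (Function.uncurry k))
    (hΨ : Integrable Ψ μ) (hE : Integrable E) (hb : ∀ ϑ τ, ‖k ϑ τ‖ ≤ Ψ ϑ * E τ)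
    (hV : IsFT V V') (hW : IsFT W W') :
    Integrable (fun ϑ => ∫ ξ, conj (V' ξ) * (𝓕 (k ϑ) ξ * W' (ξ - θ ϑ))) μ := by
  have hH := integrable_superposition hθ hk hΨ hE hb hV.left hW.left
  refine hH.integral_prod_right.congr ?_
  filter_upwards [hH.prod_left_ae] with ϑ hϑ
  have hkϑ : Integrable (k ϑ) :=
    (hE.const_mul (Ψ ϑ)).mono' (hk.comp_measurable measurable_prodMk_left).aestronglyMeasurable
      (.of_forall (hb ϑ))
  rw [← hV.integral_conj_mul_convolution (hW.modulate (θ ϑ)) hkϑ, integral_prod _ hϑ]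
  congr 1; ext t
  rw [← integral_sub_left_eq_self
      (fun τ => conj (V t) * (k ϑ τ * (character (θ ϑ * (t - τ)) * W (t - τ)))) volume t,
    ← integral_const_mul]
  congr 1; ext s
  rw [sub_sub_cancel]
  rfl

theorem integral_norm_superposition_le (hθ : Measurable θ)
    (hk : StronglyMeasurable (Function.uncurry k))
    (hΨ : Integrable Ψ μ) (hE : Integrable E) (hb : ∀ ϑ τ, ‖k ϑ τ‖ ≤ Ψ ϑ * E τ)
    (hV : MemLp V 2 volume) (hW : MemLp W 2 volume) :
    ∫ t, ‖conj (V t) * ∫ s, (∫ ϑ, k ϑ (t - s) * character (θ ϑ * s) ∂μ) * W s‖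
      ≤ (∫ ϑ, ‖Ψ ϑ‖ ∂μ) * (∫ τ, ‖E τ‖) * ((∫ t, ‖V t‖ ^ 2) + ∫ t, ‖W t‖ ^ 2) := by
  have hH := integrable_superposition hθ hk hΨ hE hb hV hW
  have hVW : Integrable (fun p : ℝ × ℝ => ‖E p.2‖ * (‖V p.1‖ ^ 2 + ‖W (p.1 - p.2)‖ ^ 2))
      ((volume : Measure ℝ).prod volume) := by
    have h1 : Integrable (fun p : ℝ × ℝ => ‖E p.2‖ * ‖W (p.1 - p.2)‖ ^ 2)
        ((volume : Measure ℝ).prod volume) := by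
      simpa using
        hE.norm.convolution_integrand (ContinuousLinearMap.mul ℝ ℝ) (memLp_two_norm_sq hW)
    have h2 : Integrable (fun p : ℝ × ℝ => ‖V p.1‖ ^ 2 * ‖E p.2‖)
        ((volume : Measure ℝ).prod volume) := (memLp_two_norm_sq hV).mul_prod hE.norm
    refine (h2.add h1).congr (.of_forall fun p => ?_)
    simp only [Pi.add_apply]; ring
  have e : (∫ ϑ, ‖Ψ ϑ‖ ∂μ) * (∫ τ, ‖E τ‖) * ((∫ t, ‖V t‖ ^ 2) + ∫ t, ‖W t‖ ^ 2)
      = ∫ t, ∫ τ, (∫ ϑ, ‖Ψ ϑ‖ ∂μ) * (‖E τ‖ * (‖V t‖ ^ 2 + ‖W (t - τ)‖ ^ 2)) := by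
    rw [integral_integral_swap (f := fun t τ =>
      (∫ ϑ, ‖Ψ ϑ‖ ∂μ) * (‖E τ‖ * (‖V t‖ ^ 2 + ‖W (t - τ)‖ ^ 2))) (hVW.const_mul _)]
    have : ∀ τ, ∫ t, (∫ ϑ, ‖Ψ ϑ‖ ∂μ) * (‖E τ‖ * (‖V t‖ ^ 2 + ‖W (t - τ)‖ ^ 2))
        = (∫ ϑ, ‖Ψ ϑ‖ ∂μ) * (‖E τ‖ * ((∫ t, ‖V t‖ ^ 2) + ∫ t, ‖W t‖ ^ 2)) := fun τ => by
      rw [integral_const_mul, integral_const_mul, integral_add (memLp_two_norm_sq hV)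
        ((memLp_two_norm_sq hW).comp_sub_right τ),
        integral_sub_right_eq_self (fun t => ‖W t‖ ^ 2)]
    simp only [this]
    rw [integral_const_mul, integral_mul_const]; ring
  rw [e]
  simp only [superposition_eq]
  refine integral_mono_ae hH.integral_prod_left.integral_prod_left.norm
    (hVW.const_mul _).integral_prod_left ?_
  filter_upwards [hH.integral_prod_left.prod_right_ae, (hVW.const_mul
    (∫ ϑ, ‖Ψ ϑ‖ ∂μ)).prod_right_ae] with t h1 h2
  refine (norm_integral_le_integral_norm _).trans (integral_mono_ae h1.norm h2
    (.of_forall fun τ => ?_))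
  refine (norm_integral_le_integral_norm _).trans ?_
  beta_reduce
  rw [← integral_mul_const]
  refine integral_mono_of_nonneg (.of_forall fun _ => norm_nonneg _) (hΨ.norm.mul_const _)
    (.of_forall fun ϑ => ?_)
  simp only [norm_mul, RCLike.norm_conj, norm_character, one_mul]
  have hb' : ‖k ϑ τ‖ ≤ ‖Ψ ϑ‖ * ‖E τ‖ := by
    rw [← norm_mul]
    exact (hb _ _).trans (le_abs_self _)
  calc ‖V t‖ * (‖k ϑ τ‖ * ‖W (t - τ)‖) ≤ ‖V t‖ * ((‖Ψ ϑ‖ * ‖E τ‖) * ‖W (t - τ)‖) := by gcongr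
    _ = ‖Ψ ϑ‖ * (‖E τ‖ * (‖V t‖ * ‖W (t - τ)‖)) := by ring
    _ ≤ ‖Ψ ϑ‖ * (‖E τ‖ * (‖V t‖ ^ 2 + ‖W (t - τ)‖ ^ 2)) := by
      gcongr
      nlinarith [sq_nonneg (‖V t‖ - ‖W (t - τ)‖), sq_nonneg ‖V t‖, sq_nonneg ‖W (t - τ)‖]

end Superposition

end NonMarkov

end

noncomputable section

open MeasureTheory Set
open scoped ENNReal FourierTransform

namespace NonMarkov

/-! ### One-dimensional integrals -/

theorem inv_sq_mul_exp_le {κ s : ℝ} (hκ : 0 < κ) (hs : 0 < s) :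
    (s ^ 2)⁻¹ * Real.exp (-(κ / s)) ≤ 2 / κ ^ 2 := by
  have h := Real.quadratic_le_exp_of_nonneg (x := κ / s) (by positivity)
  rw [Real.exp_neg, ← mul_inv]
  have h1 : (κ / s) ^ 2 / 2 ≤ Real.exp (κ / s) := by
    have : 0 < κ / s := by positivity
    linarith
  calc (s ^ 2 * Real.exp (κ / s))⁻¹ ≤ (s ^ 2 * ((κ / s) ^ 2 / 2))⁻¹ := by gcongr
    _ = 2 / κ ^ 2 := by field_simp

theorem inv_mul_exp_le {κ s : ℝ} (hκ : 0 < κ) (hs : 0 < s) :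
    s⁻¹ * Real.exp (-(κ / s)) ≤ 1 / κ := by
  have h := Real.add_one_le_exp (κ / s)
  rw [Real.exp_neg, ← mul_inv]
  calc (s * Real.exp (κ / s))⁻¹ ≤ (s * (κ / s))⁻¹ := by gcongr; linarith
    _ = 1 / κ := by field_simp

theorem integrableOn_exp_neg : IntegrableOn (fun s : ℝ => Real.exp (-s)) (Ioi 0) :=
  integrableOn_exp_neg_Ioi 0

theorem integrableOn_besselA {β : ℝ} (hβ : 0 < β) :
    IntegrableOn (fun s : ℝ => (Real.sqrt s)⁻¹ * Real.exp (-s - β ^ 2 / s)) (Ioi 0) := by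
  refine ((integrableOn_exp_neg.const_mul (1 + 1 / β ^ 2))).mono'
    (Measurable.aestronglyMeasurable (by fun_prop)) ?_
  filter_upwards [ae_restrict_mem measurableSet_Ioi] with s hs
  have hs : 0 < s := hs
  rw [Real.norm_of_nonneg (by positivity), sub_eq_add_neg, Real.exp_add]
  have h1 : (Real.sqrt s)⁻¹ ≤ 1 + s⁻¹ := by
    rw [← Real.sqrt_inv]
    exact Real.sqrt_le_iff.2 ⟨by positivity, by nlinarith [inv_pos.2 hs]⟩
  have h2 := inv_mul_exp_le (κ := β ^ 2) (by positivity) hs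
  have h3 : Real.exp (-(β ^ 2 / s)) ≤ 1 := Real.exp_le_one_iff.2 (by
    have : 0 < β ^ 2 / s := by positivity
    linarith)
  calc (Real.sqrt s)⁻¹ * (Real.exp (-s) * Real.exp (-(β ^ 2 / s)))
      ≤ (1 + s⁻¹) * (Real.exp (-s) * Real.exp (-(β ^ 2 / s))) := by gcongr
    _ = (Real.exp (-(β ^ 2 / s)) + s⁻¹ * Real.exp (-(β ^ 2 / s))) * Real.exp (-s) := by ring
    _ ≤ (1 + 1 / β ^ 2) * Real.exp (-s) := by gcongr

theorem integrableOn_besselB {β : ℝ} (hβ : 0 < β) :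
    IntegrableOn (fun s : ℝ => (s * Real.sqrt s)⁻¹ * Real.exp (-s - β ^ 2 / s)) (Ioi 0) := by
  refine ((integrableOn_exp_neg.const_mul (1 / β ^ 2 + 2 / (β ^ 2) ^ 2))).mono'
    (Measurable.aestronglyMeasurable (by fun_prop)) ?_
  filter_upwards [ae_restrict_mem measurableSet_Ioi] with s hs
  have hs : 0 < s := hs
  rw [Real.norm_of_nonneg (by positivity), sub_eq_add_neg, Real.exp_add]
  have h1 : (Real.sqrt s)⁻¹ ≤ 1 + s⁻¹ := by
    rw [← Real.sqrt_inv]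
    exact Real.sqrt_le_iff.2 ⟨by positivity, by nlinarith [inv_pos.2 hs]⟩
  have h2 := inv_mul_exp_le (κ := β ^ 2) (by positivity) hs
  have h3 := inv_sq_mul_exp_le (κ := β ^ 2) (by positivity) hs
  calc (s * Real.sqrt s)⁻¹ * (Real.exp (-s) * Real.exp (-(β ^ 2 / s)))
      = s⁻¹ * (Real.sqrt s)⁻¹ * (Real.exp (-s) * Real.exp (-(β ^ 2 / s))) := by rw [mul_inv]
    _ ≤ s⁻¹ * (1 + s⁻¹) * (Real.exp (-s) * Real.exp (-(β ^ 2 / s))) := by gcongr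
    _ = (s⁻¹ * Real.exp (-(β ^ 2 / s)) + (s ^ 2)⁻¹ * Real.exp (-(β ^ 2 / s))) * Real.exp (-s) := by
      field_simp
    _ ≤ (1 / β ^ 2 + 2 / (β ^ 2) ^ 2) * Real.exp (-s) := by gcongr

theorem besselA_eq_besselB {β : ℝ} (hβ : 0 < β) :
    ∫ s in Ioi (0 : ℝ), (Real.sqrt s)⁻¹ * Real.exp (-s - β ^ 2 / s)
      = β * ∫ s in Ioi (0 : ℝ), (s * Real.sqrt s)⁻¹ * Real.exp (-s - β ^ 2 / s) := by
  have him : (fun s : ℝ => β ^ 2 / s) '' Ioi 0 = Ioi 0 := by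
    ext s
    simp only [mem_image, mem_Ioi]
    refine ⟨?_, fun hs => ⟨β ^ 2 / s, by positivity, by field_simp⟩⟩
    rintro ⟨x, hx, rfl⟩; positivity
  have h := integral_image_eq_integral_abs_deriv_smul (s := Ioi (0 : ℝ))
    (f := fun s : ℝ => β ^ 2 / s) (f' := fun s => -(β ^ 2 / s ^ 2)) measurableSet_Ioi
    (fun x hx => by
      have hx : x ≠ 0 := ne_of_gt hx
      refine ((hasDerivAt_const x (β ^ 2)).div
        (hasDerivAt_id' x) hx).hasDerivWithinAt.congr_deriv ?_
      ring)
    (fun x hx y hy hxy => by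
      have hx : x ≠ 0 := ne_of_gt hx
      have hy : y ≠ 0 := ne_of_gt hy
      field_simp at hxy
      exact hxy.symm)
    (fun s => (Real.sqrt s)⁻¹ * Real.exp (-s - β ^ 2 / s))
  rw [him] at h
  rw [h, ← integral_const_mul]
  refine setIntegral_congr_fun measurableSet_Ioi fun s hs => ?_
  have hs : 0 < s := hs
  simp only [smul_eq_mul]
  rw [abs_neg, abs_of_pos (by positivity), Real.sqrt_div (by positivity), Real.sqrt_sq hβ.le,
    show -(β ^ 2 / s) - β ^ 2 / (β ^ 2 / s) = -s - β ^ 2 / s by field_simp; ring]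
  have h2 : s ^ 2 = s * (Real.sqrt s * Real.sqrt s) := by rw [Real.mul_self_sqrt hs.le]; ring
  have h3 : Real.sqrt s ≠ 0 := (Real.sqrt_pos.2 hs).ne'
  rw [h2]
  field_simp

theorem besselA_add_besselB {β : ℝ} (hβ : 0 < β) :
    ∫ s in Ioi (0 : ℝ), ((Real.sqrt s)⁻¹ + β * (s * Real.sqrt s)⁻¹) * Real.exp (-s - β ^ 2 / s)
      = 2 * Real.sqrt Real.pi * Real.exp (-(2 * β)) := by
  have hmono : StrictMonoOn (fun s : ℝ => Real.sqrt s - β / Real.sqrt s) (Ioi 0) := by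
    intro x hx y hy hxy
    have hx : 0 < x := hx
    have h1 := Real.sqrt_lt_sqrt hx.le hxy
    have h2 := Real.sqrt_pos.2 hx
    have : β / Real.sqrt y < β / Real.sqrt x := by gcongr
    simp only; linarith
  have him : (fun s : ℝ => Real.sqrt s - β / Real.sqrt s) '' Ioi 0 = univ := by
    refine eq_univ_of_forall fun y => ?_
    set w := Real.sqrt (y ^ 2 + 4 * β) with hw
    have hw2 : w ^ 2 = y ^ 2 + 4 * β := Real.sq_sqrt (by positivity)
    have hwy : |y| < w := by
      rw [hw, ← Real.sqrt_sq_eq_abs]; exact Real.sqrt_lt_sqrt (sq_nonneg _) (by linarith)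
    have hpos : 0 < (y + w) / 2 := by linarith [neg_abs_le y]
    refine ⟨((y + w) / 2) ^ 2, by simp only [mem_Ioi]; positivity, ?_⟩
    simp only
    rw [Real.sqrt_sq hpos.le]
    have : y + w ≠ 0 := by linarith
    field_simp
    nlinarith
  have h := integral_image_eq_integral_abs_deriv_smul (s := Ioi (0 : ℝ))
    (f := fun s : ℝ => Real.sqrt s - β / Real.sqrt s)
    (f' := fun s => (1 / 2) * ((Real.sqrt s)⁻¹ + β * (s * Real.sqrt s)⁻¹)) measurableSet_Ioi
    (fun x hx => by
      have hx : 0 < x := hx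
      have h1 := Real.hasDerivAt_sqrt hx.ne'
      have hs := Real.sqrt_pos.2 hx
      refine (h1.sub ((hasDerivAt_const x β).div h1 hs.ne')).hasDerivWithinAt.congr_deriv ?_
      rw [Real.sq_sqrt hx.le]
      field_simp
      ring)
    hmono.injOn (fun y => Real.exp (-1 * y ^ 2))
  rw [him, setIntegral_univ, integral_gaussian] at h
  rw [div_one] at h
  rw [h, mul_comm 2, mul_assoc, ← integral_mul_const]
  refine setIntegral_congr_fun measurableSet_Ioi fun s hs => ?_
  have hs : 0 < s := hs
  have hq := Real.sqrt_pos.2 hs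
  have hpos : 0 < (Real.sqrt s)⁻¹ + β * (s * Real.sqrt s)⁻¹ := by positivity
  simp only [smul_eq_mul]
  rw [abs_of_pos (by positivity)]
  have : Real.exp (-s - β ^ 2 / s)
      = Real.exp (-1 * (Real.sqrt s - β / Real.sqrt s) ^ 2) * Real.exp (-(2 * β)) := by
    rw [← Real.exp_add]
    congr 1
    rw [sub_sq, div_pow, Real.sq_sqrt hs.le]
    field_simp
    ring
  rw [this]; ring

theorem besselA {β : ℝ} (hβ : 0 < β) :
    ∫ s in Ioi (0 : ℝ), (Real.sqrt s)⁻¹ * Real.exp (-s - β ^ 2 / s)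
      = Real.sqrt Real.pi * Real.exp (-(2 * β)) := by
  have h := besselA_add_besselB hβ
  simp only [add_mul, mul_assoc β] at h
  rw [integral_add (integrableOn_besselA hβ) ((integrableOn_besselB hβ).const_mul β),
    integral_const_mul, ← besselA_eq_besselB hβ] at h
  linarith

theorem besselB {β : ℝ} (hβ : 0 < β) :
    ∫ s in Ioi (0 : ℝ), (s * Real.sqrt s)⁻¹ * Real.exp (-s - β ^ 2 / s)
      = Real.sqrt Real.pi * Real.exp (-(2 * β)) / β := by
  rw [← besselA hβ, besselA_eq_besselB hβ, mul_div_cancel_left₀ _ hβ.ne']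

/-! ### A convolution on the half line -/

theorem sqrt_mul_sub_eq_zero {s σ : ℝ} (hs : 0 ≤ s) (h : σ ≤ s) : Real.sqrt (s * (σ - s)) = 0 :=
  Real.sqrt_eq_zero_of_nonpos (by nlinarith)

theorem integrableOn_sqrt_mul_sub (σ : ℝ) :
    IntegrableOn (fun s => Real.sqrt (s * (σ - s))) (Ioi 0) := by
  have h : IntegrableOn (fun s => Real.sqrt (s * (σ - s))) (Icc 0 σ) :=
    Continuous.integrableOn_Icc (by fun_prop)
  have h2 : IntegrableOn (fun s => Real.sqrt (s * (σ - s))) (Ioi 0 \ Icc 0 σ) := by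
    refine integrableOn_zero.congr_fun (fun s hs => ?_) (measurableSet_Ioi.diff measurableSet_Icc)
    simp only [mem_sdiff, mem_Ioi, mem_Icc, not_and, not_le] at hs
    exact (sqrt_mul_sub_eq_zero hs.1.le (hs.2 hs.1.le).le).symm
  exact (h.union h2).mono_set fun s hs => by
    by_cases h' : s ∈ Icc 0 σ
    · exact .inl h'
    · exact .inr ⟨hs, h'⟩

theorem integral_sqrt_mul_sub {σ : ℝ} (hσ : 0 < σ) :
    ∫ s in Ioi (0 : ℝ), Real.sqrt (s * (σ - s))
      = σ ^ 2 * ∫ s in Ioi (0 : ℝ), Real.sqrt (s * (1 - s)) := by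
  have h := integral_comp_mul_left_Ioi (fun s => Real.sqrt (s * (σ - s))) 0 hσ
  rw [mul_zero, smul_eq_mul, eq_inv_mul_iff_mul_eq₀ hσ.ne'] at h
  rw [← h, ← integral_const_mul, ← integral_const_mul]
  refine setIntegral_congr_fun measurableSet_Ioi fun s hs => ?_
  rw [show σ * s * (σ - σ * s) = σ ^ 2 * (s * (1 - s)) by ring, Real.sqrt_mul (by positivity),
    Real.sqrt_sq hσ.le]
  ring

theorem integral_sqrt_mul_add {h : ℝ → ℝ} (hm : Measurable h)
    (hi : IntegrableOn (fun σ => σ ^ 2 * h σ) (Ioi 0)) :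
    ∫ s in Ioi (0 : ℝ), ∫ s' in Ioi (0 : ℝ), Real.sqrt (s * s') * h (s + s')
      = (∫ s in Ioi (0 : ℝ), Real.sqrt (s * (1 - s))) * ∫ σ in Ioi (0 : ℝ), σ ^ 2 * h σ := by
  have e1 : ∀ s ∈ Ioi (0 : ℝ), ∫ s' in Ioi (0 : ℝ), Real.sqrt (s * s') * h (s + s')
      = ∫ σ in Ioi (0 : ℝ), Real.sqrt (s * (σ - s)) * h σ := fun s hs => by
    have hs : 0 < s := hs
    have h1 := (measurePreserving_add_left volume s).setIntegral_preimage_emb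
      (measurableEmbedding_addLeft s) (fun σ => Real.sqrt (s * (σ - s)) * h σ) (Ioi s)
    simp only [add_sub_cancel_left, preimage_const_add_Ioi, sub_self] at h1
    rw [h1]
    symm
    refine setIntegral_eq_of_subset_of_forall_sdiff_eq_zero measurableSet_Ioi
      (Ioi_subset_Ioi hs.le) fun σ hσ => ?_
    simp only [mem_sdiff, mem_Ioi, not_lt] at hσ
    rw [sqrt_mul_sub_eq_zero hs.le hσ.2, zero_mul]
  rw [setIntegral_congr_fun measurableSet_Ioi e1, integral_integral_swap]
  · rw [← integral_const_mul]
    refine setIntegral_congr_fun measurableSet_Ioi fun σ hσ => ?_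
    rw [integral_mul_const, integral_sqrt_mul_sub hσ]
    ring
  · have hmeas : Measurable (Function.uncurry fun s σ => Real.sqrt (s * (σ - s)) * h σ) := by
      unfold Function.uncurry; fun_prop
    rw [integrable_prod_iff' hmeas.aestronglyMeasurable]
    refine ⟨.of_forall fun σ => ?_, ?_⟩
    · exact Integrable.mul_const (f := fun s => Real.sqrt (s * (σ - s)))
        (integrableOn_sqrt_mul_sub σ) (h σ)
    refine (hi.norm.const_mul (∫ s in Ioi (0 : ℝ), Real.sqrt (s * (1 - s)))).congr ?_
    filter_upwards [ae_restrict_mem measurableSet_Ioi] with σ hσ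
    simp only [Function.uncurry, norm_mul, Real.norm_of_nonneg (Real.sqrt_nonneg _)]
    rw [integral_mul_const, integral_sqrt_mul_sub hσ, Real.norm_of_nonneg (sq_nonneg σ)]
    ring

end NonMarkov

end

noncomputable section

open MeasureTheory Set
open scoped ENNReal FourierTransform

namespace NonMarkov

/-! ### Gaussian moments -/

theorem integrable_gauss {B : ℝ} (hB : 0 < B) :
    Integrable fun ξ : Vel => Real.exp (-B * ‖ξ‖ ^ 2) := by
  refine .of_integral_ne_zero ?_
  rw [GaussianFourier.integral_rexp_neg_mul_sq_norm hB]
  positivity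

theorem integral_gauss {B : ℝ} (hB : 0 < B) :
    ∫ ξ : Vel, Real.exp (-B * ‖ξ‖ ^ 2) = (Real.pi / B) ^ (3 / 2 : ℝ) := by
  have h := GaussianFourier.integral_rexp_neg_mul_sq_norm (V := Vel) hB
  have hd : (Module.finrank ℝ Vel : ℝ) = 3 := by simp
  rwa [hd] at h

theorem abs_coord_le (x : Vel) (i : Fin 3) : |x i| ≤ ‖x‖ := by
  simpa using PiLp.norm_apply_le x i

theorem integrable_sq_gauss {B : ℝ} (hB : 0 < B) :
    Integrable fun ξ : Vel => ‖ξ‖ ^ 2 * Real.exp (-B * ‖ξ‖ ^ 2) := by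
  refine ((integrable_gauss (half_pos hB)).const_mul (2 / B)).mono'
    (Continuous.aestronglyMeasurable (by fun_prop)) (.of_forall fun ξ => ?_)
  rw [Real.norm_of_nonneg (by positivity)]
  have h := Real.add_one_le_exp (B / 2 * ‖ξ‖ ^ 2)
  have h2 : ‖ξ‖ ^ 2 ≤ 2 / B * Real.exp (B / 2 * ‖ξ‖ ^ 2) := by
    rw [div_mul_eq_mul_div, le_div_iff₀ hB]
    nlinarith
  calc ‖ξ‖ ^ 2 * Real.exp (-B * ‖ξ‖ ^ 2)
      ≤ 2 / B * Real.exp (B / 2 * ‖ξ‖ ^ 2) * Real.exp (-B * ‖ξ‖ ^ 2) := by gcongr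
    _ = 2 / B * Real.exp (-(B / 2) * ‖ξ‖ ^ 2) := by
      rw [mul_assoc, ← Real.exp_add]; congr 2; ring

theorem integrable_coord_mul_coord_gauss {B : ℝ} (hB : 0 < B) (i j : Fin 3) :
    Integrable fun ξ : Vel => ξ i * ξ j * Real.exp (-B * ‖ξ‖ ^ 2) := by
  refine (integrable_sq_gauss hB).mono' (Continuous.aestronglyMeasurable (by fun_prop))
    (.of_forall fun ξ => ?_)
  rw [norm_mul, norm_mul, Real.norm_of_nonneg (Real.exp_nonneg _), sq]
  gcongr
  · exact abs_coord_le ξ i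
  · exact abs_coord_le ξ j

theorem integrable_coord_gauss {B : ℝ} (hB : 0 < B) (i : Fin 3) :
    Integrable fun ξ : Vel => ξ i * Real.exp (-B * ‖ξ‖ ^ 2) := by
  refine ((integrable_gauss hB).add (integrable_sq_gauss hB)).mono'
    (Continuous.aestronglyMeasurable (by fun_prop)) (.of_forall fun ξ => ?_)
  simp only [Pi.add_apply]
  rw [norm_mul, Real.norm_of_nonneg (Real.exp_nonneg _), ← one_add_mul]
  gcongr
  refine (abs_coord_le ξ i).trans ?_
  nlinarith [sq_nonneg (‖ξ‖ - 1)]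

theorem integral_coord_gauss (B : ℝ) (i : Fin 3) :
    ∫ ξ : Vel, ξ i * Real.exp (-B * ‖ξ‖ ^ 2) = 0 := by
  have h := integral_neg_eq_self (fun ξ : Vel => ξ i * Real.exp (-B * ‖ξ‖ ^ 2)) volume
  simp only [PiLp.neg_apply, norm_neg, neg_mul, integral_neg] at h
  simp only [neg_mul]
  linarith

theorem hasFDerivAt_gauss (B : ℝ) (ξ : Vel) :
    HasFDerivAt (fun ξ : Vel => Real.exp (-B * ‖ξ‖ ^ 2))
      ((Real.exp (-B * ‖ξ‖ ^ 2) * (-B)) • (2 • innerSL ℝ ξ)) ξ := by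
  have h := ((hasStrictFDerivAt_norm_sq ξ).hasFDerivAt.const_mul (-B)).exp
  rwa [smul_smul] at h

theorem integral_coord_mul_coord_gauss {B : ℝ} (hB : 0 < B) (i j : Fin 3) :
    ∫ ξ : Vel, ξ i * ξ j * Real.exp (-B * ‖ξ‖ ^ 2)
      = (if i = j then 1 else 0) * (1 / (2 * B)) * (Real.pi / B) ^ (3 / 2 : ℝ) := by
  have hd : ∀ ξ : Vel, fderiv ℝ (fun ξ : Vel => Real.exp (-B * ‖ξ‖ ^ 2)) ξ
      (EuclideanSpace.single j 1) = -(2 * B) * (ξ j * Real.exp (-B * ‖ξ‖ ^ 2)) := fun ξ => by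
    rw [(hasFDerivAt_gauss B ξ).fderiv]
    simp [EuclideanSpace.inner_single_right]
    ring
  have hc : ∀ ξ : Vel, fderiv ℝ (fun ξ : Vel => ξ i) ξ (EuclideanSpace.single j 1)
      = if i = j then 1 else 0 := fun ξ => by
    have : HasFDerivAt (fun ξ : Vel => ξ i) (EuclideanSpace.proj (𝕜 := ℝ) i : Vel →L[ℝ] ℝ) ξ :=
      (EuclideanSpace.proj (𝕜 := ℝ) i : Vel →L[ℝ] ℝ).hasFDerivAt
    rw [this.fderiv]
    simp
  have h := integral_mul_fderiv_eq_neg_fderiv_mul_of_integrable (μ := (volume : Measure Vel))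
    (v := EuclideanSpace.single j (1 : ℝ)) (f := fun ξ : Vel => ξ i)
    (g := fun ξ : Vel => Real.exp (-B * ‖ξ‖ ^ 2))
    (by simp only [hc]; exact (integrable_gauss hB).const_mul _)
    (by
      simp only [hd]
      refine ((integrable_coord_mul_coord_gauss hB i j).const_mul (-(2 * B))).congr
        (.of_forall fun ξ => ?_)
      simp only; ring)
    (integrable_coord_gauss hB i) (by fun_prop)
    (fun ξ _ => (hasFDerivAt_gauss B ξ).differentiableAt)
  simp only [hc, hd] at h
  rw [integral_const_mul, integral_gauss hB] at h
  have e : ∀ ξ : Vel, ξ i * (-(2 * B) * (ξ j * Real.exp (-B * ‖ξ‖ ^ 2)))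
      = -(2 * B) * (ξ i * ξ j * Real.exp (-B * ‖ξ‖ ^ 2)) := fun ξ => by ring
  simp only [e] at h
  rw [integral_const_mul] at h
  generalize (∫ ξ : Vel, ξ i * ξ j * Real.exp (-B * ‖ξ‖ ^ 2)) = I at h ⊢
  field_simp
  linarith

theorem integral_sq_gauss {B : ℝ} (hB : 0 < B) :
    ∫ ξ : Vel, ‖ξ‖ ^ 2 * Real.exp (-B * ‖ξ‖ ^ 2)
      = 3 / (2 * B) * (Real.pi / B) ^ (3 / 2 : ℝ) := by
  have e : ∀ ξ : Vel, ‖ξ‖ ^ 2 * Real.exp (-B * ‖ξ‖ ^ 2)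
      = ∑ i, ξ i * ξ i * Real.exp (-B * ‖ξ‖ ^ 2) := fun ξ => by
    rw [← Finset.sum_mul, EuclideanSpace.real_norm_sq_eq]; simp only [sq]
  simp only [e]
  rw [integral_finsetSum _ fun i _ => integrable_coord_mul_coord_gauss hB i i]
  simp only [integral_coord_mul_coord_gauss hB, if_true]
  simp
  ring

/-- The product of two displaced Gaussians, with linear factors. -/
theorem gauss_product {b b' : ℝ} (hb : 0 < b) (hb' : 0 < b') (y : Vel) (i j : Fin 3) :
    ∫ x : Vel, (x i * Real.exp (-b * ‖x‖ ^ 2)) * ((x - y) j * Real.exp (-b' * ‖x - y‖ ^ 2))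
      = Real.exp (-(b * b' / (b + b')) * ‖y‖ ^ 2) * (Real.pi / (b + b')) ^ (3 / 2 : ℝ) *
        ((if i = j then 1 else 0) * (1 / (2 * (b + b')))
          - b * b' / (b + b') ^ 2 * (y i * y j)) := by
  have hB : 0 < b + b' := by positivity
  set B := b + b' with hBdef
  set m := b' / B with hm
  rw [← integral_add_right_eq_self _ (m • y)]
  have e : ∀ ξ : Vel, ((ξ + m • y) i * Real.exp (-b * ‖ξ + m • y‖ ^ 2)) *
      ((ξ + m • y - y) j * Real.exp (-b' * ‖ξ + m • y - y‖ ^ 2))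
      = Real.exp (-(b * b' / B) * ‖y‖ ^ 2) * ((ξ i * ξ j * Real.exp (-B * ‖ξ‖ ^ 2))
        + m * y i * (ξ j * Real.exp (-B * ‖ξ‖ ^ 2))
        + (m - 1) * y j * (ξ i * Real.exp (-B * ‖ξ‖ ^ 2))
        + m * (m - 1) * (y i * y j) * Real.exp (-B * ‖ξ‖ ^ 2)) := fun ξ => by
    have h1 : ξ + m • y - y = ξ + (m - 1) • y := by rw [sub_smul, one_smul]; abel
    have h2 : ∀ r : ℝ, ‖ξ + r • y‖ ^ 2 = ‖ξ‖ ^ 2 + 2 * r * inner ℝ ξ y + r ^ 2 * ‖y‖ ^ 2 := fun r => by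
      rw [norm_add_sq_real, inner_smul_right, norm_smul, mul_pow, Real.norm_eq_abs, sq_abs]; ring
    have h3 : Real.exp (-b * ‖ξ + m • y‖ ^ 2) * Real.exp (-b' * ‖ξ + (m - 1) • y‖ ^ 2)
        = Real.exp (-(b * b' / B) * ‖y‖ ^ 2) * Real.exp (-B * ‖ξ‖ ^ 2) := by
      rw [← Real.exp_add, ← Real.exp_add, h2, h2]
      congr 1
      have hb1 : b = B * (1 - m) := by rw [hm, hBdef]; field_simp; ring
      have hb2 : b' = B * m := by rw [hm]; field_simp
      have hb3 : b * b' / B = B * (m * (1 - m)) := by rw [hb1, hb2]; field_simp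
      rw [hb3, hb1, hb2]; ring
    rw [h1]
    simp only [PiLp.add_apply, PiLp.smul_apply, smul_eq_mul]
    calc _ = (ξ i + m * y i) * (ξ j + (m - 1) * y j) *
          (Real.exp (-b * ‖ξ + m • y‖ ^ 2) * Real.exp (-b' * ‖ξ + (m - 1) • y‖ ^ 2)) := by ring
      _ = _ := by rw [h3]; ring
  simp only [e]
  have i1 := integrable_coord_mul_coord_gauss hB i j
  have i2 := (integrable_coord_gauss hB j).const_mul (m * y i)
  have i3 := (integrable_coord_gauss hB i).const_mul ((m - 1) * y j)
  have i4 := (integrable_gauss hB).const_mul (m * (m - 1) * (y i * y j))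
  have i12 : Integrable fun ξ : Vel => ξ i * ξ j * Real.exp (-B * ‖ξ‖ ^ 2)
      + m * y i * (ξ j * Real.exp (-B * ‖ξ‖ ^ 2)) := i1.add i2
  have i123 : Integrable fun ξ : Vel => ξ i * ξ j * Real.exp (-B * ‖ξ‖ ^ 2)
      + m * y i * (ξ j * Real.exp (-B * ‖ξ‖ ^ 2))
      + (m - 1) * y j * (ξ i * Real.exp (-B * ‖ξ‖ ^ 2)) := i12.add i3
  rw [integral_const_mul, integral_add i123 i4, integral_add i12 i3, integral_add i1 i2, integral_const_mul, integral_const_mul,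
    integral_const_mul, integral_coord_gauss, integral_coord_gauss, integral_gauss hB,
    integral_coord_mul_coord_gauss hB]
  have : m * (m - 1) = -(b * b' / B ^ 2) := by
    rw [hm, hBdef]; field_simp; ring
  rw [this]; ring

/-! ### The gradient of the potential -/

theorem hasDerivAt_superposed_exp {R : ℝ} (hR : 0 < R) :
    HasDerivAt (fun R => ∫ s in Ioi (0 : ℝ), s⁻¹ * Real.exp (-s) * Real.exp (-(R / (4 * s))))
      (∫ s in Ioi (0 : ℝ), s⁻¹ * Real.exp (-s) * (Real.exp (-(R / (4 * s))) * (-(1 / (4 * s))))) R := by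
  have hball : Metric.ball R (R / 2) ⊆ Ioi (R / 2) := fun x hx => by
    rw [Metric.mem_ball, Real.dist_eq, abs_lt] at hx
    simp only [mem_Ioi]; linarith
  refine (hasDerivAt_integral_of_dominated_loc_of_deriv_le
    (F := fun R s => s⁻¹ * Real.exp (-s) * Real.exp (-(R / (4 * s))))
    (F' := fun R s => s⁻¹ * Real.exp (-s) * (Real.exp (-(R / (4 * s))) * (-(1 / (4 * s)))))
    (bound := fun s => 2 / (R / 8) ^ 2 * Real.exp (-s))
    (s := Metric.ball R (R / 2)) (Metric.ball_mem_nhds R (by positivity)) ?_ ?_ ?_ ?_ ?_ ?_).2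
  · exact .of_forall fun x => Measurable.aestronglyMeasurable (by fun_prop)
  · refine ((integrableOn_exp_neg.const_mul (1 / (R / 4)))).mono'
      (Measurable.aestronglyMeasurable (by fun_prop)) ?_
    filter_upwards [ae_restrict_mem measurableSet_Ioi] with s hs
    have hs : 0 < s := hs
    rw [Real.norm_of_nonneg (by positivity)]
    have := inv_mul_exp_le (κ := R / 4) (by positivity) hs
    calc _ = s⁻¹ * Real.exp (-(R / 4 / s)) * Real.exp (-s) := by
          rw [show R / (4 * s) = R / 4 / s by field_simp]; ring
      _ ≤ _ := by gcongr
  · exact Measurable.aestronglyMeasurable (by fun_prop)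
  · filter_upwards [ae_restrict_mem measurableSet_Ioi] with s hs x hx
    have hs : 0 < s := hs
    have hx' : R / 2 < x := hball hx
    rw [norm_mul, Real.norm_of_nonneg (by positivity), norm_mul,
      Real.norm_of_nonneg (Real.exp_nonneg _), norm_neg, Real.norm_of_nonneg (by positivity)]
    have h1 := inv_sq_mul_exp_le (κ := R / 8) (by positivity) hs
    have h2 : Real.exp (-(x / (4 * s))) ≤ Real.exp (-(R / 8 / s)) := by
      apply Real.exp_le_exp.2
      rw [neg_le_neg_iff, div_div, div_le_div_iff₀ (by positivity) (by positivity)]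
      nlinarith
    calc s⁻¹ * Real.exp (-s) * (Real.exp (-(x / (4 * s))) * (1 / (4 * s)))
        ≤ s⁻¹ * Real.exp (-s) * (Real.exp (-(R / 8 / s)) * (1 / s)) := by
          gcongr; linarith
      _ = (s ^ 2)⁻¹ * Real.exp (-(R / 8 / s)) * Real.exp (-s) := by field_simp
      _ ≤ _ := by gcongr
  · exact integrableOn_exp_neg.const_mul _
  · refine .of_forall fun s x _ => ?_
    have h := (((hasDerivAt_id' x).div_const (4 * s)).neg.exp).const_mul (s⁻¹ * Real.exp (-s))
    refine h.congr_deriv ?_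
    simp only [Pi.neg_apply]

theorem gradient_potential {x : Vel} (hx : x ≠ 0) (i : Fin 3) :
    gradient potential x i = -((Real.sqrt (2 * Real.pi))⁻¹ / 2) *
      ∫ s in Ioi (0 : ℝ), (s ^ 2)⁻¹ * Real.exp (-s) * (x i * Real.exp (-(1 / (4 * s)) * ‖x‖ ^ 2)) := by
  have hR : 0 < ‖x‖ ^ 2 := by positivity
  have h1 := ((hasDerivAt_superposed_exp hR).hasFDerivAt.comp x
    (hasStrictFDerivAt_norm_sq x).hasFDerivAt).const_mul (Real.sqrt (2 * Real.pi))⁻¹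
  have h2 : gradient potential x = _ := congrArg (InnerProductSpace.toDual ℝ Vel).symm h1.fderiv
  set D := ∫ s in Ioi (0 : ℝ), s⁻¹ * Real.exp (-s) *
    (Real.exp (-(‖x‖ ^ 2 / (4 * s))) * (-(1 / (4 * s)))) with hD
  have h3 : gradient potential x = ((Real.sqrt (2 * Real.pi))⁻¹ * (D * 2)) • x := by
    rw [h2, LinearIsometryEquiv.symm_apply_eq]
    ext w
    simp [InnerProductSpace.toDual_apply_apply]
    ring
  rw [h3, PiLp.smul_apply, smul_eq_mul, hD, ← integral_mul_const, ← integral_const_mul,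
    ← integral_const_mul, ← integral_mul_const]
  refine setIntegral_congr_fun measurableSet_Ioi fun s hs => ?_
  have hs : s ≠ 0 := ne_of_gt hs
  beta_reduce
  rw [show -(1 / (4 * s)) * ‖x‖ ^ 2 = -(‖x‖ ^ 2 / (4 * s)) by field_simp]
  field_simp
  ring

end NonMarkov

end

noncomputable section

open MeasureTheory Set
open scoped ENNReal FourierTransform

namespace NonMarkov

/-! ### The interaction matrix in closed form -/

theorem rpow_three_halves {x : ℝ} (hx : 0 < x) : x ^ (3 / 2 : ℝ) = x * Real.sqrt x := by
  rw [show (3 / 2 : ℝ) = 1 + 1 / 2 by norm_num, Real.rpow_add hx, Real.rpow_one,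
    ← Real.sqrt_eq_rpow]

/-- The density of Gaussians in the gradient of the potential. -/
def gaussDensity (s : ℝ) : ℝ := (s ^ 2)⁻¹ * Real.exp (-s)

theorem gaussDensity_nonneg (s : ℝ) : 0 ≤ gaussDensity s := by unfold gaussDensity; positivity

theorem integrableOn_gaussDensity_mul_rpow :
    IntegrableOn (fun s => gaussDensity s * s ^ (5 / 4 : ℝ)) (Ioi 0) := by
  refine (Real.GammaIntegral_convergent (s := 1 / 4) (by norm_num)).congr_fun (fun s hs => ?_)
    measurableSet_Ioi
  have hs : 0 < s := hs
  have : s ^ (1 / 4 - 1 : ℝ) = (s ^ 2)⁻¹ * s ^ (5 / 4 : ℝ) := by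
    rw [← Real.rpow_natCast, ← Real.rpow_neg hs.le, ← Real.rpow_add hs]
    norm_num
  simp only [gaussDensity, this]
  ring

theorem gauss_linear_memLp {b : ℝ} (hb : 0 < b) :
    Integrable fun x : Vel => (‖x‖ * Real.exp (-b * ‖x‖ ^ 2)) ^ 2 := by
  refine (integrable_sq_gauss (B := 2 * b) (by positivity)).congr (.of_forall fun x => ?_)
  simp only [mul_pow, ← Real.exp_nat_mul]
  congr 2; push_cast; ring

theorem gauss_linear_integral {s : ℝ} (hs : 0 < s) :
    ∫ x : Vel, (‖x‖ * Real.exp (-(1 / (4 * s)) * ‖x‖ ^ 2)) ^ 2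
      = 3 * (2 * Real.pi) ^ (3 / 2 : ℝ) * (s ^ (5 / 4 : ℝ)) ^ 2 := by
  have e : ∀ x : Vel, (‖x‖ * Real.exp (-(1 / (4 * s)) * ‖x‖ ^ 2)) ^ 2
      = ‖x‖ ^ 2 * Real.exp (-(1 / (2 * s)) * ‖x‖ ^ 2) := fun x => by
    rw [mul_pow, ← Real.exp_nat_mul]
    congr 2; push_cast; field_simp; ring
  simp only [e]
  rw [integral_sq_gauss (by positivity), show Real.pi / (1 / (2 * s)) = 2 * Real.pi * s by
    field_simp, Real.mul_rpow (by positivity) hs.le, ← Real.rpow_natCast (s ^ (5 / 4 : ℝ)),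
    ← Real.rpow_mul hs.le, show (5 / 4 * (2 : ℕ) : ℝ) = 1 + 3 / 2 by norm_num,
    Real.rpow_add hs, Real.rpow_one]
  field_simp

theorem gauss_product_norm_le {b b' : ℝ} (x y : Vel) (i j : Fin 3) {κ : ℝ} (hκ : 0 < κ) :
    ‖(x i * Real.exp (-b * ‖x‖ ^ 2)) * ((x - y) j * Real.exp (-b' * ‖x - y‖ ^ 2))‖
      ≤ κ * (‖x‖ * Real.exp (-b * ‖x‖ ^ 2)) ^ 2
        + κ⁻¹ * (‖x - y‖ * Real.exp (-b' * ‖x - y‖ ^ 2)) ^ 2 := by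
  rw [norm_mul, norm_mul, norm_mul, Real.norm_of_nonneg (Real.exp_nonneg _),
    Real.norm_of_nonneg (Real.exp_nonneg _)]
  have h1 : ‖x i‖ * Real.exp (-b * ‖x‖ ^ 2) ≤ ‖x‖ * Real.exp (-b * ‖x‖ ^ 2) := by
    gcongr; exact abs_coord_le x i
  have h2 : ‖(x - y) j‖ * Real.exp (-b' * ‖x - y‖ ^ 2)
      ≤ ‖x - y‖ * Real.exp (-b' * ‖x - y‖ ^ 2) := by
    gcongr; exact abs_coord_le (x - y) j
  refine (mul_le_mul h1 h2 (by positivity) (by positivity)).trans ?_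
  set p := ‖x‖ * Real.exp (-b * ‖x‖ ^ 2)
  set q := ‖x - y‖ * Real.exp (-b' * ‖x - y‖ ^ 2)
  have h : 0 ≤ κ⁻¹ * (κ * p - q) ^ 2 := by positivity
  have h' : κ⁻¹ * (κ * p - q) ^ 2 = κ * p ^ 2 + κ⁻¹ * q ^ 2 - 2 * (p * q) := by
    field_simp; ring
  have hp : 0 ≤ κ * p ^ 2 + κ⁻¹ * q ^ 2 := by positivity
  linarith

theorem integrable_gauss_product {s s' : ℝ} (hs : 0 < s) (hs' : 0 < s') (y : Vel) (i j : Fin 3) :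
    Integrable (fun x : Vel => (x i * Real.exp (-(1 / (4 * s)) * ‖x‖ ^ 2)) *
      ((x - y) j * Real.exp (-(1 / (4 * s')) * ‖x - y‖ ^ 2))) ∧
    ∫ x : Vel, ‖(x i * Real.exp (-(1 / (4 * s)) * ‖x‖ ^ 2)) *
      ((x - y) j * Real.exp (-(1 / (4 * s')) * ‖x - y‖ ^ 2))‖
      ≤ 6 * (2 * Real.pi) ^ (3 / 2 : ℝ) * (s ^ (5 / 4 : ℝ) * s' ^ (5 / 4 : ℝ)) := by
  have i1 := gauss_linear_memLp (b := 1 / (4 * s)) (by positivity)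
  have i2 := (gauss_linear_memLp (b := 1 / (4 * s')) (by positivity)).comp_sub_right y
  set κ := s' ^ (5 / 4 : ℝ) * (s ^ (5 / 4 : ℝ))⁻¹ with hκ
  have hκ0 : 0 < κ := by positivity
  have i3 := (i1.const_mul κ).add (i2.const_mul κ⁻¹)
  have hi : Integrable (fun x : Vel => (x i * Real.exp (-(1 / (4 * s)) * ‖x‖ ^ 2)) *
      ((x - y) j * Real.exp (-(1 / (4 * s')) * ‖x - y‖ ^ 2))) :=
    i3.mono' (Continuous.aestronglyMeasurable (by fun_prop))
      (.of_forall fun x => gauss_product_norm_le x y i j hκ0)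
  refine ⟨hi, (integral_mono hi.norm i3 fun x => gauss_product_norm_le x y i j hκ0).trans ?_⟩
  simp only [Pi.add_apply]
  rw [integral_add (i1.const_mul κ) (i2.const_mul κ⁻¹), integral_const_mul, integral_const_mul,
    integral_sub_right_eq_self (fun x : Vel => (‖x‖ * Real.exp (-(1 / (4 * s')) * ‖x‖ ^ 2)) ^ 2),
    gauss_linear_integral hs, gauss_linear_integral hs', hκ]
  have h1 : (0 : ℝ) < s ^ (5 / 4 : ℝ) := by positivity
  have h2 : (0 : ℝ) < s' ^ (5 / 4 : ℝ) := by positivity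
  apply le_of_eq
  field_simp
  ring

theorem integrable_gauss_superposition (y : Vel) (i j : Fin 3) :
    Integrable (fun q : (ℝ × ℝ) × Vel => gaussDensity q.1.1 * gaussDensity q.1.2 *
      ((q.2 i * Real.exp (-(1 / (4 * q.1.1)) * ‖q.2‖ ^ 2)) *
        ((q.2 - y) j * Real.exp (-(1 / (4 * q.1.2)) * ‖q.2 - y‖ ^ 2))))
      (((volume.restrict (Ioi (0 : ℝ))).prod (volume.restrict (Ioi (0 : ℝ)))).prod volume) := by
  have hm : Measurable (fun q : (ℝ × ℝ) × Vel => gaussDensity q.1.1 * gaussDensity q.1.2 *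
      ((q.2 i * Real.exp (-(1 / (4 * q.1.1)) * ‖q.2‖ ^ 2)) *
        ((q.2 - y) j * Real.exp (-(1 / (4 * q.1.2)) * ‖q.2 - y‖ ^ 2)))) := by
    unfold gaussDensity; fun_prop
  have hpos : ∀ᵐ p : ℝ × ℝ ∂((volume.restrict (Ioi (0 : ℝ))).prod (volume.restrict (Ioi (0 : ℝ)))),
      0 < p.1 ∧ 0 < p.2 := by
    rw [Measure.prod_restrict]
    filter_upwards [ae_restrict_mem (measurableSet_Ioi.prod measurableSet_Ioi)] with p hp
    exact hp
  rw [integrable_prod_iff hm.aestronglyMeasurable]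
  constructor
  · filter_upwards [hpos] with p hp
    exact (integrable_gauss_product hp.1 hp.2 y i j).1.const_mul _
  · refine ((integrableOn_gaussDensity_mul_rpow.mul_prod
      integrableOn_gaussDensity_mul_rpow).const_mul (6 * (2 * Real.pi) ^ (3 / 2 : ℝ))).mono'
      hm.aestronglyMeasurable.norm.integral_prod_right' ?_
    filter_upwards [hpos] with p hp
    rw [Real.norm_of_nonneg (integral_nonneg fun _ => norm_nonneg _)]
    simp only [norm_mul (gaussDensity p.1 * gaussDensity p.2)]
    rw [integral_const_mul, Real.norm_of_nonneg (mul_nonneg (gaussDensity_nonneg _)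
      (gaussDensity_nonneg _))]
    refine (mul_le_mul_of_nonneg_left (integrable_gauss_product hp.1 hp.2 y i j).2
      (mul_nonneg (gaussDensity_nonneg _) (gaussDensity_nonneg _))).trans (le_of_eq ?_)
    ring

theorem gauss_product_eq {s s' : ℝ} (hs : 0 < s) (hs' : 0 < s') (y : Vel) (i j : Fin 3) :
    gaussDensity s * gaussDensity s' * ∫ x : Vel, (x i * Real.exp (-(1 / (4 * s)) * ‖x‖ ^ 2)) *
      ((x - y) j * Real.exp (-(1 / (4 * s')) * ‖x - y‖ ^ 2))
      = Real.sqrt (s * s') * ((4 * Real.pi * Real.sqrt (4 * Real.pi)) *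
        (((s + s') ^ 2 * Real.sqrt (s + s'))⁻¹ *
          Real.exp (-(s + s') - (‖y‖ / 2) ^ 2 / (s + s')) *
          ((if i = j then 1 else 0) * 2 - y i * y j / (s + s')))) := by
  rw [gauss_product (by positivity) (by positivity)]
  set σ := s + s' with hσ
  have hσ0 : 0 < σ := by positivity
  have h1 : 1 / (4 * s) + 1 / (4 * s') = σ / (4 * (s * s')) := by rw [hσ]; field_simp; ring
  rw [h1, show Real.pi / (σ / (4 * (s * s'))) = 4 * Real.pi * (s * s') / σ by field_simp,
    rpow_three_halves (by positivity), Real.sqrt_div (by positivity), Real.sqrt_mul (by positivity),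
    show 1 / (4 * s) * (1 / (4 * s')) / (σ / (4 * (s * s'))) = 1 / (4 * σ) by field_simp,
    gaussDensity, gaussDensity]
  have h2 : Real.exp (-σ - (‖y‖ / 2) ^ 2 / σ)
      = Real.exp (-s) * Real.exp (-s') * Real.exp (-(1 / (4 * σ)) * ‖y‖ ^ 2) := by
    rw [← Real.exp_add, ← Real.exp_add]
    congr 1; rw [hσ]; field_simp; ring
  rw [h2]
  have h3 : 0 < Real.sqrt σ := Real.sqrt_pos.2 hσ0
  generalize (if i = j then (1 : ℝ) else 0) = d
  field_simp
  ring

/-- The interaction matrix `∫ ∂ᵢφ(x) ∂ⱼφ(x-y) dx` is a multiple of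
`e^{-|y|} (δᵢⱼ - yᵢyⱼ/|y|)`. -/
theorem exists_interaction_eq : ∃ c : ℝ, ∀ (i j : Fin 3) (y : Vel), y ≠ 0 →
    ∫ x : Vel, gradient potential x i * gradient potential (x - y) j
      = c * (Real.exp (-‖y‖) * ((if i = j then 1 else 0) - y i * y j / ‖y‖)) := by
  set C₀ := (Real.sqrt (2 * Real.pi))⁻¹ / 2
  obtain ⟨B₀, hB₀⟩ : ∃ B, B = ∫ s in Ioi (0 : ℝ), Real.sqrt (s * (1 - s)) := ⟨_, rfl⟩
  set C₁ := 4 * Real.pi * Real.sqrt (4 * Real.pi)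
  refine ⟨C₀ ^ 2 * (B₀ * (C₁ * (2 * Real.sqrt Real.pi))), fun i j y hy => ?_⟩
  have hr : 0 < ‖y‖ / 2 := by positivity
  have e1 : ∀ᵐ x : Vel, gradient potential x i * gradient potential (x - y) j
      = C₀ ^ 2 * ∫ p : ℝ × ℝ, gaussDensity p.1 * gaussDensity p.2 *
      ((x i * Real.exp (-(1 / (4 * p.1)) * ‖x‖ ^ 2)) *
        ((x - y) j * Real.exp (-(1 / (4 * p.2)) * ‖x - y‖ ^ 2)))
        ∂((volume.restrict (Ioi (0 : ℝ))).prod (volume.restrict (Ioi (0 : ℝ)))) := by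
    filter_upwards [Measure.ae_ne volume 0, Measure.ae_ne volume y] with x h0 h1
    rw [gradient_potential h0, gradient_potential (sub_ne_zero.2 h1), ← neg_mul_neg, ← neg_mul,
      ← neg_mul, neg_neg, mul_mul_mul_comm, ← sq, ← integral_prod_mul]
    congr 2; ext p
    simp only [gaussDensity]; ring
  rw [integral_congr_ae e1, integral_const_mul]
  have hI := integrable_gauss_superposition y i j
  rw [← integral_prod_symm _ hI, integral_prod _ hI, integral_prod _ hI.integral_prod_left]
  set h : ℝ → ℝ := fun σ => C₁ * ((σ ^ 2 * Real.sqrt σ)⁻¹ *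
    Real.exp (-σ - (‖y‖ / 2) ^ 2 / σ) * ((if i = j then 1 else 0) * 2 - y i * y j / σ)) with hh
  have e2 : ∫ s in Ioi (0 : ℝ), ∫ s' in Ioi (0 : ℝ), (∫ x : Vel, gaussDensity s * gaussDensity s' *
      ((x i * Real.exp (-(1 / (4 * s)) * ‖x‖ ^ 2)) *
        ((x - y) j * Real.exp (-(1 / (4 * s')) * ‖x - y‖ ^ 2))))
      = ∫ s in Ioi (0 : ℝ), ∫ s' in Ioi (0 : ℝ), Real.sqrt (s * s') * h (s + s') := by
    refine setIntegral_congr_fun measurableSet_Ioi fun s hs =>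
      setIntegral_congr_fun measurableSet_Ioi fun s' hs' => ?_
    beta_reduce
    rw [integral_const_mul, gauss_product_eq hs hs']
  have iA := integrableOn_besselA hr
  have iB := integrableOn_besselB hr
  have e3 : ∀ σ ∈ Ioi (0 : ℝ), σ ^ 2 * h σ
      = C₁ * ((if i = j then 1 else 0) * 2) *
        ((Real.sqrt σ)⁻¹ * Real.exp (-σ - (‖y‖ / 2) ^ 2 / σ))
        - C₁ * (y i * y j) * ((σ * Real.sqrt σ)⁻¹ * Real.exp (-σ - (‖y‖ / 2) ^ 2 / σ)) := by
    intro σ hσ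
    have hσ : 0 < σ := hσ
    have := Real.sqrt_pos.2 hσ
    simp only [hh]
    generalize (if i = j then (1 : ℝ) else 0) = d
    field_simp
  have iAB := (iA.const_mul (C₁ * ((if i = j then 1 else 0) * 2))).sub
    (iB.const_mul (C₁ * (y i * y j)))
  rw [e2, integral_sqrt_mul_add (by fun_prop)
    (IntegrableOn.congr_fun iAB (fun σ hσ => (e3 σ hσ).symm) measurableSet_Ioi),
    setIntegral_congr_fun measurableSet_Ioi e3, integral_sub (iA.const_mul _) (iB.const_mul _),
    integral_const_mul, integral_const_mul, besselA hr, besselB hr, ← hB₀,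
    show 2 * (‖y‖ / 2) = ‖y‖ by ring]
  generalize (if i = j then (1 : ℝ) else 0) = d
  have : ‖y‖ ≠ 0 := by positivity
  field_simp

end NonMarkov

end

noncomputable section

open MeasureTheory Set
open scoped ENNReal FourierTransform

namespace NonMarkov

/-! ### Pointwise bounds for the Laplace transform of the interaction matrix -/

/-- The Kronecker symbol. -/
def kron (i j : Fin 3) : ℝ := if i = j then 1 else 0

theorem abs_kron_le (i j : Fin 3) : |kron i j| ≤ 1 := by
  unfold kron; split_ifs <;> simp

/-- The matrix `e^{-|y|} (δᵢⱼ - yᵢyⱼ/|y|)`. -/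
def interaction (i j : Fin 3) (y : Vel) : ℝ := Real.exp (-‖y‖) * (kron i j - y i * y j / ‖y‖)

theorem abs_coord_mul_div_le (y : Vel) (i j : Fin 3) : |y i * y j / ‖y‖| ≤ ‖y‖ := by
  rcases eq_or_ne y 0 with rfl | hy
  · simp
  have h : 0 < ‖y‖ := norm_pos_iff.2 hy
  rw [abs_div, abs_mul, abs_norm, div_le_iff₀ h]
  exact mul_le_mul (abs_coord_le y i) (abs_coord_le y j) (abs_nonneg _) h.le

theorem abs_interaction_le (i j : Fin 3) (y : Vel) : |interaction i j y| ≤ 2 := by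
  unfold interaction
  rw [abs_mul, abs_of_pos (Real.exp_pos _)]
  have h1 : |kron i j - y i * y j / ‖y‖| ≤ 1 + ‖y‖ :=
    (abs_sub _ _).trans (add_le_add (abs_kron_le i j) (abs_coord_mul_div_le y i j))
  have h2 := Real.add_one_le_exp ‖y‖
  calc Real.exp (-‖y‖) * |kron i j - y i * y j / ‖y‖| ≤ Real.exp (-‖y‖) * Real.exp ‖y‖ := by
        gcongr; linarith
    _ ≤ 2 := by rw [← Real.exp_add]; simp

theorem measurable_interaction (i j : Fin 3) : Measurable (interaction i j) := by
  unfold interaction; fun_prop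

/-- The Laplace transform of `t ↦ interaction i j (t w)`. -/
def lapInteraction (z : ℂ) (i j : Fin 3) (w : Vel) : ℂ :=
  (kron i j : ℂ) / (z + ‖w‖) - ((w i * w j / ‖w‖ : ℝ) : ℂ) / (z + ‖w‖) ^ 2

theorem measurable_lapInteraction (z : ℂ) (i j : Fin 3) : Measurable (lapInteraction z i j) := by
  unfold lapInteraction; fun_prop

theorem lapInteraction_symm (z : ℂ) (i j : Fin 3) (w : Vel) :
    lapInteraction z i j w = lapInteraction z j i w := by
  unfold lapInteraction kron
  rw [mul_comm (w i)]
  simp only [eq_comm]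

theorem integral_id_mul_cexp {ζ : ℂ} (hζ : 0 < ζ.re) :
    IntegrableOn (fun t : ℝ => (t : ℂ) * Complex.exp (-ζ * t)) (Ioi 0) ∧
    ∫ t in Ioi (0 : ℝ), (t : ℂ) * Complex.exp (-ζ * t) = 1 / ζ ^ 2 := by
  have hne : ζ ≠ 0 := fun h => by rw [h] at hζ; simp at hζ
  have hn : ∀ t : ℝ, ‖Complex.exp (-ζ * t)‖ = Real.exp (-ζ.re * t) := fun t => by
    rw [Complex.norm_exp]; simp
  have hi : IntegrableOn (fun t : ℝ => (t : ℂ) * Complex.exp (-ζ * t)) (Ioi 0) := by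
    refine (integrableOn_rpow_mul_exp_neg_mul_rpow (s := 1) (p := 1) (by norm_num) one_pos hζ).mono'
      (Continuous.aestronglyMeasurable (by fun_prop)) ?_
    filter_upwards [ae_restrict_mem measurableSet_Ioi] with t ht
    have ht : 0 < t := ht
    rw [norm_mul, hn, Complex.norm_real, Real.norm_of_nonneg ht.le, Real.rpow_one]
  refine ⟨hi, ?_⟩
  have hd : ∀ t ∈ Ici (0 : ℝ), HasDerivAt
      (fun t : ℝ => -((t : ℂ) / ζ + 1 / ζ ^ 2) * Complex.exp (-ζ * t))
      ((t : ℂ) * Complex.exp (-ζ * t)) t := fun t _ => by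
    have h1 : HasDerivAt (fun t : ℝ => (t : ℂ)) 1 t := Complex.ofRealCLM.hasDerivAt
    have h2 := (((h1.div_const ζ).add_const (1 / ζ ^ 2)).neg).mul ((h1.const_mul (-ζ)).cexp)
    refine h2.congr_deriv ?_
    simp only [Pi.neg_apply]
    field_simp
    ring
  have ht : Filter.Tendsto (fun t : ℝ => -((t : ℂ) / ζ + 1 / ζ ^ 2) * Complex.exp (-ζ * t))
      Filter.atTop (nhds 0) := by
    have a1 := tendsto_rpow_mul_exp_neg_mul_atTop_nhds_zero 1 ζ.re hζ
    have a0 := tendsto_rpow_mul_exp_neg_mul_atTop_nhds_zero 0 ζ.re hζ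
    simp only [Real.rpow_one, Real.rpow_zero, one_mul] at a0 a1
    have b1 := (a1.const_mul ‖ζ‖⁻¹).add (a0.const_mul ‖1 / ζ ^ 2‖)
    simp only [mul_zero, add_zero] at b1
    refine squeeze_zero_norm' ?_ b1
    filter_upwards [Filter.eventually_ge_atTop 0] with t ht
    rw [norm_mul, norm_neg, hn]
    refine (mul_le_mul_of_nonneg_right (norm_add_le _ _) (Real.exp_nonneg _)).trans (le_of_eq ?_)
    rw [norm_div, Complex.norm_real, Real.norm_of_nonneg ht]
    ring
  rw [integral_Ioi_of_hasDerivAt_of_tendsto' hd hi ht]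
  simp

theorem integral_exp_mul_interaction {z : ℂ} (hz : 0 < z.re) (i j : Fin 3) (w : Vel) :
    ∫ t in Ioi (0 : ℝ), Complex.exp (-z * t) * (interaction i j (t • w) : ℂ)
      = lapInteraction z i j w := by
  have hre : 0 < (z + ‖w‖).re := by
    simp only [Complex.add_re, Complex.ofReal_re]
    positivity
  have hne : z + ‖w‖ ≠ 0 := fun h => by rw [h] at hre; simp at hre
  have hneg : (-(z + ‖w‖)).re < 0 := by rw [Complex.neg_re]; linarith
  have h1 : ∫ t in Ioi (0 : ℝ), Complex.exp (-(z + ‖w‖) * t) = 1 / (z + ‖w‖) := by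
    rw [integral_exp_mul_complex_Ioi hneg 0]
    rw [Complex.ofReal_zero, mul_zero, Complex.exp_zero, neg_div_neg_eq]
  have i1 : IntegrableOn (fun t : ℝ => Complex.exp (-(z + ‖w‖) * t)) (Ioi 0) :=
    integrableOn_exp_mul_complex_Ioi hneg 0
  obtain ⟨i2, h2⟩ := integral_id_mul_cexp hre
  have e : ∀ t ∈ Ioi (0 : ℝ), Complex.exp (-z * t) * (interaction i j (t • w) : ℂ)
      = (kron i j : ℂ) * Complex.exp (-(z + ‖w‖) * t)
        - ((w i * w j / ‖w‖ : ℝ) : ℂ) * ((t : ℂ) * Complex.exp (-(z + ‖w‖) * t)) := by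
    intro t ht
    have ht : 0 < t := ht
    have h3 : interaction i j (t • w) = Real.exp (-(t * ‖w‖)) * (kron i j - t * (w i * w j / ‖w‖)) := by
      unfold interaction
      rw [norm_smul, Real.norm_of_nonneg ht.le]
      simp only [PiLp.smul_apply, smul_eq_mul]
      rcases eq_or_ne w 0 with rfl | hw
      · simp
      have : ‖w‖ ≠ 0 := norm_ne_zero_iff.2 hw
      congr 2
      field_simp
    rw [h3, show -(z + ‖w‖) * t = -z * t + ((-(t * ‖w‖) : ℝ) : ℂ) by push_cast; ring,
      Complex.exp_add, ← Complex.ofReal_exp]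
    push_cast
    ring
  rw [setIntegral_congr_fun measurableSet_Ioi e, integral_sub (i1.const_mul _) (i2.const_mul _),
    integral_const_mul, integral_const_mul, h1, h2, lapInteraction]
  ring

section Pointwise

variable {z : ℂ}

theorem norm_le_norm_add_ofReal (hz : 0 ≤ z.re) {r : ℝ} (hr : 0 ≤ r) : ‖z‖ ≤ ‖z + r‖ := by
  rw [← sq_le_sq₀ (norm_nonneg _) (norm_nonneg _), Complex.sq_norm, Complex.sq_norm,
    Complex.normSq_apply, Complex.normSq_apply]
  simp only [Complex.add_re, Complex.ofReal_re, Complex.add_im, Complex.ofReal_im, add_zero]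
  nlinarith [mul_nonneg hz hr]

theorem le_norm_add_ofReal (hz : 0 ≤ z.re) (r : ℝ) : r ≤ ‖z + r‖ := by
  refine le_trans ?_ (Complex.re_le_norm _)
  simp [hz]

theorem norm_add_ofReal_pos (hz : 0 < z.re) {r : ℝ} (hr : 0 ≤ r) : 0 < ‖z + r‖ :=
  (norm_pos_iff.2 fun h => by rw [h] at hz; simp at hz).trans_le (norm_le_norm_add_ofReal hz.le hr)

theorem add_im_le_two_mul_norm (hz : 0 ≤ z.re) (N : ℝ) : N + |z.im| ≤ 2 * ‖z + N‖ := by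
  have h1 := le_norm_add_ofReal hz N
  have h2 : |z.im| ≤ ‖z + N‖ := by
    have := Complex.abs_im_le_norm (z + N)
    simpa using this
  linarith

/-- The singular weight that comes with all kernel bounds. -/
def singWeight (v v' : Vel) : ℝ := (1 + ‖v'‖) ^ 3 * (1 + (1 + ‖v'‖) / ‖v - v'‖) ^ 2

theorem singWeight_nonneg (v v' : Vel) : 0 ≤ singWeight v v' := by
  unfold singWeight; positivity

theorem inv_norm_add_le (hz : 0 < z.re) {v v' : Vel} (hv : v ≠ v') :
    ‖z + ‖v - v'‖‖⁻¹ ≤ (1 + (1 + ‖v'‖) / ‖v - v'‖) * ‖z + (1 + ‖v‖ : ℝ)‖⁻¹ := by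
  have hρ : 0 < ‖v - v'‖ := norm_pos_iff.2 (sub_ne_zero.2 hv)
  have h1 := norm_add_ofReal_pos hz hρ.le
  have h2 := norm_add_ofReal_pos hz (r := 1 + ‖v‖) (by positivity)
  have h3 : ‖z + (1 + ‖v‖ : ℝ)‖ ≤ ‖z + ‖v - v'‖‖ + (1 + ‖v'‖) := by
    have e : z + (1 + ‖v‖ : ℝ) = (z + ‖v - v'‖) + ((1 + ‖v‖ - ‖v - v'‖ : ℝ) : ℂ) := by
      push_cast; ring
    rw [e]
    refine (norm_add_le _ _).trans ?_
    gcongr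
    rw [Complex.norm_real, Real.norm_eq_abs, abs_le]
    have := norm_sub_norm_le v v'
    have := norm_sub_le v v'
    have := norm_le_norm_add_norm_sub' v v'
    constructor <;> linarith [norm_nonneg v']
  rw [inv_le_iff_one_le_mul₀ h1, mul_right_comm, le_mul_inv_iff₀ h2, one_mul]
  refine h3.trans ?_
  have h4 := le_norm_add_ofReal hz.le ‖v - v'‖
  have h5 : (1 + ‖v'‖) ≤ (1 + ‖v'‖) / ‖v - v'‖ * ‖z + ‖v - v'‖‖ := by
    rw [div_mul_eq_mul_div, le_div_iff₀ hρ]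
    gcongr
  linarith

theorem sin_sq_le {v v' : Vel} (h0 : v ≠ 0) (hv : v ≠ v') :
    1 - (inner ℝ (v - v') v / (‖v - v'‖ * ‖v‖)) ^ 2
      ≤ (2 * (1 + ‖v'‖) / (1 + ‖v‖)) ^ 2 := by
  have hρ : 0 < ‖v - v'‖ := norm_pos_iff.2 (sub_ne_zero.2 hv)
  have hn : 0 < ‖v‖ := norm_pos_iff.2 h0
  rcases le_total ‖v‖ 1 with h | h
  · have : 1 ≤ 2 * (1 + ‖v'‖) / (1 + ‖v‖) := by
      rw [le_div_iff₀ (by positivity)]; linarith [norm_nonneg v']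
    nlinarith [sq_nonneg (inner ℝ (v - v') v / (‖v - v'‖ * ‖v‖))]
  · have h1 : 1 - (inner ℝ (v - v') v / (‖v - v'‖ * ‖v‖)) ^ 2 ≤ (‖v'‖ / ‖v‖) ^ 2 := by
      have e1 : ‖v'‖ ^ 2 = ‖v‖ ^ 2 - 2 * inner ℝ (v - v') v + ‖v - v'‖ ^ 2 := by
        rw [real_inner_comm v (v - v'), ← norm_sub_sq_real, sub_sub_cancel]
      rw [div_pow ‖v'‖, e1, le_div_iff₀ (by positivity)]
      set ip := inner ℝ (v - v') v
      have e2 : (1 - (ip / (‖v - v'‖ * ‖v‖)) ^ 2) * ‖v‖ ^ 2 = ‖v‖ ^ 2 - (ip / ‖v - v'‖) ^ 2 := by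
        field_simp
      rw [e2]
      have e3 : ip = ip / ‖v - v'‖ * ‖v - v'‖ := by field_simp
      nlinarith [sq_nonneg (ip / ‖v - v'‖ - ‖v - v'‖)]
    refine h1.trans (pow_le_pow_left₀ (by positivity) ?_ 2)
    rw [div_le_div_iff₀ hn (by positivity)]
    nlinarith [norm_nonneg v']

end Pointwise

end NonMarkov

end

noncomputable section

open MeasureTheory Set
open scoped ENNReal FourierTransform

namespace NonMarkov

section Resolvent

variable {z : ℂ}

theorem norm_inv_sub_inv_le (hz : 0 < z.re) {r s : ℝ} (hr : 0 ≤ r) (hs : 0 ≤ s) :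
    ‖1 / (z + r) - 1 / (z + s)‖ ≤ |r - s| * (‖z + r‖⁻¹ * ‖z + s‖⁻¹) := by
  have h1 := norm_pos_iff.1 (norm_add_ofReal_pos hz hr)
  have h2 := norm_pos_iff.1 (norm_add_ofReal_pos hz hs)
  have e : 1 / (z + r) - 1 / (z + s) = ((s - r : ℝ) : ℂ) * ((z + r)⁻¹ * (z + s)⁻¹) := by
    push_cast; field_simp; ring
  rw [e, norm_mul, norm_mul, norm_inv, norm_inv, Complex.norm_real, Real.norm_eq_abs, abs_sub_comm]

theorem norm_div_sq_sub_div_sq_le (hz : 0 < z.re) {r s : ℝ} (hr : 0 ≤ r) (hs : 0 ≤ s) :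
    ‖r / (z + r) ^ 2 - s / (z + s) ^ 2‖ ≤ 2 * (|r - s| * (‖z + r‖⁻¹ * ‖z + s‖⁻¹)) := by
  have h1 := norm_pos_iff.1 (norm_add_ofReal_pos hz hr)
  have h2 := norm_pos_iff.1 (norm_add_ofReal_pos hz hs)
  have e : r / (z + r) ^ 2 - s / (z + s) ^ 2
      = ((r - s : ℝ) : ℂ) * ((z / (z + r)) * (z / (z + s)) - (r / (z + r)) * (s / (z + s))) *
        ((z + r)⁻¹ * (z + s)⁻¹) := by
    push_cast; field_simp; ring
  have b1 : ∀ {x : ℝ}, 0 ≤ x → ‖z / (z + x)‖ ≤ 1 := fun hx => by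
    rw [norm_div]
    exact div_le_one_of_le₀ (norm_le_norm_add_ofReal hz.le hx) (norm_nonneg _)
  have b2 : ∀ {x : ℝ}, 0 ≤ x → ‖(x : ℂ) / (z + x)‖ ≤ 1 := fun {x} hx => by
    rw [norm_div, Complex.norm_real, Real.norm_of_nonneg hx]
    exact div_le_one_of_le₀ (le_norm_add_ofReal hz.le x) (norm_nonneg _)
  rw [e, norm_mul, norm_mul, norm_mul _⁻¹, norm_inv, norm_inv, Complex.norm_real, Real.norm_eq_abs]
  have h3 : ‖(z / (z + r)) * (z / (z + s)) - (r / (z + r)) * (s / (z + s))‖ ≤ 2 := by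
    refine (norm_sub_le _ _).trans ?_
    rw [norm_mul, norm_mul]
    have := mul_le_one₀ (b1 hr) (norm_nonneg _) (b1 hs)
    have := mul_le_one₀ (b2 hr) (norm_nonneg _) (b2 hs)
    linarith
  calc _ ≤ |r - s| * 2 * (‖z + r‖⁻¹ * ‖z + s‖⁻¹) := by gcongr
    _ = _ := by ring

theorem norm_parallel_sub_le (hz : 0 < z.re) {r s : ℝ} (hr : 0 ≤ r) (hs : 0 ≤ s) :
    ‖(1 / (z + r) - r / (z + r) ^ 2) - (1 / (z + s) - s / (z + s) ^ 2)‖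
      ≤ |r - s| * ‖z‖ * (‖z + r‖⁻¹ * ‖z + s‖⁻¹ * (‖z + r‖⁻¹ + ‖z + s‖⁻¹)) := by
  have h1 := norm_pos_iff.1 (norm_add_ofReal_pos hz hr)
  have h2 := norm_pos_iff.1 (norm_add_ofReal_pos hz hs)
  have e : (1 / (z + r) - r / (z + r) ^ 2) - (1 / (z + s) - s / (z + s) ^ 2)
      = ((s - r : ℝ) : ℂ) * z *
        ((z + r)⁻¹ * (z + s)⁻¹ * ((z + r)⁻¹ + (z + s)⁻¹)) := by
    push_cast; field_simp; ring
  rw [e]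
  simp only [norm_mul, norm_inv, Complex.norm_real, Real.norm_eq_abs]
  rw [abs_sub_comm]
  gcongr
  refine (norm_add_le _ _).trans ?_
  rw [norm_inv, norm_inv]

end Resolvent

/-- The value of the kernel that is subtracted by means of the vanishing integral. -/
def subtracted (z : ℂ) (v : Vel) (i j : Fin 3) : ℂ :=
  (kron i j : ℂ) / (z + (1 + ‖v‖ : ℝ))
    - ((1 + ‖v‖ : ℝ) : ℂ) / (z + (1 + ‖v‖ : ℝ)) ^ 2 * ((v i * v j / ‖v‖ ^ 2 : ℝ) : ℂ)

section Bounds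

variable {z : ℂ} {v v' : Vel}

theorem abs_dist_sub_le (v v' : Vel) : |‖v - v'‖ - (1 + ‖v‖)| ≤ 1 + ‖v'‖ := by
  have := norm_sub_le v v'
  have := norm_le_norm_add_norm_sub' v v'
  rw [abs_le]
  constructor <;> linarith [norm_nonneg v']

theorem dist_le_mul (v v' : Vel) : ‖v - v'‖ ≤ (1 + ‖v‖) * (1 + ‖v'‖) := by
  have := norm_sub_le v v'
  nlinarith [norm_nonneg v, norm_nonneg v', mul_nonneg (norm_nonneg v) (norm_nonneg v')]

theorem norm_sq_inv_le (hz : 0 < z.re) (hv : v ≠ v') :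
    ‖z + ‖v - v'‖‖⁻¹ ^ 2 ≤ singWeight v v' * ‖z + (1 + ‖v‖ : ℝ)‖⁻¹ ^ 2 := by
  have h := inv_norm_add_le hz hv
  have hX : 1 ≤ (1 + ‖v'‖) ^ 3 := one_le_pow₀ (by linarith [norm_nonneg v'])
  refine (pow_le_pow_left₀ (by positivity) h 2).trans ?_
  rw [mul_pow, singWeight]
  gcongr
  exact le_mul_of_one_le_left (by positivity) hX

theorem norm_pair_le (hz : 0 < z.re) (hv : v ≠ v') :
    (1 + ‖v'‖) ^ 2 * (‖z + ‖v - v'‖‖⁻¹ * ‖z + (1 + ‖v‖ : ℝ)‖⁻¹)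
      ≤ singWeight v v' * ‖z + (1 + ‖v‖ : ℝ)‖⁻¹ ^ 2 := by
  have h := inv_norm_add_le hz hv
  have hL : 1 ≤ 1 + (1 + ‖v'‖) / ‖v - v'‖ := by
    have : 0 ≤ (1 + ‖v'‖) / ‖v - v'‖ := by positivity
    linarith
  have hX : 1 ≤ 1 + ‖v'‖ := by linarith [norm_nonneg v']
  set L := 1 + (1 + ‖v'‖) / ‖v - v'‖
  set t := ‖z + (1 + ‖v‖ : ℝ)‖⁻¹
  have ht : 0 ≤ t := inv_nonneg.2 (norm_nonneg _)
  calc (1 + ‖v'‖) ^ 2 * (‖z + ‖v - v'‖‖⁻¹ * t) ≤ (1 + ‖v'‖) ^ 3 * (L ^ 2 * t * t) := by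
        gcongr
        · norm_num
        · exact h.trans (mul_le_mul_of_nonneg_right (by nlinarith) ht)
    _ = _ := by rw [singWeight]; ring

theorem norm_rank_one_le (hz : 0 < z.re) (hv : v ≠ v') :
    (1 + ‖v'‖) ^ 2 * ‖(‖v - v'‖ : ℂ) / (z + ‖v - v'‖) ^ 2‖
      ≤ (1 + ‖v‖) * (singWeight v v' * ‖z + (1 + ‖v‖ : ℝ)‖⁻¹ ^ 2) := by
  have h := inv_norm_add_le hz hv
  rw [norm_div, norm_pow, Complex.norm_real, norm_norm, div_eq_mul_inv, ← inv_pow]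
  have h2 := pow_le_pow_left₀ (by positivity) h 2
  have h3 := dist_le_mul v v'
  calc (1 + ‖v'‖) ^ 2 * (‖v - v'‖ * ‖z + ‖v - v'‖‖⁻¹ ^ 2)
      ≤ (1 + ‖v'‖) ^ 2 * ((1 + ‖v‖) * (1 + ‖v'‖) *
        ((1 + (1 + ‖v'‖) / ‖v - v'‖) * ‖z + (1 + ‖v‖ : ℝ)‖⁻¹) ^ 2) := by gcongr
    _ = _ := by rw [singWeight]; ring

/-- The full matrix of the subtracted kernel. -/
theorem norm_kernel_entry_le (hz : 0 < z.re) (hv : v ≠ v') (i j : Fin 3) :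
    ‖lapInteraction z i j (v - v') - subtracted z v i j‖
      ≤ 3 * ((1 + ‖v‖) * (singWeight v v' * ‖z + (1 + ‖v‖ : ℝ)‖⁻¹ ^ 2)) := by
  have hρ : 0 < ‖v - v'‖ := norm_pos_iff.2 (sub_ne_zero.2 hv)
  have hX : 1 ≤ 1 + ‖v'‖ := by linarith [norm_nonneg v']
  have hN : 1 ≤ 1 + ‖v‖ := by linarith [norm_nonneg v]
  have hX2 : 1 ≤ (1 + ‖v'‖) ^ 2 := one_le_pow₀ hX
  set T := singWeight v v' * ‖z + (1 + ‖v‖ : ℝ)‖⁻¹ ^ 2 with hT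
  have hT0 : 0 ≤ T := mul_nonneg (singWeight_nonneg _ _) (by positivity)
  have e : lapInteraction z i j (v - v') - subtracted z v i j
      = (kron i j : ℂ) * (1 / (z + ‖v - v'‖) - 1 / (z + (1 + ‖v‖ : ℝ)))
        - ((‖v - v'‖ : ℂ) / (z + ‖v - v'‖) ^ 2) *
          (((v - v') i * (v - v') j / ‖v - v'‖ / ‖v - v'‖ : ℝ) : ℂ)
        + ((1 + ‖v‖ : ℝ) : ℂ) / (z + (1 + ‖v‖ : ℝ)) ^ 2 * ((v i * v j / ‖v‖ ^ 2 : ℝ) : ℂ) := by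
    have : (‖v - v'‖ : ℂ) ≠ 0 := by exact_mod_cast hρ.ne'
    rw [lapInteraction, subtracted, show (((v - v') i * (v - v') j / ‖v - v'‖ : ℝ) : ℂ)
      = (‖v - v'‖ : ℂ) * (((v - v') i * (v - v') j / ‖v - v'‖ / ‖v - v'‖ : ℝ) : ℂ) by
        push_cast; field_simp]
    ring
  have b1 : ‖(kron i j : ℂ) * (1 / (z + ‖v - v'‖) - 1 / (z + (1 + ‖v‖ : ℝ)))‖ ≤ (1 + ‖v‖) * T := by
    rw [norm_mul, Complex.norm_real]
    have h1 := norm_inv_sub_inv_le hz hρ.le (s := 1 + ‖v‖) (by positivity)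
    have h2 := norm_pair_le hz hv
    calc _ ≤ 1 * ((1 + ‖v'‖) ^ 2 * (‖z + ‖v - v'‖‖⁻¹ * ‖z + (1 + ‖v‖ : ℝ)‖⁻¹)) := by
          gcongr
          · exact abs_kron_le i j
          · refine h1.trans ?_
            gcongr
            exact (abs_dist_sub_le v v').trans (by nlinarith)
      _ ≤ T := by rw [one_mul]; exact h2
      _ ≤ _ := le_mul_of_one_le_left hT0 hN
  have b2 : ‖((‖v - v'‖ : ℂ) / (z + ‖v - v'‖) ^ 2) *
      (((v - v') i * (v - v') j / ‖v - v'‖ / ‖v - v'‖ : ℝ) : ℂ)‖ ≤ (1 + ‖v‖) * T := by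
    rw [norm_mul, Complex.norm_real]
    have h1 : ‖(v - v') i * (v - v') j / ‖v - v'‖ / ‖v - v'‖‖ ≤ 1 := by
      rw [norm_div, norm_norm, div_le_one hρ]
      exact abs_coord_mul_div_le _ _ _
    calc _ ≤ (1 + ‖v'‖) ^ 2 * ‖(‖v - v'‖ : ℂ) / (z + ‖v - v'‖) ^ 2‖ * 1 := by
          gcongr
          exact le_mul_of_one_le_left (norm_nonneg _) hX2
      _ ≤ _ := by rw [mul_one]; exact norm_rank_one_le hz hv
  have b3 : ‖((1 + ‖v‖ : ℝ) : ℂ) / (z + (1 + ‖v‖ : ℝ)) ^ 2 * ((v i * v j / ‖v‖ ^ 2 : ℝ) : ℂ)‖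
      ≤ (1 + ‖v‖) * T := by
    rw [norm_mul, norm_div, norm_pow, Complex.norm_real, Complex.norm_real, Real.norm_of_nonneg
      (by positivity : 0 ≤ 1 + ‖v‖), div_eq_mul_inv, ← inv_pow]
    have h1 : ‖v i * v j / ‖v‖ ^ 2‖ ≤ 1 := by
      rw [sq, ← div_div, norm_div, norm_norm]
      exact div_le_one_of_le₀ (abs_coord_mul_div_le _ _ _) (norm_nonneg _)
    have h2 : ‖z + (1 + ‖v‖ : ℝ)‖⁻¹ ^ 2 ≤ T := by
      refine le_mul_of_one_le_left (by positivity) ?_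
      rw [singWeight]
      have : 1 ≤ 1 + (1 + ‖v'‖) / ‖v - v'‖ := by
        have : 0 ≤ (1 + ‖v'‖) / ‖v - v'‖ := by positivity
        linarith
      exact one_le_mul_of_one_le_of_one_le (one_le_pow₀ hX) (one_le_pow₀ this)
    calc _ ≤ (1 + ‖v‖) * T * 1 := by gcongr
      _ = _ := mul_one _
  rw [e]
  refine (norm_add_le _ _).trans ?_
  have := norm_sub_le ((kron i j : ℂ) * (1 / (z + ‖v - v'‖) - 1 / (z + (1 + ‖v‖ : ℝ))))
    (((‖v - v'‖ : ℂ) / (z + ‖v - v'‖) ^ 2) *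
      (((v - v') i * (v - v') j / ‖v - v'‖ / ‖v - v'‖ : ℝ) : ℂ))
  linarith

theorem sum_kron_mul (i : Fin 3) (x : Fin 3 → ℂ) : ∑ j, (kron i j : ℂ) * x j = x i := by
  rw [Finset.sum_eq_single i (fun j _ h => by simp [kron, h.symm]) (by simp)]
  simp [kron]

theorem ofReal_inner_eq (x y : Vel) : ((inner ℝ x y : ℝ) : ℂ) = ∑ j, (x j : ℂ) * (y j : ℂ) := by
  rw [PiLp.inner_apply]
  push_cast
  refine Finset.sum_congr rfl fun j _ => ?_
  simp [mul_comm]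

/-- The subtracted kernel applied to the unit vector in the direction `v`. -/
theorem sum_kernel_mul_eq (h0 : v ≠ 0) (hv : v ≠ v') (i : Fin 3) :
    ∑ j, (lapInteraction z i j (v - v') - subtracted z v i j) * ((v j / ‖v‖ : ℝ) : ℂ)
      = ((v i / ‖v‖ : ℝ) : ℂ) * ((1 / (z + ‖v - v'‖) - ‖v - v'‖ / (z + ‖v - v'‖) ^ 2)
          - (1 / (z + (1 + ‖v‖ : ℝ)) - ((1 + ‖v‖ : ℝ) : ℂ) / (z + (1 + ‖v‖ : ℝ)) ^ 2))
        + (‖v - v'‖ : ℂ) / (z + ‖v - v'‖) ^ 2 * ((v i / ‖v‖ - (v - v') i / ‖v - v'‖ *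
          (inner ℝ (v - v') v / (‖v - v'‖ * ‖v‖)) : ℝ) : ℂ) := by
  have hρ : (‖v - v'‖ : ℂ) ≠ 0 := by exact_mod_cast (norm_pos_iff.2 (sub_ne_zero.2 hv)).ne'
  have hn : (‖v‖ : ℂ) ≠ 0 := by exact_mod_cast (norm_pos_iff.2 h0).ne'
  set w := v - v' with hw
  have e : ∀ j, (lapInteraction z i j w - subtracted z v i j) * ((v j / ‖v‖ : ℝ) : ℂ)
      = (1 / (z + ‖w‖) - 1 / (z + (1 + ‖v‖ : ℝ))) * ((kron i j : ℂ) * ((v j / ‖v‖ : ℝ) : ℂ))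
        - (w i / ‖w‖ / ‖v‖ / (z + ‖w‖) ^ 2) * ((w j : ℂ) * (v j : ℂ))
        + ((1 + ‖v‖ : ℝ) : ℂ) / (z + (1 + ‖v‖ : ℝ)) ^ 2 * (v i / ‖v‖ ^ 3) *
          ((v j : ℂ) * (v j : ℂ)) := fun j => by
    rw [lapInteraction, subtracted]
    generalize z + (‖w‖ : ℂ) = d₁
    generalize z + ((1 + ‖v‖ : ℝ) : ℂ) = d₂
    push_cast
    have h3 : (‖v‖ : ℂ) / ‖v‖ = 1 := div_self hn
    linear_combination 0 * h3
  simp only [e]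
  rw [Finset.sum_add_distrib, Finset.sum_sub_distrib, ← Finset.mul_sum, ← Finset.mul_sum,
    ← Finset.mul_sum, ← ofReal_inner_eq, ← ofReal_inner_eq, sum_kron_mul,
    real_inner_self_eq_norm_sq]
  have h3 : (((‖v‖ : ℝ) ^ 2 : ℝ) : ℂ) = (‖v‖ : ℂ) ^ 2 := by push_cast; rfl
  have h4 : (v i : ℂ) / (‖v‖ : ℂ) ^ 3 * (‖v‖ : ℂ) ^ 2 = v i / ‖v‖ := by field_simp
  have h5 : (‖w‖ : ℂ) * ((w i : ℂ) / ‖w‖ * ((inner ℝ w v : ℝ) / (‖w‖ * ‖v‖)))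
      = w i / ‖w‖ / ‖v‖ * (inner ℝ w v : ℝ) := by field_simp
  rw [h3]
  generalize z + (‖w‖ : ℂ) = d₁
  generalize z + ((1 + ‖v‖ : ℝ) : ℂ) = d₂
  push_cast
  linear_combination ((1 + ‖v‖ : ℂ) / d₂ ^ 2) * h4 + (1 / d₁ ^ 2) * h5

theorem sum_coord_sq (x : Vel) : ∑ i, x i ^ 2 = ‖x‖ ^ 2 := (EuclideanSpace.real_norm_sq_eq x).symm

theorem abs_sub_proj_coord_le (h0 : v ≠ 0) (hv : v ≠ v') (i : Fin 3) :
    |v i / ‖v‖ - (v - v') i / ‖v - v'‖ * (inner ℝ (v - v') v / (‖v - v'‖ * ‖v‖))|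
      ≤ 2 * (1 + ‖v'‖) / (1 + ‖v‖) := by
  have hρ : 0 < ‖v - v'‖ := norm_pos_iff.2 (sub_ne_zero.2 hv)
  have hn : 0 < ‖v‖ := norm_pos_iff.2 h0
  have h := sin_sq_le h0 hv
  set w := v - v' with hw
  set μ := inner ℝ w v / (‖w‖ * ‖v‖) with hμ
  refine abs_le_of_sq_le_sq (le_trans ?_ h) (by positivity)
  have e : 1 - μ ^ 2 = ‖(‖v‖⁻¹ • v - (μ / ‖w‖) • w : Vel)‖ ^ 2 := by
    rw [norm_sub_sq_real, norm_smul, norm_smul, inner_smul_left, inner_smul_right,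
      real_inner_comm w v]
    simp only [norm_inv, norm_div, Real.norm_eq_abs, abs_norm, RCLike.conj_to_real]
    have h1 : inner ℝ w v = μ * (‖w‖ * ‖v‖) := by rw [hμ]; field_simp
    rw [h1, mul_pow (|μ| / ‖w‖), div_pow |μ|, sq_abs]
    field_simp
    ring
  rw [e, ← sum_coord_sq]
  refine le_trans (le_of_eq ?_) (Finset.single_le_sum (fun j _ => sq_nonneg _) (Finset.mem_univ i))
  simp only [PiLp.sub_apply, PiLp.smul_apply, smul_eq_mul]
  ring

theorem norm_kernel_row_le (hz : 0 < z.re) (h0 : v ≠ 0) (hv : v ≠ v') (i : Fin 3) :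
    ‖∑ j, (lapInteraction z i j (v - v') - subtracted z v i j) * ((v j / ‖v‖ : ℝ) : ℂ)‖
      ≤ 5 * (singWeight v v' * ‖z + (1 + ‖v‖ : ℝ)‖⁻¹ ^ 2) := by
  have hρ : 0 < ‖v - v'‖ := norm_pos_iff.2 (sub_ne_zero.2 hv)
  have hn : 0 < ‖v‖ := norm_pos_iff.2 h0
  have hX : 1 ≤ 1 + ‖v'‖ := by linarith [norm_nonneg v']
  set T := singWeight v v' * ‖z + (1 + ‖v‖ : ℝ)‖⁻¹ ^ 2 with hT
  rw [sum_kernel_mul_eq h0 hv]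
  have b1 : ‖((v i / ‖v‖ : ℝ) : ℂ) * ((1 / (z + ‖v - v'‖) - ‖v - v'‖ / (z + ‖v - v'‖) ^ 2)
          - (1 / (z + (1 + ‖v‖ : ℝ)) - ((1 + ‖v‖ : ℝ) : ℂ) / (z + (1 + ‖v‖ : ℝ)) ^ 2))‖ ≤ 3 * T := by
    have h1 := norm_inv_sub_inv_le hz hρ.le (s := 1 + ‖v‖) (by positivity)
    have h2 := norm_div_sq_sub_div_sq_le hz hρ.le (s := 1 + ‖v‖) (by positivity)
    have h3 := norm_pair_le hz hv
    have h4 : |‖v - v'‖ - (1 + ‖v‖)| * (‖z + ‖v - v'‖‖⁻¹ * ‖z + (1 + ‖v‖ : ℝ)‖⁻¹) ≤ T := by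
      refine le_trans ?_ h3
      gcongr
      exact (abs_dist_sub_le v v').trans (by nlinarith)
    have h5 : |v i / ‖v‖| ≤ 1 := by
      rw [abs_div, abs_norm]; exact div_le_one_of_le₀ (abs_coord_le v i) hn.le
    rw [norm_mul, Complex.norm_real, Real.norm_eq_abs, sub_sub_sub_comm]
    have h6 := norm_sub_le (1 / (z + ‖v - v'‖) - 1 / (z + (1 + ‖v‖ : ℝ)))
      (‖v - v'‖ / (z + ‖v - v'‖) ^ 2 - ((1 + ‖v‖ : ℝ) : ℂ) / (z + (1 + ‖v‖ : ℝ)) ^ 2)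
    calc _ ≤ 1 * (3 * T) := by
          gcongr
          linarith
      _ = _ := one_mul _
  have b2 : ‖(‖v - v'‖ : ℂ) / (z + ‖v - v'‖) ^ 2 * ((v i / ‖v‖ - (v - v') i / ‖v - v'‖ *
          (inner ℝ (v - v') v / (‖v - v'‖ * ‖v‖)) : ℝ) : ℂ)‖ ≤ 2 * T := by
    rw [norm_mul, Complex.norm_real, Real.norm_eq_abs]
    have h1 := norm_rank_one_le hz hv
    have h2 := abs_sub_proj_coord_le h0 hv i
    calc _ ≤ ‖(‖v - v'‖ : ℂ) / (z + ‖v - v'‖) ^ 2‖ * (2 * (1 + ‖v'‖) / (1 + ‖v‖)) := by gcongr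
      _ ≤ 2 * ((1 + ‖v'‖) ^ 2 * ‖(‖v - v'‖ : ℂ) / (z + ‖v - v'‖) ^ 2‖) / (1 + ‖v‖) := by
          rw [mul_div_assoc', div_le_div_iff_of_pos_right (by positivity)]
          nlinarith [norm_nonneg ((‖v - v'‖ : ℂ) / (z + ‖v - v'‖) ^ 2),
            mul_nonneg (norm_nonneg ((‖v - v'‖ : ℂ) / (z + ‖v - v'‖) ^ 2)) (norm_nonneg v'),
            mul_nonneg (mul_nonneg (norm_nonneg ((‖v - v'‖ : ℂ) / (z + ‖v - v'‖) ^ 2))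
              (norm_nonneg v')) (norm_nonneg v')]
      _ ≤ 2 * ((1 + ‖v‖) * T) / (1 + ‖v‖) := by gcongr
      _ = 2 * T := by field_simp
  refine (norm_add_le _ _).trans ?_
  linarith

theorem norm_kernel_parallel_le (hz : 0 < z.re) (h0 : v ≠ 0) (hv : v ≠ v') :
    ‖∑ i, ((v i / ‖v‖ : ℝ) : ℂ) *
      ∑ j, (lapInteraction z i j (v - v') - subtracted z v i j) * ((v j / ‖v‖ : ℝ) : ℂ)‖
      ≤ 4 * singWeight v v' * (‖z‖ * ‖z + (1 + ‖v‖ : ℝ)‖⁻¹ ^ 3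
        + ‖z + (1 + ‖v‖ : ℝ)‖⁻¹ ^ 2 / (1 + ‖v‖)) := by
  have hρ : 0 < ‖v - v'‖ := norm_pos_iff.2 (sub_ne_zero.2 hv)
  have hn : 0 < ‖v‖ := norm_pos_iff.2 h0
  have hX : 1 ≤ 1 + ‖v'‖ := by linarith [norm_nonneg v']
  have hρ' : (‖v - v'‖ : ℂ) ≠ 0 := by exact_mod_cast hρ.ne'
  have hn' : (‖v‖ : ℂ) ≠ 0 := by exact_mod_cast hn.ne'
  simp only [sum_kernel_mul_eq h0 hv]
  have hsin := sin_sq_le h0 hv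
  have hr1 := norm_rank_one_le hz hv
  have hpar := norm_parallel_sub_le hz hρ.le (s := 1 + ‖v‖) (by positivity)
  have hL := inv_norm_add_le hz hv
  have hdist := abs_dist_sub_le v v'
  set w := v - v' with hw
  set μ := inner ℝ w v / (‖w‖ * ‖v‖) with hμ
  set t := ‖z + (1 + ‖v‖ : ℝ)‖⁻¹ with ht
  set PB := ((1 / (z + ‖w‖) - ‖w‖ / (z + ‖w‖) ^ 2)
          - (1 / (z + (1 + ‖v‖ : ℝ)) - ((1 + ‖v‖ : ℝ) : ℂ) / (z + (1 + ‖v‖ : ℝ)) ^ 2)) with hPB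
  set RB := (‖w‖ : ℂ) / (z + ‖w‖) ^ 2 with hRB
  have ht0 : 0 ≤ t := inv_nonneg.2 (norm_nonneg _)
  have e : ∑ i, ((v i / ‖v‖ : ℝ) : ℂ) * (((v i / ‖v‖ : ℝ) : ℂ) * PB + RB *
      ((v i / ‖v‖ - w i / ‖w‖ * μ : ℝ) : ℂ)) = PB + RB * ((1 - μ ^ 2 : ℝ) : ℂ) := by
    have e1 : ∀ i, ((v i / ‖v‖ : ℝ) : ℂ) * (((v i / ‖v‖ : ℝ) : ℂ) * PB + RB *
        ((v i / ‖v‖ - w i / ‖w‖ * μ : ℝ) : ℂ))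
        = (PB / ‖v‖ ^ 2 + RB / ‖v‖ ^ 2) * ((v i : ℂ) * (v i : ℂ))
          - RB * μ / (‖w‖ * ‖v‖) * ((w i : ℂ) * (v i : ℂ)) := fun i => by
      push_cast; field_simp; ring
    simp only [e1]
    rw [Finset.sum_sub_distrib, ← Finset.mul_sum, ← Finset.mul_sum, ← ofReal_inner_eq,
      ← ofReal_inner_eq, real_inner_self_eq_norm_sq]
    have : inner ℝ w v = μ * (‖w‖ * ‖v‖) := by rw [hμ]; field_simp
    rw [this]
    push_cast; field_simp
    ring
  rw [e]
  have b1 : ‖PB‖ ≤ 2 * singWeight v v' * (‖z‖ * t ^ 3) := by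
    refine hpar.trans ?_
    set L := 1 + (1 + ‖v'‖) / ‖w‖ with hLdef
    have hL1 : 1 ≤ L := by
      have : 0 ≤ (1 + ‖v'‖) / ‖w‖ := by positivity
      linarith
    have hx : ‖z + ‖w‖‖⁻¹ + t ≤ 2 * (L * t) := by
      have : t ≤ L * t := le_mul_of_one_le_left ht0 hL1
      linarith
    have hX3 : 1 + ‖v'‖ ≤ (1 + ‖v'‖) ^ 3 := le_self_pow₀ hX (by norm_num)
    calc |‖w‖ - (1 + ‖v‖)| * ‖z‖ * (‖z + ‖w‖‖⁻¹ * t * (‖z + ‖w‖‖⁻¹ + t))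
        ≤ (1 + ‖v'‖) ^ 3 * ‖z‖ * (L * t * t * (2 * (L * t))) := by
          gcongr
          exact hdist.trans hX3
      _ = _ := by rw [singWeight, ← hw, ← hLdef]; ring
  have b2 : ‖RB * ((1 - μ ^ 2 : ℝ) : ℂ)‖ ≤ 4 * singWeight v v' * (t ^ 2 / (1 + ‖v‖)) := by
    have hμ1 : 0 ≤ 1 - μ ^ 2 := by
      have h1 : |μ| ≤ 1 := by
        rw [hμ, abs_div, abs_of_pos (by positivity : 0 < ‖w‖ * ‖v‖)]
        exact div_le_one_of_le₀ (abs_real_inner_le_norm w v) (by positivity)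
      have : μ ^ 2 ≤ 1 := by rw [← sq_abs]; nlinarith [abs_nonneg μ]
      linarith
    rw [norm_mul, Complex.norm_real, Real.norm_of_nonneg hμ1]
    calc ‖RB‖ * (1 - μ ^ 2) ≤ ‖RB‖ * (2 * (1 + ‖v'‖) / (1 + ‖v‖)) ^ 2 := by gcongr
      _ = 4 / (1 + ‖v‖) ^ 2 * ((1 + ‖v'‖) ^ 2 * ‖RB‖) := by rw [div_pow, mul_pow]; ring
      _ ≤ 4 / (1 + ‖v‖) ^ 2 * ((1 + ‖v‖) * (singWeight v v' * t ^ 2)) := by gcongr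
      _ = _ := by field_simp
  refine (norm_add_le _ _).trans ?_
  have hS := singWeight_nonneg v v'
  have : 0 ≤ singWeight v v' * (‖z‖ * t ^ 3) := by positivity
  linarith

/-- The kernel is Lipschitz continuous away from the singularity. -/
theorem norm_lapInteraction_sub_le (hz : 0 < z.re) {w w' : Vel} (hw : w ≠ 0) (hw' : w' ≠ 0)
    (i j : Fin 3) :
    ‖lapInteraction z i j w - lapInteraction z i j w'‖
      ≤ 8 * ‖w - w'‖ * (‖z + ‖w‖‖⁻¹ ^ 2 + ‖z + ‖w'‖‖⁻¹ ^ 2) := by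
  have hr : 0 < ‖w‖ := norm_pos_iff.2 hw
  have hs : 0 < ‖w'‖ := norm_pos_iff.2 hw'
  have h1 := norm_inv_sub_inv_le hz hr.le hs.le
  have h2 := norm_div_sq_sub_div_sq_le hz hr.le hs.le
  have hd : |‖w‖ - ‖w'‖| ≤ ‖w - w'‖ := abs_norm_sub_norm_le w w'
  set p := ‖z + ‖w‖‖⁻¹ with hp
  set q := ‖z + ‖w'‖‖⁻¹ with hq
  have hp0 : 0 ≤ p := inv_nonneg.2 (norm_nonneg _)
  have hq0 : 0 ≤ q := inv_nonneg.2 (norm_nonneg _)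
  have hpq : p * q ≤ (p ^ 2 + q ^ 2) / 2 := by nlinarith [sq_nonneg (p - q)]
  set u : ℝ := w i / ‖w‖ * (w j / ‖w‖) with hu
  set u' : ℝ := w' i / ‖w'‖ * (w' j / ‖w'‖) with hu'
  have hunit : ∀ (x : Vel) (k : Fin 3), |x k / ‖x‖| ≤ 1 := fun x k => by
    rw [abs_div, abs_norm]; exact div_le_one_of_le₀ (abs_coord_le x k) (norm_nonneg _)
  have hudiff : ∀ k : Fin 3, ‖w'‖ * |w k / ‖w‖ - w' k / ‖w'‖| ≤ 2 * ‖w - w'‖ := fun k => by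
    have e : ‖w'‖ * (w k / ‖w‖ - w' k / ‖w'‖) = (‖w'‖ - ‖w‖) * (w k / ‖w‖) + (w - w') k := by
      simp only [PiLp.sub_apply]; field_simp; ring
    rw [← abs_of_pos hs, ← abs_mul, abs_of_pos hs, e]
    refine (abs_add_le _ _).trans ?_
    rw [abs_mul, abs_sub_comm]
    have := abs_coord_le (w - w') k
    have := mul_le_mul hd (hunit w k) (abs_nonneg _) (norm_nonneg _)
    linarith
  have hu2 : ‖w'‖ * |u - u'| ≤ 4 * ‖w - w'‖ := by
    have e : u - u' = (w i / ‖w‖ - w' i / ‖w'‖) * (w j / ‖w‖)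
        + (w' i / ‖w'‖) * (w j / ‖w‖ - w' j / ‖w'‖) := by rw [hu, hu']; ring
    have h3 : |u - u'| ≤ |w i / ‖w‖ - w' i / ‖w'‖| + |w j / ‖w‖ - w' j / ‖w'‖| := by
      rw [e]
      refine (abs_add_le _ _).trans ?_
      rw [abs_mul, abs_mul]
      exact add_le_add (mul_le_of_le_one_right (abs_nonneg _) (hunit w j))
        (mul_le_of_le_one_left (abs_nonneg _) (hunit w' i))
    have := hudiff i
    have := hudiff j
    nlinarith
  have hu1 : |u| ≤ 1 := by
    rw [hu, abs_mul]; exact mul_le_one₀ (hunit w i) (abs_nonneg _) (hunit w j)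
  have e : lapInteraction z i j w - lapInteraction z i j w'
      = (kron i j : ℂ) * (1 / (z + ‖w‖) - 1 / (z + ‖w'‖))
        - (u : ℂ) * (‖w‖ / (z + ‖w‖) ^ 2 - ‖w'‖ / (z + ‖w'‖) ^ 2)
        - ((‖w'‖ * (u - u') : ℝ) : ℂ) * ((z + ‖w'‖) ^ 2)⁻¹ := by
    have a1 : w i * w j / ‖w‖ = u * ‖w‖ := by rw [hu]; field_simp
    have a2 : w' i * w' j / ‖w'‖ = u' * ‖w'‖ := by rw [hu']; field_simp
    rw [lapInteraction, lapInteraction, a1, a2]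
    push_cast; ring
  rw [e]
  have b1 : ‖(kron i j : ℂ) * (1 / (z + ‖w‖) - 1 / (z + ‖w'‖))‖ ≤ ‖w - w'‖ * (p * q) := by
    rw [norm_mul, Complex.norm_real]
    calc _ ≤ 1 * (‖w - w'‖ * (p * q)) := by
          gcongr
          · exact abs_kron_le i j
          · exact h1.trans (by gcongr)
      _ = _ := one_mul _
  have b2 : ‖(u : ℂ) * (‖w‖ / (z + ‖w‖) ^ 2 - ‖w'‖ / (z + ‖w'‖) ^ 2)‖
      ≤ 2 * (‖w - w'‖ * (p * q)) := by
    rw [norm_mul, Complex.norm_real]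
    calc _ ≤ 1 * (2 * (‖w - w'‖ * (p * q))) := by
          gcongr
          · exact hu1
          · exact h2.trans (by gcongr)
      _ = _ := one_mul _
  have b3 : ‖((‖w'‖ * (u - u') : ℝ) : ℂ) * ((z + ‖w'‖) ^ 2)⁻¹‖ ≤ 4 * ‖w - w'‖ * q ^ 2 := by
    rw [norm_mul, Complex.norm_real, Real.norm_eq_abs, abs_mul, abs_norm, norm_inv, norm_pow,
      ← inv_pow]
    gcongr
  have b4 := norm_sub_le ((kron i j : ℂ) * (1 / (z + ‖w‖) - 1 / (z + ‖w'‖))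
    - (u : ℂ) * (‖w‖ / (z + ‖w‖) ^ 2 - ‖w'‖ / (z + ‖w'‖) ^ 2))
    (((‖w'‖ * (u - u') : ℝ) : ℂ) * ((z + ‖w'‖) ^ 2)⁻¹)
  have b5 := norm_sub_le ((kron i j : ℂ) * (1 / (z + ‖w‖) - 1 / (z + ‖w'‖)))
    ((u : ℂ) * (‖w‖ / (z + ‖w‖) ^ 2 - ‖w'‖ / (z + ‖w'‖) ^ 2))
  have hn := norm_nonneg (w - w')
  have := mul_le_mul_of_nonneg_left hpq hn
  have := mul_nonneg hn (sq_nonneg p)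
  have := mul_nonneg hn (sq_nonneg q)
  nlinarith

end Bounds

end NonMarkov

end

noncomputable section

open MeasureTheory Set
open scoped ENNReal FourierTransform

namespace NonMarkov

open ComplexConjugate

/-! ### Integrated kernel bounds -/

theorem one_add_pow_five_le {x : ℝ} (hx : 0 ≤ x) :
    (1 + x) ^ 5 ≤ (4 ^ 5 * 120 * Real.exp (1 / 4)) * Real.exp (x / 4) := by
  have h := Real.pow_div_factorial_le_exp ((1 + x) / 4) (by positivity) 5
  have h2 : Real.exp ((1 + x) / 4) = Real.exp (1 / 4) * Real.exp (x / 4) := by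
    rw [← Real.exp_add]; congr 1; ring
  rw [h2, div_le_iff₀ (by positivity), div_pow, div_le_iff₀ (by positivity)] at h
  refine h.trans (le_of_eq ?_)
  simp only [Nat.factorial]
  push_cast
  ring

theorem integrable_exp_neg_norm {κ : ℝ} (hκ : 0 < κ) :
    Integrable fun v : Vel => Real.exp (-(κ * ‖v‖)) := by
  have h := (integrable_fun_norm_addHaar (volume : Measure Vel)
    (f := fun r => Real.exp (-(κ * r)))).2 ?_
  · exact h
  · have hd : Module.finrank ℝ Vel - 1 = 2 := by simp
    rw [hd]
    refine (integrableOn_rpow_mul_exp_neg_mul_rpow (s := 2) (p := 1) (b := κ) (by norm_num)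
      one_pos hκ).congr_fun (fun r _ => ?_) measurableSet_Ioi
    simp

theorem integrable_ball_inv_sq :
    Integrable ((Metric.ball (0 : Vel) 1).indicator fun w => (‖w‖ ^ 2)⁻¹) := by
  rw [integrable_indicator_iff Metric.isOpen_ball.measurableSet,
    integrableOn_fun_norm_addHaar (volume : Measure Vel) (f := fun r => (r ^ 2)⁻¹)]
  have hd : Module.finrank ℝ Vel - 1 = 2 := by simp
  rw [hd]
  refine (integrableOn_const (C := (1 : ℝ)) (s := Ioo 0 1) (μ := volume) (by simp)).congr_fun (fun r hr => ?_) measurableSet_Ioo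
  have : r ≠ 0 := hr.1.ne'
  simp only [smul_eq_mul]
  field_simp

theorem exists_singWeight_integral_le : ∃ C : ℝ, 0 < C ∧ ∀ v : Vel,
    Integrable (fun v' => singWeight v v' * Real.exp (-(‖v'‖ / 2))) ∧
      ∫ v', singWeight v v' * Real.exp (-(‖v'‖ / 2)) ≤ C := by
  set C₅ : ℝ := 4 ^ 5 * 120 * Real.exp (1 / 4) with hC₅
  set J := (Metric.ball (0 : Vel) 1).indicator fun w => (‖w‖ ^ 2)⁻¹ with hJ
  have hC₅0 : 0 < C₅ := by positivity
  have iE := integrable_exp_neg_norm (κ := 1 / 4) (by norm_num)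
  have iJ := integrable_ball_inv_sq
  have hJ0 : ∀ w, 0 ≤ J w := fun w => indicator_nonneg (fun _ _ => by positivity) w
  refine ⟨2 * C₅ * (2 * (∫ v : Vel, Real.exp (-(1 / 4 * ‖v‖))) + ∫ w, J w) + 1, ?_, fun v => ?_⟩
  · have : 0 ≤ ∫ w, J w := integral_nonneg hJ0
    have : 0 ≤ ∫ v : Vel, Real.exp (-(1 / 4 * ‖v‖)) := integral_nonneg fun v => Real.exp_nonneg _
    positivity
  have iB := (((iE.const_mul 2).add (iJ.comp_sub_left v)).const_mul (2 * C₅))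
  have hb : ∀ v', singWeight v v' * Real.exp (-(‖v'‖ / 2))
      ≤ 2 * C₅ * (2 * Real.exp (-(1 / 4 * ‖v'‖)) + J (v - v')) := fun v' => by
    set x := ‖v'‖ with hx
    set ρ := ‖v - v'‖ with hρ
    have hx0 : 0 ≤ x := norm_nonneg _
    have h1 := one_add_pow_five_le hx0
    have h2 : (1 + x) ^ 5 * Real.exp (-(x / 2)) ≤ C₅ * Real.exp (-(1 / 4 * x)) := by
      calc _ ≤ C₅ * Real.exp (x / 4) * Real.exp (-(x / 2)) := by gcongr
        _ = _ := by rw [mul_assoc, ← Real.exp_add]; congr 2; ring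
    have hX : 1 ≤ 1 + x := by linarith
    have h3 : (1 + x) ^ 3 * (1 + (1 + x) / ρ) ^ 2 ≤ (1 + x) ^ 5 * (2 * (1 + (ρ ^ 2)⁻¹)) := by
      have a1 : (1 + (1 + x) / ρ) ^ 2 ≤ (1 + x) ^ 2 * (2 * (1 + (ρ ^ 2)⁻¹)) := by
        have : 1 + (1 + x) / ρ ≤ (1 + x) * (1 + ρ⁻¹) := by
          rw [div_eq_mul_inv]; linarith
        have hρ0 : 0 ≤ ρ⁻¹ := inv_nonneg.2 (norm_nonneg _)
        refine (pow_le_pow_left₀ (by positivity) this 2).trans ?_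
        rw [mul_pow, ← inv_pow]
        gcongr
        nlinarith [sq_nonneg (1 - ρ⁻¹)]
      calc _ ≤ (1 + x) ^ 3 * ((1 + x) ^ 2 * (2 * (1 + (ρ ^ 2)⁻¹))) := by gcongr
        _ = _ := by ring
    have h4 : Real.exp (-(1 / 4 * x)) * (1 + (ρ ^ 2)⁻¹)
        ≤ 2 * Real.exp (-(1 / 4 * x)) + J (v - v') := by
      have hE1 : Real.exp (-(1 / 4 * x)) ≤ 1 := Real.exp_le_one_iff.2 (by linarith)
      have hE0 := Real.exp_nonneg (-(1 / 4 * x))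
      by_cases hball : v - v' ∈ Metric.ball (0 : Vel) 1
      · have : J (v - v') = (ρ ^ 2)⁻¹ := by rw [hJ, indicator_of_mem hball]
        rw [this]
        have : 0 ≤ (ρ ^ 2)⁻¹ := by positivity
        nlinarith
      · have h1ρ : 1 ≤ ρ := by simpa [hρ] using hball
        have : (ρ ^ 2)⁻¹ ≤ 1 := inv_le_one_of_one_le₀ (one_le_pow₀ h1ρ)
        have := hJ0 (v - v')
        nlinarith
    calc singWeight v v' * Real.exp (-(x / 2))
        ≤ (1 + x) ^ 5 * (2 * (1 + (ρ ^ 2)⁻¹)) * Real.exp (-(x / 2)) := by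
          rw [singWeight]; gcongr
      _ = 2 * ((1 + x) ^ 5 * Real.exp (-(x / 2))) * (1 + (ρ ^ 2)⁻¹) := by ring
      _ ≤ 2 * (C₅ * Real.exp (-(1 / 4 * x))) * (1 + (ρ ^ 2)⁻¹) := by gcongr
      _ = 2 * C₅ * (Real.exp (-(1 / 4 * x)) * (1 + (ρ ^ 2)⁻¹)) := by ring
      _ ≤ _ := by gcongr
  have hm : Measurable fun v' => singWeight v v' * Real.exp (-(‖v'‖ / 2)) := by
    unfold singWeight; fun_prop
  have hi : Integrable (fun v' => singWeight v v' * Real.exp (-(‖v'‖ / 2))) :=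
    iB.mono' hm.aestronglyMeasurable (.of_forall fun v' => by
      rw [Real.norm_of_nonneg (mul_nonneg (singWeight_nonneg _ _) (Real.exp_nonneg _))]
      exact hb v')
  refine ⟨hi, (integral_mono hi iB hb).trans ?_⟩
  have e : ∫ v', 2 * C₅ * (2 * Real.exp (-(1 / 4 * ‖v'‖)) + J (v - v'))
      = 2 * C₅ * (2 * (∫ v : Vel, Real.exp (-(1 / 4 * ‖v‖))) + ∫ w, J w) := by
    rw [integral_const_mul, integral_add (iE.const_mul 2) (iJ.comp_sub_left v),
      integral_const_mul, integral_sub_left_eq_self]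
  have e' := e
  simp only [Pi.add_apply] at e' ⊢
  linarith

/-- The constant in the integrated kernel bounds. -/
def singConst : ℝ := exists_singWeight_integral_le.choose

theorem singConst_pos : 0 < singConst := exists_singWeight_integral_le.choose_spec.1

theorem integrable_singWeight (v : Vel) :
    Integrable fun v' => singWeight v v' * Real.exp (-(‖v'‖ / 2)) :=
  (exists_singWeight_integral_le.choose_spec.2 v).1

theorem integral_singWeight_le (v : Vel) :
    ∫ v', singWeight v v' * Real.exp (-(‖v'‖ / 2)) ≤ singConst :=
  (exists_singWeight_integral_le.choose_spec.2 v).2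

/-- The Laplace transformed kernel acting on a density `g`. -/
def lapConv (z : ℂ) (g : Vel → ℂ) (i j : Fin 3) (v : Vel) : ℂ :=
  ∫ v', lapInteraction z i j (v - v') * g v'

theorem norm_lapInteraction_le {z : ℂ} (hz : 0 < z.re) (i j : Fin 3) (w : Vel) :
    ‖lapInteraction z i j w‖ ≤ 2 * ‖z‖⁻¹ := by
  have hz0 : 0 < ‖z‖ := norm_pos_iff.2 fun h => by rw [h] at hz; simp at hz
  have h1 := norm_le_norm_add_ofReal hz.le (norm_nonneg w)
  have h2 := le_norm_add_ofReal hz.le ‖w‖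
  have h3 : ‖z + ‖w‖‖⁻¹ ≤ ‖z‖⁻¹ := by gcongr
  have hp := norm_add_ofReal_pos hz (norm_nonneg w)
  refine (norm_sub_le _ _).trans ?_
  rw [norm_div, norm_div, norm_pow, Complex.norm_real, Complex.norm_real]
  have a1 : ‖kron i j‖ / ‖z + ‖w‖‖ ≤ ‖z + ‖w‖‖⁻¹ := by
    rw [div_eq_mul_inv]
    exact mul_le_of_le_one_left (by positivity) (abs_kron_le i j)
  have a2 : ‖w i * w j / ‖w‖‖ / ‖z + ‖w‖‖ ^ 2 ≤ ‖z + ‖w‖‖⁻¹ := by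
    rw [div_le_iff₀ (by positivity), sq, ← mul_assoc, inv_mul_cancel₀ hp.ne', one_mul]
    exact (abs_coord_mul_div_le w i j).trans h2
  linarith

section Density

variable {z : ℂ} {g : Vel → ℂ} {Ψ : ℝ}

theorem integrable_density (hg : AEStronglyMeasurable g)
    (hb : ∀ v, ‖g v‖ ≤ Ψ * Real.exp (-(‖v‖ / 2))) : Integrable g :=
  (((integrable_exp_neg_norm (κ := 1 / 2) (by norm_num)).const_mul Ψ)).mono' hg
    (.of_forall fun v => (hb v).trans (le_of_eq (by ring_nf)))

theorem integrable_lapConv (hz : 0 < z.re) (hg : AEStronglyMeasurable g)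
    (hb : ∀ v, ‖g v‖ ≤ Ψ * Real.exp (-(‖v‖ / 2))) (i j : Fin 3) (v : Vel) :
    Integrable fun v' => lapInteraction z i j (v - v') * g v' :=
  (integrable_density hg hb).bdd_mul
    (((measurable_lapInteraction z i j).comp (measurable_const_sub v)).aestronglyMeasurable)
    (.of_forall fun v' => norm_lapInteraction_le hz i j (v - v'))

theorem lapConv_eq (hz : 0 < z.re) (hg : AEStronglyMeasurable g)
    (hb : ∀ v, ‖g v‖ ≤ Ψ * Real.exp (-(‖v‖ / 2))) (h0 : ∫ v, g v = 0) (i j : Fin 3) (v : Vel) :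
    lapConv z g i j v = ∫ v', (lapInteraction z i j (v - v') - subtracted z v i j) * g v' := by
  simp only [sub_mul]
  rw [integral_sub (integrable_lapConv hz hg hb i j v) ((integrable_density hg hb).const_mul _),
    integral_const_mul, h0, mul_zero, sub_zero]
  rfl

theorem integrable_subtracted (hz : 0 < z.re) (hg : AEStronglyMeasurable g)
    (hb : ∀ v, ‖g v‖ ≤ Ψ * Real.exp (-(‖v‖ / 2))) (i j : Fin 3) (v : Vel) :
    Integrable fun v' => (lapInteraction z i j (v - v') - subtracted z v i j) * g v' := by
  simp only [sub_mul]
  exact (integrable_lapConv hz hg hb i j v).sub ((integrable_density hg hb).const_mul _)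

theorem norm_integral_mul_density_le {k : Vel → ℂ} {κ : ℝ} (hκ : 0 ≤ κ) {v : Vel}
    (hb : ∀ v, ‖g v‖ ≤ Ψ * Real.exp (-(‖v‖ / 2)))
    (hΨ : 0 ≤ Ψ) (hk : ∀ v', v ≠ v' → ‖k v'‖ ≤ κ * singWeight v v') :
    ‖∫ v', k v' * g v'‖ ≤ κ * (Ψ * singConst) := by
  calc ‖∫ v', k v' * g v'‖
      ≤ ∫ v', κ * Ψ * (singWeight v v' * Real.exp (-(‖v'‖ / 2))) := by
        refine norm_integral_le_of_norm_le ((integrable_singWeight v).const_mul _) ?_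
        filter_upwards [Measure.ae_ne volume v] with v' hv'
        rw [norm_mul]
        calc _ ≤ κ * singWeight v v' * (Ψ * Real.exp (-(‖v'‖ / 2))) :=
              mul_le_mul (hk v' hv'.symm) (hb v') (norm_nonneg _)
                (mul_nonneg hκ (singWeight_nonneg _ _))
          _ = _ := by ring
    _ ≤ κ * Ψ * singConst := by
        rw [integral_const_mul]
        exact mul_le_mul_of_nonneg_left (integral_singWeight_le v) (mul_nonneg hκ hΨ)
    _ = _ := by ring

theorem norm_lapConv_le (hz : 0 < z.re) (hg : AEStronglyMeasurable g)
    (hb : ∀ v, ‖g v‖ ≤ Ψ * Real.exp (-(‖v‖ / 2))) (hΨ : 0 ≤ Ψ) (h0 : ∫ v, g v = 0)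
    (i j : Fin 3) (v : Vel) :
    ‖lapConv z g i j v‖ ≤ 3 * (1 + ‖v‖) * ‖z + (1 + ‖v‖ : ℝ)‖⁻¹ ^ 2 * (Ψ * singConst) := by
  rw [lapConv_eq hz hg hb h0]
  refine norm_integral_mul_density_le (v := v) (by positivity) hb hΨ fun v' hv' => ?_
  refine (norm_kernel_entry_le hz hv' i j).trans (le_of_eq (by ring))

theorem norm_lapConv_row_le (hz : 0 < z.re) (hg : AEStronglyMeasurable g)
    (hb : ∀ v, ‖g v‖ ≤ Ψ * Real.exp (-(‖v‖ / 2))) (hΨ : 0 ≤ Ψ) (h0 : ∫ v, g v = 0)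
    (i : Fin 3) {v : Vel} (hv : v ≠ 0) :
    ‖∑ j, lapConv z g i j v * ((v j / ‖v‖ : ℝ) : ℂ)‖
      ≤ 5 * ‖z + (1 + ‖v‖ : ℝ)‖⁻¹ ^ 2 * (Ψ * singConst) := by
  have e : ∑ j, lapConv z g i j v * ((v j / ‖v‖ : ℝ) : ℂ)
      = ∫ v', (∑ j, (lapInteraction z i j (v - v') - subtracted z v i j) * ((v j / ‖v‖ : ℝ) : ℂ))
        * g v' := by
    simp only [lapConv_eq hz hg hb h0, Finset.sum_mul]
    rw [integral_finsetSum]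
    · refine Finset.sum_congr rfl fun j _ => ?_
      rw [← integral_mul_const]
      congr 1; ext v'; ring
    · intro j _
      refine ((integrable_subtracted hz hg hb i j v).mul_const
        ((v j / ‖v‖ : ℝ) : ℂ)).congr (.of_forall fun v' => ?_)
      simp only; ring
  rw [e]
  refine norm_integral_mul_density_le (v := v) (by positivity) hb hΨ fun v' hv' => ?_
  refine (norm_kernel_row_le hz hv hv' i).trans (le_of_eq (by ring))

theorem norm_lapConv_parallel_le (hz : 0 < z.re) (hg : AEStronglyMeasurable g)
    (hb : ∀ v, ‖g v‖ ≤ Ψ * Real.exp (-(‖v‖ / 2))) (hΨ : 0 ≤ Ψ) (h0 : ∫ v, g v = 0)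
    {v : Vel} (hv : v ≠ 0) :
    ‖∑ i, ((v i / ‖v‖ : ℝ) : ℂ) * ∑ j, lapConv z g i j v * ((v j / ‖v‖ : ℝ) : ℂ)‖
      ≤ 4 * (‖z‖ * ‖z + (1 + ‖v‖ : ℝ)‖⁻¹ ^ 3 + ‖z + (1 + ‖v‖ : ℝ)‖⁻¹ ^ 2 / (1 + ‖v‖)) *
        (Ψ * singConst) := by
  have e : ∑ i, ((v i / ‖v‖ : ℝ) : ℂ) * ∑ j, lapConv z g i j v * ((v j / ‖v‖ : ℝ) : ℂ)
      = ∫ v', (∑ i, ((v i / ‖v‖ : ℝ) : ℂ) *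
        ∑ j, (lapInteraction z i j (v - v') - subtracted z v i j) * ((v j / ‖v‖ : ℝ) : ℂ))
        * g v' := by
    simp only [lapConv_eq hz hg hb h0, Finset.sum_mul, Finset.mul_sum]
    rw [integral_finsetSum]
    · refine Finset.sum_congr rfl fun i _ => ?_
      rw [integral_finsetSum]
      · refine Finset.sum_congr rfl fun j _ => ?_
        rw [← integral_mul_const, ← integral_const_mul]
        congr 1; ext v'; ring
      · intro j _
        refine ((integrable_subtracted hz hg hb i j v).mul_const
          (((v i / ‖v‖ : ℝ) : ℂ) * ((v j / ‖v‖ : ℝ) : ℂ))).congr (.of_forall fun v' => ?_)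
        simp only; ring
    · intro i _
      refine integrable_finsetSum _ fun j _ => ?_
      refine ((integrable_subtracted hz hg hb i j v).mul_const
        (((v i / ‖v‖ : ℝ) : ℂ) * ((v j / ‖v‖ : ℝ) : ℂ))).congr (.of_forall fun v' => ?_)
      simp only; ring
  rw [e]
  refine norm_integral_mul_density_le (v := v) (by positivity) hb hΨ fun v' hv' => ?_
  refine (norm_kernel_parallel_le hz hv hv').trans (le_of_eq (by ring))

theorem norm_lapConv_sub_le (hz : 0 < z.re) (hg : AEStronglyMeasurable g)
    (hb : ∀ v, ‖g v‖ ≤ Ψ * Real.exp (-(‖v‖ / 2))) (hΨ : 0 ≤ Ψ)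
    (i j : Fin 3) {v y : Vel} (hvy : ‖y - v‖ ≤ 1) :
    ‖lapConv z g i j y - lapConv z g i j v‖
      ≤ 40 * ‖y - v‖ * ‖z + (1 + ‖v‖ : ℝ)‖⁻¹ ^ 2 * (Ψ * singConst) := by
  have hty : ‖z + (1 + ‖y‖ : ℝ)‖⁻¹ ≤ 2 * ‖z + (1 + ‖v‖ : ℝ)‖⁻¹ := by
    have h1 := norm_add_ofReal_pos hz (r := 1 + ‖y‖) (by positivity)
    have h2 := norm_add_ofReal_pos hz (r := 1 + ‖v‖) (by positivity)
    have h3 : ‖z + (1 + ‖v‖ : ℝ)‖ ≤ 2 * ‖z + (1 + ‖y‖ : ℝ)‖ := by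
      have e : z + (1 + ‖v‖ : ℝ) = (z + (1 + ‖y‖ : ℝ)) + ((‖v‖ - ‖y‖ : ℝ) : ℂ) := by
        push_cast; ring
      have h4 := le_norm_add_ofReal hz.le (1 + ‖y‖)
      have h5 : |‖v‖ - ‖y‖| ≤ 1 := by
        rw [abs_sub_comm]; exact (abs_norm_sub_norm_le y v).trans hvy
      rw [e]
      refine (norm_add_le _ _).trans ?_
      rw [Complex.norm_real, Real.norm_eq_abs]
      linarith [norm_nonneg y]
    rw [← div_eq_mul_inv, le_div_iff₀ h2, inv_mul_le_iff₀ h1]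
    linarith
  set t := ‖z + (1 + ‖v‖ : ℝ)‖⁻¹ with ht
  have ht0 : 0 ≤ t := inv_nonneg.2 (norm_nonneg _)
  have hy2 : ‖z + (1 + ‖y‖ : ℝ)‖⁻¹ ^ 2 ≤ 4 * t ^ 2 := by
    refine (pow_le_pow_left₀ (by positivity) hty 2).trans (le_of_eq (by ring))
  rw [lapConv, lapConv, ← integral_sub (integrable_lapConv hz hg hb i j y)
    (integrable_lapConv hz hg hb i j v)]
  have hi : Integrable fun v' => (8 * ‖y - v‖ * Ψ) *
      (4 * t ^ 2 * (singWeight y v' * Real.exp (-(‖v'‖ / 2)))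
        + t ^ 2 * (singWeight v v' * Real.exp (-(‖v'‖ / 2)))) :=
    (((integrable_singWeight y).const_mul _).add
      ((integrable_singWeight v).const_mul _)).const_mul _
  calc _ ≤ ∫ v', (8 * ‖y - v‖ * Ψ) *
      (4 * t ^ 2 * (singWeight y v' * Real.exp (-(‖v'‖ / 2)))
        + t ^ 2 * (singWeight v v' * Real.exp (-(‖v'‖ / 2)))) := by
        refine norm_integral_le_of_norm_le hi ?_
        filter_upwards [Measure.ae_ne volume v, Measure.ae_ne volume y] with v' h1 h2
        rw [← sub_mul, norm_mul]
        have h3 := norm_lapInteraction_sub_le hz (sub_ne_zero.2 h2.symm) (sub_ne_zero.2 h1.symm) i j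
        rw [sub_sub_sub_cancel_right] at h3
        have h4 := norm_sq_inv_le hz h2.symm
        have h5 := norm_sq_inv_le hz h1.symm
        have h6 := singWeight_nonneg y v'
        calc _ ≤ (8 * ‖y - v‖ * (singWeight y v' * (4 * t ^ 2) + singWeight v v' * t ^ 2)) *
              (Ψ * Real.exp (-(‖v'‖ / 2))) := by
              refine mul_le_mul (h3.trans ?_) (hb v') (norm_nonneg _) ?_
              · have := mul_le_mul_of_nonneg_left hy2 h6
                gcongr
                exact h4.trans this
              · have := singWeight_nonneg v v'
                positivity
          _ = _ := by ring
    _ ≤ (8 * ‖y - v‖ * Ψ) * (4 * t ^ 2 * singConst + t ^ 2 * singConst) := by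
        rw [integral_const_mul, integral_add ((integrable_singWeight y).const_mul _)
          ((integrable_singWeight v).const_mul _), integral_const_mul, integral_const_mul]
        gcongr
        · exact integral_singWeight_le y
        · exact integral_singWeight_le v
    _ = _ := by ring

end Density

end NonMarkov

end

noncomputable section

open MeasureTheory Set
open scoped ENNReal FourierTransform ComplexConjugate

namespace NonMarkov

/-- The weight of the component parallel to `v` in `transNorm`. -/
def paraWeight (a q : ℝ) : ℝ := q / (1 + a) + a / (1 + a) ^ 2

/-- An anisotropic norm for which the transformed kernel is bounded. -/
def transNorm (a : ℝ) (v : Vel) (V : CVec) : ℝ :=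
  ‖V - proj v V‖ / (1 + a) + paraWeight a (1 / (1 + ‖v‖)) * ‖proj v V‖

theorem paraWeight_nonneg {a q : ℝ} (ha : 0 ≤ a) (hq : 0 ≤ q) : 0 ≤ paraWeight a q := by
  unfold paraWeight; positivity

theorem transNorm_nonneg {a : ℝ} (ha : 0 ≤ a) (v : Vel) (V : CVec) : 0 ≤ transNorm a v V := by
  have := paraWeight_nonneg ha (q := 1 / (1 + ‖v‖)) (by positivity)
  unfold transNorm; positivity

/-- The complexified unit vector in the direction of `v`. -/
def dir (v : Vel) (i : Fin 3) : ℂ := ((v i / ‖v‖ : ℝ) : ℂ)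

theorem norm_dir_le (v : Vel) (i : Fin 3) : ‖dir v i‖ ≤ 1 := by
  rw [dir, Complex.norm_real, Real.norm_eq_abs, abs_div, abs_norm]
  exact div_le_one_of_le₀ (abs_coord_le v i) (norm_nonneg _)

theorem conj_dir (v : Vel) (i : Fin 3) : conj (dir v i) = dir v i := Complex.conj_ofReal _

theorem proj_apply (v : Vel) (W : CVec) (i : Fin 3) :
    proj v W i = (∑ j, dir v j * W j) * dir v i := by
  simp only [proj, dir, Complex.ofReal_div, Fin.sum_univ_three]
  ring

theorem norm_proj {v : Vel} (hv : v ≠ 0) (W : CVec) : ‖proj v W‖ = ‖∑ j, dir v j * W j‖ := by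
  have hn : ‖v‖ ≠ 0 := norm_ne_zero_iff.2 hv
  have h : ∑ i, ‖dir v i‖ ^ 2 = 1 := by
    simp only [dir, Complex.norm_real, Real.norm_eq_abs, sq_abs, div_pow]
    rw [← Finset.sum_div, sum_coord_sq, div_self (pow_ne_zero 2 hn)]
  rw [EuclideanSpace.norm_eq]
  simp only [proj_apply, norm_mul, mul_pow]
  rw [← Finset.mul_sum, h, mul_one, Real.sqrt_sq (norm_nonneg _)]

theorem norm_proj_le {v : Vel} (hv : v ≠ 0) (W : CVec) : ‖proj v W‖ ≤ 3 * ‖W‖ := by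
  rw [norm_proj hv]
  have h : ∀ j, ‖dir v j * W j‖ ≤ ‖W‖ := fun j => by
    rw [norm_mul]
    exact (mul_le_of_le_one_left (norm_nonneg _) (norm_dir_le v j)).trans (PiLp.norm_apply_le W j)
  refine (norm_sum_le _ _).trans ((Finset.sum_le_sum fun j _ => h j).trans ?_)
  simp

theorem proj_add (v : Vel) (V W : CVec) : proj v (V + W) = proj v V + proj v W := by
  ext i
  simp only [PiLp.add_apply, proj_apply, Fin.sum_univ_three]
  ring

theorem transNorm_add_le {a : ℝ} (ha : 0 ≤ a) (v : Vel) (V W : CVec) :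
    transNorm a v (V + W) ≤ transNorm a v V + transNorm a v W := by
  have hp := paraWeight_nonneg ha (q := 1 / (1 + ‖v‖)) (by positivity)
  have h1 : ‖V + W - proj v (V + W)‖ ≤ ‖V - proj v V‖ + ‖W - proj v W‖ := by
    rw [proj_add, add_sub_add_comm]; exact norm_add_le _ _
  have h2 : ‖proj v (V + W)‖ ≤ ‖proj v V‖ + ‖proj v W‖ := by
    rw [proj_add]; exact norm_add_le _ _
  unfold transNorm
  calc _ ≤ (‖V - proj v V‖ + ‖W - proj v W‖) / (1 + a)
        + paraWeight a (1 / (1 + ‖v‖)) * (‖proj v V‖ + ‖proj v W‖) := by gcongr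
    _ = _ := by ring

theorem transNorm_le {a : ℝ} (ha : 0 ≤ a) {v : Vel} (hv : v ≠ 0) (V : CVec) :
    transNorm a v V ≤ 10 * ‖V‖ := by
  have h1 := norm_proj_le hv V
  have h2 := norm_sub_le V (proj v V)
  have h3 : ‖V - proj v V‖ / (1 + a) ≤ ‖V - proj v V‖ :=
    div_le_self (norm_nonneg _) (by linarith)
  have h4 : paraWeight a (1 / (1 + ‖v‖)) ≤ 2 := by
    have : 1 / (1 + ‖v‖) / (1 + a) ≤ 1 := by
      rw [div_div, div_le_one (by positivity)]
      nlinarith [norm_nonneg v, mul_nonneg (norm_nonneg v) ha]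
    have : a / (1 + a) ^ 2 ≤ 1 := by
      rw [div_le_one (by positivity)]; nlinarith
    unfold paraWeight; linarith
  have h5 := mul_le_mul_of_nonneg_right h4 (norm_nonneg (proj v V))
  unfold transNorm
  linarith

theorem norm_le_transNorm {a : ℝ} (ha : 0 ≤ a) (v : Vel) (V : CVec) :
    1 / (1 + ‖v‖) / (1 + a) * ‖V‖ ≤ transNorm a v V := by
  have hq : 1 / (1 + ‖v‖) ≤ 1 := by
    rw [div_le_one (by positivity)]; linarith [norm_nonneg v]
  have h1 : ‖V‖ ≤ ‖V - proj v V‖ + ‖proj v V‖ := by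
    simpa using norm_add_le (V - proj v V) (proj v V)
  unfold transNorm paraWeight
  have h2 : 0 ≤ a / (1 + a) ^ 2 * ‖proj v V‖ := by positivity
  calc _ ≤ 1 / (1 + ‖v‖) / (1 + a) * (‖V - proj v V‖ + ‖proj v V‖) := by gcongr
    _ ≤ 1 / (1 + a) * ‖V - proj v V‖ + 1 / (1 + ‖v‖) / (1 + a) * ‖proj v V‖ := by
        rw [mul_add]; gcongr
    _ = ‖V - proj v V‖ / (1 + a) + 1 / (1 + ‖v‖) / (1 + a) * ‖proj v V‖ := by ring
    _ ≤ _ := by rw [add_mul]; linarith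

theorem transNorm_shift_le {a b h : ℝ} (ha : 0 ≤ a) (hb : 0 ≤ b) (hh : 0 ≤ h) (v : Vel)
    (hab : |a - b| ≤ h * (1 / (1 + ‖v‖))) (V : CVec) :
    transNorm a v V ≤ (1 + 2 * h) * transNorm b v V := by
  set q := 1 / (1 + ‖v‖) with hqd
  have hq0 : 0 ≤ q := by positivity
  have hq : q ≤ 1 := by
    rw [hqd, div_le_one (by positivity)]; linarith [norm_nonneg v]
  have hhq : h * q ≤ h := mul_le_of_le_one_right hh hq
  have h1 : 1 / (1 + a) ≤ (1 + h) * (1 / (1 + b)) := by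
    rw [← div_eq_mul_one_div, div_le_div_iff₀ (by positivity) (by positivity)]
    have := (abs_sub_le_iff.1 hab).2
    nlinarith [mul_nonneg hh ha]
  have h2 : a / (1 + a) ^ 2 ≤ b / (1 + b) ^ 2 + h * q * (1 / (1 + b)) := by
    have e : a / (1 + a) ^ 2 - b / (1 + b) ^ 2
        = (a - b) * (1 - a * b) / ((1 + a) * (1 + b)) * (1 / (1 + a)) * (1 / (1 + b)) := by
      field_simp; ring
    have h3 : |1 - a * b| ≤ (1 + a) * (1 + b) := by
      rw [abs_le]; constructor <;> nlinarith [mul_nonneg ha hb]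
    have h4 : (a - b) * (1 - a * b) / ((1 + a) * (1 + b)) ≤ h * q := by
      rw [div_le_iff₀ (by positivity)]
      refine (le_abs_self _).trans ?_
      rw [abs_mul]
      exact mul_le_mul hab h3 (abs_nonneg _) (by positivity)
    have h5 : 1 / (1 + a) ≤ 1 := by rw [div_le_one (by positivity)]; linarith
    have h6 : (a - b) * (1 - a * b) / ((1 + a) * (1 + b)) * (1 / (1 + a)) ≤ h * q :=
      (mul_le_mul_of_nonneg_right h4 (by positivity)).trans
        (mul_le_of_le_one_right (by positivity) h5)
    have h7 := mul_le_mul_of_nonneg_right h6 (show 0 ≤ 1 / (1 + b) by positivity)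
    linarith
  have h3 : paraWeight a q ≤ (1 + 2 * h) * paraWeight b q := by
    unfold paraWeight
    have h4 := mul_le_mul_of_nonneg_left h1 hq0
    have h5 : 0 ≤ h * (b / (1 + b) ^ 2) := by positivity
    rw [div_eq_mul_one_div q, div_eq_mul_one_div q]
    nlinarith
  have h4 : 1 / (1 + a) ≤ (1 + 2 * h) * (1 / (1 + b)) :=
    h1.trans (by gcongr; linarith)
  unfold transNorm
  rw [← hqd, div_eq_mul_one_div, div_eq_mul_one_div ‖V - proj v V‖]
  have h5 := mul_le_mul_of_nonneg_left h4 (norm_nonneg (V - proj v V))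
  have h6 := mul_le_mul_of_nonneg_right h3 (norm_nonneg (proj v V))
  linarith

theorem transNorm_sq_le_weightB1 (z : ℂ) (v : Vel) (V : CVec) :
    1 / (1 + ‖v‖) * transNorm (weightAlpha z v) v V ^ 2 ≤ 2 * weightB1 z v V V := by
  have ha : 0 ≤ weightAlpha z v := by unfold weightAlpha; positivity
  have hb : 0 ≤ weightBeta z v := by unfold weightBeta; positivity
  unfold weightB1 weightC1 weightC2 transNorm paraWeight anorm
  generalize weightAlpha z v = a at *
  generalize weightBeta z v = b at *
  generalize ‖V - proj v V‖ = x
  generalize ‖proj v V‖ = y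
  have hN : 0 < 1 + ‖v‖ := by positivity
  generalize 1 + ‖v‖ = N at *
  have e : 2 * (1 / (N * (1 + a) ^ 2) * (x + y / N) * (x + y / N)
      + (b + a ^ 2) / (N * (1 + a) ^ 4) * y * y) -
      1 / N * (x / (1 + a) + (1 / N / (1 + a) + a / (1 + a) ^ 2) * y) ^ 2
      = 1 / N * (x / (1 + a) + 1 / N / (1 + a) * y - a / (1 + a) ^ 2 * y) ^ 2
        + 2 * (b / (N * (1 + a) ^ 4) * y ^ 2) := by
    field_simp
    ring
  have : 0 ≤ 1 / N * (x / (1 + a) + 1 / N / (1 + a) * y - a / (1 + a) ^ 2 * y) ^ 2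
        + 2 * (b / (N * (1 + a) ^ 4) * y ^ 2) := by positivity
  linarith

theorem norm_bilinear_le {a κ : ℝ} (ha : 0 ≤ a) (hκ : 0 ≤ κ) {v : Vel} (hv : v ≠ 0)
    {K : Fin 3 → Fin 3 → ℂ} (hs : ∀ i j, K i j = K j i)
    (h1 : ∀ i j, ‖K i j‖ ≤ κ * (1 / (1 + ‖v‖) / (1 + a) ^ 2))
    (h2 : ∀ i, ‖∑ j, K i j * dir v j‖ ≤ κ * ((1 / (1 + ‖v‖)) ^ 2 / (1 + a) ^ 2))
    (h3 : ‖∑ i, dir v i * ∑ j, K i j * dir v j‖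
      ≤ κ * (1 / (1 + ‖v‖) * paraWeight a (1 / (1 + ‖v‖)) ^ 2)) (V W : CVec) :
    ‖∑ i, ∑ j, conj (V i) * (K i j * W j)‖
      ≤ 9 * κ * (1 / (1 + ‖v‖) * transNorm a v V * transNorm a v W) := by
  set q := 1 / (1 + ‖v‖) with hqd
  have hq0 : 0 ≤ q := by positivity
  set p := paraWeight a q with hp
  have hpq : q / (1 + a) ≤ p := by
    rw [hp, paraWeight]; linarith [show 0 ≤ a / (1 + a) ^ 2 by positivity]
  have hp0 : 0 ≤ p := paraWeight_nonneg ha hq0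
  set X := V - proj v V with hX
  set Y := W - proj v W with hY
  set α := ∑ j, dir v j * V j with hα
  set β := ∑ j, dir v j * W j with hβ
  have hVi : ∀ i, V i = X i + α * dir v i := fun i => by
    rw [hX, PiLp.sub_apply, proj_apply]; ring
  have hWi : ∀ i, W i = Y i + β * dir v i := fun i => by
    rw [hY, PiLp.sub_apply, proj_apply]; ring
  have e : ∑ i, ∑ j, conj (V i) * (K i j * W j)
      = ∑ i, ∑ j, conj (X i) * (K i j * Y j) + (∑ i, conj (X i) * ∑ j, K i j * dir v j) * β
        + conj α * (∑ i, (∑ j, K i j * dir v j) * Y i)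
        + conj α * β * ∑ i, dir v i * ∑ j, K i j * dir v j := by
    simp only [hVi, hWi, map_add, map_mul, conj_dir, Fin.sum_univ_three]
    rw [hs 1 0, hs 2 0, hs 2 1]
    ring
  set r := 1 / (1 + a) with hr
  have hr0 : 0 ≤ r := by positivity
  set x := ‖X‖
  set y := ‖Y‖
  have hx0 : 0 ≤ x := norm_nonneg _
  have hy0 : 0 ≤ y := norm_nonneg _
  have b1 : ‖∑ i, ∑ j, conj (X i) * (K i j * Y j)‖ ≤ 9 * (κ * q * (r * x) * (r * y)) := by
    have : ∀ i j, ‖conj (X i) * (K i j * Y j)‖ ≤ κ * q * (r * x) * (r * y) := fun i j => by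
      rw [norm_mul, norm_mul, RCLike.norm_conj]
      calc _ ≤ x * (κ * (q / (1 + a) ^ 2) * y) := by
            gcongr
            · exact PiLp.norm_apply_le X i
            · exact h1 i j
            · exact PiLp.norm_apply_le Y j
        _ = _ := by rw [hr]; field_simp
    refine (norm_sum_le _ _).trans ((Finset.sum_le_sum fun i _ =>
      (norm_sum_le _ _).trans (Finset.sum_le_sum fun j _ => this i j)).trans ?_)
    simp only [Finset.sum_const, Finset.card_univ, Fintype.card_fin, nsmul_eq_mul]
    push_cast
    linarith
  have row : ∀ i, ‖∑ j, K i j * dir v j‖ ≤ κ * q * r * p := fun i =>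
    (h2 i).trans (by
      calc κ * (q ^ 2 / (1 + a) ^ 2) = κ * q * r * (q / (1 + a)) := by rw [hr]; field_simp
        _ ≤ _ := by gcongr)
  have b2 : ‖(∑ i, conj (X i) * ∑ j, K i j * dir v j) * β‖
      ≤ 3 * (κ * q * (r * x) * (p * ‖β‖)) := by
    have : ∀ i, ‖conj (X i) * ∑ j, K i j * dir v j‖ ≤ x * (κ * q * r * p) := fun i => by
      rw [norm_mul, RCLike.norm_conj]
      exact mul_le_mul (PiLp.norm_apply_le X i) (row i) (norm_nonneg _) hx0
    rw [norm_mul]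
    have h := (norm_sum_le _ _).trans (Finset.sum_le_sum fun i (_ : i ∈ Finset.univ) => this i)
    simp only [Finset.sum_const, Finset.card_univ, Fintype.card_fin, nsmul_eq_mul] at h
    push_cast at h
    have h' := mul_le_mul_of_nonneg_right h (norm_nonneg β)
    linarith
  have b3 : ‖conj α * (∑ i, (∑ j, K i j * dir v j) * Y i)‖
      ≤ 3 * (κ * q * (p * ‖α‖) * (r * y)) := by
    have : ∀ i, ‖(∑ j, K i j * dir v j) * Y i‖ ≤ (κ * q * r * p) * y := fun i => by
      rw [norm_mul]
      exact mul_le_mul (row i) (PiLp.norm_apply_le Y i) (norm_nonneg _) (by positivity)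
    rw [norm_mul, RCLike.norm_conj]
    have h := (norm_sum_le _ _).trans (Finset.sum_le_sum fun i (_ : i ∈ Finset.univ) => this i)
    simp only [Finset.sum_const, Finset.card_univ, Fintype.card_fin, nsmul_eq_mul] at h
    push_cast at h
    have h' := mul_le_mul_of_nonneg_left h (norm_nonneg α)
    linarith
  have b4 : ‖conj α * β * ∑ i, dir v i * ∑ j, K i j * dir v j‖
      ≤ κ * q * (p * ‖α‖) * (p * ‖β‖) := by
    rw [norm_mul, norm_mul, RCLike.norm_conj]
    have h' := mul_le_mul_of_nonneg_left h3 (show 0 ≤ ‖α‖ * ‖β‖ by positivity)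
    linarith
  have tV : transNorm a v V = r * x + p * ‖α‖ := by
    rw [transNorm, norm_proj hv, hr, ← hqd, ← hp]
    ring
  have tW : transNorm a v W = r * y + p * ‖β‖ := by
    rw [transNorm, norm_proj hv, hr, ← hqd, ← hp]
    ring
  rw [e, tV, tW]
  refine (norm_add_le _ _).trans ((add_le_add_left ((norm_add_le _ _).trans
    (add_le_add_left (norm_add_le _ _) _)) _).trans ?_)
  have p2 : 0 ≤ κ * q * (r * x) * (p * ‖β‖) := by positivity
  have p3 : 0 ≤ κ * q * (p * ‖α‖) * (r * y) := by positivity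
  have p4 : 0 ≤ κ * q * (p * ‖α‖) * (p * ‖β‖) := by positivity
  linarith

section Density

variable {z : ℂ} {g : Vel → ℂ} {Ψ : ℝ}

theorem lapConv_symm (z : ℂ) (g : Vel → ℂ) (i j : Fin 3) (v : Vel) :
    lapConv z g i j v = lapConv z g j i v := by
  simp only [lapConv, lapInteraction_symm z i j]

theorem inv_norm_add_one_le (hz : 0 < z.re) (v : Vel) :
    ‖z + (1 + ‖v‖ : ℝ)‖⁻¹ ≤ 2 * (1 / (1 + ‖v‖) / (1 + weightAlpha z v)) := by
  have h := add_im_le_two_mul_norm hz.le (1 + ‖v‖)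
  have hp := norm_add_ofReal_pos hz (r := 1 + ‖v‖) (by positivity)
  have e : 1 / (1 + ‖v‖) / (1 + weightAlpha z v) = (1 + ‖v‖ + |z.im|)⁻¹ := by
    rw [weightAlpha]; field_simp
  rw [e, ← div_eq_mul_inv, inv_le_comm₀ hp (by positivity), inv_div]
  linarith

theorem norm_sum_lapConv_le (hz : 0 < z.re) (hz1 : z.re ≤ 1) (hg : AEStronglyMeasurable g)
    (hb : ∀ v, ‖g v‖ ≤ Ψ * Real.exp (-(‖v‖ / 2))) (hΨ : 0 ≤ Ψ) (h0 : ∫ v, g v = 0)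
    {v : Vel} (hv : v ≠ 0) (V W : CVec) :
    ‖∑ i, ∑ j, conj (V i) * (lapConv z g i j v * W j)‖
      ≤ 432 * singConst * Ψ * (1 / (1 + ‖v‖) * transNorm (weightAlpha z v) v V *
        transNorm (weightAlpha z v) v W) := by
  have ha : 0 ≤ weightAlpha z v := by unfold weightAlpha; positivity
  have hs := singConst_pos
  have ht := inv_norm_add_one_le hz v
  have h1 := fun i j => norm_lapConv_le hz hg hb hΨ h0 i j v
  have h2 := fun i => norm_lapConv_row_le hz hg hb hΨ h0 i hv
  have h3 := norm_lapConv_parallel_le hz hg hb hΨ h0 hv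
  have hzn : ‖z‖ ≤ 1 + weightAlpha z v * (1 + ‖v‖) := by
    refine (Complex.norm_le_abs_re_add_abs_im z).trans ?_
    rw [weightAlpha, abs_of_pos hz, div_mul_cancel₀ _ (by positivity)]
    linarith
  have ht0 : 0 ≤ ‖z + (1 + ‖v‖ : ℝ)‖⁻¹ := by positivity
  have hκ : 0 ≤ Ψ * singConst := by positivity
  generalize ‖z + (1 + ‖v‖ : ℝ)‖⁻¹ = t at *
  generalize weightAlpha z v = a at *
  have hN : 1 ≤ 1 + ‖v‖ := by linarith [norm_nonneg v]
  have ht2 : t ^ 2 ≤ 4 * ((1 / (1 + ‖v‖)) ^ 2 / (1 + a) ^ 2) :=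
    (pow_le_pow_left₀ ht0 ht 2).trans (le_of_eq (by rw [mul_pow, div_pow]; norm_num))
  have ht3 : t ^ 3 ≤ 8 * ((1 / (1 + ‖v‖)) ^ 3 / (1 + a) ^ 3) :=
    (pow_le_pow_left₀ ht0 ht 3).trans (le_of_eq (by rw [mul_pow, div_pow]; norm_num))
  refine (norm_bilinear_le (κ := 48 * (Ψ * singConst)) ha (by positivity) hv
    (fun i j => lapConv_symm z g i j v) (fun i j => (h1 i j).trans ?_)
    (fun i => (h2 i).trans ?_) (h3.trans ?_) V W).trans (le_of_eq (by ring))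
  · calc _ ≤ 3 * (1 + ‖v‖) * (4 * ((1 / (1 + ‖v‖)) ^ 2 / (1 + a) ^ 2)) * (Ψ * singConst) := by
          gcongr
      _ = 12 * (Ψ * singConst) * (1 / (1 + ‖v‖) / (1 + a) ^ 2) := by field_simp; ring
      _ ≤ _ := by gcongr; norm_num
  · calc _ ≤ 5 * (4 * ((1 / (1 + ‖v‖)) ^ 2 / (1 + a) ^ 2)) * (Ψ * singConst) := by gcongr
      _ = 20 * (Ψ * singConst) * ((1 / (1 + ‖v‖)) ^ 2 / (1 + a) ^ 2) := by ring
      _ ≤ _ := by gcongr; norm_num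
  · have hp : ‖z‖ * t ^ 3 + t ^ 2 / (1 + ‖v‖)
        ≤ 12 * (1 / (1 + ‖v‖) * paraWeight a (1 / (1 + ‖v‖)) ^ 2) := by
      calc _ ≤ (1 + a * (1 + ‖v‖)) * (8 * ((1 / (1 + ‖v‖)) ^ 3 / (1 + a) ^ 3))
            + 4 * ((1 / (1 + ‖v‖)) ^ 2 / (1 + a) ^ 2) / (1 + ‖v‖) := by gcongr
        _ ≤ _ := by
          unfold paraWeight
          have hN0 : 0 < 1 + ‖v‖ := by linarith
          generalize 1 + ‖v‖ = N at *
          have e : 12 * (1 / N * (1 / N / (1 + a) + a / (1 + a) ^ 2) ^ 2)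
              - ((1 + a * N) * (8 * ((1 / N) ^ 3 / (1 + a) ^ 3))
                + 4 * ((1 / N) ^ 2 / (1 + a) ^ 2) / N)
              = (8 * a + 16 * a * N * (1 + a) + 12 * a ^ 2 * N ^ 2 )
                / (N ^ 3 * (1 + a) ^ 4) + (8 * a ^ 2) / (N ^ 3 * (1 + a) ^ 4) := by
            field_simp
            ring
          have : 0 ≤ (8 * a + 16 * a * N * (1 + a) + 12 * a ^ 2 * N ^ 2 )
                / (N ^ 3 * (1 + a) ^ 4) + (8 * a ^ 2) / (N ^ 3 * (1 + a) ^ 4) := by positivity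
          linarith
    calc _ ≤ 4 * (12 * (1 / (1 + ‖v‖) * paraWeight a (1 / (1 + ‖v‖)) ^ 2)) * (Ψ * singConst) := by
          gcongr
      _ = _ := by ring

theorem norm_lapConv_sub_le' (hz : 0 < z.re) (hg : AEStronglyMeasurable g)
    (hb : ∀ v, ‖g v‖ ≤ Ψ * Real.exp (-(‖v‖ / 2))) (hΨ : 0 ≤ Ψ)
    (i j : Fin 3) {v y : Vel} (hvy : ‖y - v‖ ≤ 1) :
    ‖lapConv z g i j y - lapConv z g i j v‖
      ≤ 160 * singConst * Ψ * ‖y - v‖ * (1 / (1 + ‖v‖) / (1 + weightAlpha z v)) ^ 2 := by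
  have hs := singConst_pos
  have ht := inv_norm_add_one_le hz v
  refine (norm_lapConv_sub_le hz hg hb hΨ i j hvy).trans ?_
  have ht2 := pow_le_pow_left₀ (by positivity) ht 2
  calc _ ≤ 40 * ‖y - v‖ * (2 * (1 / (1 + ‖v‖) / (1 + weightAlpha z v))) ^ 2 * (Ψ * singConst) := by
        gcongr
    _ = _ := by ring

end Density

end NonMarkov

end

noncomputable section

open MeasureTheory Set
open scoped ENNReal FourierTransform

namespace NonMarkov

open Filter Topology SchwartzMap

/-- Bump functions on the line that shrink to the origin. -/
def shrinkingBump (n : ℕ) : ContDiffBump (0 : ℝ) where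
  rIn := 1 / (n + 1)
  rOut := 2 / (n + 1)
  rIn_pos := by positivity
  rIn_lt_rOut := by gcongr; norm_num

theorem ae_tendsto_shrinkingBump {F : ℝ → ℂ} (hF : LocallyIntegrable F) :
    ∀ᵐ ξ, Tendsto (fun n => ∫ η, (((shrinkingBump n).normed volume (ξ - η) : ℝ) : ℂ) * F η) atTop
      (𝓝 (F ξ)) := by
  have h := ContDiffBump.ae_convolution_tendsto_right_of_locallyIntegrable (μ := volume)
    (φ := shrinkingBump) (l := atTop) (K := 2) ?_ (.of_forall fun n => ?_) hF
  · filter_upwards [h] with ξ hξ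
    refine hξ.congr fun n => ?_
    rw [convolution_def, ← integral_sub_left_eq_self _ volume ξ]
    congr 1; ext η
    simp
  · have : Tendsto (fun n : ℕ => 2 * (1 / ((n : ℝ) + 1))) atTop (𝓝 (2 * 0)) :=
      tendsto_one_div_add_atTop_nhds_zero_nat.const_mul 2
    rw [mul_zero] at this
    refine this.congr fun n => ?_
    simp only [shrinkingBump]
    ring
  · simp only [shrinkingBump]
    exact le_of_eq (by ring)

/-- The Fourier transform of a family of square integrable functions has a jointly measurable
version. -/
theorem exists_measurable_isFT {X : Type*} [MeasurableSpace X] {V : ℝ → X → ℂ}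
    (hV : StronglyMeasurable (Function.uncurry V)) :
    ∃ F : ℝ → X → ℂ, StronglyMeasurable (Function.uncurry F) ∧
      ∀ x, MemLp (fun t => V t x) 2 volume → IsFT (fun t => V t x) fun ξ => F ξ x := by
  set b : ℕ → ℝ → ℝ → ℂ := fun n ξ η => (((shrinkingBump n).normed volume (ξ - η) : ℝ) : ℂ) with hb
  have hbc : ∀ n, Continuous fun p : ℝ × ℝ => b n p.1 p.2 := fun n => by
    have := (shrinkingBump n).continuous_normed (μ := volume)
    simp only [hb]; fun_prop
  set B : ℕ → ℝ → ℝ → ℂ := fun n ξ => 𝓕 (b n ξ) with hB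
  have hBm : ∀ n, StronglyMeasurable fun p : ℝ × ℝ => B n p.1 p.2 := fun n => by
    simp only [hB, Real.fourier_eq']
    refine StronglyMeasurable.integral_prod_right (ν := volume)
      (f := fun (p : ℝ × ℝ) (η : ℝ) => Complex.exp (↑(-2 * Real.pi * inner ℝ η p.2) * Complex.I) •
        b n p.1 η) ?_
    refine Continuous.stronglyMeasurable ?_
    have := (hbc n).comp (f := fun q : (ℝ × ℝ) × ℝ => (q.1.1, q.2)) (by fun_prop)
    simp only [Function.comp_def] at this
    fun_prop
  refine ⟨fun ξ x => limUnder atTop fun n => ∫ t, B n ξ t * V t x, ?_, fun x hx => ?_⟩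
  · refine StronglyMeasurable.limUnder (f := fun n (p : ℝ × X) => ∫ t, B n p.1 t * V t p.2)
      fun n => ?_
    refine StronglyMeasurable.integral_prod_right (ν := volume)
      (f := fun (p : ℝ × X) (t : ℝ) => B n p.1 t * V t p.2) ?_
    exact ((hBm n).comp_measurable (g := fun q : (ℝ × X) × ℝ => (q.1.1, q.2)) (by fun_prop)).mul
      (hV.comp_measurable (g := fun q : (ℝ × X) × ℝ => (q.2, q.1.2)) (by fun_prop))
  · have hF := isFT_fourier hx
    refine hF.congr_right ?_
    filter_upwards [ae_tendsto_shrinkingBump (hF.right.locallyIntegrable (by norm_num))] with ξ hξ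
    refine (hξ.congr fun n => ?_).limUnder_eq.symm
    have c1 : HasCompactSupport (b n ξ) :=
      (((shrinkingBump n).hasCompactSupport_normed.comp_homeomorph
        (Homeomorph.subLeft ξ)).comp_left (g := Complex.ofReal) rfl)
    have c2 : ContDiff ℝ (⊤ : ℕ∞) (b n ξ) := by
      have := (shrinkingBump n).contDiff_normed (μ := volume) (n := ⊤)
      exact Complex.ofRealCLM.contDiff.comp (this.comp (contDiff_const.sub contDiff_id))
    exact hF.pairing (c1.toSchwartzMap c2)

end NonMarkov

end

noncomputable section

open MeasureTheory Set
open scoped ENNReal FourierTransform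

namespace NonMarkov

/-- The rescaled mollifier `φ_γ`. -/
def molly (ρ : Vel → ℝ) (γ : ℝ) (w : Vel) : ℝ := (γ ^ 3)⁻¹ * ρ (γ⁻¹ • w)

/-- The partial derivatives of the rescaled mollifier. -/
def mollDeriv (ρ : Vel → ℝ) (γ : ℝ) (i : Fin 3) : Vel → ℝ := pderiv i (molly ρ γ)

section Mollifier

variable {ρ : Vel → ℝ} {γ : ℝ}

theorem contDiff_molly (hρ : IsMollifier ρ) (γ : ℝ) : ContDiff ℝ (⊤ : ℕ∞) (molly ρ γ) :=
  contDiff_const.mul (hρ.smooth.comp (contDiff_const_smul _))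

theorem molly_eq_zero (hρ : IsMollifier ρ) (hγ : 0 < γ) {w : Vel} (hw : γ < ‖w‖) :
    molly ρ γ w = 0 := by
  rw [molly, mul_eq_zero]
  right
  by_contra h
  have := hρ.supp h
  rw [mem_closedBall_zero_iff, norm_smul, norm_inv, Real.norm_of_nonneg hγ.le,
    inv_mul_le_iff₀ hγ] at this
  linarith

theorem tsupport_molly (hρ : IsMollifier ρ) (hγ : 0 < γ) :
    tsupport (molly ρ γ) ⊆ Metric.closedBall 0 γ :=
  closure_minimal (fun w hw => by
    rw [mem_closedBall_zero_iff]
    by_contra h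
    exact hw (molly_eq_zero hρ hγ (not_le.1 h))) Metric.isClosed_closedBall

theorem hasCompactSupport_molly (hρ : IsMollifier ρ) (hγ : 0 < γ) :
    HasCompactSupport (molly ρ γ) :=
  HasCompactSupport.of_support_subset_isCompact (isCompact_closedBall 0 γ)
    ((subset_tsupport _).trans (tsupport_molly hρ hγ))

theorem mollDeriv_eq_zero (hρ : IsMollifier ρ) (hγ : 0 < γ) (i : Fin 3) {w : Vel}
    (hw : γ < ‖w‖) : mollDeriv ρ γ i w = 0 := by
  have h : w ∉ tsupport (fderiv ℝ (molly ρ γ)) := fun h => by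
    have := tsupport_molly hρ hγ (tsupport_fderiv_subset ℝ h)
    rw [mem_closedBall_zero_iff] at this
    linarith
  rw [mollDeriv, pderiv, image_eq_zero_of_notMem_tsupport h]
  simp

theorem continuous_mollDeriv (hρ : IsMollifier ρ) (γ : ℝ) (i : Fin 3) :
    Continuous (mollDeriv ρ γ i) :=
  ((contDiff_molly hρ γ).continuous_fderiv (by simp)).clm_apply continuous_const

theorem exists_mollDeriv_le (hρ : IsMollifier ρ) : ∃ B : ℝ, 0 < B ∧ ∀ γ : ℝ, 0 < γ →
    ∀ (i : Fin 3) (w : Vel), |mollDeriv ρ γ i w| ≤ B * γ⁻¹ ^ 4 := by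
  have hs : HasCompactSupport ρ :=
    HasCompactSupport.of_support_subset_isCompact (isCompact_closedBall 0 1) hρ.supp
  obtain ⟨B, hB⟩ := (hs.fderiv ℝ).exists_bound_of_continuous
    (hρ.smooth.continuous_fderiv (by simp))
  refine ⟨|B| + 1, by positivity, fun γ hγ i w => ?_⟩
  have hd : HasFDerivAt (molly ρ γ)
      ((γ ^ 3)⁻¹ • (fderiv ℝ ρ (γ⁻¹ • w)).comp (γ⁻¹ • ContinuousLinearMap.id ℝ Vel)) w := by
    have h1 : HasFDerivAt (fun w : Vel => γ⁻¹ • w) (γ⁻¹ • ContinuousLinearMap.id ℝ Vel) w :=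
      (hasFDerivAt_id w).const_smul γ⁻¹
    have h2 := (hρ.smooth.differentiable (by simp) (γ⁻¹ • w)).hasFDerivAt
    exact (h2.comp w h1).const_mul _
  have e : mollDeriv ρ γ i w
      = (γ ^ 3)⁻¹ * (γ⁻¹ * fderiv ℝ ρ (γ⁻¹ • w) (EuclideanSpace.single i 1)) := by
    rw [mollDeriv, pderiv, hd.fderiv]
    simp
  have h1 : |fderiv ℝ ρ (γ⁻¹ • w) (EuclideanSpace.single i 1)| ≤ |B| + 1 := by
    refine ((fderiv ℝ ρ (γ⁻¹ • w)).le_opNorm _).trans ?_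
    have : ‖(EuclideanSpace.single i 1 : Vel)‖ = 1 := by simp
    rw [this, mul_one]
    linarith [hB (γ⁻¹ • w), le_abs_self B]
  rw [e, abs_mul, abs_mul, abs_of_pos (by positivity : 0 < (γ ^ 3)⁻¹),
    abs_of_pos (by positivity : 0 < γ⁻¹)]
  calc _ ≤ (γ ^ 3)⁻¹ * (γ⁻¹ * (|B| + 1)) := by gcongr
    _ = _ := by rw [← inv_pow]; ring

theorem integrable_mollDeriv_mul (hρ : IsMollifier ρ) (hγ : 0 < γ) (i : Fin 3) {g : Vel → ℝ}
    (hg : LocallyIntegrable g) (v : Vel) : Integrable fun y => mollDeriv ρ γ i (v - y) * g y := by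
  have hs : HasCompactSupport fun y => mollDeriv ρ γ i (v - y) := by
    refine HasCompactSupport.of_support_subset_isCompact (isCompact_closedBall v γ) fun y hy => ?_
    rw [mem_closedBall_iff_norm']
    by_contra h
    exact hy (mollDeriv_eq_zero hρ hγ i (not_le.1 h))
  exact hg.integrable_smul_left_of_hasCompactSupport
    ((continuous_mollDeriv hρ γ i).comp (by fun_prop)) hs

theorem mgrad_eq (hρ : IsMollifier ρ) (hγ : 0 < γ) (i : Fin 3) {g : Vel → ℝ}
    (hg : LocallyIntegrable g) (v : Vel) :
    mgrad ρ γ i g v = ∫ y, mollDeriv ρ γ i (v - y) * g y := by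
  have h := (hasCompactSupport_molly hρ hγ).hasFDerivAt_convolution_right
    (ContinuousLinearMap.mul ℝ ℝ).flip hg ((contDiff_molly hρ γ).of_le (by simp)) v
  have e : (MeasureTheory.convolution g (molly ρ γ) (ContinuousLinearMap.mul ℝ ℝ).flip volume)
      = mollify ρ γ g := by
    ext x
    rw [convolution_def]
    rfl
  rw [e] at h
  rw [mgrad, pderiv, h.fderiv, convolution_def, ContinuousLinearMap.integral_apply]
  · rfl
  · exact (HasCompactSupport.convolutionExists_right
      (((ContinuousLinearMap.mul ℝ ℝ).flip).precompR Vel)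
      ((hasCompactSupport_molly hρ hγ).fderiv ℝ) hg
      ((contDiff_molly hρ γ).continuous_fderiv (by simp))) v

theorem integral_mollDeriv (hρ : IsMollifier ρ) (hγ : 0 < γ) (i : Fin 3) (v : Vel) :
    ∫ y, mollDeriv ρ γ i (v - y) = 0 := by
  have h := mgrad_eq hρ hγ i (locallyIntegrable_const (1 : ℝ)) v
  simp only [mul_one] at h
  rw [← h, mgrad, pderiv]
  have e : mollify ρ γ (fun _ => (1 : ℝ)) = fun _ => ∫ y, molly ρ γ y := by
    ext x
    rw [← integral_sub_left_eq_self (molly ρ γ) volume x]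
    simp only [mollify, mul_one]
    rfl
  rw [e]
  simp

/-- The error kernel when the mollified gradient is commuted with the weight `λ`. -/
def commKernel (ρ : Vel → ℝ) (γ : ℝ) (i : Fin 3) (v y : Vel) : ℝ :=
  mollDeriv ρ γ i (v - y) * (Real.exp (‖y‖ - ‖v‖) - 1)

theorem abs_commKernel_le {B : ℝ} (hρ : IsMollifier ρ) (hγ : 0 < γ) (hγ1 : γ ≤ 1)
    (hB : ∀ (i : Fin 3) (w : Vel), |mollDeriv ρ γ i w| ≤ B * γ⁻¹ ^ 4) (i : Fin 3) (v y : Vel) :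
    |commKernel ρ γ i v y| ≤ 2 * B * γ⁻¹ ^ 3 := by
  have hB0 : 0 ≤ B * γ⁻¹ ^ 4 := (abs_nonneg _).trans (hB 0 0)
  have hB1 : 0 ≤ B := by
    by_contra h
    have : B * γ⁻¹ ^ 4 < 0 := mul_neg_of_neg_of_pos (not_le.1 h) (by positivity)
    linarith
  by_cases h : γ < ‖v - y‖
  · rw [commKernel, mollDeriv_eq_zero hρ hγ i h, zero_mul, abs_zero]
    positivity
  · have h1 : |‖y‖ - ‖v‖| ≤ γ := by
      rw [abs_sub_comm]
      exact (abs_norm_sub_norm_le v y).trans (not_lt.1 h)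
    have h2 := Real.abs_exp_sub_one_le (h1.trans hγ1)
    rw [commKernel, abs_mul]
    calc _ ≤ B * γ⁻¹ ^ 4 * (2 * γ) := by
          gcongr
          · exact hB i _
          · linarith
      _ = _ := by field_simp

theorem commKernel_eq_zero (hρ : IsMollifier ρ) (hγ : 0 < γ) (i : Fin 3) {v y : Vel}
    (h : γ < ‖v - y‖) : commKernel ρ γ i v y = 0 := by
  rw [commKernel, mollDeriv_eq_zero hρ hγ i h, zero_mul]

theorem continuous_commKernel (hρ : IsMollifier ρ) (γ : ℝ) (i : Fin 3) :
    Continuous fun p : Vel × Vel => commKernel ρ γ i p.1 p.2 := by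
  have := continuous_mollDeriv hρ γ i
  unfold commKernel
  fun_prop

theorem mgrad_mul_lam (hρ : IsMollifier ρ) (hγ : 0 < γ) (i : Fin 3) {g : Vel → ℝ}
    (hg : LocallyIntegrable g) (v : Vel) :
    mgrad ρ γ i (fun y => g y * lam y) v
      = lam v * ((∫ y, mollDeriv ρ γ i (v - y) * g y) + ∫ y, commKernel ρ γ i v y * g y) := by
  have hl : Continuous lam := by unfold lam; fun_prop
  have hgl : LocallyIntegrable fun y => g y * lam y := by
    have h := hg.continuous_smul hl
    simpa [mul_comm] using h
  have hi := integrable_mollDeriv_mul hρ hγ i hg v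
  have hgl' : LocallyIntegrable fun y => g y * (Real.exp (‖y‖ - ‖v‖)) := by
    have h := hg.continuous_smul (g := fun y : Vel => Real.exp (‖y‖ - ‖v‖)) (by fun_prop)
    simpa [mul_comm] using h
  have hi' := integrable_mollDeriv_mul hρ hγ i hgl' v
  have e : ∫ y, commKernel ρ γ i v y * g y
      = (∫ y, mollDeriv ρ γ i (v - y) * (g y * Real.exp (‖y‖ - ‖v‖)))
        - ∫ y, mollDeriv ρ γ i (v - y) * g y := by
    rw [← integral_sub hi' hi]
    congr 1; ext y
    rw [commKernel]; ring
  rw [mgrad_eq hρ hγ i hgl, e, add_sub_cancel, ← integral_const_mul]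
  congr 1; ext y
  rw [Real.exp_sub, lam, lam]
  have := Real.exp_pos ‖v‖
  field_simp

end Mollifier

end NonMarkov

end

noncomputable section

open MeasureTheory Set
open scoped ENNReal FourierTransform

namespace NonMarkov

theorem lintegral_sq_le {X : Type*} [MeasurableSpace X] (μ : Measure X) {g : X → ℝ≥0∞}
    (hg : AEMeasurable g μ) : (∫⁻ x, g x ∂μ) ^ 2 ≤ μ univ * ∫⁻ x, g x ^ 2 ∂μ := by
  have h := ENNReal.lintegral_mul_le_Lp_mul_Lq μ (Real.HolderConjugate.two_two)
    (aemeasurable_const (b := (1 : ℝ≥0∞))) hg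
  simp only [Pi.mul_apply, one_mul, ENNReal.one_rpow, lintegral_const] at h
  have h2 := pow_le_pow_left₀ zero_le h 2
  have e : ∀ x : ℝ≥0∞, (x ^ (1 / (2 : ℝ))) ^ 2 = x := fun x => by
    rw [← ENNReal.rpow_natCast, ← ENNReal.rpow_mul]; norm_num
  rw [mul_pow, e, e] at h2
  simpa using h2

/-- The constant for averages over balls in the space with weight `λ`. -/
def avgConst : ℝ := Real.exp 1 * (volume : Measure Vel).real (Metric.ball 0 1) ^ 2

theorem avgConst_nonneg : 0 ≤ avgConst := by unfold avgConst; positivity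

section Average

variable {k : Vel → Vel → ℝ} {M γ : ℝ}

theorem lintegral_average_sq_le (hγ : 0 < γ) (hγ1 : γ ≤ 1) (hM : 0 ≤ M)
    (hb : ∀ v y, |k v y| ≤ M * γ⁻¹ ^ 3) (h0 : ∀ v y, γ < ‖v - y‖ → k v y = 0)
    {g : Vel → ℝ} (hg : Measurable g) :
    ∫⁻ v, ENNReal.ofReal (lam v) * ‖∫ y, k v y * g y‖ₑ ^ 2
      ≤ ENNReal.ofReal (avgConst * M ^ 2) * ∫⁻ y, ENNReal.ofReal (lam y) * ‖g y‖ₑ ^ 2 := by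
  set S : Set (Vel × Vel) := {p | ‖p.1 - p.2‖ ≤ γ} with hS
  have hSm : MeasurableSet S := measurableSet_le (by fun_prop) measurable_const
  have hvol : ∀ v : Vel, volume (Metric.closedBall v γ)
      = ENNReal.ofReal (γ ^ 3 * (volume : Measure Vel).real (Metric.ball 0 1)) := fun v => by
    rw [Measure.addHaar_closedBall _ _ hγ.le, ENNReal.ofReal_mul (by positivity),
      ofReal_measureReal]
    simp
  set ω := (volume : Measure Vel).real (Metric.ball 0 1) with hω
  have hω0 : 0 ≤ ω := by positivity
  have p1 : ∀ v, ‖∫ y, k v y * g y‖ₑ ^ 2 ≤ ENNReal.ofReal (M ^ 2 * γ⁻¹ ^ 3 * ω) *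
      ∫⁻ y, S.indicator (fun p => ‖g p.2‖ₑ ^ 2) (v, y) := fun v => by
    have a1 : ‖∫ y, k v y * g y‖ₑ
        ≤ ENNReal.ofReal (M * γ⁻¹ ^ 3) * ∫⁻ y in Metric.closedBall v γ, ‖g y‖ₑ := by
      refine (enorm_integral_le_lintegral_enorm _).trans ?_
      rw [← lintegral_const_mul _ hg.enorm, ← lintegral_indicator Metric.isClosed_closedBall.measurableSet]
      refine lintegral_mono fun y => ?_
      beta_reduce
      by_cases hy : y ∈ Metric.closedBall v γ
      · rw [indicator_of_mem hy, enorm_mul]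
        gcongr
        rw [← ofReal_norm]
        exact ENNReal.ofReal_le_ofReal (hb v y)
      · rw [mem_closedBall_iff_norm', not_le] at hy
        rw [h0 v y hy]; simp
    have a2 : ∫⁻ y, S.indicator (fun p => ‖g p.2‖ₑ ^ 2) (v, y)
        = ∫⁻ y in Metric.closedBall v γ, ‖g y‖ₑ ^ 2 := by
      rw [← lintegral_indicator Metric.isClosed_closedBall.measurableSet]
      refine lintegral_congr fun y => ?_
      by_cases hy : ‖v - y‖ ≤ γ
      · rw [indicator_of_mem (by exact hy), indicator_of_mem (by rwa [mem_closedBall_iff_norm'])]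
      · rw [indicator_of_notMem (by exact hy),
          indicator_of_notMem (by rwa [mem_closedBall_iff_norm'])]
    have a3 := lintegral_sq_le (volume.restrict (Metric.closedBall v γ)) hg.enorm.aemeasurable
    rw [Measure.restrict_apply_univ, hvol] at a3
    rw [a2]
    calc _ ≤ (ENNReal.ofReal (M * γ⁻¹ ^ 3) * ∫⁻ y in Metric.closedBall v γ, ‖g y‖ₑ) ^ 2 :=
          pow_le_pow_left₀ zero_le a1 2
      _ ≤ ENNReal.ofReal (M * γ⁻¹ ^ 3) ^ 2 * (ENNReal.ofReal (γ ^ 3 * ω) *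
          ∫⁻ y in Metric.closedBall v γ, ‖g y‖ₑ ^ 2) := by rw [mul_pow]; gcongr
      _ = _ := by
        rw [← mul_assoc, ← ENNReal.ofReal_pow (by positivity), ← ENNReal.ofReal_mul (by positivity)]
        congr 2
        field_simp
  have p2 : ∀ v y, ENNReal.ofReal (lam v) * S.indicator (fun p => ‖g p.2‖ₑ ^ 2) (v, y)
      ≤ S.indicator (fun p => ENNReal.ofReal (Real.exp 1) *
        (ENNReal.ofReal (lam p.2) * ‖g p.2‖ₑ ^ 2)) (v, y) := fun v y => by
    by_cases hy : (v, y) ∈ S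
    · rw [indicator_of_mem hy, indicator_of_mem hy, ← mul_assoc,
        ← ENNReal.ofReal_mul (by positivity)]
      gcongr
      rw [lam, lam, ← Real.exp_add, Real.exp_le_exp]
      have : ‖v - y‖ ≤ γ := hy
      linarith [norm_sub_norm_le v y]
    · rw [indicator_of_notMem hy, mul_zero]; exact zero_le
  have hl : Measurable lam := by unfold lam; fun_prop
  have m1 : Measurable (S.indicator (fun p : Vel × Vel => ‖g p.2‖ₑ ^ 2)) :=
    Measurable.indicator (by fun_prop) hSm
  have m2 : Measurable (S.indicator (fun p : Vel × Vel => ENNReal.ofReal (Real.exp 1) *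
        (ENNReal.ofReal (lam p.2) * ‖g p.2‖ₑ ^ 2))) := Measurable.indicator (by fun_prop) hSm
  calc ∫⁻ v, ENNReal.ofReal (lam v) * ‖∫ y, k v y * g y‖ₑ ^ 2
      ≤ ∫⁻ v, ENNReal.ofReal (M ^ 2 * γ⁻¹ ^ 3 * ω) * ∫⁻ y, S.indicator
          (fun p => ENNReal.ofReal (Real.exp 1) * (ENNReal.ofReal (lam p.2) * ‖g p.2‖ₑ ^ 2))
            (v, y) := by
        refine lintegral_mono fun v => ?_
        calc _ ≤ ENNReal.ofReal (lam v) * (ENNReal.ofReal (M ^ 2 * γ⁻¹ ^ 3 * ω) *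
              ∫⁻ y, S.indicator (fun p => ‖g p.2‖ₑ ^ 2) (v, y)) := by gcongr; exact p1 v
          _ = ENNReal.ofReal (M ^ 2 * γ⁻¹ ^ 3 * ω) * ∫⁻ y, ENNReal.ofReal (lam v) *
              S.indicator (fun p => ‖g p.2‖ₑ ^ 2) (v, y) := by
              rw [lintegral_const_mul (ENNReal.ofReal (lam v)) (f := fun y => S.indicator
                (fun p => ‖g p.2‖ₑ ^ 2) (v, y)) (m1.comp measurable_prodMk_left)]
              ring
          _ ≤ _ := by gcongr with y; exact p2 v y
    _ = ENNReal.ofReal (M ^ 2 * γ⁻¹ ^ 3 * ω) * ∫⁻ y, ENNReal.ofReal (γ ^ 3 * ω) *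
          (ENNReal.ofReal (Real.exp 1) * (ENNReal.ofReal (lam y) * ‖g y‖ₑ ^ 2)) := by
        rw [lintegral_const_mul _ m2.lintegral_prod_right', lintegral_lintegral_swap
          (by exact m2.aemeasurable)]
        congr 1
        refine lintegral_congr fun y => ?_
        rw [← hvol y, mul_comm, ← lintegral_indicator_const Metric.isClosed_closedBall.measurableSet]
        refine lintegral_congr fun v => ?_
        by_cases hy : ‖v - y‖ ≤ γ
        · rw [indicator_of_mem (by exact hy), indicator_of_mem (by rwa [mem_closedBall_iff_norm])]
        · rw [indicator_of_notMem (by exact hy),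
            indicator_of_notMem (by rwa [mem_closedBall_iff_norm])]
    _ = _ := by
        rw [lintegral_const_mul _ (by fun_prop), lintegral_const_mul _ (by fun_prop),
          ← mul_assoc, ← mul_assoc, ← ENNReal.ofReal_mul (by positivity),
          ← ENNReal.ofReal_mul (by positivity)]
        congr 2
        rw [avgConst, ← hω]
        field_simp

theorem stronglyMeasurable_average {G : ℝ → Vel → ℝ} (hk : Measurable (Function.uncurry k))
    (hG : StronglyMeasurable (Function.uncurry G)) :
    StronglyMeasurable fun p : ℝ × Vel => ∫ y, k p.2 y * G p.1 y := by
  refine StronglyMeasurable.integral_prod_right (ν := volume)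
    (f := fun (p : ℝ × Vel) (y : Vel) => k p.2 y * G p.1 y) ?_
  exact (hk.stronglyMeasurable.comp_measurable
    (g := fun q : (ℝ × Vel) × Vel => (q.1.2, q.2)) (by fun_prop)).mul
    (hG.comp_measurable (g := fun q : (ℝ × Vel) × Vel => (q.1.1, q.2)) (by fun_prop))

theorem average_sq (hγ : 0 < γ) (hγ1 : γ ≤ 1) (hM : 0 ≤ M)
    (hk : Measurable (Function.uncurry k))
    (hb : ∀ v y, |k v y| ≤ M * γ⁻¹ ^ 3) (h0 : ∀ v y, γ < ‖v - y‖ → k v y = 0)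
    {G : ℝ → Vel → ℝ} (hG : StronglyMeasurable (Function.uncurry G))
    (hi : Integrable fun p : ℝ × Vel => lam p.2 * G p.1 p.2 ^ 2) :
    Integrable (fun p : ℝ × Vel => lam p.2 * (∫ y, k p.2 y * G p.1 y) ^ 2) ∧
      ∫ p : ℝ × Vel, lam p.2 * (∫ y, k p.2 y * G p.1 y) ^ 2
        ≤ avgConst * M ^ 2 * ∫ p : ℝ × Vel, lam p.2 * G p.1 p.2 ^ 2 := by
  have hl : Measurable lam := by unfold lam; fun_prop
  have hl0 : ∀ v, 0 ≤ lam v := fun v => (Real.exp_pos _).le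
  have hH := stronglyMeasurable_average hk hG
  have e : ∀ F : ℝ × Vel → ℝ, ∀ p, ENNReal.ofReal (lam p.2 * F p ^ 2)
      = ENNReal.ofReal (lam p.2) * ‖F p‖ₑ ^ 2 := fun F p => by
    rw [ENNReal.ofReal_mul (hl0 _), ← sq_abs, ENNReal.ofReal_pow (abs_nonneg _),
      ← Real.norm_eq_abs, ofReal_norm]
  have hmH : Measurable fun p : ℝ × Vel => lam p.2 * (∫ y, k p.2 y * G p.1 y) ^ 2 :=
    (hl.comp measurable_snd).mul (hH.measurable.pow_const 2)
  have hmG := hG.measurable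
  have hmG' : Measurable fun p : ℝ × Vel => lam p.2 * (Function.uncurry G p) ^ 2 :=
    (hl.comp measurable_snd).mul (hmG.pow_const 2)
  have key : ∫⁻ p : ℝ × Vel, ENNReal.ofReal (lam p.2 * (∫ y, k p.2 y * G p.1 y) ^ 2)
      ≤ ENNReal.ofReal (avgConst * M ^ 2) *
        ∫⁻ p : ℝ × Vel, ENNReal.ofReal (lam p.2 * G p.1 p.2 ^ 2) := by
    have e1 := e (fun p : ℝ × Vel => ∫ y, k p.2 y * G p.1 y)
    have e2 := e (Function.uncurry G)
    simp only [Function.uncurry] at e1 e2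
    rw [Measure.volume_eq_prod, lintegral_prod _ (by exact hmH.ennreal_ofReal.aemeasurable),
      lintegral_prod _ (by exact hmG'.ennreal_ofReal.aemeasurable),
      ← lintegral_const_mul _ (by exact hmG'.ennreal_ofReal.lintegral_prod_right')]
    refine lintegral_mono fun t => ?_
    have := lintegral_average_sq_le hγ hγ1 hM hb h0 (g := G t) (hmG.comp measurable_prodMk_left)
    calc _ = ∫⁻ v, ENNReal.ofReal (lam v) * ‖∫ y, k v y * G t y‖ₑ ^ 2 :=
          lintegral_congr fun v => e1 (t, v)
      _ ≤ _ := this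
      _ = _ := by
        congr 1
        exact lintegral_congr fun v => (e2 (t, v)).symm
  have nG : 0 ≤ᵐ[volume] fun p : ℝ × Vel => lam p.2 * G p.1 p.2 ^ 2 :=
    .of_forall fun p => mul_nonneg (hl0 _) (sq_nonneg _)
  have nH : 0 ≤ᵐ[volume] fun p : ℝ × Vel => lam p.2 * (∫ y, k p.2 y * G p.1 y) ^ 2 :=
    .of_forall fun p => mul_nonneg (hl0 _) (sq_nonneg _)
  rw [← ofReal_integral_eq_lintegral_ofReal hi nG,
    ← ENNReal.ofReal_mul (mul_nonneg avgConst_nonneg (sq_nonneg _))] at key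
  have hiH : Integrable (fun p : ℝ × Vel => lam p.2 * (∫ y, k p.2 y * G p.1 y) ^ 2) :=
    ⟨hmH.aestronglyMeasurable, (hasFiniteIntegral_iff_ofReal nH).2
      (key.trans_lt ENNReal.ofReal_lt_top)⟩
  refine ⟨hiH, ?_⟩
  rw [← ofReal_integral_eq_lintegral_ofReal hiH nH] at key
  exact (ENNReal.ofReal_le_ofReal_iff (mul_nonneg (mul_nonneg avgConst_nonneg (sq_nonneg _))
    (integral_nonneg_of_ae nG))).1 key

end Average

end NonMarkov

end

noncomputable section

open MeasureTheory Set
open scoped ENNReal FourierTransform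

namespace NonMarkov

theorem one_le_lam (v : Vel) : 1 ≤ lam v := Real.one_le_exp (norm_nonneg v)

theorem measurable_lam : Measurable lam := by unfold lam; fun_prop

/-- Functions of time and velocity that are square integrable with weight `λ`. -/
structure MemLam (G : ℝ → Vel → ℝ) : Prop where
  meas : StronglyMeasurable (Function.uncurry G)
  int : Integrable fun p : ℝ × Vel => lam p.2 * G p.1 p.2 ^ 2

/-- The square of the weighted norm. -/
def lamSq (G : ℝ → Vel → ℝ) : ℝ := ∫ p : ℝ × Vel, lam p.2 * G p.1 p.2 ^ 2

theorem lamSq_nonneg (G : ℝ → Vel → ℝ) : 0 ≤ lamSq G :=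
  integral_nonneg fun _ => mul_nonneg (Real.exp_pos _).le (sq_nonneg _)

section MemLam

variable {G : ℝ → Vel → ℝ}

theorem MemLam.integrable_sq (hG : MemLam G) : ∀ᵐ v : Vel, Integrable fun t => G t v ^ 2 := by
  have h := hG.int
  rw [Measure.volume_eq_prod] at h
  filter_upwards [h.prod_left_ae] with v hv
  have := hv.const_mul (lam v)⁻¹
  refine this.congr (.of_forall fun t => ?_)
  have := one_le_lam v
  field_simp

theorem MemLam.memLp (hG : MemLam G) :
    ∀ᵐ v : Vel, MemLp (fun t => (G t v : ℂ)) 2 volume := by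
  filter_upwards [hG.integrable_sq] with v hv
  rw [memLp_two_iff_integrable_sq_norm]
  · simpa using hv
  · exact (Complex.continuous_ofReal.comp_stronglyMeasurable
      (hG.meas.comp_measurable measurable_prodMk_right)).aestronglyMeasurable

theorem MemLam.lamSq_eq (hG : MemLam G) : lamSq G = ∫ v, lam v * ∫ t, G t v ^ 2 := by
  have h := hG.int
  rw [Measure.volume_eq_prod] at h
  rw [lamSq, Measure.volume_eq_prod, integral_prod_symm _ h]
  simp only [integral_const_mul]

theorem MemLam.integrable_inner (hG : MemLam G) :
    Integrable fun v => lam v * ∫ t, G t v ^ 2 := by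
  have h := hG.int
  rw [Measure.volume_eq_prod] at h
  refine h.integral_prod_right.congr (.of_forall fun v => ?_)
  simp only [integral_const_mul]

/-- A jointly measurable version `F` of the Fourier transform in time of `G`. -/
structure IsTimeFT (G : ℝ → Vel → ℝ) (F : ℝ → Vel → ℂ) : Prop where
  meas : StronglyMeasurable (Function.uncurry F)
  isFT : ∀ᵐ v : Vel, IsFT (fun t => (G t v : ℂ)) fun ξ => F ξ v

theorem MemLam.exists_isTimeFT (hG : MemLam G) : ∃ F, IsTimeFT G F := by
  obtain ⟨F, hF, h⟩ := exists_measurable_isFT (V := fun t v => (G t v : ℂ))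
    (Complex.continuous_ofReal.comp_stronglyMeasurable hG.meas)
  refine ⟨F, hF, ?_⟩
  filter_upwards [hG.memLp] with v hv using h v hv

theorem IsTimeFT.integral_norm_sq {F : ℝ → Vel → ℂ} (hF : IsTimeFT G F) :
    ∀ᵐ v : Vel, Integrable (fun ξ => ‖F ξ v‖ ^ 2) ∧ ∫ ξ, ‖F ξ v‖ ^ 2 = ∫ t, G t v ^ 2 := by
  filter_upwards [hF.isFT] with v hv
  refine ⟨memLp_two_norm_sq hv.right, ?_⟩
  rw [hv.integral_norm_sq]
  simp

theorem IsTimeFT.integrable {F : ℝ → Vel → ℂ} (hF : IsTimeFT G F) (hG : MemLam G) :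
    Integrable fun p : ℝ × Vel => lam p.2 * ‖F p.1 p.2‖ ^ 2 := by
  have hm : StronglyMeasurable fun p : ℝ × Vel => lam p.2 * ‖F p.1 p.2‖ ^ 2 :=
    (measurable_lam.stronglyMeasurable.comp_measurable measurable_snd).mul (hF.meas.norm.pow 2)
  rw [Measure.volume_eq_prod, integrable_prod_iff' hm.aestronglyMeasurable]
  constructor
  · filter_upwards [hF.integral_norm_sq] with v hv using hv.1.const_mul _
  · refine hG.integrable_inner.congr ?_
    filter_upwards [hF.integral_norm_sq] with v hv
    rw [← hv.2, ← integral_const_mul]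
    congr 1; ext ξ
    rw [Real.norm_of_nonneg (mul_nonneg (by linarith [one_le_lam v]) (sq_nonneg _))]

end MemLam

section Representative

variable {n : ℕ} {A : ℝ} {α : Fin 3 → ℕ} {u : ℝ → Vel → ℝ}

theorem isWeakDeriv_weakDeriv (h : ∃ g, IsWeakDeriv α u g) :
    IsWeakDeriv α u (weakDeriv α u) := by
  rw [weakDeriv, dif_pos h]; exact h.choose_spec

/-- A measurable version of a locally integrable function. -/
theorem LocInt.exists_rep {w : ℝ → Vel → ℝ} (hw : LocInt w) :
    ∃ W : ℝ → Vel → ℝ, StronglyMeasurable (Function.uncurry W) ∧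
      ∀ᵐ p ∂((volume : Measure (ℝ × Vel)).restrict (Ioi 0 ×ˢ univ)), W p.1 p.2 = w p.1 p.2 := by
  have hm : AEStronglyMeasurable (Function.uncurry w) (volume.restrict (Ioi (0 : ℝ) ×ˢ univ)) :=
    hw.aestronglyMeasurable
  refine ⟨fun t v => hm.mk _ (t, v), hm.stronglyMeasurable_mk, ?_⟩
  filter_upwards [hm.ae_eq_mk] with p hp
  exact hp.symm

/-- The damped function `e^{-At/2} w`, extended by zero to negative times. -/
def dampedRep (A : ℝ) (W : ℝ → Vel → ℝ) (t : ℝ) (v : Vel) : ℝ :=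
  (Ioi (0 : ℝ)).indicator (fun t => Real.exp (-(A / 2) * t) * W t v) t

theorem stronglyMeasurable_dampedRep (A : ℝ) {W : ℝ → Vel → ℝ}
    (hW : StronglyMeasurable (Function.uncurry W)) :
    StronglyMeasurable (Function.uncurry (dampedRep A W)) := by
  have e : Function.uncurry (dampedRep A W)
      = (Ioi (0 : ℝ) ×ˢ (univ : Set Vel)).indicator
        fun p => Real.exp (-(A / 2) * p.1) * Function.uncurry W p := by
    ext ⟨t, v⟩
    by_cases h : 0 < t <;> simp [dampedRep, indicator, h]
  rw [e]
  refine StronglyMeasurable.indicator ?_ (measurableSet_Ioi.prod .univ)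
  exact (Continuous.stronglyMeasurable (by fun_prop)).mul hW

theorem ae_prod_Ioi {P : ℝ × Vel → Prop}
    (h : ∀ᵐ p ∂((volume : Measure (ℝ × Vel)).restrict (Ioi 0 ×ˢ univ)), P p) :
    ∀ᵐ p : ℝ × Vel, 0 < p.1 → P p := by
  rw [ae_restrict_iff' (measurableSet_Ioi.prod .univ)] at h
  filter_upwards [h] with p hp h0
  exact hp ⟨h0, mem_univ _⟩

theorem volume_restrict_Ioi_prod :
    (volume : Measure (ℝ × Vel)).restrict (Ioi 0 ×ˢ univ)
      = ((volume : Measure ℝ).restrict (Ioi 0)).prod volume := by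
  rw [Measure.volume_eq_prod, ← Measure.prod_restrict, Measure.restrict_univ]

theorem integral_le_normVsq (hu : MemV n A lam u) (hα : order α ≤ n) :
    ∫ p in Ioi (0 : ℝ) ×ˢ (univ : Set Vel), Real.exp (-A * p.1) * lam p.2 *
      weakDeriv α u p.1 p.2 ^ 2 ≤ normVsq n A lam u := by
  have hi : ∀ m ∈ indices n, Integrable (fun p : ℝ × Vel => Real.exp (-A * p.1) * lam p.2 *
      weakDeriv m u p.1 p.2 ^ 2) (((volume : Measure ℝ).restrict (Ioi 0)).prod volume) :=
    fun m hm => by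
      rw [← volume_restrict_Ioi_prod]
      exact (hu m (mem_indices.1 hm)).2
  have e : normVsq n A lam u = ∑ m ∈ indices n, ∫ p in Ioi (0 : ℝ) ×ˢ (univ : Set Vel),
      Real.exp (-A * p.1) * lam p.2 * weakDeriv m u p.1 p.2 ^ 2 := by
    rw [normVsq, volume_restrict_Ioi_prod]
    simp only [normHsq, Finset.mul_sum, ← integral_const_mul]
    rw [integral_finsetSum]
    · refine Finset.sum_congr rfl fun m hm => ?_
      rw [integral_prod _ (hi m hm)]
      simp only [mul_assoc]
    · intro m hm
      refine (hi m hm).integral_prod_left.congr (.of_forall fun t => ?_)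
      simp only [mul_assoc]
  rw [e]
  refine Finset.single_le_sum (f := fun m => ∫ p in Ioi (0 : ℝ) ×ˢ (univ : Set Vel),
      Real.exp (-A * p.1) * lam p.2 * weakDeriv m u p.1 p.2 ^ 2) (fun m _ => ?_)
    (mem_indices.2 hα)
  refine integral_nonneg fun p => ?_
  have : 0 < lam p.2 := Real.exp_pos _
  positivity

theorem exists_dampedRep (hu : MemV n A lam u) (hα : order α ≤ n) :
    ∃ G : ℝ → Vel → ℝ, MemLam G ∧ (∀ t v, t ≤ 0 → G t v = 0) ∧
      (∀ᵐ p : ℝ × Vel, 0 < p.1 → G p.1 p.2 = Real.exp (-(A / 2) * p.1) * weakDeriv α u p.1 p.2) ∧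
      lamSq G ≤ normVsq n A lam u := by
  have hw := isWeakDeriv_weakDeriv (hu α hα).1
  obtain ⟨W, hWm, hW⟩ := hw.2.1.exists_rep
  have hS : MeasurableSet (Ioi (0 : ℝ) ×ˢ (univ : Set Vel)) := measurableSet_Ioi.prod .univ
  have hG : ∀ᵐ p : ℝ × Vel, 0 < p.1 →
      dampedRep A W p.1 p.2 = Real.exp (-(A / 2) * p.1) * weakDeriv α u p.1 p.2 := by
    filter_upwards [ae_prod_Ioi hW] with p hp h0
    rw [dampedRep, indicator_of_mem (mem_Ioi.2 h0), hp h0]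
  have h0 : ∀ t v, t ≤ 0 → dampedRep A W t v = 0 := fun t v ht => by
    rw [dampedRep, indicator_of_notMem (by simpa using ht)]
  have he : (fun p : ℝ × Vel => lam p.2 * dampedRep A W p.1 p.2 ^ 2) =ᵐ[volume]
      (Ioi (0 : ℝ) ×ˢ (univ : Set Vel)).indicator fun p => Real.exp (-A * p.1) * lam p.2 *
        weakDeriv α u p.1 p.2 ^ 2 := by
    filter_upwards [hG] with p hp
    by_cases ht : 0 < p.1
    · rw [hp ht, indicator_of_mem (show p ∈ Ioi (0 : ℝ) ×ˢ univ from ⟨ht, mem_univ _⟩), mul_pow, ← Real.exp_nat_mul]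
      have : ((2 : ℕ) : ℝ) * (-(A / 2) * p.1) = -A * p.1 := by push_cast; ring
      rw [this]
      ring
    · rw [h0 _ _ (not_lt.1 ht), indicator_of_notMem (fun h => ht h.1)]
      simp
  refine ⟨dampedRep A W, ⟨stronglyMeasurable_dampedRep A hWm, ?_⟩, h0, hG, ?_⟩
  · exact ((integrable_indicator_iff hS).2 (hu α hα).2).congr he.symm
  · rw [lamSq, integral_congr_ae he, integral_indicator hS]
    exact integral_le_normVsq hu hα

end Representative

end NonMarkov

end

noncomputable section

open MeasureTheory Set
open scoped ENNReal FourierTransform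

namespace NonMarkov

theorem measurable_weightB1 :
    Measurable fun q : (ℂ × Vel) × CVec => weightB1 q.1.1 q.1.2 q.2 q.2 := by
  have hp : Measurable fun q : (ℂ × Vel) × CVec => proj q.1.2 q.2 := by
    unfold proj
    refine (WithLp.measurable_toLp 2 _).comp (measurable_pi_lambda _ fun i => ?_)
    fun_prop
  have h1 : Measurable fun q : (ℂ × Vel) × CVec => ‖proj q.1.2 q.2‖ := hp.norm
  have h2 : Measurable fun q : (ℂ × Vel) × CVec => ‖q.2 - proj q.1.2 q.2‖ :=
    (measurable_snd.sub hp).norm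
  unfold weightB1 weightC1 weightC2 weightAlpha weightBeta anorm
  fun_prop

theorem weightB1_nonneg (z : ℂ) (v : Vel) (V : CVec) : 0 ≤ weightB1 z v V V := by
  unfold weightB1 weightC1 weightC2 weightAlpha weightBeta anorm
  positivity

theorem weightB1_le (z : ℂ) {v : Vel} (hv : v ≠ 0) (V : CVec) :
    weightB1 z v V V ≤ (58 + 9 * |z.re|) * ‖V‖ ^ 2 := by
  have hN : 1 ≤ 1 + ‖v‖ := by linarith [norm_nonneg v]
  have hp := norm_proj_le hv V
  have hx := norm_sub_le V (proj v V)
  have ha : 0 ≤ weightAlpha z v := by unfold weightAlpha; positivity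
  have hb0 : 0 ≤ weightBeta z v := by unfold weightBeta; positivity
  have hb : weightBeta z v ≤ |z.re| := div_le_self (abs_nonneg _) hN
  have h1 : weightC1 z v ≤ 1 := by
    rw [weightC1, div_le_one (by positivity)]
    exact one_le_mul_of_one_le_of_one_le hN (one_le_pow₀ (by linarith))
  have h2 : weightC2 z v ≤ |z.re| + 1 := by
    rw [weightC2, div_le_iff₀ (by positivity)]
    have a1 : 1 ≤ (1 + weightAlpha z v) ^ 2 := one_le_pow₀ (by linarith)
    have a2 : weightAlpha z v ^ 2 ≤ (1 + weightAlpha z v) ^ 4 := by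
      calc _ ≤ (1 + weightAlpha z v) ^ 2 := by gcongr; linarith
        _ ≤ (1 + weightAlpha z v) ^ 4 := pow_le_pow_right₀ (by linarith) (by norm_num)
    have a3 : 1 ≤ (1 + weightAlpha z v) ^ 4 := one_le_pow₀ (by linarith)
    calc _ ≤ |z.re| * (1 + weightAlpha z v) ^ 4 + (1 + weightAlpha z v) ^ 4 := by
          gcongr
          exact hb.trans (le_mul_of_one_le_right (abs_nonneg _) a3)
      _ = (|z.re| + 1) * (1 * (1 + weightAlpha z v) ^ 4) := by ring
      _ ≤ _ := by gcongr
  have h3 : anorm v V ≤ 7 * ‖V‖ := by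
    have : ‖proj v V‖ / (1 + ‖v‖) ≤ ‖proj v V‖ := div_le_self (norm_nonneg _) hN
    rw [anorm]; linarith
  have h4 : 0 ≤ anorm v V := by unfold anorm; positivity
  unfold weightB1
  calc _ ≤ 1 * (7 * ‖V‖) * (7 * ‖V‖) + (|z.re| + 1) * (3 * ‖V‖) * (3 * ‖V‖) := by gcongr
    _ = _ := by ring

theorem laplaceLine_ae_eq {a : ℝ} {h : ℝ → ℝ} {g F : ℝ → ℂ} (hF : IsFT g F)
    (hg : damped a h =ᵐ[volume] g) : ∀ᵐ ω : ℝ, laplaceLine a h ω = F (ω / (2 * Real.pi)) := by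
  have hm : MemLp (damped a h) 2 volume := hF.left.ae_eq hg.symm
  have h1 := (isFT_fourier hm).ae_eq (hF.congr_left hg.symm)
  have h2 : Measure.QuasiMeasurePreserving (fun ω : ℝ => ω / (2 * Real.pi)) volume volume := by
    have hne : (2 * Real.pi)⁻¹ ≠ 0 := by have := Real.pi_pos; positivity
    refine ⟨by fun_prop, ?_⟩
    simp only [div_eq_mul_inv]
    rw [Real.map_volume_mul_right hne]
    exact Measure.smul_absolutelyContinuous
  filter_upwards [h2.ae h1] with ω hω
  rw [laplaceLine, dif_pos hm, hω]

section Reps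

variable {ρ : Vel → ℝ} {γ : ℝ} {G : ℝ → Vel → ℝ}

/-- The mollified gradient of `G`. -/
def gradRep (ρ : Vel → ℝ) (γ : ℝ) (i : Fin 3) (G : ℝ → Vel → ℝ) (t : ℝ) (v : Vel) : ℝ :=
  ∫ y, mollDeriv ρ γ i (v - y) * G t y

/-- The error term when the mollified gradient is commuted with the weight. -/
def commRep (ρ : Vel → ℝ) (γ : ℝ) (i : Fin 3) (G : ℝ → Vel → ℝ) (t : ℝ) (v : Vel) : ℝ :=
  ∫ y, commKernel ρ γ i v y * G t y

theorem memLam_gradRep (hρ : IsMollifier ρ) (hγ : 0 < γ) (hγ1 : γ ≤ 1) (hG : MemLam G)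
    (i : Fin 3) : MemLam (gradRep ρ γ i G) := by
  obtain ⟨B, hB0, hB⟩ := exists_mollDeriv_le hρ
  have hk : Measurable (Function.uncurry fun v y : Vel => mollDeriv ρ γ i (v - y)) :=
    ((continuous_mollDeriv hρ γ i).comp
      (by fun_prop : Continuous fun p : Vel × Vel => p.1 - p.2)).measurable
  refine ⟨stronglyMeasurable_average hk hG.meas, (average_sq hγ hγ1 (M := B * γ⁻¹)
    (by positivity) hk (fun v y => ?_) (fun v y h => mollDeriv_eq_zero hρ hγ i h)
    hG.meas hG.int).1⟩
  exact (hB γ hγ i _).trans (le_of_eq (by ring))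

theorem memLam_commRep (hρ : IsMollifier ρ) (hγ : 0 < γ) (hγ1 : γ ≤ 1) (hG : MemLam G)
    {B : ℝ} (hB0 : 0 ≤ B) (hB : ∀ (i : Fin 3) (w : Vel), |mollDeriv ρ γ i w| ≤ B * γ⁻¹ ^ 4)
    (i : Fin 3) : MemLam (commRep ρ γ i G) ∧
      lamSq (commRep ρ γ i G) ≤ avgConst * (2 * B) ^ 2 * lamSq G := by
  have hk : Measurable (Function.uncurry fun v y : Vel => commKernel ρ γ i v y) :=
    (continuous_commKernel hρ γ i).measurable
  have h := average_sq hγ hγ1 (M := 2 * B) (by positivity) hk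
    (abs_commKernel_le hρ hγ hγ1 hB i) (fun v y h => commKernel_eq_zero hρ hγ i h)
    hG.meas hG.int
  exact ⟨⟨stronglyMeasurable_average hk hG.meas, h.1⟩, h.2⟩

theorem gradRep_of_nonpos (h0 : ∀ t v, t ≤ 0 → G t v = 0) (i : Fin 3) {t : ℝ} (ht : t ≤ 0)
    (v : Vel) : gradRep ρ γ i G t v = 0 := by
  simp [gradRep, h0 t _ ht]

theorem commRep_of_nonpos (h0 : ∀ t v, t ≤ 0 → G t v = 0) (i : Fin 3) {t : ℝ} (ht : t ≤ 0)
    (v : Vel) : commRep ρ γ i G t v = 0 := by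
  simp [commRep, h0 t _ ht]

theorem MemLam.locallyIntegrable (hG : MemLam G) : ∀ᵐ t : ℝ, LocallyIntegrable (G t) := by
  have h := hG.int
  rw [Measure.volume_eq_prod] at h
  filter_upwards [h.prod_right_ae] with t ht
  have hm : AEStronglyMeasurable (G t) :=
    (hG.meas.comp_measurable measurable_prodMk_left).aestronglyMeasurable
  refine MemLp.locallyIntegrable (p := 2) ?_ (by norm_num)
  rw [memLp_two_iff_integrable_sq hm]
  refine ht.mono' (hm.pow 2) (.of_forall fun v => ?_)
  rw [Real.norm_of_nonneg (sq_nonneg _)]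
  exact le_mul_of_one_le_left (sq_nonneg _) (one_le_lam v)

variable {A : ℝ} {w : ℝ → Vel → ℝ}

theorem mgrad_eq_gradRep (hρ : IsMollifier ρ) (hγ : 0 < γ) (hG : MemLam G)
    (hw : ∀ᵐ p : ℝ × Vel, 0 < p.1 → G p.1 p.2 = Real.exp (-(A / 2) * p.1) * w p.1 p.2) :
    ∀ᵐ t : ℝ, 0 < t → ∀ i v,
      mgrad ρ γ i (w t) v = Real.exp (A / 2 * t) * gradRep ρ γ i G t v ∧
      mgrad ρ γ i (fun y => w t y * lam y) v
        = Real.exp (A / 2 * t) * (lam v * (gradRep ρ γ i G t v + commRep ρ γ i G t v)) := by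
  rw [Measure.volume_eq_prod] at hw
  filter_upwards [hG.locallyIntegrable, Measure.ae_ae_of_ae_prod hw] with t h1 h2 ht i v
  have e : ∀ᵐ y : Vel, w t y = Real.exp (A / 2 * t) * G t y := by
    filter_upwards [h2] with y hy
    rw [hy ht, ← mul_assoc, ← Real.exp_add]
    simp
  have hl : LocallyIntegrable (w t) :=
    (h1.smul (Real.exp (A / 2 * t))).congr (by filter_upwards [e] with y hy; simp [hy])
  constructor
  · rw [mgrad_eq hρ hγ i hl, gradRep, ← integral_const_mul]
    refine integral_congr_ae ?_
    filter_upwards [e] with y hy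
    rw [hy]; ring
  · rw [mgrad_mul_lam hρ hγ i hl]
    have e1 : ∫ y, mollDeriv ρ γ i (v - y) * w t y
        = Real.exp (A / 2 * t) * gradRep ρ γ i G t v := by
      rw [gradRep, ← integral_const_mul]
      refine integral_congr_ae ?_
      filter_upwards [e] with y hy
      rw [hy]; ring
    have e2 : ∫ y, commKernel ρ γ i v y * w t y
        = Real.exp (A / 2 * t) * commRep ρ γ i G t v := by
      rw [commRep, ← integral_const_mul]
      refine integral_congr_ae ?_
      filter_upwards [e] with y hy
      rw [hy]; ring
    rw [e1, e2]
    ring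

/-- The point `ε (A/2 + 2πiξ)`. -/
def zpt (ε A ξ : ℝ) : ℂ := ε * ((A / 2 : ℝ) + (2 * Real.pi * ξ : ℝ) * Complex.I)

/-- Three functions as a vector. -/
def vec (F : Fin 3 → ℂ) : CVec := WithLp.toLp 2 F

theorem measurable_vec {X : Type*} [MeasurableSpace X] {F : Fin 3 → X → ℂ}
    (hF : ∀ i, Measurable (F i)) : Measurable fun x => vec fun i => F i x :=
  (WithLp.measurable_toLp 2 _).comp (measurable_pi_lambda _ hF)

theorem norm_vec_sq (F : Fin 3 → ℂ) : ‖vec F‖ ^ 2 = ∑ i, ‖F i‖ ^ 2 := by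
  rw [EuclideanSpace.norm_sq_eq]; rfl

theorem dissipation_eq {ε : ℝ} {α : Fin 3 → ℕ} {u : ℝ → Vel → ℝ} (hρ : IsMollifier ρ) (hγ : 0 < γ)
    (hG : MemLam G) (h0 : ∀ t v, t ≤ 0 → G t v = 0)
    (hw : ∀ᵐ p : ℝ × Vel, 0 < p.1 →
      G p.1 p.2 = Real.exp (-(A / 2) * p.1) * weakDeriv α u p.1 p.2)
    {F : Fin 3 → ℝ → Vel → ℂ} (hF : ∀ i, IsTimeFT (gradRep ρ γ i G) (F i)) :
    dissipation ρ γ ε A α u = 2 * Real.pi * ∫ v, (∫ ξ, weightB1 (zpt ε A ξ) v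
      (vec fun i => F i ξ v) (vec fun i => F i ξ v)) * lam v := by
  rw [dissipation, ← integral_const_mul]
  refine integral_congr_ae ?_
  filter_upwards [(hF 0).isFT, (hF 1).isFT, (hF 2).isFT] with v h0' h1 h2
  have hv : ∀ i, IsFT (fun t => (gradRep ρ γ i G t v : ℂ)) fun ξ => F i ξ v :=
    fun i => by fin_cases i; exacts [h0', h1, h2]
  have hd : ∀ i, damped (A / 2) (fun t => mgrad ρ γ i (weakDeriv α u t) v)
      =ᵐ[volume] fun t => (gradRep ρ γ i G t v : ℂ) := fun i => by
    filter_upwards [mgrad_eq_gradRep hρ hγ hG hw] with t ht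
    by_cases h : 0 < t
    · rw [damped, indicator_of_mem (mem_Ioi.2 h), (ht h i v).1, ← mul_assoc, ← Real.exp_add]
      simp
    · rw [damped, indicator_of_notMem (by simpa using h), gradRep_of_nonpos h0 i (not_lt.1 h)]
      simp
  have hl := fun i => laplaceLine_ae_eq (hv i) (hd i)
  rw [← mul_assoc]
  congr 1
  have e := Measure.integral_comp_div (fun ξ => weightB1 (zpt ε A ξ) v
      (vec fun i => F i ξ v) (vec fun i => F i ξ v)) (2 * Real.pi)
  rw [smul_eq_mul, abs_of_pos (by have := Real.pi_pos; positivity)] at e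
  rw [← e]
  refine integral_congr_ae ?_
  filter_upwards [hl 0, hl 1, hl 2] with ω a0 a1 a2
  have ha : ∀ i, laplaceLine (A / 2) (fun t => mgrad ρ γ i (weakDeriv α u t) v) ω
      = F i (ω / (2 * Real.pi)) v := fun i => by fin_cases i; exacts [a0, a1, a2]
  have hz : zpt ε A (ω / (2 * Real.pi)) = ε * ((A / 2 : ℝ) + ω * Complex.I) := by
    rw [zpt, mul_div_cancel₀ _ (by have := Real.pi_pos; positivity)]
  have hL : lapGrad ρ γ A α u ω v = vec fun i => F i (ω / (2 * Real.pi)) v := by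
    rw [lapGrad, vec]
    congr 1; ext i
    exact ha i
  rw [hz, hL]

theorem integrable_weightB1 {ε : ℝ} {H : Fin 3 → ℝ → Vel → ℝ} (hH : ∀ i, MemLam (H i))
    {F : Fin 3 → ℝ → Vel → ℂ} (hF : ∀ i, IsTimeFT (H i) (F i)) :
    Integrable fun p : ℝ × Vel => weightB1 (zpt ε A p.1) p.2
      (vec fun i => F i p.1 p.2) (vec fun i => F i p.1 p.2) * lam p.2 := by
  have hi : Integrable fun p : ℝ × Vel => (58 + 9 * |ε * (A / 2)|) *
      ∑ i, lam p.2 * ‖F i p.1 p.2‖ ^ 2 :=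
    (integrable_finsetSum _ fun i _ => (hF i).integrable (hH i)).const_mul _
  have hz : Continuous (zpt ε A) := by unfold zpt; fun_prop
  have hm : Measurable fun p : ℝ × Vel => weightB1 (zpt ε A p.1) p.2
      (vec fun i => F i p.1 p.2) (vec fun i => F i p.1 p.2) := by
    have := measurable_vec (X := ℝ × Vel) (F := fun i p => F i p.1 p.2)
      fun i => (hF i).meas.measurable
    have hq : Measurable fun p : ℝ × Vel => ((zpt ε A p.1, p.2), vec fun i => F i p.1 p.2) :=
      ((hz.measurable.comp measurable_fst).prodMk measurable_snd).prodMk this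
    have h := measurable_weightB1.comp hq
    rwa [Function.comp_def] at h
  have hm' := hm.mul (measurable_lam.comp measurable_snd)
  refine hi.mono' (Measurable.aestronglyMeasurable hm') ?_
  have hne : ∀ᵐ p : ℝ × Vel, p.2 ≠ 0 := by
    rw [Measure.volume_eq_prod]
    exact Measure.quasiMeasurePreserving_snd.ae (Measure.ae_ne volume 0)
  filter_upwards [hne] with p hp
  have hl := one_le_lam p.2
  rw [Real.norm_of_nonneg (mul_nonneg (weightB1_nonneg _ _ _) (by linarith)), ← Finset.mul_sum,
    ← norm_vec_sq]
  have h := weightB1_le (zpt ε A p.1) hp (vec fun i => F i p.1 p.2)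
  have e : (zpt ε A p.1).re = ε * (A / 2) := by simp [zpt]
  rw [e] at h
  calc _ ≤ (58 + 9 * |ε * (A / 2)|) * ‖vec fun i => F i p.1 p.2‖ ^ 2 * lam p.2 := by gcongr
    _ = _ := by ring

end Reps

end NonMarkov

end

noncomputable section

open MeasureTheory Set
open scoped ENNReal FourierTransform

namespace NonMarkov

theorem LocInt.integrable_mul {f : ℝ → Vel → ℝ} (hf : LocInt f) {ψ : ℝ × Vel → ℝ}
    (h1 : Continuous ψ) (h2 : HasCompactSupport ψ) (h3 : tsupport ψ ⊆ Ioi 0 ×ˢ univ) :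
    Integrable fun p : ℝ × Vel => f p.1 p.2 * ψ p := by
  have hi : IntegrableOn (Function.uncurry f) (tsupport ψ) :=
    LocallyIntegrableOn.integrableOn_compact_subset hf h3 h2
  have h := hi.mul_continuousOn h1.continuousOn h2
  refine (integrableOn_iff_integrable_of_support_subset ?_).1 h
  intro p hp
  have : ψ p ≠ 0 := right_ne_zero_of_mul hp
  exact subset_tsupport _ this

theorem IsWeakDeriv.ae_eq {f g : ℝ → Vel → ℝ} (h : IsWeakDeriv 0 f g) :
    ∀ᵐ p : ℝ × Vel, 0 < p.1 → g p.1 p.2 = f p.1 p.2 := by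
  have hU : IsOpen (Ioi (0 : ℝ) ×ˢ (univ : Set Vel)) := isOpen_Ioi.prod isOpen_univ
  have hl : LocallyIntegrableOn (fun p : ℝ × Vel => f p.1 p.2 - g p.1 p.2)
      (Ioi (0 : ℝ) ×ˢ (univ : Set Vel)) volume := LocallyIntegrableOn.sub h.1 h.2.1
  have := hU.ae_eq_zero_of_integral_contDiff_smul_eq_zero (μ := volume) hl fun ψ s c t => ?_
  · filter_upwards [this] with p hp h0
    have := hp ⟨h0, mem_univ _⟩
    linarith
  · have e := h.2.2 ψ ⟨s, c, t⟩
    simp only [mderiv, Pi.zero_apply, Function.iterate_zero, id_eq, order, Finset.sum_const_zero,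
      pow_zero, one_mul] at e
    have e' : ∀ p : ℝ × Vel, ψ p • (f p.1 p.2 - g p.1 p.2) = f p.1 p.2 * ψ p - g p.1 p.2 * ψ p :=
      fun p => by rw [smul_eq_mul]; ring
    simp only [e']
    rw [integral_sub (h.1.integrable_mul s.continuous c t) (h.2.1.integrable_mul s.continuous c t)]
    exact sub_eq_zero.2 e

theorem ae_ae_swap {P : ℝ × Vel → Prop} (h : ∀ᵐ p : ℝ × Vel, P p) :
    ∀ᵐ v : Vel, ∀ᵐ t : ℝ, P (t, v) := by
  rw [Measure.volume_eq_prod] at h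
  exact Measure.ae_ae_of_ae_prod
    ((Measure.measurePreserving_swap (μ := (volume : Measure Vel))
      (ν := (volume : Measure ℝ))).quasiMeasurePreserving.ae h)

theorem ae_comp_mul_two_pi {P : ℝ → Prop} (h : ∀ᵐ ω : ℝ, P ω) : ∀ᵐ ξ : ℝ, P (2 * Real.pi * ξ) := by
  have h2 : Measure.QuasiMeasurePreserving (fun ξ : ℝ => 2 * Real.pi * ξ) volume volume := by
    have hne : 2 * Real.pi ≠ 0 := by have := Real.pi_pos; positivity
    refine ⟨by fun_prop, ?_⟩
    rw [Real.map_volume_mul_left hne]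
    exact Measure.smul_absolutelyContinuous
  exact h2.ae h

/-- `G` is a measurable version of `e^{-At/2} f`, extended by zero. -/
structure IsRep (A : ℝ) (f G : ℝ → Vel → ℝ) : Prop where
  meas : StronglyMeasurable (Function.uncurry G)
  nonpos : ∀ t v, t ≤ 0 → G t v = 0
  pos : ∀ᵐ p : ℝ × Vel, 0 < p.1 → G p.1 p.2 = Real.exp (-(A / 2) * p.1) * f p.1 p.2

theorem LocInt.exists_isRep {f : ℝ → Vel → ℝ} (hf : LocInt f) (A : ℝ) : ∃ G, IsRep A f G := by
  obtain ⟨W, hWm, hW⟩ := hf.exists_rep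
  refine ⟨dampedRep A W, stronglyMeasurable_dampedRep A hWm, fun t v ht => ?_, ?_⟩
  · rw [dampedRep, indicator_of_notMem (by simpa using ht)]
  · filter_upwards [ae_prod_Ioi hW] with p hp h0
    rw [dampedRep, indicator_of_mem (mem_Ioi.2 h0), hp h0]

theorem exists_timeFT_of_lapNorm_le {k : ℕ} {A R : ℝ} {w : ℂ → ℝ} {f : ℝ → Vel → ℝ}
    (hw : Measurable w) (hR : 0 ≤ R)
    (h : lapNorm k (A / 2) w f ≤ ENNReal.ofReal R) :
    LocInt f ∧ ∀ G, IsRep A f G → ∃ F, IsTimeFT G F ∧ ∀ᵐ p : ℝ × Vel,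
      ‖F p.1 p.2‖ * w (zpt 1 A p.1) * Real.exp (‖p.2‖ / 2) ≤ R := by
  have hL : HasLaplace k (A / 2) f := by
    by_contra hc
    rw [lapNorm, if_neg hc] at h
    simp at h
  have h0 := hL 0 (by simp [order])
  have hd := isWeakDeriv_weakDeriv h0.1
  refine ⟨hd.1, fun G hG => ?_⟩
  obtain ⟨F, hF, hFT⟩ := exists_measurable_isFT (V := fun t v => (G t v : ℂ))
    (Complex.continuous_ofReal.comp_stronglyMeasurable hG.meas)
  have hdv : ∀ᵐ v : Vel, damped (A / 2) (fun t => weakDeriv 0 f t v)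
      =ᵐ[volume] fun t => (G t v : ℂ) := by
    have hh : ∀ᵐ p : ℝ × Vel, damped (A / 2) (fun t => weakDeriv 0 f t p.2) p.1 = G p.1 p.2 := by
      filter_upwards [hG.pos, hd.ae_eq] with p h1 h2
      by_cases ht : 0 < p.1
      · rw [damped, indicator_of_mem (mem_Ioi.2 ht), h1 ht, h2 ht]
      · rw [damped, indicator_of_notMem (by simpa using ht), hG.nonpos _ _ (not_lt.1 ht)]
        simp
    filter_upwards [ae_ae_swap hh] with v hv using hv
  have hFv : ∀ᵐ v : Vel, IsFT (fun t => (G t v : ℂ)) fun ξ => F ξ v := by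
    filter_upwards [hdv, h0.2] with v h1 h2 using hFT v (h2.ae_eq h1)
  refine ⟨F, ⟨hF, hFv⟩, ?_⟩
  have hm : MeasurableSet {p : ℝ × Vel |
      ‖F p.1 p.2‖ * w (zpt 1 A p.1) * Real.exp (‖p.2‖ / 2) ≤ R} := by
    have hz : Continuous (zpt 1 A) := by unfold zpt; fun_prop
    have h1 : Measurable fun p : ℝ × Vel => ‖F p.1 p.2‖ := hF.norm.measurable
    have h2 : Measurable fun p : ℝ × Vel => w (zpt 1 A p.1) :=
      hw.comp (hz.measurable.comp measurable_fst)
    exact measurableSet_le (by fun_prop) measurable_const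
  rw [Measure.volume_eq_prod, Measure.ae_prod_iff_ae_ae hm,
    Measure.ae_ae_comm (p := fun ξ v => ‖F ξ v‖ * w (zpt 1 A ξ) * Real.exp (‖v‖ / 2) ≤ R) hm]
  have hess : essSup (fun v : Vel => essSup (fun ω : ℝ =>
      ENNReal.ofReal (‖laplaceLine (A / 2) (fun t => weakDeriv 0 f t v) ω‖
        * w ((A / 2 : ℝ) + ω * Complex.I) * Real.exp (‖v‖ / 2))) volume) volume
        ≤ ENNReal.ofReal R := by
    rw [lapNorm, if_pos hL] at h
    exact (le_iSup₂ (f := fun m (_ : m ∈ indices k) => essSup (fun v : Vel => essSup (fun ω : ℝ =>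
      ENNReal.ofReal (‖laplaceLine (A / 2) (fun t => weakDeriv m f t v) ω‖
        * w ((A / 2 : ℝ) + ω * Complex.I) * Real.exp (‖v‖ / 2))) volume) volume) 0
      (mem_indices.2 (by simp [order]))).trans h
  filter_upwards [hFv, hdv, ENNReal.ae_le_essSup (fun v : Vel => essSup (fun ω : ℝ =>
      ENNReal.ofReal (‖laplaceLine (A / 2) (fun t => weakDeriv 0 f t v) ω‖
        * w ((A / 2 : ℝ) + ω * Complex.I) * Real.exp (‖v‖ / 2))) volume)] with v h1 h2 h3
  have h4 : ∀ᵐ ω : ℝ, ‖F (ω / (2 * Real.pi)) v‖ * w ((A / 2 : ℝ) + ω * Complex.I) *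
      Real.exp (‖v‖ / 2) ≤ R := by
    filter_upwards [laplaceLine_ae_eq h1 h2, ENNReal.ae_le_essSup (fun ω : ℝ =>
      ENNReal.ofReal (‖laplaceLine (A / 2) (fun t => weakDeriv 0 f t v) ω‖
        * w ((A / 2 : ℝ) + ω * Complex.I) * Real.exp (‖v‖ / 2)))] with ω h5 h6
    rw [← h5]
    exact (ENNReal.ofReal_le_ofReal_iff hR).1 (h6.trans (h3.trans hess))
  filter_upwards [ae_comp_mul_two_pi h4] with ξ hξ
  rw [mul_div_cancel_left₀ _ (by have := Real.pi_pos; positivity)] at hξ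
  rw [zpt, Complex.ofReal_one, one_mul]
  exact hξ

end NonMarkov

end

noncomputable section

open MeasureTheory Set
open scoped ENNReal FourierTransform

namespace NonMarkov

theorem exists_cutoff_fourier (A : ℝ) : ∃ η : ℝ → ℂ, Continuous η ∧ Integrable η ∧
    Integrable (fun ξ => ‖η ξ‖ * (1 + 2 * Real.pi * |ξ|)) ∧
    ∀ᵐ s : ℝ, s ∈ Icc (0 : ℝ) 2 →
      ((Real.exp (A / 2 * s) : ℝ) : ℂ) = ∫ ξ, character (ξ * s) * η ξ := by
  set b : ContDiffBump (1 : ℝ) := ⟨1, 2, one_pos, one_lt_two⟩ with hb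
  set χ : ℝ → ℂ := fun s => ((b s * Real.exp (A / 2 * s) : ℝ) : ℂ) with hχ
  have c1 : HasCompactSupport χ := (b.hasCompactSupport.mul_right).comp_left (g := Complex.ofReal) rfl
  have c2 : ContDiff ℝ (⊤ : ℕ∞) χ :=
    Complex.ofRealCLM.contDiff.comp (b.contDiff.mul (by fun_prop))
  set S := c1.toSchwartzMap c2 with hS
  have e : (𝓕 χ : ℝ → ℂ) = (𝓕 S : SchwartzMap ℝ ℂ) := by
    rw [SchwartzMap.fourier_coe]; rfl
  have hF : IsFT χ (𝓕 χ) :=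
    isFT_of_integrable (c2.continuous.memLp_of_hasCompactSupport c1)
      (c2.continuous.integrable_of_hasCompactSupport c1)
  have hI : Integrable (𝓕 χ : ℝ → ℂ) := by rw [e]; exact SchwartzMap.integrable _
  refine ⟨𝓕 χ, by rw [e]; exact SchwartzMap.continuous _, hI, ?_, ?_⟩
  · rw [e]
    have h1 := (SchwartzMap.integrable (μ := volume) (𝓕 S : SchwartzMap ℝ ℂ)).norm
    have h2 := (SchwartzMap.integrable_pow_mul volume (𝓕 S : SchwartzMap ℝ ℂ) 1).const_mul
      (2 * Real.pi)
    refine (h1.add h2).congr (.of_forall fun ξ => ?_)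
    simp only [Pi.add_apply, pow_one, Real.norm_eq_abs]
    ring
  · filter_upwards [hF.inversion hI] with s hs hmem
    have h1 : b s = 1 := b.one_of_mem_closedBall (by
      rw [Real.closedBall_eq_Icc]; simp only [hb]
      exact ⟨by linarith [hmem.1], by linarith [hmem.2]⟩)
    have h2 : χ s = ((Real.exp (A / 2 * s) : ℝ) : ℂ) := by rw [hχ]; simp [h1]
    rw [← h2, hs]
    rfl

theorem abs_le_norm_zpt_one (A ξ : ℝ) : 2 * Real.pi * |ξ| ≤ ‖zpt 1 A ξ‖ := by
  have h := Complex.abs_im_le_norm (zpt 1 A ξ)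
  have e : (zpt 1 A ξ).im = 2 * Real.pi * ξ := by simp [zpt]
  rwa [e, abs_mul, abs_of_pos (by have := Real.pi_pos; positivity)] at h

theorem norm_zpt_one_pos {A : ℝ} (hA : 0 < A) (ξ : ℝ) : 0 < ‖zpt 1 A ξ‖ := by
  refine norm_pos_iff.2 fun h => ?_
  have := congrArg Complex.re h
  simp [zpt] at this
  linarith

theorem continuous_zpt (ε A : ℝ) : Continuous (zpt ε A) := by unfold zpt; fun_prop

theorem sq_le_norm_zpt_one_sq (A ξ : ℝ) : ξ ^ 2 ≤ ‖zpt 1 A ξ‖ ^ 2 := by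
  have h := abs_le_norm_zpt_one A ξ
  have hp := Real.pi_gt_three
  have : |ξ| ≤ ‖zpt 1 A ξ‖ := by nlinarith [abs_nonneg ξ]
  rw [← sq_abs]
  gcongr

theorem integrable_inv_one_add_zpt (A : ℝ) :
    Integrable fun ξ => 2 / (1 + ‖zpt 1 A ξ‖ ^ 2) := by
  refine (integrable_inv_one_add_sq.const_mul 2).mono'
    (Continuous.aestronglyMeasurable ?_) (.of_forall fun ξ => ?_)
  · have := continuous_zpt 1 A
    exact continuous_const.div (by fun_prop) fun ξ => by positivity
  · rw [Real.norm_of_nonneg (by positivity), div_eq_mul_inv]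
    have := sq_le_norm_zpt_one_sq A ξ
    gcongr

theorem integrable_sqrt_zpt (A : ℝ) :
    Integrable fun ξ => 2 * Real.sqrt ‖zpt 1 A ξ‖ / (1 + ‖zpt 1 A ξ‖ ^ 2) := by
  have h := integrable_rpow_neg_one_add_norm_sq (μ := (volume : Measure ℝ)) (r := 3 / 2)
    (by norm_num)
  refine (h.const_mul 2).mono' (Continuous.aestronglyMeasurable ?_) (.of_forall fun ξ => ?_)
  · have := continuous_zpt 1 A
    exact (by fun_prop : Continuous fun ξ => 2 * Real.sqrt ‖zpt 1 A ξ‖).div (by fun_prop)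
      fun ξ => by positivity
  · rw [Real.norm_of_nonneg (by positivity), mul_div_assoc]
    have h1 := sq_le_norm_zpt_one_sq A ξ
    generalize ‖zpt 1 A ξ‖ = x at *
    have hX : 0 < 1 + x ^ 2 := by positivity
    have h2 : Real.sqrt x ≤ (1 + x ^ 2) ^ (1 / 4 : ℝ) := by
      have e : (1 + x ^ 2) ^ (1 / 4 : ℝ) = Real.sqrt (Real.sqrt (1 + x ^ 2)) := by
        rw [Real.sqrt_eq_rpow, Real.sqrt_eq_rpow, ← Real.rpow_mul hX.le]; norm_num
      rw [e]
      refine Real.sqrt_le_sqrt (Real.le_sqrt_of_sq_le (by linarith))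
    gcongr
    calc Real.sqrt x / (1 + x ^ 2) ≤ (1 + x ^ 2) ^ (1 / 4 : ℝ) / (1 + x ^ 2) := by gcongr
      _ = (1 + x ^ 2) ^ (-(3 / 2) / 2 : ℝ) := by
        rw [← Real.rpow_sub_one hX.ne']; norm_num
      _ ≤ (1 + ‖ξ‖ ^ 2) ^ (-(3 / 2) / 2 : ℝ) := by
        refine Real.rpow_le_rpow_of_nonpos (by positivity) ?_ (by norm_num)
        rw [Real.norm_eq_abs, sq_abs]; linarith

/-- The majorant in time frequency of the transformed density. -/
def freqBound (δ R ε A ξ : ℝ) : ℝ :=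
  (2 * δ + 2 * R * Real.sqrt (ε * ‖zpt 1 A ξ‖)) /
    ((1 + ‖zpt 1 A ξ‖ ^ 2) * (1 + ε * ‖zpt 1 A ξ‖))

section FreqBound

variable {δ R ε A : ℝ}

theorem freqBound_nonneg (hδ : 0 ≤ δ) (hR : 0 ≤ R) (hε : 0 ≤ ε) (ξ : ℝ) :
    0 ≤ freqBound δ R ε A ξ := by
  unfold freqBound; positivity

theorem continuous_freqBound (hε : 0 ≤ ε) : Continuous (freqBound δ R ε A) := by
  have := continuous_zpt 1 A
  unfold freqBound
  exact (by fun_prop : Continuous fun ξ => 2 * δ + 2 * R * Real.sqrt (ε * ‖zpt 1 A ξ‖)).div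
    (by fun_prop) fun ξ => by positivity

theorem freqBound_mul_eq (hε : 0 ≤ ε) (ξ : ℝ) :
    freqBound δ R ε A ξ * (1 + ε * ‖zpt 1 A ξ‖) = δ * (2 / (1 + ‖zpt 1 A ξ‖ ^ 2))
      + R * Real.sqrt ε * (2 * Real.sqrt ‖zpt 1 A ξ‖ / (1 + ‖zpt 1 A ξ‖ ^ 2)) := by
  have h1 : 0 < 1 + ‖zpt 1 A ξ‖ ^ 2 := by positivity
  have h2 : 0 < 1 + ε * ‖zpt 1 A ξ‖ := by positivity
  rw [freqBound, Real.sqrt_mul hε]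
  field_simp

theorem integrable_freqBound_mul (hε : 0 ≤ ε) :
    Integrable fun ξ => freqBound δ R ε A ξ * (1 + ε * ‖zpt 1 A ξ‖) := by
  simp only [freqBound_mul_eq hε]
  exact ((integrable_inv_one_add_zpt A).const_mul _).add ((integrable_sqrt_zpt A).const_mul _)

theorem integral_freqBound_mul (hε : 0 ≤ ε) :
    ∫ ξ, freqBound δ R ε A ξ * (1 + ε * ‖zpt 1 A ξ‖) = δ * (∫ ξ, 2 / (1 + ‖zpt 1 A ξ‖ ^ 2))
      + R * Real.sqrt ε * ∫ ξ, 2 * Real.sqrt ‖zpt 1 A ξ‖ / (1 + ‖zpt 1 A ξ‖ ^ 2) := by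
  simp only [freqBound_mul_eq hε]
  rw [integral_add ((integrable_inv_one_add_zpt A).const_mul _)
    ((integrable_sqrt_zpt A).const_mul _), integral_const_mul, integral_const_mul]

theorem integrable_freqBound (hδ : 0 ≤ δ) (hR : 0 ≤ R) (hε : 0 ≤ ε) :
    Integrable (freqBound δ R ε A) := by
  refine (integrable_freqBound_mul (δ := δ) (R := R) (A := A) hε).mono'
    (continuous_freqBound hε).aestronglyMeasurable (.of_forall fun ξ => ?_)
  rw [Real.norm_of_nonneg (freqBound_nonneg hδ hR hε ξ)]
  refine le_mul_of_one_le_right (freqBound_nonneg hδ hR hε ξ) ?_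
  have : 0 ≤ ε * ‖zpt 1 A ξ‖ := by positivity
  linarith

/-- The splitting into a small part and a part of high frequency. -/
theorem le_freqBound (hδ : 0 ≤ δ) (hR : 0 ≤ R) (hε : 0 < ε) (hA : 0 < A) {ξ E x y : ℝ}
    (hE : 0 < E)
    (h1 : x * (1 + ‖zpt 1 A ξ‖ ^ 2) * E ≤ δ)
    (h2 : y * ((1 + ‖zpt 1 A ξ‖ ^ 2) * (1 + ε * ‖zpt 1 A ξ‖) / (ε * ‖zpt 1 A ξ‖)) * E ≤ R)
    {w : ℝ} (hw : w ≤ x + y)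
    (h3 : w * ((1 + ‖zpt 1 A ξ‖ ^ 2) * (1 + ε * ‖zpt 1 A ξ‖)) * E ≤ R) :
    w * E ≤ freqBound δ R ε A ξ := by
  have hz := norm_zpt_one_pos hA ξ
  rw [freqBound, le_div_iff₀ (by positivity)]
  set Z := 1 + ‖zpt 1 A ξ‖ ^ 2
  have hx : 0 < ε * ‖zpt 1 A ξ‖ := by positivity
  generalize ε * ‖zpt 1 A ξ‖ = X at *
  have hs := Real.sqrt_nonneg X
  have hs2 := Real.mul_self_sqrt hx.le
  rcases le_or_gt X 1 with hX | hX
  · have h4 : y * (Z * (1 + X)) * E ≤ R * X := by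
      have e : y * (Z * (1 + X) / X) * E = y * (Z * (1 + X)) * E / X := by ring
      rwa [e, div_le_iff₀ hx] at h2
    have h5 : X ≤ Real.sqrt X := Real.le_sqrt_of_sq_le (by nlinarith)
    have h6 : x * (Z * (1 + X)) * E ≤ δ * (1 + X) := by
      have := mul_le_mul_of_nonneg_right h1 (by positivity : 0 ≤ 1 + X)
      linarith
    have hZ : 0 < Z := by positivity
    calc w * E * (Z * (1 + X)) ≤ (x + y) * E * (Z * (1 + X)) := by gcongr
      _ ≤ δ * (1 + X) + R * X := by linarith
      _ ≤ _ := by nlinarith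
  · have h5 : 1 ≤ Real.sqrt X := Real.one_le_sqrt.2 hX.le
    nlinarith

end FreqBound

end NonMarkov

end

noncomputable section

open MeasureTheory Set
open scoped ENNReal FourierTransform

namespace NonMarkov

section Omega

variable {n : ℕ} {A δ R' δ₁ R ε : ℝ} {f : ℝ → Vel → ℝ}

theorem IsRep.add {f f₁ f₂ G G₁ G₂ : ℝ → Vel → ℝ} (hG : IsRep A f G) (hG₁ : IsRep A f₁ G₁)
    (hG₂ : IsRep A f₂ G₂)
    (h : ∀ᵐ p ∂((volume : Measure (ℝ × Vel)).restrict (Ioi 0 ×ˢ univ)),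
        f p.1 p.2 = f₁ p.1 p.2 + f₂ p.1 p.2) :
    ∀ᵐ p : ℝ × Vel, G p.1 p.2 = G₁ p.1 p.2 + G₂ p.1 p.2 := by
  filter_upwards [hG.pos, hG₁.pos, hG₂.pos, ae_prod_Ioi h] with p a b c d
  by_cases ht : 0 < p.1
  · rw [a ht, b ht, c ht, d ht]; ring
  · rw [hG.nonpos _ _ (not_lt.1 ht), hG₁.nonpos _ _ (not_lt.1 ht), hG₂.nonpos _ _ (not_lt.1 ht),
      add_zero]

theorem IsTimeFT.add {G G₁ G₂ : ℝ → Vel → ℝ} {F F₁ F₂ : ℝ → Vel → ℂ} (hF : IsTimeFT G F)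
    (hF₁ : IsTimeFT G₁ F₁) (hF₂ : IsTimeFT G₂ F₂)
    (h : ∀ᵐ p : ℝ × Vel, G p.1 p.2 = G₁ p.1 p.2 + G₂ p.1 p.2) :
    ∀ᵐ p : ℝ × Vel, F p.1 p.2 = F₁ p.1 p.2 + F₂ p.1 p.2 := by
  have hm : MeasurableSet {p : ℝ × Vel | F p.1 p.2 = F₁ p.1 p.2 + F₂ p.1 p.2} :=
    hF.meas.measurableSet_eq_fun (hF₁.meas.add hF₂.meas)
  rw [Measure.volume_eq_prod, Measure.ae_prod_iff_ae_ae hm,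
    Measure.ae_ae_comm (p := fun ξ v => F ξ v = F₁ ξ v + F₂ ξ v) hm]
  filter_upwards [hF.isFT, hF₁.isFT, hF₂.isFT, ae_ae_swap h] with v a b c d
  refine a.ae_eq ((b.add c).congr_left ?_)
  filter_upwards [d] with t ht
  rw [ht]; push_cast; rfl

theorem exists_timeFT_of_mem_Omega (hA : 1 ≤ A) (hδ : 0 ≤ δ) (hR : 0 ≤ R) (hε : 0 < ε)
    (hf : f ∈ Omega n A δ R' δ₁ R ε) : ∃ G F, IsRep A f G ∧ IsTimeFT G F ∧
      ∀ᵐ p : ℝ × Vel, ‖F p.1 p.2‖ ≤ freqBound δ R ε A p.1 * Real.exp (-(‖p.2‖ / 2)) := by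
  obtain ⟨-, -, -, hG, f₁, f₂, hadd, hF, hE⟩ := hf
  have mE : Measurable fun z : ℂ => 1 + ‖z‖ ^ 2 := by fun_prop
  have mF : Measurable fun z : ℂ => (1 + ‖z‖ ^ 2) * (1 + ε * ‖z‖) / (ε * ‖z‖) := by fun_prop
  have mG : Measurable fun z : ℂ => (1 + ‖z‖ ^ 2) * (1 + ε * ‖z‖) := by fun_prop
  obtain ⟨l0, h0⟩ := exists_timeFT_of_lapNorm_le mG hR hG
  obtain ⟨l1, h1⟩ := exists_timeFT_of_lapNorm_le mE hδ hE
  obtain ⟨l2, h2⟩ := exists_timeFT_of_lapNorm_le mF hR hF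
  obtain ⟨G, hG⟩ := l0.exists_isRep A
  obtain ⟨G₁, hG₁⟩ := l1.exists_isRep A
  obtain ⟨G₂, hG₂⟩ := l2.exists_isRep A
  obtain ⟨F, hF, b0⟩ := h0 G hG
  obtain ⟨F₁, hF₁, b1⟩ := h1 G₁ hG₁
  obtain ⟨F₂, hF₂, b2⟩ := h2 G₂ hG₂
  refine ⟨G, F, hG, hF, ?_⟩
  filter_upwards [b0, b1, b2, hF.add hF₁ hF₂ (hG.add hG₁ hG₂ hadd)] with p c0 c1 c2 c3
  have := le_freqBound hδ hR hε (by linarith) (Real.exp_pos _) c1 c2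
    (w := ‖F p.1 p.2‖) (by rw [c3]; exact norm_add_le _ _) c0
  rw [Real.exp_neg, ← div_eq_mul_inv, le_div_iff₀ (Real.exp_pos _)]
  exact this

theorem integrable_inv_lamTilde : Integrable fun v : Vel => (lamTilde v)⁻¹ := by
  refine ((integrable_exp_neg_norm (κ := 1 / 2) (by norm_num)).const_mul 2).mono' ?_
    (.of_forall fun v => ?_)
  · have : Measurable lamTilde := by unfold lamTilde; fun_prop
    exact this.inv.aestronglyMeasurable
  · have h1 : 0 < 1 + ‖v‖ := by positivity
    rw [lamTilde, Real.norm_of_nonneg (by positivity), inv_div, div_le_iff₀ (Real.exp_pos _),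
      mul_assoc, ← Real.exp_add]
    have := Real.add_one_le_exp (-(1 / 2 * ‖v‖) + ‖v‖)
    linarith

theorem IsRep.integrable {G : ℝ → Vel → ℝ} (hG : IsRep A f G) (hf : f ∈ Gam n A δ₁)
    (hδ₁ : δ₁ < 1) : Integrable fun p : ℝ × Vel => G p.1 p.2 := by
  obtain ⟨hV, -, hs⟩ := hf
  have h0 := hV 0 (by simp [order])
  have hd := (isWeakDeriv_weakDeriv h0.1).ae_eq
  have hlt : ∀ v, 0 < lamTilde v := fun v => by unfold lamTilde; positivity
  have hS : MeasurableSet (Ioi (0 : ℝ) ×ˢ (univ : Set Vel)) := measurableSet_Ioi.prod .univ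
  have i1 : Integrable ((Ioi (0 : ℝ) ×ˢ (univ : Set Vel)).indicator fun p : ℝ × Vel =>
      Real.exp (-A * p.1) * lamTilde p.2 * weakDeriv 0 f p.1 p.2 ^ 2) :=
    (integrable_indicator_iff hS).2 h0.2
  have i2 : Integrable fun p : ℝ × Vel => (Icc (0 : ℝ) 2).indicator (fun _ => (1 : ℝ)) p.1 *
      (lamTilde p.2)⁻¹ := by
    have : Integrable ((Icc (0 : ℝ) 2).indicator fun _ => (1 : ℝ)) :=
      (integrable_indicator_iff measurableSet_Icc).2 (integrableOn_const (by simp))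
    exact this.mul_prod integrable_inv_lamTilde
  have hs' : ∀ᵐ p : ℝ × Vel, 2 * δ₁ < p.1 → f p.1 p.2 = 0 := by
    rw [ae_restrict_iff' (measurableSet_Ioi.prod .univ)] at hs
    filter_upwards [hs] with p hp h using hp ⟨h, mem_univ _⟩
  refine (i1.add i2).mono' hG.meas.aestronglyMeasurable ?_
  filter_upwards [hG.pos, hd, hs'] with p a b c
  simp only [Pi.add_apply]
  have hl := hlt p.2
  by_cases ht : 0 < p.1
  · have e1 : Real.exp (-A * p.1) * lamTilde p.2 * weakDeriv 0 f p.1 p.2 ^ 2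
        = lamTilde p.2 * G p.1 p.2 ^ 2 := by
      rw [a ht, b ht, mul_pow, ← Real.exp_nat_mul,
        show ((2 : ℕ) : ℝ) * (-(A / 2) * p.1) = -A * p.1 by push_cast; ring]
      ring
    rw [indicator_of_mem (show p ∈ Ioi (0 : ℝ) ×ˢ univ from ⟨ht, mem_univ _⟩), e1]
    by_cases h2 : p.1 ≤ 2
    · rw [indicator_of_mem (show p.1 ∈ Icc (0 : ℝ) 2 from ⟨ht.le, h2⟩), one_mul,
        Real.norm_eq_abs, ← sq_abs]
      generalize |G p.1 p.2| = x
      have e : lamTilde p.2 * x ^ 2 + (lamTilde p.2)⁻¹ - x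
          = (lamTilde p.2)⁻¹ * ((lamTilde p.2 * x - 1 / 2) ^ 2 + 3 / 4) := by
        field_simp; ring
      have : 0 ≤ (lamTilde p.2)⁻¹ * ((lamTilde p.2 * x - 1 / 2) ^ 2 + 3 / 4) := by positivity
      linarith
    · rw [a ht, c (by linarith), mul_zero, norm_zero,
        indicator_of_notMem (fun h => h2 h.2)]
      simp
  · rw [hG.nonpos _ _ (not_lt.1 ht), norm_zero]
    refine add_nonneg (indicator_nonneg (fun p _ => ?_) _) (mul_nonneg
      (indicator_nonneg (fun _ _ => zero_le_one) _) (by positivity))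
    have := hlt p.2
    positivity

theorem IsRep.integral_eq_zero {G : ℝ → Vel → ℝ} (hG : IsRep A f G) (hf : f ∈ Gam n A δ₁) :
    ∀ᵐ t : ℝ, ∫ v, G t v = 0 := by
  have h1 := hf.2.1
  rw [ae_restrict_iff' measurableSet_Ioi] at h1
  have h2 := hG.pos
  rw [Measure.volume_eq_prod] at h2
  filter_upwards [h1, Measure.ae_ae_of_ae_prod h2] with t ht h
  by_cases h0 : 0 < t
  · have : ∫ v, G t v = ∫ v, Real.exp (-(A / 2) * t) * f t v := by
      refine integral_congr_ae ?_
      filter_upwards [h] with v hv using hv h0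
    rw [this, integral_const_mul, ht h0, mul_zero]
  · simp [hG.nonpos t _ (not_lt.1 h0)]

theorem IsTimeFT.integral_eq_zero {G : ℝ → Vel → ℝ} {F : ℝ → Vel → ℂ} (hF : IsTimeFT G F)
    (hG : Integrable fun p : ℝ × Vel => G p.1 p.2) (h0 : ∀ᵐ t : ℝ, ∫ v, G t v = 0)
    (hi : Integrable fun p : ℝ × Vel => F p.1 p.2) : ∀ᵐ ξ : ℝ, ∫ v, F ξ v = 0 := by
  rw [Measure.volume_eq_prod] at hG hi
  have key : (fun ξ => ∫ v, F ξ v) =ᵐ[volume] fun _ => 0 := by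
    refine ae_eq_of_schwartz hi.integral_prod_left.locallyIntegrable
      (locallyIntegrable_const 0) fun ψ _ => ?_
    simp only [mul_zero, integral_zero]
    have j1 : Integrable (fun p : ℝ × Vel => ψ p.1 * F p.1 p.2)
        ((volume : Measure ℝ).prod volume) := by
      refine hi.bdd_mul (c := ‖ψ.toBoundedContinuousFunction‖) (ψ.continuous.comp continuous_fst).aestronglyMeasurable
        (.of_forall fun p => ψ.toBoundedContinuousFunction.norm_coe_le_norm p.1)
    have j2 : Integrable (fun p : ℝ × Vel => (𝓕 (ψ : ℝ → ℂ)) p.1 * (G p.1 p.2 : ℂ))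
        ((volume : Measure ℝ).prod volume) := by
      rw [← SchwartzMap.fourier_coe]
      refine hG.ofReal.bdd_mul (c := ‖(𝓕 ψ : SchwartzMap ℝ ℂ).toBoundedContinuousFunction‖)
        ((𝓕 ψ : SchwartzMap ℝ ℂ).continuous.comp continuous_fst).aestronglyMeasurable
        (.of_forall fun p =>
          (𝓕 ψ : SchwartzMap ℝ ℂ).toBoundedContinuousFunction.norm_coe_le_norm p.1)
    calc ∫ ξ, ψ ξ * ∫ v, F ξ v = ∫ ξ, ∫ v, ψ ξ * F ξ v := by simp only [integral_const_mul]
      _ = ∫ v, ∫ ξ, ψ ξ * F ξ v := integral_integral_swap j1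
      _ = ∫ v, ∫ t, (𝓕 (ψ : ℝ → ℂ)) t * (G t v : ℂ) := by
        refine integral_congr_ae ?_
        filter_upwards [hF.isFT] with v hv using hv.pairing ψ
      _ = ∫ t, ∫ v, (𝓕 (ψ : ℝ → ℂ)) t * (G t v : ℂ) := (integral_integral_swap j2).symm
      _ = 0 := by
        rw [← integral_zero ℝ ℂ (μ := volume)]
        refine integral_congr_ae ?_
        filter_upwards [h0] with t ht
        rw [integral_const_mul, integral_complex_ofReal, ht]
        simp
  exact key

end Omega

end NonMarkov

end

noncomputable section

open MeasureTheory Set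
open scoped ENNReal FourierTransform

namespace NonMarkov

/-- `f` is a superposition of time harmonics with densities of mean zero and total weight `σ`. -/
structure IsSuperposition (ε σ : ℝ) (f : ℝ → Vel → ℝ) (H : ℝ × ℝ → Vel → ℂ) (Ψ : ℝ × ℝ → ℝ) :
    Prop where
  meas : StronglyMeasurable (Function.uncurry H)
  bound : ∀ ϑ v, ‖H ϑ v‖ ≤ Ψ ϑ * Real.exp (-(‖v‖ / 2))
  nonneg : ∀ ϑ, 0 ≤ Ψ ϑ
  integrable : Integrable Ψ
  integrable_mul : Integrable fun ϑ => Ψ ϑ * (1 + ε * (2 * Real.pi * |ϑ.1 + ϑ.2|))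
  integral_le : ∫ ϑ, Ψ ϑ * (1 + ε * (2 * Real.pi * |ϑ.1 + ϑ.2|)) ≤ σ
  mean : ∀ ϑ, ∫ v, H ϑ v = 0
  eq : ∀ᵐ s : ℝ, 0 < s → ∀ᵐ v : Vel,
    (f s v : ℂ) = ∫ ϑ : ℝ × ℝ, character ((ϑ.1 + ϑ.2) * s) * H ϑ v

/-- A jointly measurable version of an almost everywhere bounded density of mean zero, for which
the bound and the vanishing of the mean hold everywhere. -/
theorem exists_cut {F : ℝ → Vel → ℂ} (hF : StronglyMeasurable (Function.uncurry F)) {ψ : ℝ → ℝ}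
    (hψ : Measurable ψ) (h0 : ∀ ξ, 0 ≤ ψ ξ)
    (hb : ∀ᵐ p : ℝ × Vel, ‖F p.1 p.2‖ ≤ ψ p.1 * Real.exp (-(‖p.2‖ / 2)))
    (hm : ∀ᵐ ξ : ℝ, ∫ v, F ξ v = 0) :
    ∃ H : ℝ → Vel → ℂ, StronglyMeasurable (Function.uncurry H) ∧
      (∀ ξ v, ‖H ξ v‖ ≤ ψ ξ * Real.exp (-(‖v‖ / 2))) ∧ (∀ ξ, ∫ v, H ξ v = 0) ∧
      ∀ᵐ p : ℝ × Vel, H p.1 p.2 = F p.1 p.2 := by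
  set S : Set (ℝ × Vel) := {p | ‖F p.1 p.2‖ ≤ ψ p.1 * Real.exp (-(‖p.2‖ / 2))} with hS
  have hSm : MeasurableSet S := by
    have h1 : Measurable fun p : ℝ × Vel => ‖F p.1 p.2‖ := hF.norm.measurable
    exact measurableSet_le h1 (by fun_prop)
  set E : ℝ × Vel → ℂ := S.indicator (Function.uncurry F) with hE
  have hEm : StronglyMeasurable E := hF.indicator hSm
  have hEb : ∀ p : ℝ × Vel, ‖E p‖ ≤ ψ p.1 * Real.exp (-(‖p.2‖ / 2)) := fun p => by
    by_cases hp : p ∈ S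
    · rw [hE, indicator_of_mem hp]; exact hp
    · rw [hE, indicator_of_notMem hp, norm_zero]
      exact mul_nonneg (h0 _) (Real.exp_nonneg _)
  set T : Set ℝ := {ξ | ∫ v, E (ξ, v) = 0} with hT
  have hTm : MeasurableSet T :=
    (hEm.integral_prod_right' (ν := volume)).measurableSet_eq_fun stronglyMeasurable_const
  have hEF : ∀ᵐ p : ℝ × Vel, E p = F p.1 p.2 := by
    filter_upwards [hb] with p hp
    rw [hE, indicator_of_mem (show p ∈ S from hp)]; rfl
  have hTa : ∀ᵐ ξ : ℝ, ξ ∈ T := by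
    have := hEF
    rw [Measure.volume_eq_prod] at this
    filter_upwards [hm, Measure.ae_ae_of_ae_prod this] with ξ h1 h2
    rw [hT, mem_ofPred_eq, ← h1]
    exact integral_congr_ae h2
  have hTm' : MeasurableSet {p : ℝ × Vel | p.1 ∈ T} := measurable_fst hTm
  refine ⟨fun ξ v => {p : ℝ × Vel | p.1 ∈ T}.indicator E (ξ, v), hEm.indicator hTm',
    fun ξ v => (norm_indicator_le_norm_self _ _).trans (hEb _), fun ξ => ?_, ?_⟩
  · by_cases hξ : ξ ∈ T
    · have e : ∀ v, {p : ℝ × Vel | p.1 ∈ T}.indicator E (ξ, v) = E (ξ, v) := fun v =>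
        indicator_of_mem (show (ξ, v) ∈ {p : ℝ × Vel | p.1 ∈ T} from hξ) _
      simp only [e]
      exact hξ
    · have e : ∀ v, {p : ℝ × Vel | p.1 ∈ T}.indicator E (ξ, v) = 0 := fun v =>
        indicator_of_notMem (show (ξ, v) ∉ {p : ℝ × Vel | p.1 ∈ T} from hξ) _
      simp only [e, integral_zero]
  · have hTa' : ∀ᵐ p : ℝ × Vel, p.1 ∈ T := by
      rw [Measure.volume_eq_prod]
      exact Measure.quasiMeasurePreserving_fst.ae hTa
    filter_upwards [hEF, hTa'] with p h1 h2
    rw [indicator_of_mem (show p ∈ {p : ℝ × Vel | p.1 ∈ T} from h2), h1]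

theorem exists_superposition_const (A : ℝ) (hA : 1 ≤ A) : ∃ C : ℝ, 0 < C ∧
    ∀ (n : ℕ) (δ R' δ₁ R ε : ℝ), 0 < δ → 0 < R → δ₁ < 1 → 0 < ε → ε ≤ 1 →
      ∀ f ∈ Omega n A δ R' δ₁ R ε,
        ∃ H Ψ, IsSuperposition ε (C * (δ + R * Real.sqrt ε)) f H Ψ := by
  obtain ⟨η, hηc, hηi, hηw, hη⟩ := exists_cutoff_fourier A
  set K₁ := ∫ ξ, 2 / (1 + ‖zpt 1 A ξ‖ ^ 2) with hK₁
  set K₂ := ∫ ξ, 2 * Real.sqrt ‖zpt 1 A ξ‖ / (1 + ‖zpt 1 A ξ‖ ^ 2) with hK₂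
  set K := ∫ ξ, ‖η ξ‖ * (1 + 2 * Real.pi * |ξ|) with hK
  have hpi := Real.pi_pos
  have p1 : 0 ≤ K₁ := integral_nonneg fun ξ => by positivity
  have p2 : 0 ≤ K₂ := integral_nonneg fun ξ => by positivity
  have p3 : 0 ≤ K := integral_nonneg fun ξ => by positivity
  refine ⟨(K₁ + K₂) * K + 1, by positivity, fun n δ R' δ₁ R ε hδ hR hδ₁ hε hε1 f hf => ?_⟩
  obtain ⟨G, F, hG, hF, hFb⟩ := exists_timeFT_of_mem_Omega hA hδ.le hR.le hε hf
  have hψ0 := freqBound_nonneg (A := A) hδ.le hR.le hε.le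
  have hψc := continuous_freqBound (δ := δ) (R := R) (A := A) hε.le
  have hψi := integrable_freqBound (A := A) hδ.le hR.le hε.le
  have hexp := integrable_exp_neg_norm (κ := 1 / 2) (by norm_num)
  have hFi : Integrable fun p : ℝ × Vel => F p.1 p.2 := by
    refine (hψi.mul_prod hexp).mono' hF.meas.aestronglyMeasurable ?_
    rw [← Measure.volume_eq_prod]
    filter_upwards [hFb] with p hp
    refine hp.trans (le_of_eq ?_)
    congr 2; ring
  have hGi := hG.integrable hf.1 hδ₁
  obtain ⟨H, hHm, hHb, hH0, hHF⟩ := exists_cut hF.meas hψc.measurable hψ0 hFb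
    (hF.integral_eq_zero hGi (hG.integral_eq_zero hf.1) hFi)
  have hHi : ∀ v, Integrable fun ξ => H ξ v := fun v =>
    (hψi.mul_const (Real.exp (-(‖v‖ / 2)))).mono'
      (hHm.comp_measurable measurable_prodMk_right).aestronglyMeasurable
      (.of_forall fun ξ => hHb ξ v)
  have hGH : ∀ᵐ t : ℝ, ∀ᵐ v : Vel, (G t v : ℂ) = ∫ ξ, character (ξ * t) * H ξ v := by
    have hm : MeasurableSet {p : ℝ × Vel | (G p.1 p.2 : ℂ) = ∫ ξ, character (ξ * p.1) * H ξ p.2} := by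
      refine StronglyMeasurable.measurableSet_eq_fun
        (Complex.continuous_ofReal.comp_stronglyMeasurable hG.meas) ?_
      refine StronglyMeasurable.integral_prod_right (ν := volume)
        (f := fun (p : ℝ × Vel) ξ => character (ξ * p.1) * H ξ p.2) ?_
      refine StronglyMeasurable.mul ?_ (hHm.comp_measurable
        (g := fun q : (ℝ × Vel) × ℝ => (q.2, q.1.2)) (by fun_prop))
      exact (continuous_character.comp
        (by fun_prop : Continuous fun q : (ℝ × Vel) × ℝ => q.2 * q.1.1)).stronglyMeasurable
    rw [Measure.ae_ae_comm
      (p := fun t v => (G t v : ℂ) = ∫ ξ, character (ξ * t) * H ξ v) hm]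
    filter_upwards [hF.isFT, ae_ae_swap hHF] with v h1 h2
    have h3 := h1.congr_right (G := fun ξ => H ξ v) (by filter_upwards [h2] with ξ h using h.symm)
    exact h3.inversion (hHi v)
  have hw : ∀ ϑ : ℝ × ℝ, 1 + ε * (2 * Real.pi * |ϑ.1 + ϑ.2|)
      ≤ (1 + ε * ‖zpt 1 A ϑ.1‖) * (1 + 2 * Real.pi * |ϑ.2|) := fun ϑ => by
    have h1 := abs_le_norm_zpt_one A ϑ.1
    have h2 := abs_add_le ϑ.1 ϑ.2
    have h3 : 2 * Real.pi * |ϑ.1 + ϑ.2| ≤ ‖zpt 1 A ϑ.1‖ + 2 * Real.pi * |ϑ.2| := by nlinarith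
    have h4 : 0 ≤ 2 * Real.pi * |ϑ.2| := by positivity
    have h5 : 0 ≤ ε * ‖zpt 1 A ϑ.1‖ := by positivity
    have h6 := mul_le_mul_of_nonneg_left h3 hε.le
    have h7 : ε * (2 * Real.pi * |ϑ.2|) ≤ 2 * Real.pi * |ϑ.2| := mul_le_of_le_one_left h4 hε1
    nlinarith [mul_nonneg h5 h4]
  have hP := (integrable_freqBound_mul (δ := δ) (R := R) (A := A) hε.le).mul_prod hηw
  rw [← Measure.volume_eq_prod] at hP
  have hPb : ∀ ϑ : ℝ × ℝ, freqBound δ R ε A ϑ.1 * ‖η ϑ.2‖ *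
      (1 + ε * (2 * Real.pi * |ϑ.1 + ϑ.2|))
        ≤ (freqBound δ R ε A ϑ.1 * (1 + ε * ‖zpt 1 A ϑ.1‖)) *
          (‖η ϑ.2‖ * (1 + 2 * Real.pi * |ϑ.2|)) := fun ϑ => by
    have := mul_le_mul_of_nonneg_left (hw ϑ) (mul_nonneg (hψ0 ϑ.1) (norm_nonneg (η ϑ.2)))
    linarith
  have hPi : Integrable fun ϑ : ℝ × ℝ => freqBound δ R ε A ϑ.1 * ‖η ϑ.2‖ *
      (1 + ε * (2 * Real.pi * |ϑ.1 + ϑ.2|)) := by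
    refine hP.mono' (Continuous.aestronglyMeasurable (by fun_prop)) (.of_forall fun ϑ => ?_)
    rw [Real.norm_of_nonneg]
    · exact hPb ϑ
    · have := hψ0 ϑ.1; positivity
  refine ⟨fun ϑ v => H ϑ.1 v * η ϑ.2, fun ϑ => freqBound δ R ε A ϑ.1 * ‖η ϑ.2‖, ?_, ?_, ?_, ?_,
    hPi, ?_, ?_, ?_⟩
  · exact (hHm.comp_measurable (g := fun q : (ℝ × ℝ) × Vel => (q.1.1, q.2)) (by fun_prop)).mul
      (hηc.comp (by fun_prop : Continuous fun q : (ℝ × ℝ) × Vel => q.1.2)).stronglyMeasurable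
  · intro ϑ v
    rw [norm_mul]
    have := mul_le_mul_of_nonneg_right (hHb ϑ.1 v) (norm_nonneg (η ϑ.2))
    linarith
  · exact fun ϑ => mul_nonneg (hψ0 _) (norm_nonneg _)
  · exact hψi.mul_prod hηi.norm
  · calc _ ≤ ∫ ϑ : ℝ × ℝ, (freqBound δ R ε A ϑ.1 * (1 + ε * ‖zpt 1 A ϑ.1‖)) *
          (‖η ϑ.2‖ * (1 + 2 * Real.pi * |ϑ.2|)) := integral_mono hPi hP hPb
      _ = (δ * K₁ + R * Real.sqrt ε * K₂) * K := by
        have e := integral_prod_mul (μ := (volume : Measure ℝ)) (ν := (volume : Measure ℝ))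
          (fun ξ => freqBound δ R ε A ξ * (1 + ε * ‖zpt 1 A ξ‖))
          (fun ξ => ‖η ξ‖ * (1 + 2 * Real.pi * |ξ|))
        rw [Measure.volume_eq_prod, e, integral_freqBound_mul hε.le]
      _ ≤ _ := by
        have hr : 0 ≤ R * Real.sqrt ε := by positivity
        nlinarith [mul_nonneg (mul_nonneg hδ.le p2) p3, mul_nonneg (mul_nonneg hr p1) p3]
  · intro ϑ
    rw [integral_mul_const, hH0, zero_mul]
  · have hs := hf.1.2.2
    have hs' : ∀ᵐ t : ℝ, ∀ᵐ v : Vel, 2 * δ₁ < t → f t v = 0 := by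
      rw [ae_restrict_iff' (measurableSet_Ioi.prod .univ), Measure.volume_eq_prod] at hs
      filter_upwards [Measure.ae_ae_of_ae_prod hs] with t ht
      filter_upwards [ht] with v hv h using hv ⟨h, mem_univ _⟩
    have hpos := hG.pos
    rw [Measure.volume_eq_prod] at hpos
    filter_upwards [hη, hGH, hs', Measure.ae_ae_of_ae_prod hpos] with s a b c d h0
    filter_upwards [b, c, d] with v b c d
    have e' := integral_prod_mul (μ := (volume : Measure ℝ)) (ν := (volume : Measure ℝ))
      (fun ξ => character (ξ * s) * H ξ v) (fun ξ => character (ξ * s) * η ξ)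
    have e : ∫ ϑ : ℝ × ℝ, character ((ϑ.1 + ϑ.2) * s) * (H ϑ.1 v * η ϑ.2)
        = (∫ ξ, character (ξ * s) * H ξ v) * ∫ ξ, character (ξ * s) * η ξ := by
      rw [Measure.volume_eq_prod, ← e']
      congr 1; ext ϑ
      have : character ((ϑ.1 + ϑ.2) * s) = character (ϑ.1 * s) * character (ϑ.2 * s) := by
        rw [character, character, character, ← Complex.exp_add]
        congr 1; push_cast; ring
      rw [this]; ring
    rw [e, ← b]
    by_cases h2 : s ≤ 2
    · rw [← a ⟨h0.le, h2⟩, d h0, ← Complex.ofReal_mul]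
      congr 1
      rw [mul_right_comm, ← Real.exp_add]
      simp
    · have : f s v = 0 := c (by linarith)
      rw [d h0, this]
      simp

end NonMarkov

end

noncomputable section

open MeasureTheory Set
open scoped ENNReal FourierTransform

namespace NonMarkov

/-- The constant in the explicit formula for the interaction kernel. -/
def interactionConst : ℝ := exists_interaction_eq.choose

theorem kernelK_eq (g : Vel → ℝ) {τ : ℝ} (hτ : 0 < τ) (v : Vel) (i j : Fin 3) :
    kernelK g τ v i j = interactionConst * ∫ v', interaction i j (τ • (v - v')) * g v' := by
  rw [kernelK, Matrix.of_apply, ← integral_const_mul]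
  refine integral_congr_ae ?_
  filter_upwards [Measure.ae_ne volume v] with v' hv'
  have h := exists_interaction_eq.choose_spec i j (τ • (v - v'))
    (smul_ne_zero hτ.ne' (sub_ne_zero.2 hv'.symm))
  rw [h, mul_assoc]
  rfl

/-- The kernel generated by one time harmonic. -/
def harmK (H : ℝ × ℝ → Vel → ℂ) (i j : Fin 3) (ϑ : ℝ × ℝ) (τ : ℝ) (v : Vel) : ℂ :=
  interactionConst * ∫ v', (interaction i j (τ • (v - v')) : ℂ) * H ϑ v'

/-- The mollified divergence of `harmK`. -/
def harmDiv (ρ : Vel → ℝ) (γ : ℝ) (H : ℝ × ℝ → Vel → ℂ) (i : Fin 3) (ϑ : ℝ × ℝ) (τ : ℝ)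
    (v : Vel) : ℂ :=
  ∑ j, ∫ y, (mollDeriv ρ γ j (v - y) : ℂ) * harmK H i j ϑ τ y

/-- The integral of `e^{-|v|/2}`. -/
def expConst : ℝ := ∫ v : Vel, Real.exp (-(‖v‖ / 2))

theorem integrable_exp_half : Integrable fun v : Vel => Real.exp (-(‖v‖ / 2)) := by
  refine (integrable_exp_neg_norm (κ := 1 / 2) (by norm_num)).congr (.of_forall fun v => ?_)
  simp only
  congr 1; ring

theorem expConst_nonneg : 0 ≤ expConst := integral_nonneg fun _ => Real.exp_nonneg _

section Harmonics

variable {ε σ : ℝ} {f : ℝ → Vel → ℝ} {H : ℝ × ℝ → Vel → ℂ} {Ψ : ℝ × ℝ → ℝ}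

theorem IsSuperposition.norm_harmK_le (hf : IsSuperposition ε σ f H Ψ) (i j : Fin 3) (ϑ : ℝ × ℝ)
    (τ : ℝ) (v : Vel) : ‖harmK H i j ϑ τ v‖ ≤ 2 * |interactionConst| * expConst * Ψ ϑ := by
  have h : ‖∫ v', (interaction i j (τ • (v - v')) : ℂ) * H ϑ v'‖ ≤ 2 * Ψ ϑ * expConst := by
    rw [expConst, ← integral_const_mul]
    refine norm_integral_le_of_norm_le (integrable_exp_half.const_mul _) (.of_forall fun v' => ?_)
    rw [norm_mul, Complex.norm_real, Real.norm_eq_abs, mul_assoc]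
    exact mul_le_mul (abs_interaction_le i j _) (hf.bound ϑ v') (norm_nonneg _) (by norm_num)
  rw [harmK, norm_mul, Complex.norm_real, Real.norm_eq_abs]
  have := mul_le_mul_of_nonneg_left h (abs_nonneg interactionConst)
  linarith

theorem IsSuperposition.stronglyMeasurable_harmK (hf : IsSuperposition ε σ f H Ψ) (i j : Fin 3) :
    StronglyMeasurable fun p : ((ℝ × ℝ) × ℝ) × Vel => harmK H i j p.1.1 p.1.2 p.2 := by
  unfold harmK
  refine StronglyMeasurable.const_mul ?_ _
  refine StronglyMeasurable.integral_prod_right (ν := volume)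
    (f := fun (p : ((ℝ × ℝ) × ℝ) × Vel) v' =>
      (interaction i j (p.1.2 • (p.2 - v')) : ℂ) * H p.1.1 v') ?_
  refine StronglyMeasurable.mul ?_ (hf.meas.comp_measurable
    (g := fun q : (((ℝ × ℝ) × ℝ) × Vel) × Vel => (q.1.1.1, q.2)) (by fun_prop))
  have := (measurable_interaction i j).comp
    (by fun_prop : Measurable fun q : (((ℝ × ℝ) × ℝ) × Vel) × Vel => q.1.1.2 • (q.1.2 - q.2))
  exact (Complex.measurable_ofReal.comp this).stronglyMeasurable

theorem ofReal_kernelK_eq (hf : IsSuperposition ε σ f H Ψ) :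
    ∀ᵐ s : ℝ, 0 < s → ∀ τ, 0 < τ → ∀ i j v, (kernelK (f s) τ v i j : ℂ)
      = ∫ ϑ : ℝ × ℝ, harmK H i j ϑ τ v * character ((ϑ.1 + ϑ.2) * s) := by
  filter_upwards [hf.eq] with s hs h0 τ hτ i j v
  have hm : AEStronglyMeasurable (fun p : Vel × (ℝ × ℝ) =>
      (interaction i j (τ • (v - p.1)) : ℂ) * (character ((p.2.1 + p.2.2) * s) * H p.2 p.1))
      ((volume : Measure Vel).prod (volume : Measure (ℝ × ℝ))) := by
    have h1 := Complex.measurable_ofReal.comp ((measurable_interaction i j).comp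
      (by fun_prop : Measurable fun q : Vel × (ℝ × ℝ) => τ • (v - q.1)))
    have h2 : Continuous fun q : Vel × (ℝ × ℝ) => character ((q.2.1 + q.2.2) * s) :=
      continuous_character.comp (by fun_prop)
    exact (h1.stronglyMeasurable.mul (h2.stronglyMeasurable.mul (hf.meas.comp_measurable
      (g := fun q : Vel × (ℝ × ℝ) => (q.2, q.1)) (by fun_prop)))).aestronglyMeasurable
  have hi : Integrable (fun p : Vel × (ℝ × ℝ) =>
      (interaction i j (τ • (v - p.1)) : ℂ) * (character ((p.2.1 + p.2.2) * s) * H p.2 p.1))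
      ((volume : Measure Vel).prod (volume : Measure (ℝ × ℝ))) := by
    refine ((integrable_exp_half.mul_prod hf.integrable).const_mul 2).mono' hm
      (.of_forall fun p => ?_)
    rw [norm_mul, norm_mul, norm_character, one_mul, Complex.norm_real, Real.norm_eq_abs,
      mul_comm (Real.exp _)]
    exact mul_le_mul (abs_interaction_le i j _) (hf.bound p.2 p.1) (norm_nonneg _) (by norm_num)
  rw [kernelK_eq _ hτ, Complex.ofReal_mul, ← integral_complex_ofReal]
  have e : ∫ v', ((interaction i j (τ • (v - v')) * f s v' : ℝ) : ℂ)
      = ∫ v', ∫ ϑ : ℝ × ℝ, (interaction i j (τ • (v - v')) : ℂ) *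
        (character ((ϑ.1 + ϑ.2) * s) * H ϑ v') := by
    refine integral_congr_ae ?_
    filter_upwards [hs h0] with v' hv'
    rw [Complex.ofReal_mul, hv', integral_const_mul]
  rw [e, integral_integral_swap hi, ← integral_const_mul]
  congr 1; ext ϑ
  rw [harmK, mul_assoc, ← integral_mul_const]
  congr 2; ext v'
  ring

section Mollified

variable {ρ : Vel → ℝ} {γ : ℝ}

theorem integrable_mollDeriv (hρ : IsMollifier ρ) (hγ : 0 < γ) (i : Fin 3) (v : Vel) :
    Integrable fun y => mollDeriv ρ γ i (v - y) := by
  have := integrable_mollDeriv_mul hρ hγ i (locallyIntegrable_const (1 : ℝ)) v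
  simpa using this

/-- The integral of the absolute derivative of the mollifier. -/
def mollConst (ρ : Vel → ℝ) (γ : ℝ) : ℝ := ∑ j, ∫ y, |mollDeriv ρ γ j y|

theorem IsSuperposition.norm_harmDiv_le (hf : IsSuperposition ε σ f H Ψ) (hρ : IsMollifier ρ)
    (hγ : 0 < γ) (i : Fin 3) (ϑ : ℝ × ℝ) (τ : ℝ) (v : Vel) :
    ‖harmDiv ρ γ H i ϑ τ v‖
      ≤ mollConst ρ γ * (2 * |interactionConst| * expConst) * Ψ ϑ := by
  rw [harmDiv, mollConst, Finset.sum_mul, Finset.sum_mul]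
  refine (norm_sum_le _ _).trans (Finset.sum_le_sum fun j _ => ?_)
  rw [← integral_sub_left_eq_self (fun y => |mollDeriv ρ γ j y|) volume v, mul_assoc,
    ← integral_mul_const]
  refine norm_integral_le_of_norm_le ((integrable_mollDeriv hρ hγ j v).norm.mul_const _)
    (.of_forall fun y => ?_)
  rw [norm_mul, Complex.norm_real]
  exact mul_le_mul_of_nonneg_left (hf.norm_harmK_le i j ϑ τ y) (norm_nonneg _)

theorem IsSuperposition.stronglyMeasurable_harmDiv (hf : IsSuperposition ε σ f H Ψ)
    (hρ : IsMollifier ρ) (i : Fin 3) :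
    StronglyMeasurable fun p : ((ℝ × ℝ) × ℝ) × Vel => harmDiv ρ γ H i p.1.1 p.1.2 p.2 := by
  unfold harmDiv
  refine Finset.stronglyMeasurable_fun_sum _ fun j _ => ?_
  refine StronglyMeasurable.integral_prod_right (ν := volume)
    (f := fun (p : ((ℝ × ℝ) × ℝ) × Vel) y =>
      (mollDeriv ρ γ j (p.2 - y) : ℂ) * harmK H i j p.1.1 p.1.2 y) ?_
  refine StronglyMeasurable.mul ?_ ((hf.stronglyMeasurable_harmK i j).comp_measurable
    (g := fun q : (((ℝ × ℝ) × ℝ) × Vel) × Vel => (q.1.1, q.2)) (by fun_prop))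
  exact (Complex.continuous_ofReal.comp ((continuous_mollDeriv hρ γ j).comp
    (by fun_prop : Continuous fun q : (((ℝ × ℝ) × ℝ) × Vel) × Vel =>
      q.1.2 - q.2))).stronglyMeasurable

theorem ofReal_mgrad_kernelK_eq (hf : IsSuperposition ε σ f H Ψ) (hρ : IsMollifier ρ)
    (hγ : 0 < γ) : ∀ᵐ s : ℝ, 0 < s → ∀ τ, 0 < τ → ∀ i v,
      ((∑ j, mgrad ρ γ j (fun y => kernelK (f s) τ y i j) v : ℝ) : ℂ)
        = ∫ ϑ : ℝ × ℝ, harmDiv ρ γ H i ϑ τ v * character ((ϑ.1 + ϑ.2) * s) := by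
  filter_upwards [ofReal_kernelK_eq hf] with s hs h0 τ hτ i v
  set M := 2 * |interactionConst| * expConst with hM
  have hM0 : 0 ≤ M := mul_nonneg (by positivity) expConst_nonneg
  have hch : Continuous fun q : ℝ × ℝ => character ((q.1 + q.2) * s) :=
    continuous_character.comp (by fun_prop)
  have hl : ∀ j, LocallyIntegrable fun y => kernelK (f s) τ y i j := fun j => by
    have e : ∀ y, kernelK (f s) τ y i j
        = (∫ ϑ : ℝ × ℝ, harmK H i j ϑ τ y * character ((ϑ.1 + ϑ.2) * s)).re := fun y => by
      rw [← hs h0 τ hτ, Complex.ofReal_re]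
    have hm : StronglyMeasurable fun y => kernelK (f s) τ y i j := by
      simp only [e]
      refine Complex.measurable_re.comp (StronglyMeasurable.measurable ?_) |>.stronglyMeasurable
      refine StronglyMeasurable.integral_prod_right (ν := volume)
        (f := fun (y : Vel) (ϑ : ℝ × ℝ) => harmK H i j ϑ τ y * character ((ϑ.1 + ϑ.2) * s)) ?_
      exact ((hf.stronglyMeasurable_harmK i j).comp_measurable
        (g := fun q : Vel × (ℝ × ℝ) => ((q.2, τ), q.1)) (by fun_prop)).mul
          (hch.comp (by fun_prop : Continuous fun q : Vel × (ℝ × ℝ) => q.2)).stronglyMeasurable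
    have hb : ∀ y, ‖kernelK (f s) τ y i j‖ ≤ ∫ ϑ, M * Ψ ϑ := fun y => by
      rw [e, Real.norm_eq_abs]
      refine (Complex.abs_re_le_norm _).trans ?_
      refine norm_integral_le_of_norm_le (hf.integrable.const_mul M) (.of_forall fun ϑ => ?_)
      rw [norm_mul, norm_character, mul_one]
      exact hf.norm_harmK_le i j ϑ τ y
    refine (locallyIntegrable_const (∫ ϑ, M * Ψ ϑ)).mono hm.aestronglyMeasurable
      (.of_forall fun y => (hb y).trans (le_abs_self _))
  have hj : ∀ j, Integrable (fun p : Vel × (ℝ × ℝ) => (mollDeriv ρ γ j (v - p.1) : ℂ) *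
      (harmK H i j p.2 τ p.1 * character ((p.2.1 + p.2.2) * s)))
      ((volume : Measure Vel).prod (volume : Measure (ℝ × ℝ))) := fun j => by
    have hm : StronglyMeasurable fun p : Vel × (ℝ × ℝ) => (mollDeriv ρ γ j (v - p.1) : ℂ) *
        (harmK H i j p.2 τ p.1 * character ((p.2.1 + p.2.2) * s)) := by
      refine StronglyMeasurable.mul ?_ (((hf.stronglyMeasurable_harmK i j).comp_measurable
        (g := fun q : Vel × (ℝ × ℝ) => ((q.2, τ), q.1)) (by fun_prop)).mul
          (hch.comp (by fun_prop : Continuous fun q : Vel × (ℝ × ℝ) => q.2)).stronglyMeasurable)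
      exact (Complex.continuous_ofReal.comp ((continuous_mollDeriv hρ γ j).comp
        (by fun_prop : Continuous fun q : Vel × (ℝ × ℝ) => v - q.1))).stronglyMeasurable
    refine ((integrable_mollDeriv hρ hγ j v).norm.mul_prod (hf.integrable.const_mul M)).mono'
      hm.aestronglyMeasurable (.of_forall fun p => ?_)
    rw [norm_mul, norm_mul, norm_character, mul_one, Complex.norm_real]
    exact mul_le_mul_of_nonneg_left (hf.norm_harmK_le i j p.2 τ p.1) (norm_nonneg _)
  simp only [harmDiv, Finset.sum_mul]
  rw [integral_finsetSum]
  · push_cast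
    refine Finset.sum_congr rfl fun j _ => ?_
    rw [mgrad_eq hρ hγ j (hl j), ← integral_complex_ofReal]
    simp only [Complex.ofReal_mul, hs h0 τ hτ, ← integral_const_mul]
    rw [integral_integral_swap (hj j)]
    congr 1; ext ϑ
    rw [← integral_mul_const]
    congr 1; ext y
    ring
  · intro j _
    refine (hj j).integral_prod_right.congr (.of_forall fun ϑ => ?_)
    simp only
    rw [← integral_mul_const]
    congr 1; ext y
    ring

end Mollified

end Harmonics

end NonMarkov

end

noncomputable section

open MeasureTheory Set
open scoped ENNReal FourierTransform ComplexConjugate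

namespace NonMarkov

/-- The damped and rescaled time kernel of a family of harmonics. -/
def timeKernel (ε A : ℝ) (κ : ℝ × ℝ → ℝ → Vel → ℂ) (v : Vel) (ϑ : ℝ × ℝ) (τ : ℝ) : ℂ :=
  (Ioi (0 : ℝ)).indicator
    (fun τ => ((ε⁻¹ * Real.exp (-(A / 2) * τ) : ℝ) : ℂ) * κ ϑ (τ / ε) v) τ

/-- The bilinear time convolution at fixed time and velocity. -/
def superTerm (ε A : ℝ) (κ : ℝ × ℝ → ℝ → Vel → ℂ) (X Y : ℝ → Vel → ℝ) (t : ℝ) (v : Vel) : ℂ :=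
  conj (X t v : ℂ) * ∫ s, (∫ ϑ : ℝ × ℝ, timeKernel ε A κ v ϑ (t - s) *
    character ((ϑ.1 + ϑ.2) * s)) * (Y s v : ℂ)

section Kernel

variable {ε A M : ℝ} {κ : ℝ × ℝ → ℝ → Vel → ℂ} {Ψ : ℝ × ℝ → ℝ} {X Y : ℝ → Vel → ℝ}

theorem stronglyMeasurable_timeKernel (ε A : ℝ)
    (hκ : StronglyMeasurable fun p : ((ℝ × ℝ) × ℝ) × Vel => κ p.1.1 p.1.2 p.2) :
    StronglyMeasurable fun p : Vel × ((ℝ × ℝ) × ℝ) => timeKernel ε A κ p.1 p.2.1 p.2.2 := by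
  have e : (fun p : Vel × ((ℝ × ℝ) × ℝ) => timeKernel ε A κ p.1 p.2.1 p.2.2)
      = {p : Vel × ((ℝ × ℝ) × ℝ) | p.2.2 ∈ Ioi (0 : ℝ)}.indicator fun p =>
        ((ε⁻¹ * Real.exp (-(A / 2) * p.2.2) : ℝ) : ℂ) * κ p.2.1 (p.2.2 / ε) p.1 := by
    ext p
    by_cases h : 0 < p.2.2 <;> simp [timeKernel, indicator, h]
  rw [e]
  refine StronglyMeasurable.indicator ?_ (measurableSet_Ioi.preimage (by fun_prop))
  exact (Continuous.stronglyMeasurable (by fun_prop)).mul (hκ.comp_measurable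
    (g := fun p : Vel × ((ℝ × ℝ) × ℝ) => ((p.2.1, p.2.2 / ε), p.1)) (by fun_prop))

/-- The integrable majorant in time of the time kernel. -/
def timeBound (ε A M τ : ℝ) : ℝ :=
  (Ioi (0 : ℝ)).indicator (fun τ => M * ε⁻¹ * Real.exp (-(A / 2) * τ)) τ

theorem integrable_timeBound (hA : 0 < A) : Integrable (timeBound ε A M) := by
  have h : IntegrableOn (fun τ => M * ε⁻¹ * Real.exp (-(A / 2) * τ)) (Ioi 0) :=
    (integrableOn_exp_mul_Ioi (by linarith) 0).const_mul _
  exact (integrable_indicator_iff measurableSet_Ioi).2 h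

theorem norm_timeKernel_le (hε : 0 < ε) (hb : ∀ ϑ τ v, ‖κ ϑ τ v‖ ≤ M * Ψ ϑ) (v : Vel)
    (ϑ : ℝ × ℝ) (τ : ℝ) : ‖timeKernel ε A κ v ϑ τ‖ ≤ Ψ ϑ * timeBound ε A M τ := by
  by_cases h : τ ∈ Ioi (0 : ℝ)
  · rw [timeKernel, timeBound, indicator_of_mem h, indicator_of_mem h, norm_mul,
      Complex.norm_real, Real.norm_of_nonneg (by positivity)]
    have := mul_le_mul_of_nonneg_left (hb ϑ (τ / ε) v)
      (by positivity : 0 ≤ ε⁻¹ * Real.exp (-(A / 2) * τ))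
    linarith
  · rw [timeKernel, timeBound, indicator_of_notMem h, indicator_of_notMem h]
    simp

theorem fourier_timeKernel (hε : 0 < ε) (v : Vel) (ϑ : ℝ × ℝ) (ξ : ℝ) :
    𝓕 (timeKernel ε A κ v ϑ) ξ
      = ∫ τ in Ioi (0 : ℝ), Complex.exp (-zpt ε A ξ * τ) * κ ϑ τ v := by
  rw [Real.fourier_eq']
  have e1 : ∫ τ : ℝ, Complex.exp (↑(-2 * Real.pi * inner ℝ τ ξ) * Complex.I) •
      timeKernel ε A κ v ϑ τ = ∫ τ in Ioi (0 : ℝ),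
        (ε⁻¹ : ℂ) * (fun x : ℝ => Complex.exp (-zpt ε A ξ * x) * κ ϑ x v) (ε⁻¹ * τ) := by
    rw [← integral_indicator measurableSet_Ioi]
    congr 1; ext τ
    by_cases h : τ ∈ Ioi (0 : ℝ)
    · rw [timeKernel, indicator_of_mem h, indicator_of_mem h, smul_eq_mul, div_eq_inv_mul τ ε]
      have e : Complex.exp (↑(-2 * Real.pi * inner ℝ τ ξ) * Complex.I) *
          Complex.exp ((-(A / 2) * τ : ℝ) : ℂ)
          = Complex.exp (-zpt ε A ξ * ((ε⁻¹ * τ : ℝ) : ℂ)) := by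
        rw [← Complex.exp_add]
        congr 1
        have hε' : (ε : ℂ) ≠ 0 := by exact_mod_cast hε.ne'
        simp only [zpt, RCLike.inner_apply, conj_trivial]
        push_cast
        field_simp
        ring
      simp only
      rw [← e, Complex.ofReal_mul ε⁻¹, Complex.ofReal_inv, Complex.ofReal_exp]
      ring
    · rw [timeKernel, indicator_of_notMem h, indicator_of_notMem h, smul_zero]
  have e2 := integral_comp_mul_left_Ioi (fun x : ℝ => Complex.exp (-zpt ε A ξ * x) * κ ϑ x v) 0
    (inv_pos.2 hε)
  rw [e1, integral_const_mul, e2, inv_inv, mul_zero,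
    Complex.real_smul, ← mul_assoc, inv_mul_cancel₀ (by exact_mod_cast hε.ne'), one_mul]

theorem stronglyMeasurable_superTerm (ε A : ℝ)
    (hκ : StronglyMeasurable fun p : ((ℝ × ℝ) × ℝ) × Vel => κ p.1.1 p.1.2 p.2)
    (hX : StronglyMeasurable (Function.uncurry X)) (hY : StronglyMeasurable (Function.uncurry Y)) :
    StronglyMeasurable fun p : ℝ × Vel => superTerm ε A κ X Y p.1 p.2 := by
  unfold superTerm
  have hX' : StronglyMeasurable fun p : ℝ × Vel => conj (X p.1 p.2 : ℂ) :=
    (Complex.continuous_conj.comp Complex.continuous_ofReal).comp_stronglyMeasurable hX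
  refine hX'.mul ?_
  refine StronglyMeasurable.integral_prod_right (ν := volume)
    (f := fun (p : ℝ × Vel) s => (∫ ϑ : ℝ × ℝ, timeKernel ε A κ p.2 ϑ (p.1 - s) *
      character ((ϑ.1 + ϑ.2) * s)) * (Y s p.2 : ℂ)) ?_
  refine StronglyMeasurable.mul ?_ (Complex.continuous_ofReal.comp_stronglyMeasurable
    (hY.comp_measurable (g := fun q : (ℝ × Vel) × ℝ => (q.2, q.1.2)) (by fun_prop)))
  refine StronglyMeasurable.integral_prod_right (ν := volume)
    (f := fun (q : (ℝ × Vel) × ℝ) (ϑ : ℝ × ℝ) => timeKernel ε A κ q.1.2 ϑ (q.1.1 - q.2) *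
      character ((ϑ.1 + ϑ.2) * q.2)) ?_
  refine StronglyMeasurable.mul ((stronglyMeasurable_timeKernel ε A hκ).comp_measurable
    (g := fun r : ((ℝ × Vel) × ℝ) × (ℝ × ℝ) => (r.1.1.2, (r.2, r.1.1.1 - r.1.2)))
    (by fun_prop)) ?_
  exact (continuous_character.comp (by fun_prop :
    Continuous fun r : ((ℝ × Vel) × ℝ) × (ℝ × ℝ) => (r.2.1 + r.2.2) * r.1.2)).stronglyMeasurable

theorem integrable_superTerm (hε : 0 < ε) (hA : 0 < A)
    (hκ : StronglyMeasurable fun p : ((ℝ × ℝ) × ℝ) × Vel => κ p.1.1 p.1.2 p.2)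
    (hb : ∀ ϑ τ v, ‖κ ϑ τ v‖ ≤ M * Ψ ϑ) (hΨ : Integrable Ψ)
    (hX : MemLam X) (hY : MemLam Y) :
    Integrable fun p : ℝ × Vel => (lam p.2 : ℂ) * superTerm ε A κ X Y p.1 p.2 := by
  have hθ : Measurable fun ϑ : ℝ × ℝ => ϑ.1 + ϑ.2 := by fun_prop
  have hk : ∀ v, StronglyMeasurable (Function.uncurry (timeKernel ε A κ v)) := fun v =>
    (stronglyMeasurable_timeKernel ε A hκ).comp_measurable measurable_prodMk_left
  have hm : StronglyMeasurable fun p : ℝ × Vel => (lam p.2 : ℂ) * superTerm ε A κ X Y p.1 p.2 :=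
    (Complex.continuous_ofReal.comp_stronglyMeasurable
      (measurable_lam.stronglyMeasurable.comp_measurable measurable_snd)).mul
        (stronglyMeasurable_superTerm ε A hκ hX.meas hY.meas)
  rw [Measure.volume_eq_prod, integrable_prod_iff' hm.aestronglyMeasurable]
  constructor
  · filter_upwards [hX.memLp, hY.memLp] with v h1 h2
    exact (integrable_conj_mul_superposition hθ (hk v) hΨ (integrable_timeBound hA)
      (norm_timeKernel_le hε hb v) h1 h2).const_mul _
  · refine (((hX.integrable_inner.add hY.integrable_inner).const_mul
      ((∫ ϑ, ‖Ψ ϑ‖) * ∫ τ, ‖timeBound ε A M τ‖))).mono'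
        (hm.norm.integral_prod_left (μ := volume)
          (f := fun t v => ‖(lam v : ℂ) * superTerm ε A κ X Y t v‖)).aestronglyMeasurable ?_
    filter_upwards [hX.memLp, hY.memLp] with v h1 h2
    have h := integral_norm_superposition_le hθ (hk v) hΨ (integrable_timeBound hA)
      (norm_timeKernel_le hε hb v) h1 h2
    have hl : 0 ≤ lam v := by linarith [one_le_lam v]
    have e : ∀ t, ‖(lam v : ℂ) * superTerm ε A κ X Y t v‖
        = lam v * ‖superTerm ε A κ X Y t v‖ := fun t => by
      rw [norm_mul, Complex.norm_real, Real.norm_of_nonneg hl]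
    simp only [e, integral_const_mul]
    rw [Real.norm_of_nonneg (mul_nonneg hl (integral_nonneg fun t => norm_nonneg _))]
    simp only [Complex.norm_real, Real.norm_eq_abs, sq_abs] at h
    have := mul_le_mul_of_nonneg_left h hl
    refine this.trans (le_of_eq ?_)
    simp only [Pi.add_apply, Real.norm_eq_abs]
    ring

theorem integral_superTerm (hε : 0 < ε) (hA : 0 < A)
    (hκ : StronglyMeasurable fun p : ((ℝ × ℝ) × ℝ) × Vel => κ p.1.1 p.1.2 p.2)
    (hb : ∀ ϑ τ v, ‖κ ϑ τ v‖ ≤ M * Ψ ϑ) (hΨ : Integrable Ψ)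
    {FX FY : ℝ → Vel → ℂ} (hX : IsTimeFT X FX) (hY : IsTimeFT Y FY) :
    ∀ᵐ v : Vel,
      Integrable (fun ϑ : ℝ × ℝ => ∫ ξ, conj (FX ξ v) *
        (𝓕 (timeKernel ε A κ v ϑ) ξ * FY (ξ - (ϑ.1 + ϑ.2)) v)) ∧
      ∫ t, superTerm ε A κ X Y t v = ∫ ϑ : ℝ × ℝ, ∫ ξ, conj (FX ξ v) *
        (𝓕 (timeKernel ε A κ v ϑ) ξ * FY (ξ - (ϑ.1 + ϑ.2)) v) := by
  have hθ : Measurable fun ϑ : ℝ × ℝ => ϑ.1 + ϑ.2 := by fun_prop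
  have hk : ∀ v, StronglyMeasurable (Function.uncurry (timeKernel ε A κ v)) := fun v =>
    (stronglyMeasurable_timeKernel ε A hκ).comp_measurable measurable_prodMk_left
  filter_upwards [hX.isFT, hY.isFT] with v h1 h2
  have h3 := integrable_superposition_fourier hθ (hk v) hΨ (integrable_timeBound hA)
    (norm_timeKernel_le hε hb v) h1 h2
  have h4 := integral_conj_mul_superposition hθ (hk v) hΨ (integrable_timeBound hA)
    (norm_timeKernel_le hε hb v) h1 h2
  beta_reduce at h3 h4
  exact ⟨h3, h4⟩

theorem integrable_fourier_term (hε : 0 < ε) (hA : 0 < A)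
    (hκ : StronglyMeasurable fun p : ((ℝ × ℝ) × ℝ) × Vel => κ p.1.1 p.1.2 p.2)
    (hb : ∀ ϑ τ v, ‖κ ϑ τ v‖ ≤ M * Ψ ϑ)
    {F G : ℝ → ℂ} (hF : MemLp F 2 volume) (hG : MemLp G 2 volume)
    (v : Vel) (ϑ : ℝ × ℝ) :
    Integrable fun ξ => conj (F ξ) * (𝓕 (timeKernel ε A κ v ϑ) ξ * G (ξ - (ϑ.1 + ϑ.2))) := by
  have hk : StronglyMeasurable (timeKernel ε A κ v ϑ) :=
    (stronglyMeasurable_timeKernel ε A hκ).comp_measurable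
      (g := fun τ : ℝ => (v, (ϑ, τ))) (by fun_prop)
  have hki : Integrable (timeKernel ε A κ v ϑ) :=
    ((integrable_timeBound (ε := ε) (M := M) hA).const_mul (Ψ ϑ)).mono' hk.aestronglyMeasurable
      (.of_forall (norm_timeKernel_le hε hb v ϑ))
  have hG' : MemLp (fun ξ => G (ξ - (ϑ.1 + ϑ.2))) 2 volume :=
    hG.comp_measurePreserving (measurePreserving_sub_right volume (ϑ.1 + ϑ.2))
  have hFc : MemLp (fun ξ => conj (F ξ)) 2 volume := hF.star
  have h1 : Integrable fun ξ => conj (F ξ) * G (ξ - (ϑ.1 + ϑ.2)) := hFc.integrable_mul hG'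
  have hc : Continuous (𝓕 (timeKernel ε A κ v ϑ)) :=
    VectorFourier.fourierIntegral_continuous Real.continuous_fourierChar (by fun_prop) hki
  have h2 := h1.bdd_mul (c := ∫ τ, ‖timeKernel ε A κ v ϑ τ‖) hc.aestronglyMeasurable
    (.of_forall fun ξ => VectorFourier.norm_fourierIntegral_le_integral_norm _ _ _ _ _)
  refine h2.congr (.of_forall fun ξ => ?_)
  simp only
  ring

end Kernel

end NonMarkov

end

noncomputable section

open MeasureTheory Set
open scoped ENNReal FourierTransform

namespace NonMarkov

theorem zpt_re (ε A ξ : ℝ) : (zpt ε A ξ).re = ε * (A / 2) := by simp [zpt]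

theorem zpt_im (ε A ξ : ℝ) : (zpt ε A ξ).im = ε * (2 * Real.pi * ξ) := by simp [zpt]

theorem norm_cexp_neg_mul (z : ℂ) (τ : ℝ) : ‖Complex.exp (-z * τ)‖ = Real.exp (-z.re * τ) := by
  rw [Complex.norm_exp]; simp

theorem integrableOn_cexp {z : ℂ} (hz : 0 < z.re) :
    IntegrableOn (fun τ : ℝ => Complex.exp (-z * τ)) (Ioi 0) := by
  have h : IntegrableOn (fun τ : ℝ => Real.exp (-z.re * τ)) (Ioi 0) :=
    integrableOn_exp_mul_Ioi (by linarith) 0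
  refine h.mono' (Continuous.aestronglyMeasurable (by fun_prop)) (.of_forall fun τ => ?_)
  rw [norm_cexp_neg_mul]

theorem stronglyMeasurable_lapConv (z : ℂ) {g : Vel → ℂ} (hg : StronglyMeasurable g)
    (i j : Fin 3) : StronglyMeasurable (lapConv z g i j) := by
  unfold lapConv
  refine StronglyMeasurable.integral_prod_right (ν := volume)
    (f := fun (v v' : Vel) => lapInteraction z i j (v - v') * g v') ?_
  exact ((measurable_lapInteraction z i j).comp
    (by fun_prop : Measurable fun p : Vel × Vel => p.1 - p.2)).stronglyMeasurable.mul
      (hg.comp_measurable measurable_snd)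

section Symbols

variable {ε σ A : ℝ} {f : ℝ → Vel → ℝ} {H : ℝ × ℝ → Vel → ℂ} {Ψ : ℝ × ℝ → ℝ}

theorem IsSuperposition.meas_right (hf : IsSuperposition ε σ f H Ψ) (ϑ : ℝ × ℝ) :
    StronglyMeasurable (H ϑ) := hf.meas.comp_measurable measurable_prodMk_left

theorem fourier_harmK (hf : IsSuperposition ε σ f H Ψ) (hε : 0 < ε) (hA : 0 < A) (i j : Fin 3)
    (v : Vel) (ϑ : ℝ × ℝ) (ξ : ℝ) :
    𝓕 (timeKernel ε A (harmK H i j) v ϑ) ξ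
      = interactionConst * lapConv (zpt ε A ξ) (H ϑ) i j v := by
  have hz : 0 < (zpt ε A ξ).re := by rw [zpt_re]; positivity
  rw [fourier_timeKernel hε]
  generalize zpt ε A ξ = z at *
  have hi : Integrable (fun p : ℝ × Vel => Complex.exp (-z * p.1) *
      ((interaction i j (p.1 • (v - p.2)) : ℂ) * H ϑ p.2))
      (((volume : Measure ℝ).restrict (Ioi 0)).prod (volume : Measure Vel)) := by
    have h1 := Complex.measurable_ofReal.comp ((measurable_interaction i j).comp
      (by fun_prop : Measurable fun q : ℝ × Vel => q.1 • (v - q.2)))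
    have h2 := (hf.meas_right ϑ).comp_measurable (measurable_snd : Measurable (Prod.snd : ℝ × Vel → Vel))
    refine ((integrableOn_cexp hz).norm.mul_prod (integrable_exp_half.const_mul (2 * Ψ ϑ))).mono'
      ((Continuous.stronglyMeasurable (by fun_prop)).mul
        (h1.stronglyMeasurable.mul h2)).aestronglyMeasurable (.of_forall fun p => ?_)
    rw [norm_mul, norm_mul, Complex.norm_real, Real.norm_eq_abs, mul_assoc 2]
    exact mul_le_mul_of_nonneg_left (mul_le_mul (abs_interaction_le i j _) (hf.bound ϑ p.2)
      (norm_nonneg _) (by norm_num)) (norm_nonneg _)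
  calc ∫ τ in Ioi (0 : ℝ), Complex.exp (-z * τ) * harmK H i j ϑ τ v
      = interactionConst * ∫ τ in Ioi (0 : ℝ), ∫ v', Complex.exp (-z * τ) *
          ((interaction i j (τ • (v - v')) : ℂ) * H ϑ v') := by
        rw [← integral_const_mul]
        congr 1; ext τ
        rw [harmK, integral_const_mul]; ring
    _ = interactionConst * ∫ v', ∫ τ in Ioi (0 : ℝ), Complex.exp (-z * τ) *
          ((interaction i j (τ • (v - v')) : ℂ) * H ϑ v') := by
        rw [integral_integral_swap hi]
    _ = _ := by
        rw [lapConv]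
        congr 2; ext v'
        rw [← integral_exp_mul_interaction hz, ← integral_mul_const]
        congr 1; ext τ
        ring

variable {ρ : Vel → ℝ} {γ : ℝ}

theorem fourier_harmDiv (hf : IsSuperposition ε σ f H Ψ) (hρ : IsMollifier ρ) (hγ : 0 < γ)
    (hε : 0 < ε) (hA : 0 < A) (i : Fin 3) (v : Vel) (ϑ : ℝ × ℝ) (ξ : ℝ) :
    𝓕 (timeKernel ε A (harmDiv ρ γ H i) v ϑ) ξ
      = interactionConst * ∑ j, ∫ y, (mollDeriv ρ γ j (v - y) : ℂ) *
        lapConv (zpt ε A ξ) (H ϑ) i j y := by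
  have hz : 0 < (zpt ε A ξ).re := by rw [zpt_re]; positivity
  have hy := fun j y => fourier_harmK hf hε hA i j y ϑ ξ
  simp only [fourier_timeKernel hε] at hy ⊢
  generalize zpt ε A ξ = z at *
  set M := 2 * |interactionConst| * expConst with hM
  have hi : ∀ j, Integrable (fun p : ℝ × Vel => Complex.exp (-z * p.1) *
      ((mollDeriv ρ γ j (v - p.2) : ℂ) * harmK H i j ϑ p.1 p.2))
      (((volume : Measure ℝ).restrict (Ioi 0)).prod (volume : Measure Vel)) := fun j => by
    have h1 : Continuous fun q : ℝ × Vel => (mollDeriv ρ γ j (v - q.2) : ℂ) :=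
      Complex.continuous_ofReal.comp ((continuous_mollDeriv hρ γ j).comp (by fun_prop))
    have h2 := (hf.stronglyMeasurable_harmK i j).comp_measurable
      (g := fun q : ℝ × Vel => ((ϑ, q.1), q.2)) (by fun_prop)
    refine ((integrableOn_cexp hz).norm.mul_prod
      ((integrable_mollDeriv hρ hγ j v).norm.mul_const (M * Ψ ϑ))).mono'
      ((Continuous.stronglyMeasurable (by fun_prop)).mul
        (h1.stronglyMeasurable.mul h2)).aestronglyMeasurable (.of_forall fun p => ?_)
    rw [norm_mul, norm_mul, Complex.norm_real]
    exact mul_le_mul_of_nonneg_left (mul_le_mul_of_nonneg_left (hf.norm_harmK_le i j ϑ p.1 p.2)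
      (norm_nonneg _)) (norm_nonneg _)
  simp only [harmDiv, Finset.mul_sum]
  rw [integral_finsetSum]
  · refine Finset.sum_congr rfl fun j _ => ?_
    simp only [← integral_const_mul]
    rw [integral_integral_swap (hi j)]
    congr 1; ext y
    rw [mul_left_comm, ← hy, ← integral_const_mul]
    congr 1; ext τ
    ring
  · intro j _
    refine (hi j).integral_prod_left.congr (.of_forall fun τ => ?_)
    simp only [integral_const_mul]

theorem integrable_mollDeriv_mul_lapConv (hf : IsSuperposition ε σ f H Ψ) (hρ : IsMollifier ρ)
    (hγ : 0 < γ) {z : ℂ} (hz : 0 < z.re) (i j : Fin 3) (v : Vel) (ϑ : ℝ × ℝ) :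
    Integrable fun y => (mollDeriv ρ γ j (v - y) : ℂ) * lapConv z (H ϑ) i j y := by
  have hb : ∀ y, ‖lapConv z (H ϑ) i j y‖ ≤ ∫ v', 2 * ‖z‖⁻¹ * ‖H ϑ v'‖ := fun y => by
    refine norm_integral_le_of_norm_le
      ((integrable_density (hf.meas_right ϑ).aestronglyMeasurable (hf.bound ϑ)).norm.const_mul _)
      (.of_forall fun v' => ?_)
    rw [norm_mul]
    exact mul_le_mul_of_nonneg_right (norm_lapInteraction_le hz i j _) (norm_nonneg _)
  have h := (integrable_mollDeriv hρ hγ j v).ofReal (𝕜 := ℂ)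
  refine (h.bdd_mul (stronglyMeasurable_lapConv z (hf.meas_right ϑ) i j).aestronglyMeasurable
    (.of_forall hb)).congr (.of_forall fun y => mul_comm _ _)

theorem norm_divSymbol_le (hf : IsSuperposition ε σ f H Ψ) (hρ : IsMollifier ρ) (hγ : 0 < γ)
    (hγ1 : γ ≤ 1) {B : ℝ} (hB0 : 0 ≤ B)
    (hB : ∀ (i : Fin 3) (w : Vel), |mollDeriv ρ γ i w| ≤ B * γ⁻¹ ^ 4)
    {z : ℂ} (hz : 0 < z.re) (i : Fin 3) (v : Vel) (ϑ : ℝ × ℝ) :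
    ‖∑ j, ∫ y, (mollDeriv ρ γ j (v - y) : ℂ) * lapConv z (H ϑ) i j y‖
      ≤ 480 * B * (volume : Measure Vel).real (Metric.ball 0 1) * singConst * Ψ ϑ *
        (1 / (1 + ‖v‖) / (1 + weightAlpha z v)) ^ 2 := by
  set ω := (volume : Measure Vel).real (Metric.ball 0 1) with hω
  set Q := 160 * singConst * Ψ ϑ * (1 / (1 + ‖v‖) / (1 + weightAlpha z v)) ^ 2 with hQ
  have hQ0 : 0 ≤ Q := by
    have := singConst_pos
    have := hf.nonneg ϑ
    positivity
  have hvol : (volume : Measure Vel).real (Metric.closedBall v γ) = γ ^ 3 * ω := by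
    rw [hω, measureReal_def, Measure.addHaar_closedBall _ _ hγ.le, ENNReal.toReal_mul,
      ENNReal.toReal_ofReal (by positivity), measureReal_def]
    simp
  have h1 : ∀ j, ‖∫ y, (mollDeriv ρ γ j (v - y) : ℂ) * lapConv z (H ϑ) i j y‖ ≤ B * ω * Q :=
    fun j => by
    have hi := integrable_mollDeriv_mul_lapConv hf hρ hγ hz i j v ϑ
    have hc : Integrable fun y => (mollDeriv ρ γ j (v - y) : ℂ) * lapConv z (H ϑ) i j v :=
      ((integrable_mollDeriv hρ hγ j v).ofReal (𝕜 := ℂ)).mul_const _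
    have e : ∫ y, (mollDeriv ρ γ j (v - y) : ℂ) * lapConv z (H ϑ) i j y
        = ∫ y, (mollDeriv ρ γ j (v - y) : ℂ) *
          (lapConv z (H ϑ) i j y - lapConv z (H ϑ) i j v) := by
      simp only [mul_sub]
      rw [integral_sub hi hc, integral_mul_const, integral_complex_ofReal,
        integral_mollDeriv hρ hγ j v]
      simp
    rw [e]
    calc _ ≤ ∫ y, (Metric.closedBall v γ).indicator (fun _ => B * γ⁻¹ ^ 3 * Q) y := by
          refine norm_integral_le_of_norm_le ?_ (.of_forall fun y => ?_)
          · exact (integrable_indicator_iff Metric.isClosed_closedBall.measurableSet).2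
              (integrableOn_const measure_closedBall_lt_top.ne)
          · by_cases hy : y ∈ Metric.closedBall v γ
            · have hyv : ‖y - v‖ ≤ γ := by rwa [mem_closedBall_iff_norm] at hy
              rw [indicator_of_mem hy, norm_mul, Complex.norm_real, Real.norm_eq_abs]
              have h2 := norm_lapConv_sub_le' hz (hf.meas_right ϑ).aestronglyMeasurable
                (hf.bound ϑ) (hf.nonneg ϑ) i j (hyv.trans hγ1)
              have h3 : ‖lapConv z (H ϑ) i j y - lapConv z (H ϑ) i j v‖ ≤ Q * γ := by
                have := mul_le_mul_of_nonneg_left hyv hQ0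
                refine h2.trans (le_trans (le_of_eq ?_) this)
                rw [hQ]; ring
              calc _ ≤ B * γ⁻¹ ^ 4 * (Q * γ) :=
                    mul_le_mul (hB j _) h3 (norm_nonneg _) (by positivity)
                _ = _ := by field_simp
            · have hyv : γ < ‖v - y‖ := by
                rw [mem_closedBall_iff_norm', not_le] at hy; exact hy
              rw [indicator_of_notMem hy, mollDeriv_eq_zero hρ hγ j hyv]
              simp
      _ = B * ω * Q := by
          rw [integral_indicator_const _ Metric.isClosed_closedBall.measurableSet, hvol,
            smul_eq_mul]
          field_simp
  refine (norm_sum_le _ _).trans ((Finset.sum_le_sum fun j _ => h1 j).trans (le_of_eq ?_))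
  simp only [Finset.sum_const, Finset.card_univ, Fintype.card_fin, nsmul_eq_mul]
  rw [hQ]
  push_cast
  ring

end Symbols

end NonMarkov

end

noncomputable section

open MeasureTheory Set
open scoped ENNReal FourierTransform ComplexConjugate

namespace NonMarkov

/-- The constant in the bound for the symbols. -/
def symbConst (B : ℝ) : ℝ :=
  200 * (|interactionConst| * singConst *
    (432 + 1440 * B * (volume : Measure Vel).real (Metric.ball 0 1)))

theorem symbConst_nonneg {B : ℝ} (hB : 0 ≤ B) : 0 ≤ symbConst B := by
  have := singConst_pos
  unfold symbConst; positivity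

theorem weight_combination_le {s t η b y b' u : ℝ} (hs : 0 ≤ s) (ht : 0 ≤ t) (hη : 0 ≤ η)
    (hb : 0 ≤ b) (hy : 0 ≤ y) (hb' : 0 ≤ b') (hu : 0 ≤ u) :
    s * ((1 + 2 * η) * (2 * b + 100 * y + 2 * b')) + t * (2 * b + 100 * y + u)
      ≤ (s + t) * (200 * ((1 + η) * (b + y + b' + u))) := by
  have g1 : (1 + 2 * η) * (2 * b + 100 * y + 2 * b')
      ≤ (2 * (1 + η)) * (100 * (b + y + b' + u)) :=
    mul_le_mul (by linarith) (by linarith) (by positivity) (by positivity)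
  have g2 : 1 * (2 * b + 100 * y + u) ≤ (2 * (1 + η)) * (100 * (b + y + b' + u)) :=
    mul_le_mul (by linarith) (by linarith) (by positivity) (by positivity)
  have h1 := mul_le_mul_of_nonneg_left g1 hs
  have h2 := mul_le_mul_of_nonneg_left g2 ht
  linarith

section Symbols

variable {ε σ A : ℝ} {f : ℝ → Vel → ℝ} {H : ℝ × ℝ → Vel → ℂ} {Ψ : ℝ × ℝ → ℝ}

theorem weightAlpha_zpt_sub_le (hε : 0 < ε) (A ξ θ : ℝ) (v : Vel) :
    |weightAlpha (zpt ε A ξ) v - weightAlpha (zpt ε A (ξ - θ)) v|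
      ≤ ε * (2 * Real.pi * |θ|) * (1 / (1 + ‖v‖)) := by
  have hpi := Real.pi_pos
  rw [weightAlpha, weightAlpha, zpt_im, zpt_im, ← sub_div, abs_div,
    abs_of_pos (by positivity : 0 < 1 + ‖v‖), div_eq_mul_one_div]
  refine mul_le_mul_of_nonneg_right ?_ (by positivity)
  refine (abs_abs_sub_abs_le_abs_sub _ _).trans (le_of_eq ?_)
  rw [show ε * (2 * Real.pi * ξ) - ε * (2 * Real.pi * (ξ - θ)) = ε * (2 * Real.pi * θ) by ring,
    abs_mul, abs_mul, abs_of_pos hε, abs_of_pos (by positivity : 0 < 2 * Real.pi)]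

theorem norm_symbol_le (hf : IsSuperposition ε σ f H Ψ) (hε : 0 < ε) (hA : 0 < A)
    (hεA : ε * (A / 2) ≤ 1) {B : ℝ} (hB : 0 ≤ B) {v : Vel} (hv : v ≠ 0) (ϑ : ℝ × ℝ) (ξ θ : ℝ)
    {L : Fin 3 → ℂ}
    (hL : ∀ i, ‖L i‖ ≤ 480 * B * (volume : Measure Vel).real (Metric.ball 0 1) * singConst * Ψ ϑ *
        (1 / (1 + ‖v‖) / (1 + weightAlpha (zpt ε A ξ) v)) ^ 2)
    (W h W' : CVec) (U' : ℂ) :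
    ‖∑ i, ∑ j, conj ((W + h) i) *
        (interactionConst * lapConv (zpt ε A ξ) (H ϑ) i j v * W' j)
      - ∑ i, conj ((W + h) i) * (interactionConst * L i * U')‖
      ≤ symbConst B * (Ψ ϑ * (1 + ε * (2 * Real.pi * |θ|))) *
        (weightB1 (zpt ε A ξ) v W W + ‖h‖ ^ 2 + weightB1 (zpt ε A (ξ - θ)) v W' W' + ‖U'‖ ^ 2) := by
  have hz : 0 < (zpt ε A ξ).re := by rw [zpt_re]; positivity
  have hz1 : (zpt ε A ξ).re ≤ 1 := by rwa [zpt_re]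
  set z := zpt ε A ξ with hzd
  set z' := zpt ε A (ξ - θ) with hzd'
  have hs := singConst_pos
  have hP := hf.nonneg ϑ
  have ha : 0 ≤ weightAlpha z v := by unfold weightAlpha; positivity
  have hb : 0 ≤ weightAlpha z' v := by unfold weightAlpha; positivity
  have hpi := Real.pi_pos
  set η := ε * (2 * Real.pi * |θ|) with hη
  have hη0 : 0 ≤ η := by positivity
  have e1 := norm_sum_lapConv_le hz hz1 (hf.meas_right ϑ).aestronglyMeasurable (hf.bound ϑ) hP
    (hf.mean ϑ) hv (W + h) W'
  have e2 := transNorm_shift_le ha hb hη0 v (weightAlpha_zpt_sub_le hε A ξ θ v) W'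
  have e3 := (transNorm_add_le ha v W h).trans (add_le_add_right (transNorm_le ha hv h) _)
  have e4 := transNorm_sq_le_weightB1 z v W
  have e5 := transNorm_sq_le_weightB1 z' v W'
  have e6 := norm_le_transNorm ha v (W + h)
  have n1 := transNorm_nonneg ha v W
  have n2 := transNorm_nonneg hb v W'
  have n3 := transNorm_nonneg ha v (W + h)
  have n4 := transNorm_nonneg ha v W'
  set ω := (volume : Measure Vel).real (Metric.ball 0 1) with hω
  set q := 1 / (1 + ‖v‖) with hq
  have hq0 : 0 < q := by positivity
  have hq1 : q ≤ 1 := by rw [hq, div_le_one (by positivity)]; linarith [norm_nonneg v]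
  set r := q / (1 + weightAlpha z v) with hr
  have hr0 : 0 ≤ r := by positivity
  have hrq : r ≤ q := div_le_self hq0.le (by linarith)
  set x := transNorm (weightAlpha z v) v W
  set w := transNorm (weightAlpha z' v) v W'
  set V := W + h
  have hy := norm_nonneg h
  have hB1 := weightB1_nonneg z v W
  have hB1' := weightB1_nonneg z' v W'
  set b := weightB1 z v W W
  set b' := weightB1 z' v W' W'
  set y := ‖h‖
  set m := |interactionConst| with hm
  have hm0 : 0 ≤ m := abs_nonneg _
  have t1 : ‖∑ i, ∑ j, conj (V i) * (interactionConst * lapConv z (H ϑ) i j v * W' j)‖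
      ≤ m * (432 * singConst * Ψ ϑ) * ((1 + 2 * η) * (2 * b + 100 * y ^ 2 + 2 * b')) := by
    have e : ∑ i, ∑ j, conj (V i) * (interactionConst * lapConv z (H ϑ) i j v * W' j)
        = interactionConst * ∑ i, ∑ j, conj (V i) * (lapConv z (H ϑ) i j v * W' j) := by
      simp only [Finset.mul_sum]
      refine Finset.sum_congr rfl fun i _ => Finset.sum_congr rfl fun j _ => ?_
      ring
    rw [e, norm_mul, Complex.norm_real, Real.norm_eq_abs, mul_assoc m]
    refine mul_le_mul_of_nonneg_left (e1.trans (mul_le_mul_of_nonneg_left ?_ (by positivity))) hm0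
    calc q * transNorm (weightAlpha z v) v V * transNorm (weightAlpha z v) v W'
        ≤ q * (x + 10 * y) * ((1 + 2 * η) * w) := by
          refine mul_le_mul ?_ e2 n4 (by positivity)
          exact mul_le_mul_of_nonneg_left e3 hq0.le
      _ = (1 + 2 * η) * (q * ((x + 10 * y) * w)) := by ring
      _ ≤ (1 + 2 * η) * (2 * b + 100 * y ^ 2 + 2 * b') := by
        gcongr
        have k1 : (x + 10 * y) * w ≤ x ^ 2 + 100 * y ^ 2 + w ^ 2 := by
          nlinarith [sq_nonneg (x - 10 * y), sq_nonneg (x + 10 * y - w)]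
        have k2 := mul_le_mul_of_nonneg_left k1 hq0.le
        have k3 : q * (100 * y ^ 2) ≤ 100 * y ^ 2 := mul_le_of_le_one_left (by positivity) hq1
        linarith
  have t2 : ‖∑ i, conj (V i) * (interactionConst * L i * U')‖
      ≤ m * (1440 * B * ω * singConst * Ψ ϑ) * (2 * b + 100 * y ^ 2 + ‖U'‖ ^ 2) := by
    have hi : ∀ i, ‖conj (V i) * (interactionConst * L i * U')‖
        ≤ m * (480 * B * ω * singConst * Ψ ϑ) * (2 * b + 100 * y ^ 2 + ‖U'‖ ^ 2) := fun i => by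
      rw [norm_mul, norm_mul, norm_mul, RCLike.norm_conj, Complex.norm_real, Real.norm_eq_abs]
      have k0 : r * (r * ‖V‖) * ‖U'‖ ≤ 2 * b + 100 * y ^ 2 + ‖U'‖ ^ 2 := by
        calc r * (r * ‖V‖) * ‖U'‖ ≤ q * (x + 10 * y) * ‖U'‖ := by
              gcongr
              exact e6.trans e3
          _ ≤ _ := by
            have hu := norm_nonneg U'
            have k1 : (x + 10 * y) * ‖U'‖ ≤ x ^ 2 + 100 * y ^ 2 + ‖U'‖ ^ 2 := by
              nlinarith [sq_nonneg (x - 10 * y), sq_nonneg (x + 10 * y - ‖U'‖)]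
            have k2 := mul_le_mul_of_nonneg_left k1 hq0.le
            have k3 : q * (100 * y ^ 2 + ‖U'‖ ^ 2) ≤ 100 * y ^ 2 + ‖U'‖ ^ 2 :=
              mul_le_of_le_one_left (by positivity) hq1
            linarith
      calc ‖V i‖ * (m * ‖L i‖ * ‖U'‖)
          ≤ ‖V‖ * (m * (480 * B * ω * singConst * Ψ ϑ * r ^ 2) * ‖U'‖) := by
            gcongr
            · exact PiLp.norm_apply_le V i
            · exact hL i
        _ = m * (480 * B * ω * singConst * Ψ ϑ) * (r * (r * ‖V‖) * ‖U'‖) := by ring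
        _ ≤ _ := by gcongr
    refine (norm_sum_le _ _).trans ((Finset.sum_le_sum fun i _ => hi i).trans (le_of_eq ?_))
    simp only [Finset.sum_const, Finset.card_univ, Fintype.card_fin, nsmul_eq_mul]
    push_cast
    ring
  refine (norm_sub_le _ _).trans ((add_le_add t1 t2).trans ?_)
  have hk := weight_combination_le (s := m * (432 * singConst * Ψ ϑ))
    (t := m * (1440 * B * ω * singConst * Ψ ϑ)) (by positivity) (by positivity) hη0 hB1
    (sq_nonneg y) hB1' (sq_nonneg ‖U'‖)
  refine hk.trans (le_of_eq ?_)
  rw [symbConst]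
  ring

end Symbols

end NonMarkov

end

noncomputable section

open MeasureTheory Set
open scoped ENNReal FourierTransform ComplexConjugate

namespace NonMarkov

theorem MemLam.add {G H : ℝ → Vel → ℝ} (hG : MemLam G) (hH : MemLam H) :
    MemLam fun t v => G t v + H t v := by
  have hm : StronglyMeasurable (Function.uncurry fun t v => G t v + H t v) :=
    hG.meas.add hH.meas
  refine ⟨hm, ((hG.int.add hH.int).const_mul 2).mono'
    ((measurable_lam.stronglyMeasurable.comp_measurable measurable_snd).mul
      (hm.pow 2)).aestronglyMeasurable (.of_forall fun p => ?_)⟩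
  have hl : 0 ≤ lam p.2 := by linarith [one_le_lam p.2]
  rw [Real.norm_of_nonneg (mul_nonneg hl (sq_nonneg _))]
  simp only [Pi.add_apply]
  have h : (G p.1 p.2 + H p.1 p.2) ^ 2 ≤ 2 * (G p.1 p.2 ^ 2 + H p.1 p.2 ^ 2) := by
    nlinarith [sq_nonneg (G p.1 p.2 - H p.1 p.2)]
  have := mul_le_mul_of_nonneg_left h hl
  linarith

section Symbols

variable {ε σ A γ B : ℝ} {ρ : Vel → ℝ} {f : ℝ → Vel → ℝ} {H : ℝ × ℝ → Vel → ℂ} {Ψ : ℝ × ℝ → ℝ}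

theorem norm_integral_symbol_le (hf : IsSuperposition ε σ f H Ψ) (hρ : IsMollifier ρ)
    (hγ : 0 < γ) (hγ1 : γ ≤ 1) (hε : 0 < ε) (hA : 0 < A) (hεA : ε * (A / 2) ≤ 1) (hB0 : 0 ≤ B)
    (hB : ∀ (i : Fin 3) (w : Vel), |mollDeriv ρ γ i w| ≤ B * γ⁻¹ ^ 4)
    {v : Vel} (hv : v ≠ 0) {F E : Fin 3 → ℝ → ℂ} {U : ℝ → ℂ}
    (hF : ∀ i, MemLp (F i) 2 volume) (hE : ∀ i, MemLp (E i) 2 volume) (hU : MemLp U 2 volume)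
    (hb : Integrable fun ξ => weightB1 (zpt ε A ξ) v (vec fun i => F i ξ) (vec fun i => F i ξ))
    (ϑ : ℝ × ℝ) :
    ‖∑ i, ∑ j, (∫ ξ, conj (F i ξ + E i ξ) *
        (𝓕 (timeKernel ε A (harmK H i j) v ϑ) ξ * F j (ξ - (ϑ.1 + ϑ.2))))
      - ∑ i, ∫ ξ, conj (F i ξ + E i ξ) *
        (𝓕 (timeKernel ε A (harmDiv ρ γ H i) v ϑ) ξ * U (ξ - (ϑ.1 + ϑ.2)))‖
      ≤ symbConst B * (Ψ ϑ * (1 + ε * (2 * Real.pi * |ϑ.1 + ϑ.2|))) *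
        (2 * (∫ ξ, weightB1 (zpt ε A ξ) v (vec fun i => F i ξ) (vec fun i => F i ξ))
          + ∑ i, (∫ ξ, ‖E i ξ‖ ^ 2) + ∫ ξ, ‖U ξ‖ ^ 2) := by
  set θ := ϑ.1 + ϑ.2 with hθ
  have h1 : ∀ i j, Integrable fun ξ => conj (F i ξ + E i ξ) *
      (𝓕 (timeKernel ε A (harmK H i j) v ϑ) ξ * F j (ξ - θ)) := fun i j =>
    integrable_fourier_term hε hA (hf.stronglyMeasurable_harmK i j) (hf.norm_harmK_le i j)
      ((hF i).add (hE i)) (hF j) v ϑ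
  have h2 : ∀ i, Integrable fun ξ => conj (F i ξ + E i ξ) *
      (𝓕 (timeKernel ε A (harmDiv ρ γ H i) v ϑ) ξ * U (ξ - θ)) := fun i =>
    integrable_fourier_term hε hA (hf.stronglyMeasurable_harmDiv hρ i)
      (hf.norm_harmDiv_le hρ hγ i) ((hF i).add (hE i)) hU v ϑ
  have e : ∑ i, ∑ j, (∫ ξ, conj (F i ξ + E i ξ) *
        (𝓕 (timeKernel ε A (harmK H i j) v ϑ) ξ * F j (ξ - θ)))
      - ∑ i, ∫ ξ, conj (F i ξ + E i ξ) *
        (𝓕 (timeKernel ε A (harmDiv ρ γ H i) v ϑ) ξ * U (ξ - θ))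
      = ∫ ξ, (∑ i, ∑ j, conj (F i ξ + E i ξ) *
        (𝓕 (timeKernel ε A (harmK H i j) v ϑ) ξ * F j (ξ - θ))
      - ∑ i, conj (F i ξ + E i ξ) *
        (𝓕 (timeKernel ε A (harmDiv ρ γ H i) v ϑ) ξ * U (ξ - θ))) := by
    rw [integral_sub (integrable_finsetSum _ fun i _ => integrable_finsetSum _ fun j _ => h1 i j)
      (integrable_finsetSum _ fun i _ => h2 i),
      integral_finsetSum _ fun i _ => integrable_finsetSum _ fun j _ => h1 i j,
      integral_finsetSum _ fun i _ => h2 i]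
    congr 1
    exact Finset.sum_congr rfl fun i _ => (integral_finsetSum _ fun j _ => h1 i j).symm
  have hE2 : Integrable fun ξ => ‖vec fun i => E i ξ‖ ^ 2 := by
    simp only [norm_vec_sq]
    exact integrable_finsetSum _ fun i _ => memLp_two_norm_sq (hE i)
  have hb' := hb.comp_sub_right θ
  have hU' := (memLp_two_norm_sq hU).comp_sub_right θ
  have eE : ∫ ξ, ‖vec fun i => E i ξ‖ ^ 2 = ∑ i, ∫ ξ, ‖E i ξ‖ ^ 2 := by
    simp only [norm_vec_sq]
    exact integral_finsetSum _ fun i _ => memLp_two_norm_sq (hE i)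
  rw [e]
  refine (norm_integral_le_of_norm_le (((((hb.add hE2).add hb').add hU').const_mul
    (symbConst B * (Ψ ϑ * (1 + ε * (2 * Real.pi * |θ|)))))) (.of_forall fun ξ => ?_)).trans
      (le_of_eq ?_)
  · have hz : 0 < (zpt ε A ξ).re := by rw [zpt_re]; positivity
    have h := norm_symbol_le hf hε hA hεA hB0 hv ϑ ξ θ
      (fun i => norm_divSymbol_le hf hρ hγ hγ1 hB0 hB hz i v ϑ)
      (vec fun i => F i ξ) (vec fun i => E i ξ) (vec fun i => F i (ξ - θ)) (U (ξ - θ))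
    simp only [fourier_harmK hf hε hA, fourier_harmDiv hf hρ hγ hε hA]
    exact h
  · rw [integral_const_mul, integral_add' ((hb.add hE2).add hb') hU',
      integral_add' (hb.add hE2) hb', integral_add' hb hE2, eE,
      integral_sub_right_eq_self (fun ξ => weightB1 (zpt ε A ξ) v (vec fun i => F i ξ)
        (vec fun i => F i ξ)) θ, integral_sub_right_eq_self (fun ξ => ‖U ξ‖ ^ 2) θ]
    ring

end Symbols

end NonMarkov

end

noncomputable section

open MeasureTheory Set
open scoped ENNReal FourierTransform ComplexConjugate

namespace NonMarkov

theorem isTimeFT_add {G H : ℝ → Vel → ℝ} {F E : ℝ → Vel → ℂ} (hF : IsTimeFT G F)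
    (hE : IsTimeFT H E) : IsTimeFT (fun t v => G t v + H t v) fun ξ v => F ξ v + E ξ v := by
  refine ⟨hF.meas.add hE.meas, ?_⟩
  filter_upwards [hF.isFT, hE.isFT] with v h1 h2
  simpa only [Complex.ofReal_add] using h1.add h2

theorem IsTimeFT.memLp {G : ℝ → Vel → ℝ} {F : ℝ → Vel → ℂ} (hF : IsTimeFT G F) :
    ∀ᵐ v : Vel, MemLp (fun ξ => F ξ v) 2 volume := by
  filter_upwards [hF.isFT] with v hv using hv.right

section Total

variable {ε σ A γ B : ℝ} {ρ : Vel → ℝ} {f : ℝ → Vel → ℝ} {H : ℝ × ℝ → Vel → ℂ} {Ψ : ℝ × ℝ → ℝ}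
  {W h : Fin 3 → ℝ → Vel → ℝ} {G : ℝ → Vel → ℝ}

/-- The complete quadratic form, integrated over time and velocity. -/
def totalForm (ρ : Vel → ℝ) (γ ε A : ℝ) (H : ℝ × ℝ → Vel → ℂ) (W h : Fin 3 → ℝ → Vel → ℝ)
    (G : ℝ → Vel → ℝ) : ℂ :=
  ∑ i, ∑ j, (∫ p : ℝ × Vel, (lam p.2 : ℂ) *
    superTerm ε A (harmK H i j) (fun t v => W i t v + h i t v) (W j) p.1 p.2) -
  ∑ i, ∫ p : ℝ × Vel, (lam p.2 : ℂ) *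
    superTerm ε A (harmDiv ρ γ H i) (fun t v => W i t v + h i t v) G p.1 p.2

theorem norm_totalForm_le (hf : IsSuperposition ε σ f H Ψ) (hρ : IsMollifier ρ)
    (hγ : 0 < γ) (hγ1 : γ ≤ 1) (hε : 0 < ε) (hA : 0 < A) (hεA : ε * (A / 2) ≤ 1) (hB0 : 0 ≤ B)
    (hB : ∀ (i : Fin 3) (w : Vel), |mollDeriv ρ γ i w| ≤ B * γ⁻¹ ^ 4)
    (hW : ∀ i, MemLam (W i)) (hh : ∀ i, MemLam (h i)) (hG : MemLam G)
    {F : Fin 3 → ℝ → Vel → ℂ} (hF : ∀ i, IsTimeFT (W i) (F i)) :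
    ‖totalForm ρ γ ε A H W h G‖ ≤ symbConst B * σ *
      (2 * (∫ v, (∫ ξ, weightB1 (zpt ε A ξ) v (vec fun i => F i ξ v) (vec fun i => F i ξ v)) *
        lam v) + ∑ i, lamSq (h i) + lamSq G) := by
  choose E hE using fun i => (hh i).exists_isTimeFT
  obtain ⟨U, hU⟩ := hG.exists_isTimeFT
  have hX := fun i => (hW i).add (hh i)
  have hFE := fun i => isTimeFT_add (hF i) (hE i)
  have i1 : ∀ i j, Integrable fun p : ℝ × Vel => (lam p.2 : ℂ) *
      superTerm ε A (harmK H i j) (fun t v => W i t v + h i t v) (W j) p.1 p.2 := fun i j =>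
    integrable_superTerm hε hA (hf.stronglyMeasurable_harmK i j) (hf.norm_harmK_le i j)
      hf.integrable (hX i) (hW j)
  have i2 : ∀ i, Integrable fun p : ℝ × Vel => (lam p.2 : ℂ) *
      superTerm ε A (harmDiv ρ γ H i) (fun t v => W i t v + h i t v) G p.1 p.2 := fun i =>
    integrable_superTerm hε hA (hf.stronglyMeasurable_harmDiv hρ i) (hf.norm_harmDiv_le hρ hγ i)
      hf.integrable (hX i) hG
  have s1 := fun i j => integral_superTerm hε hA (hf.stronglyMeasurable_harmK i j)
    (hf.norm_harmK_le i j) hf.integrable (hFE i) (hF j)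
  have s2 := fun i => integral_superTerm hε hA (hf.stronglyMeasurable_harmDiv hρ i)
    (hf.norm_harmDiv_le hρ hγ i) hf.integrable (hFE i) hU
  have hb := integrable_weightB1 (ε := ε) (A := A) hW hF
  rw [Measure.volume_eq_prod] at i1 i2 hb
  have e : totalForm ρ γ ε A H W h G = ∫ v, (∑ i, ∑ j, (∫ t, (lam v : ℂ) *
        superTerm ε A (harmK H i j) (fun t v => W i t v + h i t v) (W j) t v)
      - ∑ i, ∫ t, (lam v : ℂ) *
        superTerm ε A (harmDiv ρ γ H i) (fun t v => W i t v + h i t v) G t v) := by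
    rw [integral_sub (integrable_finsetSum _ fun i _ => integrable_finsetSum _ fun j _ =>
        (i1 i j).integral_prod_right)
      (integrable_finsetSum _ fun i _ => (i2 i).integral_prod_right),
      integral_finsetSum _ fun i _ => integrable_finsetSum _ fun j _ =>
        (i1 i j).integral_prod_right,
      integral_finsetSum _ fun i _ => (i2 i).integral_prod_right, totalForm,
      Measure.volume_eq_prod]
    congr 1
    · refine Finset.sum_congr rfl fun i _ => ?_
      rw [integral_finsetSum _ fun j _ => (i1 i j).integral_prod_right]
      exact Finset.sum_congr rfl fun j _ => integral_prod_symm _ (i1 i j)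
    · exact Finset.sum_congr rfl fun i _ => integral_prod_symm _ (i2 i)
  have hbi : Integrable fun v =>
      (∫ ξ, weightB1 (zpt ε A ξ) v (vec fun i => F i ξ v) (vec fun i => F i ξ v)) * lam v := by
    refine hb.integral_prod_right.congr (.of_forall fun v => ?_)
    simp only [integral_mul_const]
  have hhi : Integrable fun v => ∑ i, lam v * ∫ t, h i t v ^ 2 :=
    integrable_finsetSum _ fun i _ => (hh i).integrable_inner
  rw [e]
  refine (norm_integral_le_of_norm_le (((hbi.const_mul 2).add hhi).add
    hG.integrable_inner |>.const_mul (symbConst B * σ)) ?_).trans (le_of_eq ?_)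
  · filter_upwards [Measure.ae_ne volume (0 : Vel), hb.prod_left_ae,
      ae_all_iff.2 fun i => ae_all_iff.2 (s1 i), ae_all_iff.2 s2,
      ae_all_iff.2 fun i => (hF i).memLp, ae_all_iff.2 fun i => (hE i).memLp, hU.memLp,
      ae_all_iff.2 fun i => (hE i).integral_norm_sq, hU.integral_norm_sq]
      with v hv hbv t1 t2 mF mE mU nE nU
    have hl : 0 < lam v := by linarith [one_le_lam v]
    have hbv' : Integrable fun ξ =>
        weightB1 (zpt ε A ξ) v (vec fun i => F i ξ v) (vec fun i => F i ξ v) := by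
      refine (hbv.mul_const (lam v)⁻¹).congr (.of_forall fun ξ => ?_)
      field_simp
    have hk := norm_integral_symbol_le hf hρ hγ hγ1 hε hA hεA hB0 hB hv mF mE mU hbv'
    set T := 2 * (∫ ξ, weightB1 (zpt ε A ξ) v (vec fun i => F i ξ v) (vec fun i => F i ξ v))
      + ∑ i, (∫ ξ, ‖E i ξ v‖ ^ 2) + ∫ ξ, ‖U ξ v‖ ^ 2 with hT
    have hT0 : 0 ≤ T := by
      have a1 : 0 ≤ ∫ ξ, weightB1 (zpt ε A ξ) v (vec fun i => F i ξ v) (vec fun i => F i ξ v) :=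
        integral_nonneg fun ξ => weightB1_nonneg _ _ _
      have a2 : ∀ i, 0 ≤ ∫ ξ, ‖E i ξ v‖ ^ 2 := fun i => integral_nonneg fun ξ => sq_nonneg _
      have a3 : 0 ≤ ∫ ξ, ‖U ξ v‖ ^ 2 := integral_nonneg fun ξ => sq_nonneg _
      have a4 := Finset.sum_nonneg fun i (_ : i ∈ Finset.univ) => a2 i
      positivity
    have e2 : ∑ i, ∑ j, (∫ t, (lam v : ℂ) *
          superTerm ε A (harmK H i j) (fun t v => W i t v + h i t v) (W j) t v)
        - ∑ i, (∫ t, (lam v : ℂ) *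
          superTerm ε A (harmDiv ρ γ H i) (fun t v => W i t v + h i t v) G t v)
        = lam v * ∫ ϑ : ℝ × ℝ, (∑ i, ∑ j, (∫ ξ, conj (F i ξ v + E i ξ v) *
            (𝓕 (timeKernel ε A (harmK H i j) v ϑ) ξ * F j (ξ - (ϑ.1 + ϑ.2)) v))
          - ∑ i, ∫ ξ, conj (F i ξ v + E i ξ v) *
            (𝓕 (timeKernel ε A (harmDiv ρ γ H i) v ϑ) ξ * U (ξ - (ϑ.1 + ϑ.2)) v)) := by
      rw [integral_sub (integrable_finsetSum _ fun i _ => integrable_finsetSum _ fun j _ =>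
          (t1 i j).1) (integrable_finsetSum _ fun i _ => (t2 i).1),
        integral_finsetSum _ fun i _ => integrable_finsetSum _ fun j _ => (t1 i j).1,
        integral_finsetSum _ fun i _ => (t2 i).1, mul_sub, Finset.mul_sum, Finset.mul_sum]
      congr 1
      · refine Finset.sum_congr rfl fun i _ => ?_
        rw [integral_finsetSum _ fun j _ => (t1 i j).1, Finset.mul_sum]
        exact Finset.sum_congr rfl fun j _ => by rw [integral_const_mul, (t1 i j).2]
      · exact Finset.sum_congr rfl fun i _ => by rw [integral_const_mul, (t2 i).2]
    have h3 := norm_integral_le_of_norm_le ((hf.integrable_mul.const_mul (symbConst B)).mul_const T)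
      (.of_forall hk)
    rw [integral_mul_const, integral_const_mul] at h3
    have h4 := h3.trans (mul_le_mul_of_nonneg_right (mul_le_mul_of_nonneg_left hf.integral_le
      (symbConst_nonneg hB0)) hT0)
    rw [e2, norm_mul, Complex.norm_real, Real.norm_of_nonneg hl.le]
    refine (mul_le_mul_of_nonneg_left h4 hl.le).trans (le_of_eq ?_)
    simp only [Pi.add_apply, hT, nU.2, fun i => (nE i).2]
    rw [← Finset.mul_sum]
    ring
  · rw [integral_const_mul, integral_add' ((hbi.const_mul 2).add hhi) hG.integrable_inner,
      integral_add' (hbi.const_mul 2) hhi, integral_const_mul,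
      integral_finsetSum _ fun i _ => (hh i).integrable_inner, ← hG.lamSq_eq]
    simp only [← (hh _).lamSq_eq]

end Total

end NonMarkov

end

noncomputable section

open MeasureTheory Set
open scoped ENNReal FourierTransform ComplexConjugate

namespace NonMarkov

theorem superTerm_eq {ε A : ℝ} {κ : ℝ × ℝ → ℝ → Vel → ℂ} {X Y : ℝ → Vel → ℝ} {t : ℝ} {v : Vel}
    (ht : 0 < t) (hY : ∀ s, s ≤ 0 → Y s v = 0) {k y : ℝ → ℝ}
    (hk : ∀ᵐ s : ℝ, 0 < s → s < t → (k s : ℂ) =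
      ∫ ϑ : ℝ × ℝ, κ ϑ ((t - s) / ε) v * character ((ϑ.1 + ϑ.2) * s))
    (hy : ∀ᵐ s : ℝ, 0 < s → y s = Real.exp (A / 2 * s) * Y s v) :
    superTerm ε A κ X Y t v = ((X t v * (ε⁻¹ * Real.exp (-(A / 2) * t) *
      ∫ s in (0 : ℝ)..t, k s * y s) : ℝ) : ℂ) := by
  have e : ∫ s, (∫ ϑ : ℝ × ℝ, timeKernel ε A κ v ϑ (t - s) * character ((ϑ.1 + ϑ.2) * s)) *
      (Y s v : ℂ) = ∫ s in Ioc 0 t, ((ε⁻¹ * Real.exp (-(A / 2) * t) * (k s * y s) : ℝ) : ℂ) := by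
    rw [← integral_indicator measurableSet_Ioc]
    refine integral_congr_ae ?_
    filter_upwards [hk, hy, Measure.ae_ne volume t] with s h1 h2 h3
    by_cases hs : 0 < s
    · by_cases hst : s < t
      · have ht' : t - s ∈ Ioi (0 : ℝ) := sub_pos.2 hst
        rw [indicator_of_mem (show s ∈ Ioc 0 t from ⟨hs, hst.le⟩), h2 hs]
        simp only [timeKernel, indicator_of_mem ht', mul_assoc]
        rw [integral_const_mul, ← h1 hs hst]
        have e3 : Real.exp (-(A / 2) * (t - s))
            = Real.exp (-(A / 2) * t) * Real.exp (A / 2 * s) := by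
          rw [← Real.exp_add]; congr 1; ring
        rw [e3]
        push_cast
        ring
      · have ht' : t - s ∉ Ioi (0 : ℝ) := by simpa using not_lt.1 hst
        have hm : s ∉ Ioc 0 t := fun h => h3 (le_antisymm h.2 (not_lt.1 hst))
        simp only [timeKernel, indicator_of_notMem ht', indicator_of_notMem hm, zero_mul,
          integral_zero]
    · rw [indicator_of_notMem (show s ∉ Ioc 0 t from fun h => hs h.1), hY s (not_lt.1 hs)]
      simp
  rw [superTerm, e, integral_complex_ofReal, integral_const_mul,
    intervalIntegral.integral_of_le ht.le, Complex.conj_ofReal, ← Complex.ofReal_mul]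

theorem intervalIntegrable_superposition {ε M : ℝ} {κ : ℝ × ℝ → ℝ → Vel → ℂ} {Ψ : ℝ × ℝ → ℝ}
    (hκ : StronglyMeasurable fun p : ((ℝ × ℝ) × ℝ) × Vel => κ p.1.1 p.1.2 p.2)
    (hb : ∀ ϑ τ v, ‖κ ϑ τ v‖ ≤ M * Ψ ϑ) (hΨ : Integrable Ψ) {A t : ℝ} {v : Vel} (ht : 0 < t)
    {Y : ℝ → ℝ} (hY : MemLp (fun s => (Y s : ℂ)) 2 volume) {k y : ℝ → ℝ}
    (hk : ∀ᵐ s : ℝ, 0 < s → s < t → (k s : ℂ) =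
      ∫ ϑ : ℝ × ℝ, κ ϑ ((t - s) / ε) v * character ((ϑ.1 + ϑ.2) * s))
    (hy : ∀ᵐ s : ℝ, 0 < s → y s = Real.exp (A / 2 * s) * Y s) :
    IntervalIntegrable (fun s => k s * y s) volume 0 t := by
  rw [intervalIntegrable_iff_integrableOn_Ioc_of_le ht.le]
  have h1 : IntegrableOn (fun s => (Y s : ℂ)) (Icc 0 t) :=
    (hY.locallyIntegrable one_le_two).integrableOn_isCompact isCompact_Icc
  have h2 : IntegrableOn (fun s => (Real.exp (A / 2 * s) : ℂ) * (Y s : ℂ)) (Icc 0 t) :=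
    h1.continuousOn_mul (Continuous.continuousOn (by fun_prop)) isCompact_Icc
  have hm : StronglyMeasurable fun s : ℝ =>
      ∫ ϑ : ℝ × ℝ, κ ϑ ((t - s) / ε) v * character ((ϑ.1 + ϑ.2) * s) := by
    refine StronglyMeasurable.integral_prod_right (ν := volume)
      (f := fun (s : ℝ) (ϑ : ℝ × ℝ) => κ ϑ ((t - s) / ε) v * character ((ϑ.1 + ϑ.2) * s)) ?_
    exact (hκ.comp_measurable
      (g := fun q : ℝ × (ℝ × ℝ) => ((q.2, (t - q.1) / ε), v)) (by fun_prop)).mul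
        (continuous_character.comp (by fun_prop :
          Continuous fun q : ℝ × (ℝ × ℝ) => (q.2.1 + q.2.2) * q.1)).stronglyMeasurable
  have h3 := (h2.mono_set Ioc_subset_Icc_self).bdd_mul (c := ∫ ϑ, M * Ψ ϑ)
    hm.aestronglyMeasurable (.of_forall fun s => by
      refine norm_integral_le_of_norm_le (hΨ.const_mul M) (.of_forall fun ϑ => ?_)
      rw [norm_mul, norm_character, mul_one]
      exact hb _ _ _)
  refine h3.re.congr ?_
  filter_upwards [ae_restrict_of_ae hk, ae_restrict_of_ae hy,
    ae_restrict_of_ae (Measure.ae_ne volume t), ae_restrict_mem measurableSet_Ioc] with s a1 a2 a3 a4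
  rw [← a1 a4.1 (lt_of_le_of_ne a4.2 a3), a2 a4.1, ← Complex.ofReal_mul, ← Complex.ofReal_mul]
  exact Complex.ofReal_re _

theorem superTerm_of_nonpos {ε A : ℝ} {κ : ℝ × ℝ → ℝ → Vel → ℂ} {X Y : ℝ → Vel → ℝ} {t : ℝ}
    {v : Vel} (hX : X t v = 0) : superTerm ε A κ X Y t v = 0 := by
  simp [superTerm, hX]

/-- The integral over positive times of a finite sum of weighted forms. -/
theorem integral_Ioi_sum {ι : Type*} (s : Finset ι) {g : ι → ℝ × Vel → ℂ}
    (hg : ∀ i ∈ s, Integrable (g i)) (h0 : ∀ i ∈ s, ∀ t v, t ≤ 0 → g i (t, v) = 0)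
    {q : ℝ → Vel → ℝ} (hq : ∀ᵐ t : ℝ, 0 < t → ∀ᵐ v : Vel, (q t v : ℂ) = ∑ i ∈ s, g i (t, v)) :
    ((∫ t in Ioi (0 : ℝ), ∫ v, q t v : ℝ) : ℂ) = ∑ i ∈ s, ∫ p, g i p := by
  rw [← integral_finsetSum _ hg]
  have hi := integrable_finsetSum _ hg
  rw [Measure.volume_eq_prod] at hi ⊢
  rw [integral_prod _ hi, ← integral_complex_ofReal, ← integral_indicator measurableSet_Ioi]
  refine integral_congr_ae ?_
  filter_upwards [hq] with t ht
  by_cases h : 0 < t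
  · rw [indicator_of_mem (mem_Ioi.2 h), ← integral_complex_ofReal]
    exact integral_congr_ae (ht h)
  · rw [indicator_of_notMem (by simpa using h)]
    have : ∀ v, ∑ i ∈ s, g i (t, v) = 0 := fun v =>
      Finset.sum_eq_zero fun i hi => h0 i hi t v (not_lt.1 h)
    simp [this]

theorem damping_cancel (ε A t x : ℝ) :
    Real.exp (-A * t) / ε * (Real.exp (A / 2 * t) * x) = ε⁻¹ * Real.exp (-(A / 2) * t) * x := by
  rw [show -(A / 2) * t = -A * t + A / 2 * t by ring, Real.exp_add]
  ring

section Total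

variable {ε σ A γ : ℝ} {ρ : Vel → ℝ} {f : ℝ → Vel → ℝ} {H : ℝ × ℝ → Vel → ℂ} {Ψ : ℝ × ℝ → ℝ}
  {G : ℝ → Vel → ℝ} {α : Fin 3 → ℕ} {u : ℝ → Vel → ℝ}

theorem ofReal_Q_eq (hf : IsSuperposition ε σ f H Ψ) (hρ : IsMollifier ρ)
    (hγ : 0 < γ) (hγ1 : γ ≤ 1) (hε : 0 < ε) (hA : 0 < A)
    (hG : MemLam G) (h0 : ∀ t v, t ≤ 0 → G t v = 0)
    (hw : ∀ᵐ p : ℝ × Vel, 0 < p.1 →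
      G p.1 p.2 = Real.exp (-(A / 2) * p.1) * weakDeriv α u p.1 p.2)
    (hh : ∀ i, MemLam (commRep ρ γ i G)) :
    (Q ρ γ ε A α α f u : ℂ)
      = totalForm ρ γ ε A H (fun i => gradRep ρ γ i G) (fun i => commRep ρ γ i G) G := by
  have hW := memLam_gradRep hρ hγ hγ1 hG
  have hX := fun i => (hW i).add (hh i)
  have hX0 : ∀ i t v, t ≤ 0 → gradRep ρ γ i G t v + commRep ρ γ i G t v = 0 := fun i t v ht => by
    rw [gradRep_of_nonpos h0 i ht, commRep_of_nonpos h0 i ht, add_zero]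
  have i1 : ∀ i j, Integrable fun p : ℝ × Vel => (lam p.2 : ℂ) *
      superTerm ε A (harmK H i j) (fun t v => gradRep ρ γ i G t v + commRep ρ γ i G t v)
        (gradRep ρ γ j G) p.1 p.2 := fun i j =>
    integrable_superTerm hε hA (hf.stronglyMeasurable_harmK i j) (hf.norm_harmK_le i j)
      hf.integrable (hX i) (hW j)
  have i2 : ∀ i, Integrable fun p : ℝ × Vel => (lam p.2 : ℂ) *
      superTerm ε A (harmDiv ρ γ H i) (fun t v => gradRep ρ γ i G t v + commRep ρ γ i G t v)
        G p.1 p.2 := fun i =>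
    integrable_superTerm hε hA (hf.stronglyMeasurable_harmDiv hρ i) (hf.norm_harmDiv_le hρ hγ i)
      hf.integrable (hX i) hG
  have hm : ∀ g : Vel → ℝ, mderiv (α - α) g = g := fun g => by simp [mderiv]
  have hgr := mgrad_eq_gradRep hρ hγ hG hw
  rw [Q, totalForm, Complex.ofReal_sub]
  simp only [hm]
  congr 1
  · rw [← Finset.sum_product']
    refine integral_Ioi_sum _ (fun p _ => i1 p.1 p.2)
      (fun p _ t v ht => by rw [superTerm_of_nonpos (hX0 p.1 t v ht), mul_zero]) ?_
    filter_upwards [hgr] with t h1 ht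
    filter_upwards [ae_all_iff.2 fun j => (hW j).memLp] with v hv
    rw [Finset.sum_product, Complex.ofReal_mul, Complex.ofReal_sum, Finset.mul_sum]
    refine Finset.sum_congr rfl fun i _ => ?_
    have hk : ∀ j, ∀ᵐ s : ℝ, 0 < s → s < t → ((kernelK (f s) ((t - s) / ε) v i j : ℝ) : ℂ)
        = ∫ ϑ : ℝ × ℝ, harmK H i j ϑ ((t - s) / ε) v * character ((ϑ.1 + ϑ.2) * s) := fun j => by
      filter_upwards [ofReal_kernelK_eq hf] with s hs hs0 hst
      exact hs hs0 _ (div_pos (sub_pos.2 hst) hε) i j v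
    have hy : ∀ j, ∀ᵐ s : ℝ, 0 < s → mgrad ρ γ j (weakDeriv α u s) v
        = Real.exp (A / 2 * s) * gradRep ρ γ j G s v := fun j => by
      filter_upwards [hgr] with s hs hs0 using (hs hs0 j v).1
    have hI := fun j => intervalIntegrable_superposition (hf.stronglyMeasurable_harmK i j)
      (hf.norm_harmK_le i j) hf.integrable ht (hv j) (hk j) (hy j)
    rw [intervalIntegral.integral_finsetSum fun j _ => hI j, (h1 ht i v).2]
    simp only [fun j => superTerm_eq (X := fun t v => gradRep ρ γ i G t v + commRep ρ γ i G t v)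
      ht (fun s hs => gradRep_of_nonpos h0 j hs v) (hk j) (hy j)]
    rw [← Complex.ofReal_mul, mul_assoc (Real.exp (A / 2 * t)), damping_cancel]
    push_cast
    simp only [Finset.mul_sum]
    refine Finset.sum_congr rfl fun j _ => ?_
    ring
  · refine integral_Ioi_sum _ (fun i _ => i2 i)
      (fun i _ t v ht => by rw [superTerm_of_nonpos (hX0 i t v ht), mul_zero]) ?_
    filter_upwards [hgr] with t h1 ht
    filter_upwards [ae_ae_swap hw] with v hv
    rw [Complex.ofReal_mul, Complex.ofReal_sum, Finset.mul_sum]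
    refine Finset.sum_congr rfl fun i _ => ?_
    have hk : ∀ᵐ s : ℝ, 0 < s → s < t →
        ((∑ j, mgrad ρ γ j (fun y => kernelK (f s) ((t - s) / ε) y i j) v : ℝ) : ℂ)
          = ∫ ϑ : ℝ × ℝ, harmDiv ρ γ H i ϑ ((t - s) / ε) v * character ((ϑ.1 + ϑ.2) * s) := by
      filter_upwards [ofReal_mgrad_kernelK_eq hf hρ hγ] with s hs hs0 hst
      exact hs hs0 _ (div_pos (sub_pos.2 hst) hε) i v
    have hy : ∀ᵐ s : ℝ, 0 < s → weakDeriv α u s v = Real.exp (A / 2 * s) * G s v := by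
      filter_upwards [hv] with s hs hs0
      rw [hs hs0, ← mul_assoc, ← Real.exp_add]
      simp
    rw [superTerm_eq (X := fun t v => gradRep ρ γ i G t v + commRep ρ γ i G t v) ht
      (fun s hs => h0 s v hs) hk hy, (h1 ht i v).2, ← Complex.ofReal_mul,
      mul_assoc (Real.exp (A / 2 * t)), damping_cancel]
    push_cast
    ring

end Total

end NonMarkov

end

noncomputable section

open MeasureTheory Set
open scoped ENNReal FourierTransform ComplexConjugate

namespace NonMarkov

theorem dissipation_nonneg (ρ : Vel → ℝ) (γ ε A : ℝ) (α : Fin 3 → ℕ) (u : ℝ → Vel → ℝ) :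
    0 ≤ dissipation ρ γ ε A α u :=
  integral_nonneg fun _ => mul_nonneg (integral_nonneg fun _ => weightB1_nonneg _ _ _)
    (Real.exp_pos _).le

/-- The constant in the bound for the quadratic form. -/
def formConst (B : ℝ) : ℝ := symbConst B * (3 * (avgConst * (2 * B) ^ 2) + 1)

theorem formConst_nonneg {B : ℝ} (hB : 0 ≤ B) : 0 ≤ formConst B := by
  have := symbConst_nonneg hB
  have := avgConst_nonneg
  unfold formConst; positivity

theorem abs_Q_le {ε σ A γ B : ℝ} {ρ : Vel → ℝ} {f : ℝ → Vel → ℝ} {H : ℝ × ℝ → Vel → ℂ}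
    {Ψ : ℝ × ℝ → ℝ} (hf : IsSuperposition ε σ f H Ψ) (hσ : 0 ≤ σ) (hρ : IsMollifier ρ)
    (hγ : 0 < γ) (hγ1 : γ ≤ 1) (hε : 0 < ε) (hA : 0 < A) (hεA : ε * (A / 2) ≤ 1) (hB0 : 0 ≤ B)
    (hB : ∀ (i : Fin 3) (w : Vel), |mollDeriv ρ γ i w| ≤ B * γ⁻¹ ^ 4)
    {n : ℕ} {u : ℝ → Vel → ℝ} (hu : MemV n A lam u) {α : Fin 3 → ℕ} (hα : order α ≤ n) :
    |Q ρ γ ε A α α f u|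
      ≤ formConst B * σ * (dissipation ρ γ ε A α u + normVsq n A lam u) := by
  obtain ⟨G, hG, h0, hw, hGu⟩ := exists_dampedRep hu hα
  have hW := memLam_gradRep hρ hγ hγ1 hG
  have hh := memLam_commRep hρ hγ hγ1 hG hB0 hB
  choose F hF using fun i => (hW i).exists_isTimeFT
  have h := norm_totalForm_le hf hρ hγ hγ1 hε hA hεA hB0 hB hW (fun i => (hh i).1) hG hF
  rw [← ofReal_Q_eq hf hρ hγ hγ1 hε hA hG h0 hw fun i => (hh i).1, Complex.norm_real,
    Real.norm_eq_abs] at h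
  refine h.trans ?_
  have hd := dissipation_eq (ε := ε) hρ hγ hG h0 hw hF
  have hd0 := dissipation_nonneg ρ γ ε A α u
  set I := ∫ v, (∫ ξ, weightB1 (zpt ε A ξ) v (vec fun i => F i ξ v) (vec fun i => F i ξ v)) *
    lam v with hI
  have hpi := Real.pi_gt_three
  have hI1 : 2 * I ≤ dissipation ρ γ ε A α u := by
    have hI0 : 0 ≤ I := integral_nonneg fun v => mul_nonneg
      (integral_nonneg fun ξ => weightB1_nonneg _ _ _) (Real.exp_pos _).le
    rw [hd]
    nlinarith
  have hS : ∑ i, lamSq (commRep ρ γ i G) ≤ 3 * (avgConst * (2 * B) ^ 2) * lamSq G := by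
    refine (Finset.sum_le_sum fun i _ => (hh i).2).trans (le_of_eq ?_)
    simp only [Finset.sum_const, Finset.card_univ, Fintype.card_fin, nsmul_eq_mul]
    push_cast
    ring
  have ha : 0 ≤ avgConst * (2 * B) ^ 2 := mul_nonneg avgConst_nonneg (sq_nonneg _)
  have hG0 := lamSq_nonneg G
  have key : 2 * I + ∑ i, lamSq (commRep ρ γ i G) + lamSq G
      ≤ (3 * (avgConst * (2 * B) ^ 2) + 1) *
        (dissipation ρ γ ε A α u + normVsq n A lam u) := by
    have k1 := mul_nonneg ha hd0
    have k2 := mul_le_mul_of_nonneg_left hGu ha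
    linarith
  calc _ ≤ symbConst B * σ * ((3 * (avgConst * (2 * B) ^ 2) + 1) *
        (dissipation ρ γ ε A α u + normVsq n A lam u)) :=
        mul_le_mul_of_nonneg_left key (mul_nonneg (symbConst_nonneg hB0) hσ)
    _ = _ := by rw [formConst]; ring

theorem normVsq_nonneg_of_memV {n : ℕ} {A : ℝ} {u : ℝ → Vel → ℝ} (hu : MemV n A lam u) :
    0 ≤ normVsq n A lam u := by
  obtain ⟨G, -, -, -, h⟩ := exists_dampedRep hu (α := 0) (by simp [order])
  exact (lamSq_nonneg G).trans h

end NonMarkov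

end

theorem mainTheorem6 (ρ : NonMarkov.Vel → ℝ) (hρ : NonMarkov.IsMollifier ρ)
    (A : ℝ) (hA : 1 ≤ A) (n : ℕ) (hn : 12 ≤ n) (c : ℝ) (hc : 0 < c) :
    ∃ δ₀ : ℝ, 0 < δ₀ ∧ ∀ δ : ℝ, 0 < δ → δ ≤ δ₀ →
      ∀ R R' δ₁ : ℝ, 0 < R → 0 < R' → 0 < δ₁ → δ₁ < 1 →
        ∃ ε₀ : ℝ, 0 < ε₀ ∧ ∀ ε : ℝ, 0 < ε → ε ≤ ε₀ →
          ∀ γ : ℝ, 0 < γ → γ ≤ 1 →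
            ∀ α : Fin 3 → ℕ, NonMarkov.order α ≤ n →
              ∀ f ∈ NonMarkov.Omega n A δ R' δ₁ R ε,
                ∀ u : ℝ → NonMarkov.Vel → ℝ, NonMarkov.MemV n A NonMarkov.lam u →
                  (2 * Real.pi) ^ (1 / 2 : ℝ) * |NonMarkov.Q ρ γ ε A α α f u|
                    ≤ c * NonMarkov.dissipation ρ γ ε A α u
                      + NonMarkov.normVsq n A NonMarkov.lam u := by
  obtain ⟨C, hC, hsup⟩ := NonMarkov.exists_superposition_const A hA
  obtain ⟨B, hB0, hB⟩ := NonMarkov.exists_mollDeriv_le hρ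
  set m := min c 1 with hm
  have hm0 : 0 < m := lt_min hc one_pos
  set K := (2 * Real.pi) ^ (1 / 2 : ℝ) * NonMarkov.formConst B * C + 1 with hK
  have hp : 0 ≤ (2 * Real.pi) ^ (1 / 2 : ℝ) := Real.rpow_nonneg (by positivity) _
  have hF := NonMarkov.formConst_nonneg hB0.le
  have hK0 : 0 < K := by positivity
  refine ⟨m / (2 * K), by positivity, fun δ hδ hδ0 R R' δ₁ hR _ _ hδ1 => ?_⟩
  refine ⟨min (min 1 (2 / A)) ((m / (2 * K * R)) ^ 2), by positivity, ?_⟩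
  intro ε hε hεm γ hγ hγ1 α hα f hf u hu
  have hε1 : ε ≤ 1 := hεm.trans ((min_le_left _ _).trans (min_le_left _ _))
  have hε2 : ε ≤ 2 / A := hεm.trans ((min_le_left _ _).trans (min_le_right _ _))
  have hε3 : ε ≤ (m / (2 * K * R)) ^ 2 := hεm.trans (min_le_right _ _)
  have hA0 : 0 < A := by linarith
  obtain ⟨H, Ψ, hs⟩ := hsup n δ R' δ₁ R ε hδ hR hδ1 hε hε1 f hf
  have hsq : Real.sqrt ε ≤ m / (2 * K * R) := Real.sqrt_le_iff.2 ⟨by positivity, hε3⟩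
  have hσ : 0 ≤ C * (δ + R * Real.sqrt ε) := by positivity
  have hεA : ε * (A / 2) ≤ 1 := by
    rw [le_div_iff₀ hA0] at hε2
    linarith
  have h := NonMarkov.abs_Q_le hs hσ hρ hγ hγ1 hε hA0 hεA hB0.le (hB γ hγ) hu hα
  have hd := NonMarkov.dissipation_nonneg ρ γ ε A α u
  have hu0 := NonMarkov.normVsq_nonneg_of_memV hu
  have hsum : δ + R * Real.sqrt ε ≤ m / K := by
    have h1 := mul_le_mul_of_nonneg_left hsq hR.le
    have h2 : m / (2 * K) + R * (m / (2 * K * R)) = m / K := by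
      field_simp
      norm_num
    linarith
  have hsmall : (2 * Real.pi) ^ (1 / 2 : ℝ) *
      (NonMarkov.formConst B * (C * (δ + R * Real.sqrt ε))) ≤ m := by
    calc _ = (2 * Real.pi) ^ (1 / 2 : ℝ) * NonMarkov.formConst B * C *
          (δ + R * Real.sqrt ε) := by ring
      _ ≤ K * (m / K) := mul_le_mul (by linarith) hsum (by positivity) hK0.le
      _ = m := by field_simp
  calc _ ≤ (2 * Real.pi) ^ (1 / 2 : ℝ) * (NonMarkov.formConst B * (C * (δ + R * Real.sqrt ε)) *
        (NonMarkov.dissipation ρ γ ε A α u + NonMarkov.normVsq n A NonMarkov.lam u)) :=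
        mul_le_mul_of_nonneg_left h hp
    _ = (2 * Real.pi) ^ (1 / 2 : ℝ) * (NonMarkov.formConst B * (C * (δ + R * Real.sqrt ε))) *
        (NonMarkov.dissipation ρ γ ε A α u + NonMarkov.normVsq n A NonMarkov.lam u) := by ring
    _ ≤ m * (NonMarkov.dissipation ρ γ ε A α u + NonMarkov.normVsq n A NonMarkov.lam u) :=
        mul_le_mul_of_nonneg_right hsmall (by positivity)
    _ ≤ _ := by
        rw [mul_add]
        exact add_le_add (mul_le_mul_of_nonneg_right (min_le_left _ _) hd)
          (mul_le_of_le_one_left hu0 (min_le_right _ _))
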